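/- **Setting.** Let $T\ge 2$. An oblivious adversary fixes $q_1,\dots,q_T\in[0,1]$; the outcomes $y_t\sim\mathrm{Ber}(q_t)$ are independent. In round $t$ a forecaster chooses, from $y_1,\dots,y_{t-1}$, a finitely supported distribution $\mathcal P_t$ on $[0,1]$, predicts $p_t\sim\mathcal P_t$, and then sees $y_t$. Put $C=\min_{q\in[0,1]}\sum_{t=1}^T|q_t-q|$, which is known to the forecaster, $\mathrm{KL}(p,q)=p\log\frac pq+(1-p)\log\frac{1-p}{1-q}$, and $$\mathrm{PKL}=\sum_{t=1}^T\mathbb E_{p\sim\mathcal P_t}\big[\mathrm{KL}(\bar\rho_p,p)\big],\qquad \bar\rho_p=\frac{\sum_t\mathcal P_t(p)y_t}{\sum_t\mathcal P_t(p)} .$$ **Algorithm.** Let $\theta(y)=2\arcsin\sqrt y$, $\psi(z)=\sin^2(z/2)$, $\eta=\frac1{T+1}$, $D=[\theta(\eta),\theta(1-\eta)]$, $s_m=2^m$, $Q=\lceil\log_2T\rceil$, $K=\max\{\lceil((1+C)/\log^2T)^{1/3}\rceil,2\}$, and let $\iota>0$ be a parameter of order $\log(T/\delta)$. Epoch $m=1,2,\dots$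 lasts $s_m$ rounds (the last one is cut off at $T$). In epoch $1$ the distributions $\mathcal P_t$ are arbitrary on $[\eta,1-\eta]$. For $m\ge2$ let $\hat y_m$ be the average outcome of epoch $m-1$, $r_m=2\pi\sqrt{(\iota+C)/s_{m-1}}$, $I_m=[a_m,b_m]=[\theta(\hat y_m)-2r_m,\theta(\hat y_m)+2r_m]\cap D$, and $N_m=\max\{\lceil s_m^{1/3}|I_m|^{2/3}\iota^{-1/3}\rceil,\lceil 2|I_m|/\pi\rceil\}$. The partition $\Pi_m$ of $D$ consists of $N_m$ equal pieces of $I_m$ and of $K$ equal pieces of each non-empty band $[a_m-(2^{q+1}-1)r_m,\,a_m-(2^q-1)r_m)\cap D$ and $(b_m+(2^q-1)r_m,\,b_m+(2^{q+1}-1)r_m]\cap D$, $0\le q\le Q$. Let $\mathcal Z_m=\{\psi(\sup J):J\in\Pi_m\}\cup\{\eta,1-\eta\}$. Each $s\in\mathcal Z_m$ runs, from scratch in each epoch, exponentially weighted online optimization on $[0,1]$: in round $t$ its action is $$a_{s,t}=\frac{\int_0^1x\,e^{-L_{s,t}(x)}dx}{\int_0^1e^{-L_{s,t}(x)}dx},\qquad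 L_{s,t}(x)=\sum_{\tau<t,\ \tau\text{ in epoch }m}\mathcal P_\tau(s)\,\ell(x,y_\tau),\quad \ell(x,y)=-y\log x-(1-y)\log(1-x).$$ If $\theta(a_{s,t})$ lies in the interval of $\Pi_m$ with endpoints $\theta(d)<\theta(b)$, let $\mathcal Q_t(s,\cdot)$ be the distribution on $\{d,b\}$ with masses at $d$ and $b$ proportional to $\frac{b-a_{s,t}}{b(1-b)}$ and $\frac{a_{s,t}-d}{d(1-d)}$. Then $\mathcal P_t$ is a stationary distribution on $\mathcal Z_m$ of the stochastic matrix $\mathcal Q_t$. **Theorem.** There is an absolute constant $\kappa_0>0$ such that the following holds. 1. For all $\kappa,b$ there is a constant $A$ such that for all $T\ge2$, $\delta\in(0,1)$ with $\log(1/\delta)\le b\log^2T$ (in particular for polynomially small $\delta$), all $\iota$ with $\kappa_0\log(T/\delta)\le\iota\le\kappa\log(T/\delta)$, all $q_1,\dots,q_T\in[0,1]$, and every choice of the distributions in the first epoch and of the stationary distributions (each a function of the past outcomes), with probability at least $1-\delta$ $$\mathrm{PKL}\le A\left(\iota\log^2T+(1+C)^{1/3}\log^{7/3}T\right).$$ 2.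 The computational complexity per round is $\tilde O((1+C)^{2/3})$: there are a single program for a real random access machine (exact real arithmetic, unit cost for $+,-,\times,\div,\sqrt{\cdot},\log,\sin,\arcsin$, comparisons and array accesses, no rounding of reals to integers) and constants $A,k$ such that for all $T\ge2$, $C\in[0,T]$, $\delta\in(0,1)$ and $\iota\ge\kappa_0\log(T/\delta)$, the program, given $T,C,\iota$, executes the algorithm for some choice of the stationary distributions, sampling $p_t\sim\mathcal P_t$ from one uniform random number per round, with at most $A\,(\log T)^k(1+C)^{2/3}$ steps in each round. -/

import Mathlib

namespace AdaptiveCalibration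

noncomputable section

/-! ### Outcomes, non-stationarity and pseudo KL calibration

Rounds are numbered `0, …, T - 1`; an outcome sequence is a map `ℕ → Bool`. -/

/-- The numerical value of an outcome. -/
def bit (b : Bool) : ℝ := if b then 1 else 0

/-- The divergence `KL(p, q)` of two Bernoulli laws with means `p` and `q`, for `q ∈ (0, 1)`. -/
def klBer (p q : ℝ) : ℝ :=
  p * Real.log (p / q) + (1 - p) * Real.log ((1 - p) / (1 - q))

/-- The minimal `ℓ₁` deviation `min_{x ∈ [0,1]} ∑_t |q_t - x|` of the mean outcomes. -/
def nonStationarity (T : ℕ) (q : ℕ → ℝ) : ℝ :=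
  ⨅ x : Set.Icc (0 : ℝ) 1, ∑ t ∈ Finset.range T, |q t - (x : ℝ)|

/-- A finitely supported probability distribution on the reals, given by its masses. -/
def IsDist (P : ℝ →₀ ℝ) : Prop :=
  (∀ p, 0 ≤ P p) ∧ ∑ p ∈ P.support, P p = 1

/-- The conditional empirical mean `(∑_t P_t(p) y_t) / (∑_t P_t(p))`. -/
def rhoBar (T : ℕ) (P : ℕ → ℝ →₀ ℝ) (y : ℕ → Bool) (p : ℝ) : ℝ :=
  (∑ t ∈ Finset.range T, P t p * bit (y t)) / ∑ t ∈ Finset.range T, P t p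

/-- Pseudo KL calibration error `∑_t E_{p ∼ P_t} KL(rhoBar p, p)`. -/
def pseudoKL (T : ℕ) (P : ℕ → ℝ →₀ ℝ) (y : ℕ → Bool) : ℝ :=
  ∑ t ∈ Finset.range T, ∑ p ∈ (P t).support, P t p * klBer (rhoBar T P y p) p

/-! ### The arcsine-transformed non-uniform partition -/

/-- Numerical parameters of the algorithm: the horizon `T`, the non-stationarity `C`, and the
logarithmic factor `ι` of order `log (T / δ)`, through which alone the confidence enters. -/
structure Params where
  T : ℕ
  C : ℝ
  ι : ℝ

/-- `θ(y) = 2 arcsin √y`. -/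
def theta (y : ℝ) : ℝ := 2 * Real.arcsin (Real.sqrt y)

/-- `ψ(z) = sin² (z / 2)`, the inverse of `θ : [0,1] → [0,π]`. -/
def psi (z : ℝ) : ℝ := Real.sin (z / 2) ^ 2

/-- `η = 1 / (T + 1)`. -/
def Params.eta (p : Params) : ℝ := 1 / ((p.T : ℝ) + 1)

/-- Epoch `m ≥ 1` consists of the `2 ^ m` rounds `2 ^ m - 2 ≤ t < 2 ^ (m + 1) - 2` (the last epoch
is cut off at the horizon); this is the epoch of round `t`. -/
def epoch (t : ℕ) : ℕ := Nat.log 2 (t + 2)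

/-- The average outcome of the epoch preceding epoch `m ≥ 2`. -/
def prevMean (m : ℕ) (y : ℕ → Bool) : ℝ :=
  (∑ t ∈ Finset.Ico (2 ^ (m - 1) - 2) (2 ^ m - 2), bit (y t)) / 2 ^ (m - 1)

/-- `r_m = 2 π √((ι + C) / s_{m-1})` with `s_m = 2 ^ m`. -/
def Params.radius (p : Params) (m : ℕ) : ℝ :=
  2 * Real.pi * Real.sqrt ((p.ι + p.C) / 2 ^ (m - 1))

/-- Left end `a_m` of the inner region, where `v` is the average outcome of the last epoch. -/
def Params.innerLo (p : Params) (m : ℕ) (v : ℝ) : ℝ :=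
  max (theta v - 2 * p.radius m) (theta p.eta)

/-- Right end `b_m` of the inner region. -/
def Params.innerHi (p : Params) (m : ℕ) (v : ℝ) : ℝ :=
  min (theta v + 2 * p.radius m) (theta (1 - p.eta))

/-- The number `N_m` of intervals of the inner region. -/
def Params.innerCount (p : Params) (m : ℕ) (v : ℝ) : ℕ :=
  max
    ⌈((2 : ℝ) ^ m) ^ (1 / 3 : ℝ) * (p.innerHi m v - p.innerLo m v) ^ (2 / 3 : ℝ)
      * p.ι ^ (-(1 / 3) : ℝ)⌉₊
    ⌈2 * (p.innerHi m v - p.innerLo m v) / Real.pi⌉₊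

/-- The number `K` of intervals of each outer band. -/
def Params.outerCount (p : Params) : ℕ :=
  max ⌈((1 + p.C) / Real.log p.T ^ 2) ^ (1 / 3 : ℝ)⌉₊ 2

/-- The uniform partition of the interval from `l` to `u` into `N` pieces of equal length, each
piece recorded by its two endpoints; there are no pieces if the interval is empty. -/
def unifPart (l u : ℝ) (N : ℕ) : Finset (ℝ × ℝ) :=
  if l < u then
    (Finset.range N).image fun k : ℕ =>
      (l + (k : ℝ) / N * (u - l), l + ((k : ℝ) + 1) / N * (u - l))
  else ∅

/-- The intervals, cut to `[θ(η), θ(1-η)]`, of the `q`-th band to the left of the inner region. -/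
def Params.leftBand (p : Params) (m : ℕ) (v : ℝ) (q : ℕ) : Finset (ℝ × ℝ) :=
  unifPart
    (max (p.innerLo m v - (2 ^ (q + 1) - 1) * p.radius m) (theta p.eta))
    (min (p.innerLo m v - (2 ^ q - 1) * p.radius m) (theta (1 - p.eta)))
    p.outerCount

/-- The intervals, cut to `[θ(η), θ(1-η)]`, of the `q`-th band to the right. -/
def Params.rightBand (p : Params) (m : ℕ) (v : ℝ) (q : ℕ) : Finset (ℝ × ℝ) :=
  unifPart
    (max (p.innerHi m v + (2 ^ q - 1) * p.radius m) (theta p.eta))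
    (min (p.innerHi m v + (2 ^ (q + 1) - 1) * p.radius m) (theta (1 - p.eta)))
    p.outerCount

/-- The overall partition of `[θ(η), θ(1-η)]` in epoch `m`; the bands are numbered
`0, …, ⌈log₂ T⌉`. -/
def Params.partition (p : Params) (m : ℕ) (v : ℝ) : Finset (ℝ × ℝ) :=
  unifPart (p.innerLo m v) (p.innerHi m v) (p.innerCount m v) ∪
    (Finset.range (Nat.clog 2 p.T + 1)).biUnion fun q => p.leftBand m v q ∪ p.rightBand m v q

/-- The finite set of possible predictions in epoch `m`. -/
def Params.grid (p : Params) (m : ℕ) (v : ℝ) : Finset ℝ :=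
  (p.partition m v).image (fun J => psi J.2) ∪ {p.eta, 1 - p.eta}

/-! ### The swap-regret base algorithm -/

/-- The log loss. -/
def logLoss (a : ℝ) (y : Bool) : ℝ :=
  -bit y * Real.log a - (1 - bit y) * Real.log (1 - a)

/-- Exponentially weighted online optimization on `[0,1]` (learning rate one): the action after
the cumulative loss `L`. -/
def ewoo (L : ℝ → ℝ) : ℝ :=
  (∫ x in (0 : ℝ)..1, x * Real.exp (-L x)) / ∫ x in (0 : ℝ)..1, Real.exp (-L x)

/-- The action in round `t` of the instance attached to the grid point `s`: it is started
from scratch at the beginning of the current epoch and is fed the losses `P_τ(s) ℓ(·, y_τ)`. -/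
def action (P : ℕ → ℝ →₀ ℝ) (y : ℕ → Bool) (t : ℕ) (s : ℝ) : ℝ :=
  ewoo fun x => ∑ τ ∈ Finset.Ico (2 ^ epoch t - 2) t, P τ s * logLoss x (y τ)

/-- The randomized rounding of `a ∈ [d, b]` to the two points `d < b` of `(0,1)`. -/
def twoPoint (a d b : ℝ) : ℝ →₀ ℝ :=
  let u := (b - a) / (b * (1 - b))
  let v := (a - d) / (d * (1 - d))
  Finsupp.single d (u / (u + v)) + Finsupp.single b (v / (u + v))

/-- `P` is an admissible distribution of the base algorithm in round `t`, given the past: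
it lives on the grid and is stationary for the row-stochastic matrix `Q` whose row `s` is the
rounding of the action of instance `s` to the ends of an interval of the partition containing it.
(An action which is a common endpoint of two intervals is rounded to itself in either case.) -/
def IsStationaryChoice (p : Params) (past : ℕ → ℝ →₀ ℝ) (y : ℕ → Bool) (t : ℕ)
    (P : ℝ →₀ ℝ) : Prop :=
  P.support ⊆ p.grid (epoch t) (prevMean (epoch t) y) ∧
  ∃ Q : ℝ → ℝ →₀ ℝ,
    (∀ s ∈ p.grid (epoch t) (prevMean (epoch t) y),
      ∃ J ∈ p.partition (epoch t) (prevMean (epoch t) y),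
        theta (action past y t s) ∈ Set.Icc J.1 J.2 ∧
        Q s = twoPoint (action past y t s) (psi J.1) (psi J.2)) ∧
    ∀ z, ∑ s ∈ p.grid (epoch t) (prevMean (epoch t) y), P s * Q s z = P z

/-- `P t y` is the conditional distribution of the prediction in round `t` when the outcomes are
`y`, for a forecaster that follows the epoch-based algorithm. It depends on past outcomes only.
In the first epoch (rounds `0` and `1`) it is an arbitrary distribution on `[η, 1-η]`; later on it
is any stationary distribution, however selected. -/
structure IsForecaster (p : Params) (P : ℕ → (ℕ → Bool) → ℝ →₀ ℝ) : Prop where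
  nonanticipating : ∀ t < p.T, ∀ y y' : ℕ → Bool, (∀ i < t, y i = y' i) → P t y = P t y'
  isDist : ∀ t < p.T, ∀ y, IsDist (P t y)
  firstEpoch : ∀ t < p.T, t < 2 → ∀ y, ∀ z ∈ (P t y).support, z ∈ Set.Icc p.eta (1 - p.eta)
  laterEpochs : ∀ t < p.T, 2 ≤ t → ∀ y,
    IsStationaryChoice p (fun τ => P τ y) y t (P t y)

/-! ### A real random access machine

A structured programming language over integer arrays and real arrays (array names and indices
are natural numbers), with exact real arithmetic. Every operation and every executed command has
cost one. There is no conversion from reals to integers. -/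

/-- The memory. -/
structure Store where
  int : ℕ → ℕ → ℕ
  real : ℕ → ℕ → ℝ

def Store.setInt (σ : Store) (a i n : ℕ) : Store :=
  { σ with int := Function.update σ.int a (Function.update (σ.int a) i n) }

def Store.setReal (σ : Store) (a i : ℕ) (x : ℝ) : Store :=
  { σ with real := Function.update σ.real a (Function.update (σ.real a) i x) }

/-- Integer expressions. -/
inductive IExpr where
  | lit (n : ℕ)
  | get (arr : ℕ) (i : IExpr)
  | add (e f : IExpr)
  | sub (e f : IExpr)

def IExpr.eval (σ : Store) : IExpr → ℕ
  | .lit n => n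
  | .get arr i => σ.int arr (i.eval σ)
  | .add e f => e.eval σ + f.eval σ
  | .sub e f => e.eval σ - f.eval σ

def IExpr.cost : IExpr → ℕ
  | .lit _ => 1
  | .get _ i => i.cost + 1
  | .add e f => e.cost + f.cost + 1
  | .sub e f => e.cost + f.cost + 1

/-- Real expressions. -/
inductive RExpr where
  | ofInt (e : IExpr)
  | get (arr : ℕ) (i : IExpr)
  | add (e f : RExpr)
  | sub (e f : RExpr)
  | mul (e f : RExpr)
  | div (e f : RExpr)
  | sqrt (e : RExpr)
  | log (e : RExpr)
  | sin (e : RExpr)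
  | arcsin (e : RExpr)

def RExpr.eval (σ : Store) : RExpr → ℝ
  | .ofInt e => (e.eval σ : ℝ)
  | .get arr i => σ.real arr (i.eval σ)
  | .add e f => e.eval σ + f.eval σ
  | .sub e f => e.eval σ - f.eval σ
  | .mul e f => e.eval σ * f.eval σ
  | .div e f => e.eval σ / f.eval σ
  | .sqrt e => Real.sqrt (e.eval σ)
  | .log e => Real.log (e.eval σ)
  | .sin e => Real.sin (e.eval σ)
  | .arcsin e => Real.arcsin (e.eval σ)

def RExpr.cost : RExpr → ℕ
  | .ofInt e => e.cost + 1
  | .get _ i => i.cost + 1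
  | .add e f => e.cost + f.cost + 1
  | .sub e f => e.cost + f.cost + 1
  | .mul e f => e.cost + f.cost + 1
  | .div e f => e.cost + f.cost + 1
  | .sqrt e => e.cost + 1
  | .log e => e.cost + 1
  | .sin e => e.cost + 1
  | .arcsin e => e.cost + 1

/-- Tests. -/
inductive BExpr where
  | leInt (e f : IExpr)
  | leReal (e f : RExpr)
  | neg (b : BExpr)
  | conj (b c : BExpr)

def BExpr.holds (σ : Store) : BExpr → Prop
  | .leInt e f => e.eval σ ≤ f.eval σ
  | .leReal e f => e.eval σ ≤ f.eval σ
  | .neg b => ¬ b.holds σ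
  | .conj b c => b.holds σ ∧ c.holds σ

def BExpr.cost : BExpr → ℕ
  | .leInt e f => e.cost + f.cost + 1
  | .leReal e f => e.cost + f.cost + 1
  | .neg b => b.cost + 1
  | .conj b c => b.cost + c.cost + 1

/-- Programs. -/
inductive Prog where
  | skip
  | setInt (arr : ℕ) (i e : IExpr)
  | setReal (arr : ℕ) (i : IExpr) (e : RExpr)
  | seq (c d : Prog)
  | ite (b : BExpr) (c d : Prog)
  | loop (b : BExpr) (c : Prog)

/-- `Exec c σ σ' n`: the program `c`, started in the memory `σ`, halts in the memory `σ'` after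
`n` steps; `loop b c` repeats `c` as long as `b` holds. -/
inductive Exec : Prog → Store → Store → ℕ → Prop where
  | skip (σ : Store) : Exec .skip σ σ 1
  | setInt (arr : ℕ) (i e : IExpr) (σ : Store) :
      Exec (.setInt arr i e) σ (σ.setInt arr (i.eval σ) (e.eval σ)) (i.cost + e.cost + 1)
  | setReal (arr : ℕ) (i : IExpr) (e : RExpr) (σ : Store) :
      Exec (.setReal arr i e) σ (σ.setReal arr (i.eval σ) (e.eval σ)) (i.cost + e.cost + 1)
  | seq {c d : Prog} {σ σ' σ'' : Store} {n k : ℕ} :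
      Exec c σ σ' n → Exec d σ' σ'' k → Exec (.seq c d) σ σ'' (n + k)
  | iteTrue {b : BExpr} {c d : Prog} {σ σ' : Store} {n : ℕ} :
      b.holds σ → Exec c σ σ' n → Exec (.ite b c d) σ σ' (b.cost + n + 1)
  | iteFalse {b : BExpr} {c d : Prog} {σ σ' : Store} {n : ℕ} :
      ¬ b.holds σ → Exec d σ σ' n → Exec (.ite b c d) σ σ' (b.cost + n + 1)
  | loopDone {b : BExpr} {c : Prog} {σ : Store} :
      ¬ b.holds σ → Exec (.loop b c) σ σ (b.cost + 1)
  | loopStep {b : BExpr} {c : Prog} {σ σ' σ'' : Store} {n k : ℕ} :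
      b.holds σ → Exec c σ σ' n → Exec (.loop b c) σ' σ'' k →
      Exec (.loop b c) σ σ'' (b.cost + n + k + 1)

/-- The memory before the first round: the horizon is in integer cell `(0,0)`, the numbers `C` and
`ι` are in the real cells `(0,0)` and `(0,1)`, and all else is zero. -/
def Params.initialStore (p : Params) : Store :=
  (({ int := fun _ _ => 0, real := fun _ _ => 0 } : Store).setInt 0 0 p.T
    |>.setReal 0 0 p.C).setReal 0 1 p.ι

/-- At the beginning of round `t` the machine receives the outcome of the previous round (zero in
the first round) in integer cell `(0,1)` and a number `u ∈ (0,1]`, thought of as uniformly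
random, in real cell `(0,2)`. -/
def roundInput (t : ℕ) (y : ℕ → Bool) (u : ℝ) (σ : Store) : Store :=
  (σ.setInt 0 1 (if 1 ≤ t ∧ y (t - 1) = true then 1 else 0)).setReal 0 2 u

/-- `z` is the sample from `P` that inversion of the distribution function yields from `u`:
if `u` is uniform on `(0,1]`, then `z` has distribution `P`. -/
def IsSample (P : ℝ →₀ ℝ) (u z : ℝ) : Prop :=
  ∑ x ∈ P.support with x < z, P x < u ∧ u ≤ ∑ x ∈ P.support with x ≤ z, P x

/-- The program `c`, executed once per round with the memory carried over from round to round,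
samples in every round `t < T` its prediction, which it leaves in real cell `(0,3)`, from `P t y`,
and takes at most `B` steps in each round (the first round includes all initialization; the
processing of an outcome is charged to the next round). -/
def Implements (c : Prog) (p : Params) (P : ℕ → (ℕ → Bool) → ℝ →₀ ℝ) (B : ℝ) : Prop :=
  ∀ (y : ℕ → Bool) (u : ℕ → ℝ), (∀ t, u t ∈ Set.Ioc (0 : ℝ) 1) →
    ∃ σ : ℕ → Store, σ 0 = p.initialStore ∧
      ∀ t < p.T, ∃ n : ℕ,
        Exec c (roundInput t y (u t) (σ t)) (σ (t + 1)) n ∧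
        IsSample (P t y) (u t) ((σ (t + 1)).real 0 3) ∧
        (n : ℝ) ≤ B

end

end AdaptiveCalibration

namespace AdaptiveCalibration
noncomputable section
open Real Set MeasureTheory

/-! A Bernoulli KL divergence is an excess log loss, so the pseudo KL error is the swap regret of
the predictions for the log loss: each grid point `s` competes with its own constant `rhoBar s`
(`IsRun.pseudoKL_eq`). By stationarity the mean loss of the prediction is the mean loss of the
rounded actions. Hence the swap regret is the sum of the regrets of the instances plus the excess
loss caused by rounding (`IsRun.pseudoKL_le`).

Regret: the action of an instance is a ratio of smoothed weights, and a potential argument bounds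
its regret by O(log T) per epoch (`regret_le`). With R = (1 + C/ι)^(1/3) an epoch has O(R + K log T)
grid points, so all regrets add up to O(log² T · (R + K log T)).

Rounding: in the coordinate θ, where the Hellinger distance is Euclidean up to constants, rounding
to the ends of an interval of length h costs at most 2h² (`twoPoint_excess_le`). The choice of N_m
makes the inner pieces cost O(ιR) per epoch. If c is the best constant mean and θ of the last
average is within r_m of θ(c), then an outer piece is shorter, by the factor K, than the distance of
each of its points from θ(c) (`Params.Good.partition_sq_le`). So the outer excess is at most 2V/K²,
where V sums the squared distances of the transformed actions from θ(c).

The sum V is in turn controlled by the regret. Since E √(a(y)/q(y)) is one minus the Hellinger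
distance of a and q, a supermartingale bounds the Hellinger distances of the actions from the true
means by half the loss of the actions in excess of that of the means, plus ι. This excess is the
regret against c plus the excess of c over the means, and a second supermartingale bounds the latter
by O((1 + C + ι) log T) (`IsForecaster.sqDist_le`). As K³ is of order (1 + C)/log² T, unless this is
small, the terms (1 + C) log T / K² and K log³ T balance at (1 + C)^(1/3) log^(7/3) T. The closeness
of the epoch averages to c follows from an exponential moment of their Hellinger deviation
(`expect_exp_hell_le`), and a single use of Markov's inequality covers all three events.

Computation: each row of the transition matrix Q has two adjacent entries, so 1 - Q and its adjoint
are applied in time linear in the number M of grid points. Conjugate gradients for the least-squares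
problem (1 - Q)x ≈ 1 reach within M steps a residual in the kernel of the adjoint. It is nonzero,
because (1 - Q)x = 1 fails where x is minimal, and its normalized absolute value is stationary
(`statDist_stationary`). A round thus costs O(M²), with M = O(log T · (1 + C)^(1/3)). The program is
verified by cost-bounded triples `Ter` and the frame relation `Same`. -/

lemma bit_true : bit true = 1 := rfl
lemma bit_false : bit false = 0 := rfl
lemma bit_nonneg (b : Bool) : 0 ≤ bit b := by cases b <;> simp [bit]
lemma bit_le_one (b : Bool) : bit b ≤ 1 := by cases b <;> simp [bit]

/-! ### The arcsine transformation -/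

lemma theta_nonneg (x : ℝ) : 0 ≤ theta x := by
  unfold theta
  have := arcsin_nonneg.2 (sqrt_nonneg x)
  linarith

lemma theta_le_pi (x : ℝ) : theta x ≤ π := by
  unfold theta
  have := arcsin_le_pi_div_two (sqrt x)
  linarith

lemma theta_mono : Monotone theta := fun _ _ h => by
  unfold theta
  have := monotone_arcsin (sqrt_le_sqrt h)
  linarith

lemma sin_theta_half {x : ℝ} (h : x ∈ Icc (0 : ℝ) 1) : sin (theta x / 2) = sqrt x := by
  unfold theta
  rw [mul_div_cancel_left₀ _ (two_ne_zero)]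
  exact sin_arcsin (by linarith [sqrt_nonneg x]) (sqrt_le_one.2 h.2)

lemma cos_theta_half {x : ℝ} (h : x ∈ Icc (0 : ℝ) 1) : cos (theta x / 2) = sqrt (1 - x) := by
  unfold theta
  rw [mul_div_cancel_left₀ _ (two_ne_zero), cos_arcsin, sq_sqrt h.1]

lemma psi_theta {x : ℝ} (h : x ∈ Icc (0 : ℝ) 1) : psi (theta x) = x := by
  unfold psi
  rw [sin_theta_half h, sq_sqrt h.1]

lemma theta_psi {z : ℝ} (h : z ∈ Icc (0 : ℝ) π) : theta (psi z) = z := by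
  unfold theta psi
  rw [sqrt_sq (sin_nonneg_of_nonneg_of_le_pi (by linarith [h.1]) (by linarith [h.2, pi_pos])),
    arcsin_sin (by linarith [h.1, pi_pos]) (by linarith [h.2])]
  ring

lemma psi_strictMonoOn : StrictMonoOn psi (Icc 0 π) := by
  intro x hx y hy hxy
  by_contra h
  push Not at h
  have := theta_mono h
  rw [theta_psi hx, theta_psi hy] at this
  linarith

lemma theta_strictMonoOn : StrictMonoOn theta (Icc 0 1) := by
  intro x hx y hy hxy
  by_contra h
  push Not at h
  have := psi_strictMonoOn.monotoneOn ⟨theta_nonneg _, theta_le_pi _⟩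
    ⟨theta_nonneg _, theta_le_pi _⟩ h
  rw [psi_theta hx, psi_theta hy] at this
  linarith

/-! ### The squared Hellinger distance of Bernoulli laws -/

/-- One minus the Bhattacharyya coefficient of two Bernoulli laws. -/
def hell (x q : ℝ) : ℝ := 1 - sqrt (x * q) - sqrt ((1 - x) * (1 - q))

/-- The Bhattacharyya coefficient is the cosine of half the difference of the transformed points, by
the addition formula. This is why the partition is uniform in θ. -/
lemma hell_eq {x q : ℝ} (hx : x ∈ Icc (0 : ℝ) 1) (hq : q ∈ Icc (0 : ℝ) 1) :
    hell x q = 2 * sin ((theta x - theta q) / 4) ^ 2 := by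
  have h1 : cos ((theta x - theta q) / 2) = sqrt (1 - x) * sqrt (1 - q) + sqrt x * sqrt q := by
    rw [sub_div, cos_sub, cos_theta_half hx, cos_theta_half hq, sin_theta_half hx,
      sin_theta_half hq]
  have h2 : cos ((theta x - theta q) / 2) = 1 - 2 * sin ((theta x - theta q) / 4) ^ 2 := by
    rw [show (theta x - theta q) / 2 = 2 * ((theta x - theta q) / 4) by ring, cos_two_mul, sin_sq]
    ring
  unfold hell
  rw [sqrt_mul hx.1, sqrt_mul (by linarith [hx.2])]
  linarith

/-- Jordan's inequality `2/π * |u| ≤ |sin u|` at a quarter of the difference, which is at most π/4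
in absolute value. -/
lemma sq_theta_sub_le {x q : ℝ} (hx : x ∈ Icc (0 : ℝ) 1) (hq : q ∈ Icc (0 : ℝ) 1) :
    (theta x - theta q) ^ 2 ≤ 2 * π ^ 2 * hell x q := by
  rw [hell_eq hx hq, ← sq_abs (sin _), ← sq_abs (theta x - theta q)]
  have hpi := pi_pos
  have h0 : |theta x - theta q| ≤ π := by
    rw [abs_le]
    constructor <;> linarith [theta_nonneg x, theta_nonneg q, theta_le_pi x, theta_le_pi q]
  have h1 : 2 / π * |(theta x - theta q) / 4| ≤ |sin ((theta x - theta q) / 4)| := by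
    apply mul_abs_le_abs_sin
    rw [abs_div, abs_of_pos (by norm_num : (0 : ℝ) < 4)]
    linarith
  rw [abs_div, abs_of_pos (by norm_num : (0 : ℝ) < 4)] at h1
  have h2 : |theta x - theta q| ≤ 2 * π * |sin ((theta x - theta q) / 4)| := by
    have := mul_le_mul_of_nonneg_left h1 (by positivity : 0 ≤ 2 * π)
    calc |theta x - theta q| = 2 * π * (2 / π * (|theta x - theta q| / 4)) := by field_simp; ring
      _ ≤ _ := this
  calc |theta x - theta q| ^ 2 ≤ (2 * π * |sin ((theta x - theta q) / 4)|) ^ 2 := by gcongr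
    _ = _ := by ring

/-- A geometric mean dominates the minimum, and the minima of the two masses add up to one minus the
total variation distance `|x - q|`. -/
lemma hell_le_abs {x q : ℝ} (hx : x ∈ Icc (0 : ℝ) 1) (hq : q ∈ Icc (0 : ℝ) 1) :
    hell x q ≤ |x - q| := by
  have key : ∀ a b : ℝ, 0 ≤ a → a ≤ b → a ≤ sqrt (a * b) := fun a b h0 h =>
    le_sqrt_of_sq_le (by nlinarith)
  unfold hell
  rcases le_total x q with h | h
  · rw [abs_of_nonpos (by linarith)]
    have h1 := key x q hx.1 h
    have h2 := key (1 - q) (1 - x) (by linarith [hq.2]) (by linarith)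
    rw [mul_comm (1 - q)] at h2
    linarith
  · rw [abs_of_nonneg (by linarith)]
    have h1 := key q x hq.1 h
    have h2 := key (1 - x) (1 - q) (by linarith [hx.2]) (by linarith)
    rw [mul_comm q] at h1
    linarith

/-! ### The action of exponentially weighted online optimization -/

/-- The action is the mean of a Beta law. The function `x^(α+1) (1-x)^(β+1)` vanishes at both ends
of `[0,1]`, and the integral of its derivative is a linear relation between the two integrals in
question. -/
lemma ewoo_log {α β : ℝ} (hα : 0 ≤ α) (hβ : 0 ≤ β) :
    ewoo (fun x => -α * log x - β * log (1 - x)) = (α + 1) / (α + β + 2) := by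
  set E : ℝ → ℝ := fun x => exp (-(-α * log x - β * log (1 - x))) with hE
  have hmeas : Measurable E := by fun_prop
  have hE1 : ∀ x ∈ Icc (0 : ℝ) 1, E x ≤ 1 := by
    intro x hx
    rw [hE]
    simp only [exp_le_one_iff]
    have h1 := log_nonpos hx.1 hx.2
    have h2 := log_nonpos (by linarith [hx.2] : 0 ≤ 1 - x) (by linarith [hx.1])
    nlinarith
  have hint : IntervalIntegrable E volume 0 1 := by
    rw [intervalIntegrable_iff_integrableOn_Icc_of_le zero_le_one]
    refine Measure.integrableOn_of_bounded (M := 1) (by simp) hmeas.aestronglyMeasurable ?_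
    filter_upwards [ae_restrict_mem measurableSet_Icc] with x hx
    rw [norm_of_nonneg (exp_pos _).le]
    exact hE1 x hx
  have hint2 : IntervalIntegrable (fun x => x * E x) volume 0 1 := by
    rw [intervalIntegrable_iff_integrableOn_Icc_of_le zero_le_one]
    refine Measure.integrableOn_of_bounded (M := 1) (by simp)
      (measurable_id.mul hmeas).aestronglyMeasurable ?_
    filter_upwards [ae_restrict_mem measurableSet_Icc] with x hx
    rw [norm_of_nonneg (mul_nonneg hx.1 (exp_pos _).le)]
    have := hE1 x hx
    nlinarith [hx.1, hx.2, (exp_pos (-(-α * log x - β * log (1 - x)))).le]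
  have hpos : 0 < ∫ x in (0 : ℝ)..1, E x :=
    intervalIntegral.intervalIntegral_pos_of_pos_on hint (fun x _ => exp_pos _) zero_lt_one
  have hcont : ContinuousOn (fun x : ℝ => x ^ (α + 1) * (1 - x) ^ (β + 1)) (Icc 0 1) := by
    refine ContinuousOn.mul ?_ ?_
    · exact (continuous_id.rpow_const fun x => Or.inr (by linarith)).continuousOn
    · exact ((continuous_const.sub continuous_id).rpow_const
        fun x => Or.inr (by linarith)).continuousOn
  have hderiv : ∀ x ∈ Ioo (0 : ℝ) 1, HasDerivAt (fun x : ℝ => x ^ (α + 1) * (1 - x) ^ (β + 1))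
      ((α + 1) * E x - (α + β + 2) * (x * E x)) x := by
    intro x hx
    have hx1 : 0 < 1 - x := by linarith [hx.2]
    have d1 := hasDerivAt_rpow_const (x := x) (p := α + 1) (Or.inl hx.1.ne')
    have d2 : HasDerivAt (fun x : ℝ => (1 - x) ^ (β + 1)) ((-1) * (β + 1) * (1 - x) ^ (β + 1 - 1)) x :=
      ((hasDerivAt_id x).const_sub 1).rpow_const (Or.inl hx1.ne')
    refine (d1.mul d2).congr_deriv ?_
    symm
    have e1 : E x = x ^ α * (1 - x) ^ β := by
      rw [hE]
      simp only
      rw [rpow_def_of_pos hx.1, rpow_def_of_pos hx1, ← exp_add]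
      congr 1
      ring
    rw [e1, add_sub_cancel_right, add_sub_cancel_right, rpow_add_one hx.1.ne',
      rpow_add_one hx1.ne']
    ring
  have hfund := intervalIntegral.integral_eq_sub_of_hasDerivAt_of_le zero_le_one hcont hderiv
    ((hint.const_mul _).sub (hint2.const_mul _))
  rw [intervalIntegral.integral_sub (hint.const_mul _) (hint2.const_mul _),
    intervalIntegral.integral_const_mul, intervalIntegral.integral_const_mul,
    zero_rpow (by linarith), sub_self, zero_rpow (by linarith)] at hfund
  unfold ewoo
  rw [div_eq_div_iff hpos.ne' (by linarith)]
  change (∫ x in (0 : ℝ)..1, x * E x) * (α + β + 2) = (α + 1) * ∫ x in (0 : ℝ)..1, E x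
  linarith

/-- The weight that the instance `s` has received in the rounds of `Ico lo t`. -/
def weight (P : ℕ → ℝ →₀ ℝ) (lo t : ℕ) (s : ℝ) : ℝ := ∑ τ ∈ Finset.Ico lo t, P τ s

/-- The part of the weight that came with a positive outcome. -/
def weightOne (P : ℕ → ℝ →₀ ℝ) (y : ℕ → Bool) (lo t : ℕ) (s : ℝ) : ℝ :=
  ∑ τ ∈ Finset.Ico lo t, P τ s * bit (y τ)

lemma weightOne_nonneg {P : ℕ → ℝ →₀ ℝ} {y : ℕ → Bool} {lo t : ℕ} {s : ℝ}
    (h : ∀ τ ∈ Finset.Ico lo t, 0 ≤ P τ s) : 0 ≤ weightOne P y lo t s :=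
  Finset.sum_nonneg fun τ hτ => mul_nonneg (h τ hτ) (bit_nonneg _)

lemma weightOne_le_weight {P : ℕ → ℝ →₀ ℝ} {y : ℕ → Bool} {lo t : ℕ} {s : ℝ}
    (h : ∀ τ ∈ Finset.Ico lo t, 0 ≤ P τ s) : weightOne P y lo t s ≤ weight P lo t s :=
  Finset.sum_le_sum fun τ hτ => mul_le_of_le_one_right (h τ hτ) (bit_le_one _)

/-- The cumulative loss depends on the history only through the weights of the two outcomes, so the
action is a weighted Laplace rule. Two counters per instance therefore suffice to run it. -/
lemma action_eq {P : ℕ → ℝ →₀ ℝ} {y : ℕ → Bool} {t : ℕ} {s : ℝ}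
    (h : ∀ τ ∈ Finset.Ico (2 ^ epoch t - 2) t, 0 ≤ P τ s) :
    action P y t s = (weightOne P y (2 ^ epoch t - 2) t s + 1) /
      (weight P (2 ^ epoch t - 2) t s + 2) := by
  have h1 := weightOne_nonneg (y := y) h
  have h2 := weightOne_le_weight (y := y) h
  have := ewoo_log h1 (sub_nonneg.2 h2)
  rw [add_sub_cancel] at this
  rw [← this]
  unfold action
  congr 1
  funext x
  unfold logLoss weightOne weight
  rw [← Finset.sum_sub_distrib, neg_mul, Finset.sum_mul, Finset.sum_mul, ← Finset.sum_neg_distrib,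
    ← Finset.sum_sub_distrib]
  exact Finset.sum_congr rfl fun τ _ => by ring

end
end AdaptiveCalibration

namespace AdaptiveCalibration
noncomputable section
open Real Set MeasureTheory

/-! ### The log loss and the regret of the base instances -/

lemma logLoss_true (a : ℝ) : logLoss a true = -log a := by simp [logLoss, bit]

lemma logLoss_false (a : ℝ) : logLoss a false = -log (1 - a) := by simp [logLoss, bit]

lemma logLoss_nonneg {a : ℝ} (h : a ∈ Icc (0 : ℝ) 1) (y : Bool) : 0 ≤ logLoss a y := by
  have h1 := log_nonpos h.1 h.2
  have h2 := log_nonpos (by linarith [h.2] : 0 ≤ 1 - a) (by linarith [h.1])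
  cases y <;> simp [logLoss, bit] <;> assumption

lemma logLoss_le {a c : ℝ} (hc : 0 < c) (h : a ∈ Icc c (1 - c)) (y : Bool) :
    logLoss a y ≤ log (1 / c) := by
  rw [one_div, log_inv]
  have h1 := log_le_log hc h.1
  have h2 := log_le_log hc (by linarith [h.2] : c ≤ 1 - a)
  cases y <;> simp [logLoss, bit] <;> linarith

/-- The convex function `x log x` lies above its tangent at `x`. -/
lemma mul_log_sub_ge {x y : ℝ} (hx : 0 < x) (hy : 0 < y) :
    (y - x) * (log x + 1) ≤ y * log y - x * log x := by
  have h := log_le_sub_one_of_pos (div_pos hx hy)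
  rw [log_div hx.ne' hy.ne'] at h
  have := mul_le_mul_of_nonneg_left h hy.le
  have e : y * (x / y - 1) = x - y := by field_simp
  nlinarith

/-- The potential whose increments bound the losses of the base instances. -/
def potential (α β : ℝ) : ℝ :=
  (α + β + 2) * log (α + β + 2) - (α + 1) * log (α + 1) - (β + 1) * log (β + 1)
    + log (α + 1) + log (β + 1)

/-- Tangents of `x log x` at the old total and at the new count give the bound with `log (α + p +
1)` in place of `log (α + 1)`. The summand `log (α + 1)` of the potential pays for the difference,
because `p ≤ 1`. -/
lemma potential_step {α β p : ℝ} (hα : 0 ≤ α) (hβ : 0 ≤ β) (hp0 : 0 ≤ p) (hp1 : p ≤ 1) :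
    p * -log ((α + 1) / (α + β + 2)) ≤ potential (α + p) β - potential α β := by
  have h1 := mul_log_sub_ge (x := α + β + 2) (y := α + p + β + 2) (by linarith) (by linarith)
  have h2 := mul_log_sub_ge (x := α + p + 1) (y := α + 1) (by linarith) (by linarith)
  have h3 : log (α + 1) ≤ log (α + p + 1) := log_le_log (by linarith) (by linarith)
  rw [log_div (by linarith) (by linarith)]
  unfold potential
  nlinarith

lemma potential_symm (α β : ℝ) : potential α β = potential β α := by
  unfold potential
  rw [add_comm α β]
  ring

/-- Up to logarithms the potential is the unnormalized empirical entropy, which no constant action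
`ρ` beats. Of the four logarithms, two come from replacing `α + β + 2` by `α + β` and two from the
correction terms. The hypotheses `h1` and `h2` exclude comparators of infinite loss, which the
convention `log 0 = 0` would make cheap. -/
lemma potential_le {α β ρ : ℝ} (hα : 0 ≤ α) (hβ : 0 ≤ β) (h1 : 0 < α → 0 < ρ)
    (h2 : 0 < β → ρ < 1) (hρ : ρ ∈ Icc (0 : ℝ) 1) :
    potential α β ≤ -α * log ρ - β * log (1 - ρ) + 4 * log (α + β + 2) + 2 := by
  have hmono : ∀ x : ℝ, 0 ≤ x → x * log x ≤ (x + 1) * log (x + 1) := by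
    intro x hx
    rcases hx.eq_or_lt with rfl | hx
    · simp
    · have := mul_log_sub_ge (x := x + 1) (y := x) (by linarith) hx
      have h4 := log_le_log hx (by linarith : x ≤ x + 1)
      have h3 := log_nonneg (by linarith : 1 ≤ x + 1)
      nlinarith
  have hn : (α + β + 2) * log (α + β + 2) ≤ (α + β) * log (α + β) + 2 * (log (α + β + 2) + 1) := by
    rcases (add_nonneg hα hβ).eq_or_lt with h | h
    · rw [← h]; norm_num
    · have := mul_log_sub_ge (x := α + β + 2) (y := α + β) (by linarith) h
      nlinarith
  have hl1 : log (α + 1) ≤ log (α + β + 2) := log_le_log (by linarith) (by linarith)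
  have hl2 : log (β + 1) ≤ log (α + β + 2) := log_le_log (by linarith) (by linarith)
  -- Gibbs' inequality, from `log u ≤ u - 1` for each of the two outcomes.
  have hkey : (α + β) * log (α + β) - α * log α - β * log β ≤ -α * log ρ - β * log (1 - ρ) := by
    have aux : ∀ x r n : ℝ, 0 ≤ x → (0 < x → 0 < r) → (0 < x → 0 < n) → 0 ≤ r → 0 ≤ n →
        x * log r + x * log n - x * log x ≤ r * n - x := by
      intro x r n hx h1 h2 hr hn
      rcases hx.eq_or_lt with rfl | hx
      · simp; positivity
      · have h1 := h1 hx
        have h2 := h2 hx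
        have h := log_le_sub_one_of_pos (div_pos (mul_pos h1 h2) hx)
        rw [log_div (mul_pos h1 h2).ne' hx.ne', log_mul h1.ne' h2.ne'] at h
        have := mul_le_mul_of_nonneg_left h hx.le
        have e : x * (r * n / x - 1) = r * n - x := by field_simp
        linarith
    have a1 := aux α ρ (α + β) hα h1 (by intro; linarith) hρ.1 (by linarith)
    have a2 := aux β (1 - ρ) (α + β) hβ (fun h => by linarith [h2 h]) (by intro; linarith)
      (by linarith [hρ.2]) (by linarith)
    nlinarith
  have m1 := hmono α hα
  have m2 := hmono β hβ
  unfold potential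
  linarith

lemma potential_zero_nonneg : 0 ≤ potential 0 0 := by
  unfold potential
  norm_num
  exact log_nonneg (by norm_num)

lemma weight_succ {P : ℕ → ℝ →₀ ℝ} {lo t : ℕ} (h : lo ≤ t) (s : ℝ) :
    weight P lo (t + 1) s = weight P lo t s + P t s := by
  unfold weight
  rw [Finset.sum_Ico_succ_top h]

lemma weightOne_succ {P : ℕ → ℝ →₀ ℝ} {y : ℕ → Bool} {lo t : ℕ} (h : lo ≤ t) (s : ℝ) :
    weightOne P y lo (t + 1) s = weightOne P y lo t s + P t s * bit (y t) := by
  unfold weightOne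
  rw [Finset.sum_Ico_succ_top h]

/-- The increments of the potential telescope, starting from `potential 0 0 = 2 log 2`; a negative
outcome is reduced to a positive one by the symmetry of the potential. -/
lemma sum_loss_le_potential {P : ℕ → ℝ →₀ ℝ} {y : ℕ → Bool} {lo hi : ℕ} {s : ℝ} (hle : lo ≤ hi)
    (h : ∀ τ ∈ Finset.Ico lo hi, P τ s ∈ Icc (0 : ℝ) 1) :
    ∑ t ∈ Finset.Ico lo hi, P t s *
        logLoss ((weightOne P y lo t s + 1) / (weight P lo t s + 2)) (y t)
      ≤ potential (weightOne P y lo hi s) (weight P lo hi s - weightOne P y lo hi s) := by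
  induction hi, hle using Nat.le_induction with
  | base => simpa [weight, weightOne] using potential_zero_nonneg
  | succ n hn ih =>
    have hsub : ∀ τ ∈ Finset.Ico lo n, P τ s ∈ Icc (0 : ℝ) 1 := fun τ hτ => by
      rw [Finset.mem_Ico] at hτ
      exact h τ (Finset.mem_Ico.2 ⟨hτ.1, by omega⟩)
    have ih := ih hsub
    have hP := h n (Finset.mem_Ico.2 ⟨hn, by omega⟩)
    rw [Finset.sum_Ico_succ_top hn, weight_succ hn, weightOne_succ hn]
    set α := weightOne P y lo n s
    have hα : 0 ≤ α := weightOne_nonneg fun τ hτ => (hsub τ hτ).1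
    have hβ : 0 ≤ weight P lo n s - α :=
      sub_nonneg.2 (weightOne_le_weight fun τ hτ => (hsub τ hτ).1)
    set β := weight P lo n s - α with hβdef
    have hw : weight P lo n s = α + β := by rw [hβdef]; ring
    rw [hw]
    cases hy : y n
    · have := potential_step hβ hα hP.1 hP.2
      rw [potential_symm (β + P n s), potential_symm β] at this
      have e : 1 - (α + 1) / (α + β + 2) = (β + 1) / (β + α + 2) := by
        rw [add_comm β α]; field_simp; ring
      rw [logLoss_false, e, bit_false, mul_zero, add_zero]
      rw [show α + β + P n s - α = β + P n s by ring]
      linarith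
    · have := potential_step hα hβ hP.1 hP.2
      rw [logLoss_true, bit_true, mul_one]
      rw [show α + β + P n s - (α + P n s) = β by ring]
      linarith

/-- The loss of the constant action `ρ`. -/
lemma sum_logLoss_const (P : ℕ → ℝ →₀ ℝ) (y : ℕ → Bool) (lo hi : ℕ) (s ρ : ℝ) :
    ∑ t ∈ Finset.Ico lo hi, P t s * logLoss ρ (y t) =
      -weightOne P y lo hi s * log ρ
        - (weight P lo hi s - weightOne P y lo hi s) * log (1 - ρ) := by
  unfold logLoss weight weightOne
  rw [← Finset.sum_sub_distrib, neg_mul, Finset.sum_mul, Finset.sum_mul, ← Finset.sum_neg_distrib,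
    ← Finset.sum_sub_distrib]
  exact Finset.sum_congr rfl fun τ _ => by ring

lemma regret_le {P : ℕ → ℝ →₀ ℝ} {y : ℕ → Bool} {lo hi : ℕ} {s ρ : ℝ} (hle : lo ≤ hi)
    (h : ∀ τ ∈ Finset.Ico lo hi, P τ s ∈ Icc (0 : ℝ) 1) (hρ : ρ ∈ Icc (0 : ℝ) 1)
    (h1 : 0 < weightOne P y lo hi s → 0 < ρ)
    (h2 : 0 < weight P lo hi s - weightOne P y lo hi s → ρ < 1) :
    ∑ t ∈ Finset.Ico lo hi, P t s *
        (logLoss ((weightOne P y lo t s + 1) / (weight P lo t s + 2)) (y t) - logLoss ρ (y t))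
      ≤ 4 * log (weight P lo hi s + 2) + 2 := by
  have a1 := sum_loss_le_potential (y := y) hle h
  have a2 := potential_le (weightOne_nonneg (y := y) fun τ hτ => (h τ hτ).1)
    (sub_nonneg.2 (weightOne_le_weight (y := y) fun τ hτ => (h τ hτ).1)) h1 h2 hρ
  rw [add_sub_cancel] at a2
  simp_rw [mul_sub]
  rw [Finset.sum_sub_distrib, sum_logLoss_const]
  linarith

/-! ### Randomized rounding -/

lemma twoPoint_sum (a d b : ℝ) (f : ℝ → ℝ) :
    (twoPoint a d b).sum (fun z w => w * f z) =
      ((b - a) / (b * (1 - b))) / ((b - a) / (b * (1 - b)) + (a - d) / (d * (1 - d))) * f d +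
      ((a - d) / (d * (1 - d))) / ((b - a) / (b * (1 - b)) + (a - d) / (d * (1 - d))) * f b := by
  unfold twoPoint
  rw [Finsupp.sum_add_index' (by simp) (by intros; ring), Finsupp.sum_single_index (by simp),
    Finsupp.sum_single_index (by simp)]

/-- After `log u ≤ u - 1` is applied at both ends, the weights of the rounding are exactly those for
which the two outcomes give the same bound: the contributions of `d` and `b` combine to `(b - a) (a
- d) (b - d)` in both cases. -/
lemma twoPoint_excess {a d b : ℝ} (hd : 0 < d) (hb : b < 1) (hdb : d < b) (hda : d ≤ a)
    (hab : a ≤ b) (y : Bool) :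
    (twoPoint a d b).sum (fun z w => w * logLoss z y) - logLoss a y ≤
      (b - a) * (a - d) * (b - d) / ((b - a) * (d * (1 - d)) + (a - d) * (b * (1 - b))) := by
  rw [twoPoint_sum]
  have hd1 : 0 < 1 - d := by linarith
  have hb0 : 0 < b := by linarith
  have hb1 : 0 < 1 - b := by linarith
  have ha0 : 0 < a := by linarith
  have ha1 : 0 < 1 - a := by linarith
  have hbb : 0 < b * (1 - b) := by positivity
  have hdd : 0 < d * (1 - d) := by positivity
  have hu0 : 0 ≤ b - a := by linarith
  have hv0 : 0 ≤ a - d := by linarith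
  have hW : 0 < (b - a) * (d * (1 - d)) + (a - d) * (b * (1 - b)) := by
    rcases hu0.eq_or_lt with h | h
    · have : 0 < a - d := by linarith
      rw [← h]; simp; positivity
    · have := mul_nonneg hv0 hbb.le
      have := mul_pos h hdd
      linarith
  set W := (b - a) * (d * (1 - d)) + (a - d) * (b * (1 - b)) with hWdef
  have e0 : (b - a) / (b * (1 - b)) + (a - d) / (d * (1 - d)) = W / (b * (1 - b) * (d * (1 - d))) := by
    rw [hWdef]; field_simp
  have eu : (b - a) / (b * (1 - b)) / (W / (b * (1 - b) * (d * (1 - d)))) =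
      (b - a) * (d * (1 - d)) / W := by field_simp
  have ev : (a - d) / (d * (1 - d)) / (W / (b * (1 - b) * (d * (1 - d)))) =
      (a - d) * (b * (1 - b)) / W := by field_simp
  rw [e0, eu, ev]
  have hlog : ∀ x z : ℝ, 0 < x → 0 < z → x * (log x - log z) ≥ x - z := by
    intro x z hx hz
    have := mul_log_sub_ge (x := x) (y := z) hx hz
    have h := log_le_sub_one_of_pos (div_pos hz hx)
    rw [log_div hz.ne' hx.ne'] at h
    have := mul_le_mul_of_nonneg_left h hx.le
    have e : x * (z / x - 1) = z - x := by field_simp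
    linarith
  rw [le_div_iff₀ hW]
  have e1 : ∀ L1 L2 L3 : ℝ, ((b - a) * (d * (1 - d)) / W * L1 + (a - d) * (b * (1 - b)) / W * L2 - L3) * W
      = (b - a) * (d * (1 - d)) * (L1 - L3) + (a - d) * (b * (1 - b)) * (L2 - L3) := by
    intro L1 L2 L3
    have : ((b - a) * (d * (1 - d)) / W * L1 + (a - d) * (b * (1 - b)) / W * L2 - L3) * W =
      (b - a) * (d * (1 - d)) * L1 + (a - d) * (b * (1 - b)) * L2 - L3 * W := by field_simp
    rw [this, hWdef]; ring
  rw [e1]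
  cases y
  · simp only [logLoss, bit_false, neg_zero, zero_mul, zero_sub, sub_zero, one_mul]
    have h1 := hlog (1 - d) (1 - a) hd1 ha1
    have h2 := hlog (1 - b) (1 - a) hb1 ha1
    have h3 := mul_le_mul_of_nonneg_left h1 (mul_nonneg hu0 hd.le)
    have h4 := mul_le_mul_of_nonneg_left h2 (mul_nonneg hv0 hb0.le)
    linarith
  · simp only [logLoss, bit_true, neg_mul, one_mul, sub_self, zero_mul, sub_zero]
    have h1 := hlog d a hd ha0
    have h2 := hlog b a hb0 ha0
    have h3 := mul_le_mul_of_nonneg_left h1 (mul_nonneg hu0 hd1.le)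
    have h4 := mul_le_mul_of_nonneg_left h2 (mul_nonneg hv0 hb1.le)
    linarith

/-- In the transformed coordinate `b - d` is a product of the sines of the midpoint and of the
half-length, and `x (1 - x)` is a quarter of a squared sine. It remains to compare the sine at the
midpoint with that at one endpoint, and there the length bound π/2 enters. -/
lemma twoPoint_excess_le {a z w : ℝ} (hz : 0 < z) (hzw : z < w) (hw : w < π) (hh : w - z ≤ π / 2)
    (ha : theta a ∈ Icc z w) (ha01 : a ∈ Icc (0 : ℝ) 1) (y : Bool) :
    (twoPoint a (psi z) (psi w)).sum (fun x m => m * logLoss x y) - logLoss a y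
      ≤ 2 * (w - z) ^ 2 := by
  have hpi := pi_pos
  have hmz : z ∈ Icc (0 : ℝ) π := ⟨hz.le, by linarith⟩
  have hmw : w ∈ Icc (0 : ℝ) π := ⟨by linarith, hw.le⟩
  have hma : theta a ∈ Icc (0 : ℝ) π := ⟨theta_nonneg _, theta_le_pi _⟩
  have hd : 0 < psi z := pow_pos (sin_pos_of_pos_of_lt_pi (by linarith) (by linarith)) 2
  have hb : psi w < 1 := by
    have := psi_strictMonoOn hmw ⟨hpi.le, le_rfl⟩ hw
    simpa [psi] using this
  have hdb := psi_strictMonoOn hmz hmw hzw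
  have hda : psi z ≤ a := by
    have := psi_strictMonoOn.monotoneOn hmz hma ha.1
    rwa [psi_theta ha01] at this
  have hab : a ≤ psi w := by
    have := psi_strictMonoOn.monotoneOn hma hmw ha.2
    rwa [psi_theta ha01] at this
  refine (twoPoint_excess hd hb hdb hda hab y).trans ?_
  set d := psi z with hddef
  set b := psi w with hbdef
  have hbb : 0 < b * (1 - b) := mul_pos (by linarith) (by linarith)
  have hdd : 0 < d * (1 - d) := mul_pos (by linarith) (by linarith)
  have hu0 : 0 ≤ b - a := by linarith
  have hv0 : 0 ≤ a - d := by linarith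
  have hbd : 0 ≤ b - d := by linarith
  have hW : 0 < (b - a) * (d * (1 - d)) + (a - d) * (b * (1 - b)) := by
    rcases hu0.eq_or_lt with h | h
    · have : 0 < a - d := by linarith
      rw [← h]; simp; positivity
    · have := mul_nonneg hv0 hbb.le
      have := mul_pos h hdd
      linarith
  rw [div_le_iff₀ hW]
  -- `b - d` and `x (1 - x)` in terms of sines
  have hbde : b - d = sin ((w + z) / 2) * sin ((w - z) / 2) := by
    rw [hbdef, hddef]
    unfold psi
    rw [sin_sq_eq_half_sub, sin_sq_eq_half_sub, show 2 * (w / 2) = w by ring,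
      show 2 * (z / 2) = z by ring]
    have := cos_sub_cos z w
    rw [show (z - w) / 2 = -((w - z) / 2) by ring, sin_neg, add_comm z w] at this
    linarith
  have hvar : ∀ x : ℝ, psi x * (1 - psi x) = sin x ^ 2 / 4 := by
    intro x
    have h2 := sin_two_mul (x / 2)
    rw [show 2 * (x / 2) = x by ring] at h2
    unfold psi
    rw [← cos_sq', h2]
    ring
  have hsin : sin ((w - z) / 2) ≤ (w - z) / 2 := sin_le (by linarith)
  have hsin0 : 0 ≤ sin ((w - z) / 2) :=
    sin_nonneg_of_nonneg_of_le_pi (by linarith) (by linarith)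
  have hsin1 : 0 ≤ sin ((w + z) / 2) :=
    sin_nonneg_of_nonneg_of_le_pi (by linarith) (by linarith)
  -- it suffices to control one of the two endpoints
  have suff : (b - d) ^ 2 ≤ 2 * (w - z) ^ 2 * (b * (1 - b)) ∨
      (b - d) ^ 2 ≤ 2 * (w - z) ^ 2 * (d * (1 - d)) := by
    have half : ∀ u v : ℝ, 0 ≤ sin u → sin u ≤ sqrt 2 * sin v →
        (sin u * sin ((w - z) / 2)) ^ 2 ≤ 2 * (w - z) ^ 2 * (sin v ^ 2 / 4) := by
      intro u v hu h
      have h1 : sin u ^ 2 ≤ 2 * sin v ^ 2 := by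
        calc sin u ^ 2 ≤ (sqrt 2 * sin v) ^ 2 := by gcongr
          _ = (sqrt 2) ^ 2 * sin v ^ 2 := by ring
          _ = _ := by rw [sq_sqrt (by norm_num)]
      have h2 : sin ((w - z) / 2) ^ 2 ≤ ((w - z) / 2) ^ 2 := by gcongr
      calc _ = sin u ^ 2 * sin ((w - z) / 2) ^ 2 := by ring
        _ ≤ (2 * sin v ^ 2) * ((w - z) / 2) ^ 2 := by gcongr
        _ = _ := by ring
    have hs2 : 1 ≤ sqrt 2 := one_le_sqrt.2 (by norm_num)
    have hquarter : ∀ v : ℝ, sqrt 2 / 2 ≤ sin v → sin ((w + z) / 2) ≤ sqrt 2 * sin v := by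
      intro v hv
      have h1 := sin_le_one ((w + z) / 2)
      have h2 : sqrt 2 * (sqrt 2 / 2) = 1 := by
        rw [← mul_div_assoc, mul_self_sqrt (by norm_num)]; norm_num
      nlinarith
    have hbig : ∀ v : ℝ, 0 ≤ sin v → sin ((w + z) / 2) ≤ sin v →
        sin ((w + z) / 2) ≤ sqrt 2 * sin v := fun v h0 h => by nlinarith
    rw [hbde, hbdef, hddef, hvar, hvar]
    have hw0 : 0 ≤ sin w := sin_nonneg_of_nonneg_of_le_pi hmw.1 hmw.2
    have hz0 : 0 ≤ sin z := sin_nonneg_of_nonneg_of_le_pi hmz.1 hmz.2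
    rcases le_total w (π / 2) with h | h
    · exact Or.inl (half _ _ hsin1 (hbig _ hw0
        (sin_le_sin_of_le_of_le_pi_div_two (by linarith) h (by linarith))))
    rcases le_total (π / 2) z with h' | h'
    · refine Or.inr (half _ _ hsin1 (hbig _ hz0 ?_))
      rw [← sin_pi_sub z, ← sin_pi_sub ((w + z) / 2)]
      exact sin_le_sin_of_le_of_le_pi_div_two (by linarith) (by linarith) (by linarith)
    -- The interval contains π/2. Being no longer than π/2, it has an endpoint in [π/4, 3π/4], where
    -- the sine is at least √2/2.
    rcases le_total w (3 * π / 4) with h'' | h''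
    · refine Or.inl (half _ _ hsin1 (hquarter _ ?_))
      rw [← sin_pi_div_four, ← sin_pi_sub w]
      exact sin_le_sin_of_le_of_le_pi_div_two (by linarith) (by linarith) (by linarith)
    · refine Or.inr (half _ _ hsin1 (hquarter _ ?_))
      rw [← sin_pi_div_four]
      exact sin_le_sin_of_le_of_le_pi_div_two (by linarith) (by linarith) (by linarith)
  have hprod : (b - a) * (a - d) * (b - d) ≤ (a - d) * (b - d) ^ 2 := by
    have := mul_le_mul_of_nonneg_right (by linarith : b - a ≤ b - d) (mul_nonneg hv0 hbd)
    linarith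
  have hprod' : (b - a) * (a - d) * (b - d) ≤ (b - a) * (b - d) ^ 2 := by
    have := mul_le_mul_of_nonneg_right (by linarith : a - d ≤ b - d) (mul_nonneg hu0 hbd)
    linarith
  have n1 : 0 ≤ 2 * (w - z) ^ 2 * ((b - a) * (d * (1 - d))) := by positivity
  have n2 : 0 ≤ 2 * (w - z) ^ 2 * ((a - d) * (b * (1 - b))) := by positivity
  rcases suff with h | h
  · have := mul_le_mul_of_nonneg_left h hv0
    linarith
  · have := mul_le_mul_of_nonneg_left h hu0
    linarith

end
end AdaptiveCalibration

namespace AdaptiveCalibration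
noncomputable section
open Real Set MeasureTheory

/-! ### Epochs -/

lemma two_pow_epoch_le (t : ℕ) : 2 ^ epoch t ≤ t + 2 := Nat.pow_log_le_self 2 (by omega)

lemma lt_two_pow_epoch (t : ℕ) : t + 2 < 2 ^ (epoch t + 1) := Nat.lt_pow_succ_log_self one_lt_two _

lemma one_le_epoch (t : ℕ) : 1 ≤ epoch t := Nat.log_pos one_lt_two (by omega)

lemma epoch_start_le (t : ℕ) : 2 ^ epoch t - 2 ≤ t := by
  have := two_pow_epoch_le t
  omega

lemma epoch_eq {t m : ℕ} (h1 : 2 ^ m ≤ t + 2) (h2 : t + 2 < 2 ^ (m + 1)) : epoch t = m :=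
  Nat.log_eq_of_pow_le_of_lt_pow h1 h2

/-- The epoch before that of `t` has been completed within the horizon. In the form `2 ^ (m - 1) ≤
T` this is the standing assumption on `m` below: it bounds the radius from below. -/
lemma two_pow_epoch_pred_le {T t : ℕ} (ht : t < T) : 2 ^ (epoch t - 1) ≤ T := by
  have h := two_pow_epoch_le t
  obtain ⟨k, hk⟩ := Nat.exists_eq_add_of_le' (one_le_epoch t)
  rw [hk] at h ⊢
  rw [pow_succ] at h
  simp only [Nat.add_sub_cancel]
  have := Nat.one_le_two_pow (n := k)
  omega

lemma epoch_le {T t : ℕ} (hT : 2 ≤ T) (ht : t < T) : (epoch t : ℝ) ≤ 3 * log T := by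
  have h : (2 : ℝ) ^ (epoch t - 1) ≤ T := by exact_mod_cast two_pow_epoch_pred_le ht
  have h1 := log_le_log (by positivity) h
  rw [log_pow, Nat.cast_sub (one_le_epoch t)] at h1
  have h2 := log_le_log (by norm_num) (by exact_mod_cast hT : (2 : ℝ) ≤ T)
  have h3 := log_two_gt_d9
  push_cast at h1
  nlinarith

/-! ### Geometry of the partition -/

lemma mem_unifPart {l u : ℝ} {N : ℕ} {J : ℝ × ℝ} (h : J ∈ unifPart l u N) :
    l < u ∧ l ≤ J.1 ∧ J.1 < J.2 ∧ J.2 ≤ u ∧ J.2 - J.1 = (u - l) / N := by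
  unfold unifPart at h
  split_ifs at h with hlu
  · obtain ⟨k, hk, rfl⟩ := Finset.mem_image.1 h
    have hk := Finset.mem_range.1 hk
    have hN : (0 : ℝ) < N := by exact_mod_cast (by omega : 0 < N)
    have hk' : (k : ℝ) + 1 ≤ N := by exact_mod_cast hk
    have hu : 0 < u - l := by linarith
    have e : l + ((k : ℝ) + 1) / N * (u - l) - (l + (k : ℝ) / N * (u - l)) = (u - l) / N := by
      field_simp; ring
    refine ⟨hlu, ?_, ?_, ?_, e⟩
    · have : 0 ≤ (k : ℝ) / N * (u - l) := by positivity
      simpa using this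
    · have : 0 < (u - l) / N := by positivity
      simp only
      linarith
    · have := mul_le_mul_of_nonneg_right ((div_le_one hN).2 hk') hu.le
      simp only
      linarith
  · simp at h

lemma card_unifPart_le (l u : ℝ) (N : ℕ) : (unifPart l u N).card ≤ N := by
  unfold unifPart
  split_ifs
  · exact Finset.card_image_le.trans (by simp)
  · simp

/-- The parameters for which the algorithm is run. -/
structure Params.Good (p : Params) : Prop where
  two_le : 2 ≤ p.T
  C_nonneg : 0 ≤ p.C
  one_le : 1 ≤ p.ι

lemma theta_one_sub {x : ℝ} (h : x ∈ Icc (0 : ℝ) 1) : theta (1 - x) = π - theta x := by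
  have e : psi (π - theta x) = 1 - x := by
    rw [← psi_theta h]
    unfold psi
    rw [sub_div, sin_pi_div_two_sub, cos_sq']
    simp only [theta]
    congr 3
    have := psi_theta h
    unfold psi theta at this
    rw [this]
  rw [← e, theta_psi]
  exact ⟨by linarith [theta_le_pi x], by linarith [theta_nonneg x]⟩

section
variable {p : Params}

lemma Params.eta_pos (p : Params) : 0 < p.eta := by unfold Params.eta; positivity

lemma Params.Good.eta_lt (hp : p.Good) : p.eta < 1 / 2 := by
  unfold Params.eta
  have : (2 : ℝ) ≤ p.T := by exact_mod_cast hp.two_le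
  rw [div_lt_div_iff₀ (by positivity) (by norm_num)]
  linarith

lemma Params.Good.eta_mem (hp : p.Good) : p.eta ∈ Icc (0 : ℝ) 1 :=
  ⟨p.eta_pos.le, by linarith [hp.eta_lt]⟩

lemma Params.Good.one_sub_eta_mem (hp : p.Good) : 1 - p.eta ∈ Icc (0 : ℝ) 1 :=
  ⟨by linarith [hp.eta_lt], by linarith [p.eta_pos]⟩

lemma Params.Good.theta_eta_pos (hp : p.Good) : 0 < theta p.eta := by
  have := theta_strictMonoOn (by simp) hp.eta_mem p.eta_pos
  simpa [theta] using this

lemma Params.Good.theta_one_sub_eta (hp : p.Good) : theta (1 - p.eta) = π - theta p.eta :=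
  theta_one_sub hp.eta_mem

lemma Params.Good.theta_eta_lt (hp : p.Good) : theta p.eta < theta (1 - p.eta) :=
  theta_strictMonoOn hp.eta_mem hp.one_sub_eta_mem (by linarith [hp.eta_lt])

lemma Params.Good.T_pos (hp : p.Good) : (0 : ℝ) < p.T := by
  have := hp.two_le
  exact_mod_cast (by omega : 0 < p.T)

lemma Params.Good.radius_ge (hp : p.Good) {m : ℕ} (hm : 2 ^ (m - 1) ≤ p.T) :
    2 * π / sqrt p.T ≤ p.radius m := by
  unfold Params.radius
  rw [div_eq_mul_inv, ← sqrt_inv, inv_eq_one_div]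
  have hm' : (2 : ℝ) ^ (m - 1) ≤ p.T := by exact_mod_cast hm
  have := hp.C_nonneg
  have := hp.one_le
  gcongr
  linarith

lemma Params.Good.radius_pos (hp : p.Good) (m : ℕ) : 0 < p.radius m := by
  unfold Params.radius
  have := hp.C_nonneg
  have := hp.one_le
  have h : 0 < p.ι + p.C := by linarith
  have := pi_pos
  positivity

/-- Jordan's inequality gives `θ(η) ≤ π √η`, which is less than `π / √T`, whereas the radius is at
least `2π / √T`. -/
lemma Params.Good.theta_eta_lt_radius (hp : p.Good) {m : ℕ} (hm : 2 ^ (m - 1) ≤ p.T) :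
    theta p.eta < 2 * p.radius m := by
  have h1 := hp.radius_ge hm
  have hpi := pi_pos
  have hs : 0 < sqrt p.T := sqrt_pos.2 hp.T_pos
  have h2 := mul_le_sin (x := theta p.eta / 2) (by linarith [theta_nonneg p.eta])
    (by linarith [theta_le_pi p.eta])
  rw [sin_theta_half hp.eta_mem] at h2
  have h3 : sqrt p.eta ≤ 1 / sqrt p.T := by
    rw [one_div, ← sqrt_inv, ← one_div]
    apply sqrt_le_sqrt
    unfold Params.eta
    have := hp.T_pos
    gcongr
    linarith
  have h4 : theta p.eta ≤ π * (1 / sqrt p.T) := by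
    calc theta p.eta = π * (2 / π * (theta p.eta / 2)) := by field_simp
      _ ≤ π * (1 / sqrt p.T) := by gcongr; exact h2.trans h3
  have h5 : 2 * π / sqrt p.T = 2 * (π * (1 / sqrt p.T)) := by ring
  have : 0 < π * (1 / sqrt p.T) := by positivity
  linarith

/-- Clipping cannot empty the inner region: even around an average outcome 0 or 1, the half-width `2
r_m` exceeds the margin `θ(η)` that is cut off at each end. -/
lemma Params.Good.inner_lt (hp : p.Good) {m : ℕ} (hm : 2 ^ (m - 1) ≤ p.T) (v : ℝ) :
    p.innerLo m v < p.innerHi m v := by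
  have h1 := hp.theta_eta_lt_radius hm
  have h2 := hp.theta_eta_lt
  have h3 := hp.theta_one_sub_eta
  have h4 := hp.radius_pos m
  unfold Params.innerLo Params.innerHi
  rw [max_lt_iff, lt_min_iff, lt_min_iff]
  refine ⟨⟨?_, ?_⟩, ?_, h2⟩ <;> linarith [theta_nonneg v, theta_le_pi v]

lemma Params.inner_sub_le (p : Params) (m : ℕ) (v : ℝ) :
    p.innerHi m v - p.innerLo m v ≤ 4 * p.radius m := by
  unfold Params.innerLo Params.innerHi
  have := le_max_left (theta v - 2 * p.radius m) (theta p.eta)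
  have := min_le_left (theta v + 2 * p.radius m) (theta (1 - p.eta))
  linarith

lemma Params.theta_eta_le_innerLo (p : Params) (m : ℕ) (v : ℝ) : theta p.eta ≤ p.innerLo m v :=
  le_max_right _ _

lemma Params.innerHi_le (p : Params) (m : ℕ) (v : ℝ) : p.innerHi m v ≤ theta (1 - p.eta) :=
  min_le_right _ _

lemma Params.Good.scaled_inner_le (hp : p.Good) {m : ℕ} (hm1 : 1 ≤ m) (hm : 2 ^ (m - 1) ≤ p.T)
    (v : ℝ) :
    (2 : ℝ) ^ m * (p.innerHi m v - p.innerLo m v) ^ 2 ≤ 11 ^ 3 * (1 + p.C / p.ι) * p.ι := by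
  have h1 := p.inner_sub_le m v
  have h0 := hp.inner_lt hm v
  have hι : 0 < p.ι := by linarith [hp.one_le]
  have hC := hp.C_nonneg
  have h2 : (p.innerHi m v - p.innerLo m v) ^ 2 ≤ (4 * p.radius m) ^ 2 := by
    apply pow_le_pow_left₀ (by linarith) h1
  have h3 : (4 * p.radius m) ^ 2 = 64 * π ^ 2 * ((p.ι + p.C) / 2 ^ (m - 1)) := by
    unfold Params.radius
    rw [mul_pow, mul_pow, sq_sqrt (by positivity)]
    ring
  obtain ⟨k, rfl⟩ := Nat.exists_eq_add_of_le' hm1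
  simp only [Nat.add_sub_cancel] at h3
  calc (2 : ℝ) ^ (k + 1) * (p.innerHi (k + 1) v - p.innerLo (k + 1) v) ^ 2
      ≤ 2 ^ (k + 1) * (64 * π ^ 2 * ((p.ι + p.C) / 2 ^ k)) := by rw [← h3]; gcongr
    _ = 128 * π ^ 2 * (p.ι + p.C) := by field_simp; ring
    -- `128 * 3.15 ^ 2 < 1331 = 11 ^ 3`; a perfect cube is convenient because a cube root is taken
    -- later.
    _ ≤ 11 ^ 3 * (p.ι + p.C) := by
        have : π ^ 2 ≤ 3.15 ^ 2 := by
          have := pi_lt_d2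
          have := pi_pos
          gcongr
        gcongr
        linarith
    _ = _ := by field_simp

/-- The rate that governs the number of inner intervals. -/
def Params.innerRate (p : Params) : ℝ := (1 + p.C / p.ι) ^ (1 / 3 : ℝ)

lemma Params.Good.innerRate_cube (hp : p.Good) : p.innerRate ^ 3 = 1 + p.C / p.ι := by
  unfold Params.innerRate
  rw [← rpow_natCast, ← rpow_mul]
  · norm_num
  · have := hp.C_nonneg
    have := hp.one_le
    positivity

lemma Params.Good.innerRate_nonneg (hp : p.Good) : 0 ≤ p.innerRate := by
  unfold Params.innerRate
  have := hp.C_nonneg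
  have := hp.one_le
  positivity

/-- The real number whose ceiling enters the number of inner intervals. -/
def Params.innerReal (p : Params) (m : ℕ) (v : ℝ) : ℝ :=
  ((2 : ℝ) ^ m) ^ (1 / 3 : ℝ) * (p.innerHi m v - p.innerLo m v) ^ (2 / 3 : ℝ)
    * p.ι ^ (-(1 / 3) : ℝ)

lemma Params.Good.innerReal_pos (hp : p.Good) {m : ℕ} (hm : 2 ^ (m - 1) ≤ p.T) (v : ℝ) :
    0 < p.innerReal m v := by
  have h0 := sub_pos.2 (hp.inner_lt hm v)
  have hι : 0 < p.ι := by linarith [hp.one_le]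
  unfold Params.innerReal
  positivity

/-- Fractional powers are avoided by cubing. The same identity lets the program find the ceiling by
comparing cubes. -/
lemma Params.Good.innerReal_cube (hp : p.Good) {m : ℕ} (hm : 2 ^ (m - 1) ≤ p.T) (v : ℝ) :
    p.innerReal m v ^ 3 * p.ι = (2 : ℝ) ^ m * (p.innerHi m v - p.innerLo m v) ^ 2 := by
  have h0 := sub_pos.2 (hp.inner_lt hm v)
  have hι : 0 < p.ι := by linarith [hp.one_le]
  unfold Params.innerReal
  rw [mul_pow, mul_pow, ← rpow_natCast, ← rpow_mul (by positivity), ← rpow_natCast (_ ^ (2 / 3 : ℝ)),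
    ← rpow_mul h0.le, ← rpow_natCast (p.ι ^ (-(1 / 3) : ℝ)), ← rpow_mul hι.le]
  norm_num
  rw [rpow_neg_one]
  field_simp

lemma Params.Good.innerReal_le (hp : p.Good) {m : ℕ} (hm1 : 1 ≤ m) (hm : 2 ^ (m - 1) ≤ p.T)
    (v : ℝ) : p.innerReal m v ≤ 11 * p.innerRate := by
  have hι : 0 < p.ι := by linarith [hp.one_le]
  have h := hp.scaled_inner_le hm1 hm v
  rw [← hp.innerReal_cube hm, ← hp.innerRate_cube, ← mul_pow] at h
  exact le_of_pow_le_pow_left₀ (by norm_num) (by have := hp.innerRate_nonneg; positivity)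
    (le_of_mul_le_mul_right h hι)

lemma Params.Good.innerCount_le (hp : p.Good) {m : ℕ} (hm1 : 1 ≤ m) (hm : 2 ^ (m - 1) ≤ p.T)
    (v : ℝ) : (p.innerCount m v : ℝ) ≤ 11 * p.innerRate + 4 := by
  have hpi := pi_pos
  have h1 := hp.innerReal_le hm1 hm v
  have h2 := (Nat.ceil_lt_add_one (hp.innerReal_pos hm v).le).le
  have h0 := sub_pos.2 (hp.inner_lt hm v)
  have h3 := (Nat.ceil_lt_add_one (a := 2 * (p.innerHi m v - p.innerLo m v) / π)
    (by positivity)).le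
  have h4 : 2 * (p.innerHi m v - p.innerLo m v) / π ≤ 2 := by
    rw [div_le_iff₀ hpi]
    have := p.innerHi_le m v
    have := p.theta_eta_le_innerLo m v
    linarith [theta_le_pi (1 - p.eta), theta_nonneg p.eta]
  have := hp.innerRate_nonneg
  change ((max ⌈p.innerReal m v⌉₊ _ : ℕ) : ℝ) ≤ _
  rw [Nat.cast_max]
  apply max_le <;> linarith

lemma Params.innerReal_le_innerCount (p : Params) (m : ℕ) (v : ℝ) :
    p.innerReal m v ≤ p.innerCount m v := by
  refine (Nat.le_ceil _).trans ?_
  exact_mod_cast le_max_left _ _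

lemma Params.Good.innerCount_pos (hp : p.Good) {m : ℕ} (hm : 2 ^ (m - 1) ≤ p.T) (v : ℝ) :
    0 < p.innerCount m v := by
  have := (hp.innerReal_pos hm v).trans_le (p.innerReal_le_innerCount m v)
  exact_mod_cast this

/-- If `X` is the real number rounded up to `N_m`, the left side is `X³ι/N_m² ≤ Xι`. This is the
rounding cost of the inner region over a whole epoch. -/
lemma Params.Good.inner_rounding (hp : p.Good) {m : ℕ} (hm1 : 1 ≤ m) (hm : 2 ^ (m - 1) ≤ p.T)
    (v : ℝ) :
    (2 : ℝ) ^ m * ((p.innerHi m v - p.innerLo m v) / p.innerCount m v) ^ 2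
      ≤ 11 * p.innerRate * p.ι := by
  have hX := hp.innerReal_pos hm v
  have hι : 0 < p.ι := by linarith [hp.one_le]
  have h := p.innerReal_le_innerCount m v
  have hR := hp.innerRate_nonneg
  have hN : (0 : ℝ) < p.innerCount m v := hX.trans_le h
  rw [div_pow, ← mul_div_assoc, ← hp.innerReal_cube hm, div_le_iff₀ (by positivity)]
  have h1 := hp.innerReal_le hm1 hm v
  calc p.innerReal m v ^ 3 * p.ι = p.innerReal m v * p.ι * p.innerReal m v ^ 2 := by ring
    _ ≤ (11 * p.innerRate) * p.ι * (p.innerCount m v : ℝ) ^ 2 := by gcongr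

lemma Params.two_le_outerCount (p : Params) : 2 ≤ p.outerCount := le_max_right _ _

lemma Params.le_outerCount (p : Params) :
    ((1 + p.C) / log p.T ^ 2) ^ (1 / 3 : ℝ) ≤ p.outerCount := by
  refine (Nat.le_ceil _).trans ?_
  exact_mod_cast le_max_left _ _

lemma Params.Good.outerCount_le (hp : p.Good) :
    (p.outerCount : ℝ) ≤ ((1 + p.C) / log p.T ^ 2) ^ (1 / 3 : ℝ) + 2 := by
  have h0 : 0 ≤ ((1 + p.C) / log p.T ^ 2) ^ (1 / 3 : ℝ) := by
    have := hp.C_nonneg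
    positivity
  have h := (Nat.ceil_lt_add_one h0).le
  unfold Params.outerCount
  rw [Nat.cast_max]
  apply max_le
  · linarith
  · push_cast; linarith

lemma Params.Good.log_T_ge (hp : p.Good) : log 2 ≤ log p.T :=
  log_le_log (by norm_num) (by exact_mod_cast hp.two_le)

lemma Params.Good.clog_le (hp : p.Good) : (Nat.clog 2 p.T : ℝ) + 1 ≤ 5 * log p.T := by
  have h0 : 0 < Nat.clog 2 p.T := Nat.clog_pos one_lt_two hp.two_le
  have h : (2 : ℝ) ^ (Nat.clog 2 p.T - 1) ≤ p.T := by
    have := Nat.pow_pred_clog_lt_self one_lt_two (x := p.T) (by have := hp.two_le; omega)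
    exact_mod_cast this.le
  have h1 := log_le_log (by positivity) h
  rw [log_pow, Nat.cast_sub h0] at h1
  have h2 := hp.log_T_ge
  have h3 := log_two_gt_d9
  push_cast at h1
  nlinarith

lemma Params.mem_partition {m : ℕ} {v : ℝ} {J : ℝ × ℝ} (hJ : J ∈ p.partition m v) :
    J ∈ unifPart (p.innerLo m v) (p.innerHi m v) (p.innerCount m v) ∨
      ∃ q, J ∈ p.leftBand m v q ∨ J ∈ p.rightBand m v q := by
  unfold Params.partition at hJ
  rw [Finset.mem_union, Finset.mem_biUnion] at hJ
  rcases hJ with h | ⟨q, -, h⟩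
  · exact Or.inl h
  · exact Or.inr ⟨q, Finset.mem_union.1 h⟩

lemma Params.partition_bounds {m : ℕ} {v : ℝ} {J : ℝ × ℝ} (hJ : J ∈ p.partition m v) :
    theta p.eta ≤ J.1 ∧ J.1 < J.2 ∧ J.2 ≤ theta (1 - p.eta) := by
  rcases p.mem_partition hJ with h | ⟨q, h | h⟩ <;>
  obtain ⟨-, h1, h2, h3, -⟩ := mem_unifPart h
  · exact ⟨(p.theta_eta_le_innerLo m v).trans h1, h2, h3.trans (p.innerHi_le m v)⟩
  · exact ⟨(le_max_right _ _).trans h1, h2, h3.trans (min_le_right _ _)⟩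
  · exact ⟨(le_max_right _ _).trans h1, h2, h3.trans (min_le_right _ _)⟩

/-- The reason for the second term in `N_m` and for `K ≥ 2`: the rounding bound requires pieces no
longer than π/2. -/
lemma Params.Good.partition_length_le (hp : p.Good) {m : ℕ} {v : ℝ} (hm : 2 ^ (m - 1) ≤ p.T)
    {J : ℝ × ℝ} (hJ : J ∈ p.partition m v) : J.2 - J.1 ≤ π / 2 := by
  have hpi := pi_pos
  have outer : ∀ l u : ℝ, theta p.eta ≤ l → u ≤ theta (1 - p.eta) → J ∈ unifPart l u p.outerCount →
      J.2 - J.1 ≤ π / 2 := by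
    intro l u hl hu h
    obtain ⟨hlu, -, -, -, e⟩ := mem_unifPart h
    have h2 : (2 : ℝ) ≤ p.outerCount := by exact_mod_cast p.two_le_outerCount
    rw [e]
    have := theta_nonneg p.eta
    have := theta_le_pi (1 - p.eta)
    exact div_le_div₀ hpi.le (by linarith) (by norm_num) h2
  rcases p.mem_partition hJ with h | ⟨q, h | h⟩
  · obtain ⟨hlu, -, -, -, e⟩ := mem_unifPart h
    rw [e, div_le_iff₀ (by exact_mod_cast hp.innerCount_pos hm v)]
    have h1 : 2 * (p.innerHi m v - p.innerLo m v) / π ≤ p.innerCount m v := by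
      refine (Nat.le_ceil _).trans ?_
      exact_mod_cast le_max_right _ _
    rw [div_le_iff₀ hpi] at h1
    linarith
  · exact outer _ _ (le_max_right _ _) (min_le_right _ _) h
  · exact outer _ _ (le_max_right _ _) (min_le_right _ _) h

/-- Pieces are short or far from the transformed mean, relative to their length. -/
lemma Params.Good.partition_sq_le (hp : p.Good) {m : ℕ} {v c x : ℝ}
    (hc : |theta v - c| ≤ p.radius m) {J : ℝ × ℝ} (hJ : J ∈ p.partition m v)
    (hx : x ∈ Icc J.1 J.2) :
    (J.2 - J.1) ^ 2 ≤ ((p.innerHi m v - p.innerLo m v) / p.innerCount m v) ^ 2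
      + (x - c) ^ 2 / (p.outerCount : ℝ) ^ 2 := by
  have hr := hp.radius_pos m
  have hK : (0 : ℝ) < p.outerCount := by
    have := p.two_le_outerCount
    exact_mod_cast (by omega : 0 < p.outerCount)
  obtain ⟨hc1, hc2⟩ := abs_le.1 hc
  have hpow : ∀ q : ℕ, (1 : ℝ) ≤ 2 ^ q := fun q => one_le_pow₀ (by norm_num)
  -- The inner region extends `2 r` from `θ(v)` and `c` lies within `r` of `θ(v)`, so points of band
  -- `q` have distance at least `2r + (2^q - 1) r - r = 2^q r` from `c`. This is also the width of
  -- the band, which is cut into `K` pieces.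
  have outer : ∀ (l u : ℝ) (q : ℕ), u - l ≤ 2 ^ q * p.radius m →
      J ∈ unifPart l u p.outerCount → 2 ^ q * p.radius m ≤ |x - c| →
      (J.2 - J.1) ^ 2 ≤ ((p.innerHi m v - p.innerLo m v) / p.innerCount m v) ^ 2
        + (x - c) ^ 2 / (p.outerCount : ℝ) ^ 2 := by
    intro l u q h1 h2 h3
    obtain ⟨hlu, -, -, -, e⟩ := mem_unifPart h2
    have h4 : ((u - l) / p.outerCount) ^ 2 ≤ (x - c) ^ 2 / (p.outerCount : ℝ) ^ 2 := by
      rw [div_pow, ← sq_abs (x - c)]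
      have : 0 ≤ u - l := by linarith
      gcongr
      linarith
    rw [e]
    have := sq_nonneg ((p.innerHi m v - p.innerLo m v) / p.innerCount m v)
    linarith
  rcases p.mem_partition hJ with h | ⟨q, h | h⟩
  · obtain ⟨-, -, -, -, e⟩ := mem_unifPart h
    rw [e]
    have : 0 ≤ (x - c) ^ 2 / (p.outerCount : ℝ) ^ 2 := by positivity
    linarith
  · obtain ⟨hlu, -, -, hu, -⟩ := mem_unifPart h
    have hmax := le_max_left (p.innerLo m v - (2 ^ (q + 1) - 1) * p.radius m) (theta p.eta)
    have hmin := min_le_left (p.innerLo m v - (2 ^ q - 1) * p.radius m) (theta (1 - p.eta))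
    have hmax' := le_max_right (p.innerLo m v - (2 ^ (q + 1) - 1) * p.radius m) (theta p.eta)
    have hq := mul_nonneg (sub_nonneg.2 (hpow q)) hr.le
    -- If the inner region were clipped on the left, it would already start at the lower end of the
    -- domain, and every left band would be empty.
    have hlo : p.innerLo m v = theta v - 2 * p.radius m := by
      unfold Params.innerLo
      rcases max_choice (theta v - 2 * p.radius m) (theta p.eta) with h' | h'
      · exact h'
      · exfalso
        have : p.innerLo m v = theta p.eta := h'
        linarith
    refine outer _ _ q ?_ h ?_
    · have e : ((2 : ℝ) ^ (q + 1) - 1) * p.radius m = 2 * (2 ^ q * p.radius m) - p.radius m := by ring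
      rw [e] at hmax ⊢
      linarith
    · have := hx.2
      rw [abs_sub_comm]
      refine le_trans ?_ (le_abs_self _)
      linarith
  · obtain ⟨hlu, hl, -, -, -⟩ := mem_unifPart h
    have hmax := le_max_left (p.innerHi m v + (2 ^ q - 1) * p.radius m) (theta p.eta)
    have hmin := min_le_left (p.innerHi m v + (2 ^ (q + 1) - 1) * p.radius m) (theta (1 - p.eta))
    have hmin' := min_le_right (p.innerHi m v + (2 ^ (q + 1) - 1) * p.radius m) (theta (1 - p.eta))
    have hq := mul_nonneg (sub_nonneg.2 (hpow q)) hr.le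
    have hhi : p.innerHi m v = theta v + 2 * p.radius m := by
      unfold Params.innerHi
      rcases min_choice (theta v + 2 * p.radius m) (theta (1 - p.eta)) with h' | h'
      · exact h'
      · exfalso
        have : p.innerHi m v = theta (1 - p.eta) := h'
        linarith
    refine outer _ _ q ?_ h ?_
    · have e : ((2 : ℝ) ^ (q + 1) - 1) * p.radius m = 2 * (2 ^ q * p.radius m) - p.radius m := by ring
      rw [e] at hmin ⊢
      linarith
    · have := hx.1
      refine le_trans ?_ (le_abs_self _)
      linarith

lemma Params.Good.grid_subset (hp : p.Good) {m : ℕ} {v z : ℝ} (hz : z ∈ p.grid m v) :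
    z ∈ Icc p.eta (1 - p.eta) := by
  have h12 := hp.eta_lt
  unfold Params.grid at hz
  rw [Finset.mem_union, Finset.mem_image] at hz
  rcases hz with ⟨J, hJ, rfl⟩ | hz
  · obtain ⟨h1, h2, h3⟩ := p.partition_bounds hJ
    have hJ2 : J.2 ∈ Icc (0 : ℝ) π :=
      ⟨by linarith [theta_nonneg p.eta], h3.trans (theta_le_pi _)⟩
    constructor
    · rw [← psi_theta hp.eta_mem]
      exact psi_strictMonoOn.monotoneOn ⟨theta_nonneg _, theta_le_pi _⟩ hJ2 (by linarith)
    · rw [← psi_theta hp.one_sub_eta_mem]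
      exact psi_strictMonoOn.monotoneOn hJ2 ⟨theta_nonneg _, theta_le_pi _⟩ h3
  · rw [Finset.mem_insert, Finset.mem_singleton] at hz
    rcases hz with rfl | rfl <;> constructor <;> linarith

lemma Params.card_partition_le (p : Params) (m : ℕ) (v : ℝ) :
    (p.partition m v).card ≤
      p.innerCount m v + (Nat.clog 2 p.T + 1) * (2 * p.outerCount) := by
  unfold Params.partition
  refine (Finset.card_union_le _ _).trans ?_
  gcongr
  · exact card_unifPart_le _ _ _
  · refine (Finset.card_biUnion_le_card_mul _ _ (2 * p.outerCount) (fun q _ => ?_)).trans (by simp)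
    refine (Finset.card_union_le _ _).trans ?_
    unfold Params.leftBand Params.rightBand
    rw [two_mul]
    exact add_le_add (card_unifPart_le _ _ _) (card_unifPart_le _ _ _)

lemma Params.card_grid_le (p : Params) (m : ℕ) (v : ℝ) :
    (p.grid m v).card ≤
      p.innerCount m v + (Nat.clog 2 p.T + 1) * (2 * p.outerCount) + 2 := by
  unfold Params.grid
  refine (Finset.card_union_le _ _).trans ?_
  gcongr
  · exact Finset.card_image_le.trans (p.card_partition_le m v)
  · exact Finset.card_le_two

end

lemma prevMean_mem (m : ℕ) (y : ℕ → Bool) : prevMean m y ∈ Icc (0 : ℝ) 1 := by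
  unfold prevMean
  refine ⟨div_nonneg (Finset.sum_nonneg fun _ _ => bit_nonneg _) (by positivity), ?_⟩
  rw [div_le_one (by positivity)]
  calc _ ≤ ∑ t ∈ Finset.Ico (2 ^ (m - 1) - 2) (2 ^ m - 2), (1 : ℝ) :=
        Finset.sum_le_sum fun _ _ => bit_le_one _
    _ ≤ _ := by
      rw [Finset.sum_const, Nat.card_Ico, nsmul_eq_mul, mul_one]
      have : 2 ^ m - 2 - (2 ^ (m - 1) - 2) ≤ 2 ^ (m - 1) := by
        cases m with
        | zero => simp
        | succ k => simp only [Nat.add_sub_cancel, pow_succ]; omega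
      exact_mod_cast this

end
end AdaptiveCalibration

namespace AdaptiveCalibration
noncomputable section
open Real Set MeasureTheory

/-! ### Pathwise bound for the swap regret. -/

lemma IsDist.mem_Icc {P : ℝ →₀ ℝ} (h : IsDist P) (s : ℝ) : P s ∈ Icc (0 : ℝ) 1 := by
  refine ⟨h.1 s, ?_⟩
  by_cases hs : s ∈ P.support
  · rw [← h.2]
    exact Finset.single_le_sum (fun i _ => h.1 i) hs
  · rw [Finsupp.notMem_support_iff.1 hs]
    exact zero_le_one

lemma sum_support_eq {P : ℝ →₀ ℝ} {S : Finset ℝ} (h : P.support ⊆ S) (f : ℝ → ℝ) :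
    ∑ s ∈ P.support, P s * f s = ∑ s ∈ S, P s * f s :=
  Finset.sum_subset h fun s _ hs => by rw [Finsupp.notMem_support_iff.1 hs, zero_mul]

lemma IsDist.sum_eq_one {P : ℝ →₀ ℝ} (h : IsDist P) {S : Finset ℝ} (hS : P.support ⊆ S) :
    ∑ s ∈ S, P s = 1 := by
  rw [← h.2]
  exact (Finset.sum_subset hS fun s _ hs => Finsupp.notMem_support_iff.1 hs).symm

/-- Stationarity, tested against a function. -/
lemma stationary_sum {P : ℝ →₀ ℝ} {Q : ℝ → ℝ →₀ ℝ} {S : Finset ℝ}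
    (h : ∀ z, ∑ s ∈ S, P s * Q s z = P z) (f : ℝ → ℝ) :
    ∑ z ∈ P.support, P z * f z = ∑ s ∈ S, P s * (Q s).sum fun z w => w * f z := by
  set U := P.support ∪ S.biUnion fun s => (Q s).support with hU
  rw [sum_support_eq (S := U) Finset.subset_union_left]
  have h1 : ∀ s ∈ S, (Q s).sum (fun z w => w * f z) = ∑ z ∈ U, Q s z * f z := by
    intro s hs
    rw [Finsupp.sum]
    exact sum_support_eq ((Finset.subset_biUnion_of_mem (fun s => (Q s).support) hs).trans
      Finset.subset_union_right) f
  have h2 : ∑ s ∈ S, P s * (Q s).sum (fun z w => w * f z) = ∑ s ∈ S, P s * ∑ z ∈ U, Q s z * f z :=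
    Finset.sum_congr rfl fun s hs => by rw [h1 s hs]
  rw [h2]
  simp_rw [Finset.mul_sum]
  rw [Finset.sum_comm]
  refine Finset.sum_congr rfl fun z _ => ?_
  rw [← h z, Finset.sum_mul]
  exact Finset.sum_congr rfl fun s _ => by ring

/-- The run of the algorithm along one sequence of outcomes. -/
structure IsRun (p : Params) (P : ℕ → ℝ →₀ ℝ) (y : ℕ → Bool) : Prop where
  good : p.Good
  isDist : ∀ t < p.T, IsDist (P t)
  first : ∀ t < p.T, t < 2 → ∀ z ∈ (P t).support, z ∈ Icc p.eta (1 - p.eta)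
  later : ∀ t < p.T, 2 ≤ t → IsStationaryChoice p P y t (P t)

/-- The grid in round `t`. -/
def gridAt (p : Params) (y : ℕ → Bool) (t : ℕ) : Finset ℝ :=
  p.grid (epoch t) (prevMean (epoch t) y)

section
variable {p : Params} {P : ℕ → ℝ →₀ ℝ} {y : ℕ → Bool}

lemma IsRun.nonneg (h : IsRun p P y) {t : ℕ} (ht : t < p.T) (s : ℝ) : 0 ≤ P t s :=
  (h.isDist t ht).1 s

lemma IsRun.action_eq (h : IsRun p P y) {t : ℕ} (ht : t < p.T) (s : ℝ) :
    action P y t s = (weightOne P y (2 ^ epoch t - 2) t s + 1) /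
      (weight P (2 ^ epoch t - 2) t s + 2) :=
  AdaptiveCalibration.action_eq fun _ hτ => h.nonneg ((Finset.mem_Ico.1 hτ).2.trans ht) s

lemma IsRun.action_mem (h : IsRun p P y) {t : ℕ} (ht : t < p.T) (s : ℝ) :
    action P y t s ∈ Ioo (0 : ℝ) 1 := by
  have h0 : ∀ τ ∈ Finset.Ico (2 ^ epoch t - 2) t, 0 ≤ P τ s := fun _ hτ =>
    h.nonneg ((Finset.mem_Ico.1 hτ).2.trans ht) s
  have h1 := weightOne_nonneg (y := y) h0
  have h2 := weightOne_le_weight (y := y) h0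
  rw [h.action_eq ht]
  constructor
  · apply div_pos <;> linarith
  · rw [div_lt_one] <;> linarith

/-- Rounds are grouped by epoch, and there are at most `3 log T` epochs. The bound `B` is only asked
for epochs that begin before the horizon. -/
lemma sum_by_epoch {T : ℕ} (hT : 2 ≤ T) (f : ℕ → ℝ) {B : ℝ} (hB0 : 0 ≤ B)
    (hB : ∀ m, 2 ≤ m → 2 ^ (m - 1) ≤ T → 2 ^ m - 2 < T →
      ∑ t ∈ Finset.Ico (2 ^ m - 2) (min (2 ^ (m + 1) - 2) T), f t ≤ B) :
    ∑ t ∈ Finset.Ico 2 T, f t ≤ 3 * log T * B := by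
  have hmaps : ∀ t ∈ Finset.Ico 2 T, epoch t ∈ Finset.Icc 2 (epoch (T - 1)) := by
    intro t ht
    rw [Finset.mem_Ico] at ht
    rw [Finset.mem_Icc]
    refine ⟨?_, Nat.log_mono_right (by omega)⟩
    exact Nat.le_log_of_pow_le one_lt_two (by omega)
  rw [← Finset.sum_fiberwise_of_maps_to hmaps]
  have hcard : ((Finset.Icc 2 (epoch (T - 1))).card : ℝ) ≤ 3 * log T := by
    refine le_trans ?_ (epoch_le hT (by omega : T - 1 < T))
    rw [Nat.card_Icc]
    exact_mod_cast (by omega : epoch (T - 1) + 1 - 2 ≤ epoch (T - 1))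
  calc _ ≤ ∑ m ∈ Finset.Icc 2 (epoch (T - 1)), B := by
        refine Finset.sum_le_sum fun m hm => ?_
        rw [Finset.mem_Icc] at hm
        have h2 : 2 ^ m ≤ T - 1 + 2 :=
          (Nat.pow_le_pow_right (by norm_num) hm.2).trans (two_pow_epoch_le _)
        have h4 : 4 ≤ 2 ^ m := by
          calc 4 = 2 ^ 2 := rfl
            _ ≤ _ := Nat.pow_le_pow_right (by norm_num) hm.1
        have h3 : 2 ^ (m - 1) ≤ T :=
          (Nat.pow_le_pow_right (by norm_num) (by omega)).trans
            (two_pow_epoch_pred_le (by omega : T - 1 < T))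
        refine le_trans (le_of_eq ?_) (hB m hm.1 h3 (by omega))
        refine Finset.sum_congr ?_ fun _ _ => rfl
        ext t
        rw [Finset.mem_filter, Finset.mem_Ico, Finset.mem_Ico, lt_min_iff]
        constructor
        · rintro ⟨⟨h5, h6⟩, rfl⟩
          have := lt_two_pow_epoch t
          exact ⟨epoch_start_le t, by omega, h6⟩
        · rintro ⟨h5, h6, h7⟩
          exact ⟨⟨by omega, h7⟩, epoch_eq (by omega) (by omega)⟩
    _ = ((Finset.Icc 2 (epoch (T - 1))).card : ℝ) * B := by
        rw [Finset.sum_const, nsmul_eq_mul]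
    _ ≤ _ := by gcongr

/-- A bound for the size of the grids. -/
def Params.gridBound (p : Params) : ℝ :=
  11 * p.innerRate + 6 + 10 * log p.T * p.outerCount

lemma Params.Good.card_grid_le (hp : p.Good) {m : ℕ} (hm1 : 1 ≤ m) (hm : 2 ^ (m - 1) ≤ p.T)
    (v : ℝ) : ((p.grid m v).card : ℝ) ≤ p.gridBound := by
  have h : ((p.grid m v).card : ℝ) ≤
      p.innerCount m v + (Nat.clog 2 p.T + 1) * (2 * p.outerCount) + 2 := by
    exact_mod_cast p.card_grid_le m v
  have h1 := hp.innerCount_le hm1 hm v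
  have h2 := mul_le_mul_of_nonneg_right hp.clog_le (by positivity : 0 ≤ 2 * (p.outerCount : ℝ))
  unfold Params.gridBound
  linarith

lemma Params.Good.gridBound_nonneg (hp : p.Good) : 0 ≤ p.gridBound := by
  unfold Params.gridBound
  have := hp.innerRate_nonneg
  have := hp.log_T_ge
  have := log_two_gt_d9
  have : 0 ≤ log p.T := by linarith
  positivity

lemma Params.Good.regret_const_le (hp : p.Good) : 4 * log (p.T + 2) + 2 ≤ 11 * log p.T := by
  have h2 : (2 : ℝ) ≤ p.T := by exact_mod_cast hp.two_le
  have h := log_le_log (by linarith) (by nlinarith : (p.T : ℝ) + 2 ≤ p.T ^ 2)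
  rw [log_pow] at h
  have := hp.log_T_ge
  have := log_two_gt_d9
  push_cast at h
  linarith

/-- The comparator may depend on the grid point but not on the epoch. It is used with `rhoBar` for
calibration and with a constant to locate the actions. The factors are the number of epochs, the
size of a grid and the regret of one instance; `h1` and `h2` keep the comparator's loss finite on
the observed outcomes. -/
lemma IsRun.total_regret_le (h : IsRun p P y) {ρ : ℝ → ℝ} (hρ : ∀ s, ρ s ∈ Icc (0 : ℝ) 1)
    (h1 : ∀ t < p.T, ∀ s, 0 < P t s → y t = true → 0 < ρ s)
    (h2 : ∀ t < p.T, ∀ s, 0 < P t s → y t = false → ρ s < 1) :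
    ∑ t ∈ Finset.Ico 2 p.T, ∑ s ∈ gridAt p y t,
        P t s * (logLoss (action P y t s) (y t) - logLoss (ρ s) (y t))
      ≤ 3 * log p.T * (p.gridBound * (11 * log p.T)) := by
  have hp := h.good
  have hlog : 0 ≤ log p.T := by
    have := hp.log_T_ge
    have := log_two_gt_d9
    linarith
  refine sum_by_epoch hp.two_le _ (mul_nonneg hp.gridBound_nonneg (by positivity)) ?_
  intro m hm hm' hlt
  set hi := min (2 ^ (m + 1) - 2) p.T with hhi
  have hle : 2 ^ m - 2 ≤ hi := by
    rw [hhi, le_min_iff]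
    refine ⟨?_, hlt.le⟩
    have : 2 ^ (m + 1) = 2 * 2 ^ m := by ring
    omega
  have hep : ∀ t ∈ Finset.Ico (2 ^ m - 2) hi, epoch t = m ∧ t < p.T := by
    intro t ht
    rw [Finset.mem_Ico, hhi, lt_min_iff] at ht
    have h4 : 4 ≤ 2 ^ m := by
      calc 4 = 2 ^ 2 := rfl
        _ ≤ _ := Nat.pow_le_pow_right (by norm_num) hm
    exact ⟨epoch_eq (by omega) (by omega), ht.2.2⟩
  -- Within an epoch the grid does not change, so the two sums may be interchanged.
  have hrw : ∑ t ∈ Finset.Ico (2 ^ m - 2) hi, ∑ s ∈ gridAt p y t,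
        P t s * (logLoss (action P y t s) (y t) - logLoss (ρ s) (y t)) =
      ∑ s ∈ p.grid m (prevMean m y), ∑ t ∈ Finset.Ico (2 ^ m - 2) hi,
        P t s * (logLoss ((weightOne P y (2 ^ m - 2) t s + 1) / (weight P (2 ^ m - 2) t s + 2)) (y t)
          - logLoss (ρ s) (y t)) := by
    rw [Finset.sum_comm]
    refine Finset.sum_congr rfl fun t ht => ?_
    obtain ⟨e, ht⟩ := hep t ht
    unfold gridAt
    rw [e]
    refine Finset.sum_congr rfl fun s _ => ?_
    rw [h.action_eq ht, e]
  rw [hrw]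
  have hpos : ∀ (s : ℝ) (g : ℕ → ℝ), (∀ t, 0 ≤ g t) →
      0 < ∑ t ∈ Finset.Ico (2 ^ m - 2) hi, P t s * g t →
      ∃ t < p.T, 0 < P t s ∧ 0 < g t := by
    intro s g hg hpos
    obtain ⟨t, ht, h0⟩ : ∃ t ∈ Finset.Ico (2 ^ m - 2) hi, 0 < P t s * g t := by
      by_contra! hcon
      exact absurd (Finset.sum_nonpos hcon) (not_le.2 hpos)
    have hP := h.nonneg (hep t ht).2 s
    exact ⟨t, (hep t ht).2, pos_of_mul_pos_left h0 (hg t), pos_of_mul_pos_right h0 hP⟩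
  calc _ ≤ ∑ s ∈ p.grid m (prevMean m y), 11 * log p.T := by
        refine Finset.sum_le_sum fun s _ => ?_
        have hmem : ∀ τ ∈ Finset.Ico (2 ^ m - 2) hi, P τ s ∈ Icc (0 : ℝ) 1 := fun τ hτ =>
          (h.isDist τ (hep τ hτ).2).mem_Icc s
        refine (regret_le hle hmem (hρ s) ?_ ?_).trans ?_
        · intro hw
          obtain ⟨t, ht, hP, hb⟩ := hpos s (fun t => bit (y t)) (fun t => bit_nonneg _) hw
          refine h1 t ht s hP ?_
          by_contra hy
          simp [bit, hy] at hb
        · intro hw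
          have e : weight P (2 ^ m - 2) hi s - weightOne P y (2 ^ m - 2) hi s =
              ∑ t ∈ Finset.Ico (2 ^ m - 2) hi, P t s * (1 - bit (y t)) := by
            unfold weight weightOne
            rw [← Finset.sum_sub_distrib]
            exact Finset.sum_congr rfl fun _ _ => by ring
          rw [e] at hw
          obtain ⟨t, ht, hP, hb⟩ := hpos s (fun t => 1 - bit (y t))
            (fun t => sub_nonneg.2 (bit_le_one _)) hw
          refine h2 t ht s hP ?_
          by_contra hy
          rw [Bool.not_eq_false] at hy
          simp [bit, hy] at hb
        · refine le_trans ?_ hp.regret_const_le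
          have hw : weight P (2 ^ m - 2) hi s ≤ p.T := by
            calc _ ≤ ∑ τ ∈ Finset.Ico (2 ^ m - 2) hi, (1 : ℝ) :=
                  Finset.sum_le_sum fun τ hτ => (hmem τ hτ).2
              _ ≤ _ := by
                rw [Finset.sum_const, Nat.card_Ico, nsmul_eq_mul, mul_one]
                have : hi ≤ p.T := min_le_right _ _
                exact_mod_cast (by omega : hi - (2 ^ m - 2) ≤ p.T)
          have hw0 : 0 ≤ weight P (2 ^ m - 2) hi s := Finset.sum_nonneg fun τ hτ => (hmem τ hτ).1
          have := log_le_log (by linarith : 0 < weight P (2 ^ m - 2) hi s + 2)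
            (by linarith : _ ≤ (p.T : ℝ) + 2)
          linarith
    _ = ((p.grid m (prevMean m y)).card : ℝ) * (11 * log p.T) := by
        rw [Finset.sum_const, nsmul_eq_mul]
    _ ≤ _ := by
        have := hp.card_grid_le (by omega) hm' (prevMean m y)
        gcongr

/-- The squared distances of the actions from a fixed mean, in the transformed coordinate. -/
def sqDist (p : Params) (P : ℕ → ℝ →₀ ℝ) (y : ℕ → Bool) (c : ℝ) : ℝ :=
  ∑ t ∈ Finset.Ico 2 p.T, ∑ s ∈ gridAt p y t, P t s * (theta (action P y t s) - theta c) ^ 2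

/-- Stationarity replaces the loss of the prediction by that of the rounded action. The squared
length of the piece used is then charged either to the inner pieces, summed epoch by epoch, or to
the squared distance of the action from `c`. -/
lemma IsRun.rounding_le (h : IsRun p P y) {c : ℝ}
    (hc : ∀ t < p.T, 2 ≤ t → |theta (prevMean (epoch t) y) - theta c| ≤ p.radius (epoch t)) :
    ∑ t ∈ Finset.Ico 2 p.T, (∑ s ∈ gridAt p y t, P t s * logLoss s (y t) -
        ∑ s ∈ gridAt p y t, P t s * logLoss (action P y t s) (y t))
      ≤ 66 * log p.T * p.innerRate * p.ι + 2 / (p.outerCount : ℝ) ^ 2 * sqDist p P y c := by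
  have hp := h.good
  have hstep : ∀ t ∈ Finset.Ico 2 p.T, ∑ s ∈ gridAt p y t, P t s * logLoss s (y t) -
      ∑ s ∈ gridAt p y t, P t s * logLoss (action P y t s) (y t) ≤
      2 * ((p.innerHi (epoch t) (prevMean (epoch t) y) - p.innerLo (epoch t) (prevMean (epoch t) y))
        / p.innerCount (epoch t) (prevMean (epoch t) y)) ^ 2 +
      2 / (p.outerCount : ℝ) ^ 2 *
        ∑ s ∈ gridAt p y t, P t s * (theta (action P y t s) - theta c) ^ 2 := by
    intro t ht
    rw [Finset.mem_Ico] at ht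
    obtain ⟨hsub, Q, hQ, hstat⟩ := h.later t ht.2 ht.1
    have e1 := stationary_sum hstat fun z => logLoss z (y t)
    rw [sum_support_eq hsub] at e1
    have hone := (h.isDist t ht.2).sum_eq_one hsub
    change ∑ s ∈ gridAt p y t, _ = ∑ s ∈ gridAt p y t, _ at e1
    change ∑ s ∈ gridAt p y t, _ = _ at hone
    set X := (p.innerHi (epoch t) (prevMean (epoch t) y) -
      p.innerLo (epoch t) (prevMean (epoch t) y)) / p.innerCount (epoch t) (prevMean (epoch t) y)
      with hX
    rw [e1, ← Finset.sum_sub_distrib, Finset.mul_sum]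
    have e2 : 2 * X ^ 2 = ∑ s ∈ gridAt p y t, P t s * (2 * X ^ 2) := by
      rw [← Finset.sum_mul, hone, one_mul]
    rw [e2, ← Finset.sum_add_distrib]
    refine Finset.sum_le_sum fun s hs => ?_
    obtain ⟨J, hJ, hmem, hQs⟩ := hQ s hs
    have ha := h.action_mem ht.2 s
    obtain ⟨b1, b2, b3⟩ := p.partition_bounds hJ
    have hm := two_pow_epoch_pred_le ht.2
    have h1 := twoPoint_excess_le (a := action P y t s) (z := J.1) (w := J.2)
      (hp.theta_eta_pos.trans_le b1) b2
      (by have := hp.theta_one_sub_eta; have := hp.theta_eta_pos; linarith)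
      (hp.partition_length_le hm hJ) hmem ⟨ha.1.le, ha.2.le⟩ (y t)
    have h2 := hp.partition_sq_le (hc t ht.2 ht.1) hJ hmem
    rw [← mul_sub, hQs]
    have h0 := h.nonneg ht.2 s
    calc _ ≤ P t s * (2 * (X ^ 2 + (theta (action P y t s) - theta c) ^ 2 / p.outerCount ^ 2)) := by
          gcongr
          linarith
      _ = _ := by ring
  refine (Finset.sum_le_sum hstep).trans ?_
  rw [Finset.sum_add_distrib]
  refine add_le_add ?_ (le_of_eq (by rw [sqDist, Finset.mul_sum]))
  have hι : 0 ≤ p.ι := by linarith [hp.one_le]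
  have hR := hp.innerRate_nonneg
  -- Twice the bound `11 R ι` of `inner_rounding`, the factor 2 coming from the excess `2h²`.
  refine (sum_by_epoch hp.two_le _ (B := 22 * p.innerRate * p.ι) (by positivity) ?_).trans
    (le_of_eq (by ring))
  intro m hm hm' hlt
  have hrw : ∑ t ∈ Finset.Ico (2 ^ m - 2) (min (2 ^ (m + 1) - 2) p.T),
      2 * ((p.innerHi (epoch t) (prevMean (epoch t) y) - p.innerLo (epoch t) (prevMean (epoch t) y))
        / p.innerCount (epoch t) (prevMean (epoch t) y)) ^ 2 =
      ∑ t ∈ Finset.Ico (2 ^ m - 2) (min (2 ^ (m + 1) - 2) p.T),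
      2 * ((p.innerHi m (prevMean m y) - p.innerLo m (prevMean m y))
        / p.innerCount m (prevMean m y)) ^ 2 := by
    refine Finset.sum_congr rfl fun t ht => ?_
    rw [Finset.mem_Ico, lt_min_iff] at ht
    have h4 : 4 ≤ 2 ^ m := by
      calc 4 = 2 ^ 2 := rfl
        _ ≤ _ := Nat.pow_le_pow_right (by norm_num) hm
    rw [epoch_eq (t := t) (m := m) (by omega) (by omega)]
  rw [hrw, Finset.sum_const, nsmul_eq_mul, Nat.card_Ico]
  have hcard : ((min (2 ^ (m + 1) - 2) p.T - (2 ^ m - 2) : ℕ) : ℝ) ≤ 2 ^ m := by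
    have : min (2 ^ (m + 1) - 2) p.T - (2 ^ m - 2) ≤ 2 ^ m := by
      have : 2 ^ (m + 1) = 2 * 2 ^ m := by ring
      have := min_le_left (2 ^ (m + 1) - 2) p.T
      omega
    exact_mod_cast this
  have := hp.inner_rounding (by omega) hm' (prevMean m y)
  calc _ ≤ (2 : ℝ) ^ m * (2 * ((p.innerHi m (prevMean m y) - p.innerLo m (prevMean m y))
        / p.innerCount m (prevMean m y)) ^ 2) := by gcongr
    _ ≤ _ := by linarith

/-- The weighted divergence is the loss of the constant `z` minus that of `ρ`. The cases `ρ = 0` and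
`ρ = 1` are consistent because the offending logarithm is multiplied by zero. -/
lemma weight_mul_klBer {W W1 ρ z : ℝ} (hρ : W * ρ = W1) (hz0 : 0 < z) (hz1 : z < 1)  :
    W * klBer ρ z = (-W1 * log z - (W - W1) * log (1 - z)) -
      (-W1 * log ρ - (W - W1) * log (1 - ρ)) := by
  have key : ∀ a b : ℝ, 0 < b → a * log (a / b) = a * log a - a * log b := by
    intro a b hb
    rcases eq_or_ne a 0 with rfl | ha
    · simp
    · rw [log_div ha hb.ne']; ring
  unfold klBer
  rw [key _ _ hz0, key _ _ (by linarith), ← hρ]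
  ring

lemma IsRun.support_mem (h : IsRun p P y) {t : ℕ} (ht : t < p.T) {z : ℝ}
    (hz : z ∈ (P t).support) : z ∈ Icc p.eta (1 - p.eta) := by
  rcases lt_or_ge t 2 with h2 | h2
  · exact h.first t ht h2 z hz
  · exact h.good.grid_subset ((h.later t ht h2).1 hz)

/-- Here calibration turns into swap regret. The union `U` of all supports provides one index set
for all rounds, so that rounds can be summed first for each grid point. -/
lemma IsRun.pseudoKL_eq (h : IsRun p P y) {U : Finset ℝ}
    (hU : U = (Finset.range p.T).biUnion fun t => (P t).support) :
    pseudoKL p.T P y = ∑ t ∈ Finset.range p.T, ∑ s ∈ U,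
      P t s * (logLoss s (y t) - logLoss (rhoBar p.T P y s) (y t)) := by
  have hsub : ∀ t ∈ Finset.range p.T, (P t).support ⊆ U := fun t ht => by
    rw [hU]
    exact Finset.subset_biUnion_of_mem (fun t => (P t).support) ht
  unfold pseudoKL
  rw [Finset.sum_congr rfl fun t ht => sum_support_eq (hsub t ht) _, Finset.sum_comm,
    Finset.sum_comm (s := Finset.range p.T)]
  refine Finset.sum_congr rfl fun s hs => ?_
  rw [hU, Finset.mem_biUnion] at hs
  obtain ⟨t, ht, hts⟩ := hs
  have ht := Finset.mem_range.1 ht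
  have hmem := h.support_mem ht hts
  have hη := p.eta_pos
  have hρ : weight P 0 p.T s * rhoBar p.T P y s = weightOne P y 0 p.T s := by
    have hne : weight P 0 p.T s ≠ 0 := by
      have h1 : P t s ≤ weight P 0 p.T s :=
        Finset.single_le_sum (f := fun τ => P τ s)
          (fun τ hτ => h.nonneg (Finset.mem_Ico.1 hτ).2 s) (Finset.mem_Ico.2 ⟨Nat.zero_le _, ht⟩)
      have h2 := h.nonneg ht s
      have h3 := Finsupp.mem_support_iff.1 hts
      have := lt_of_le_of_ne h2 (Ne.symm h3)
      linarith
    unfold rhoBar weightOne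
    rw [Finset.range_eq_Ico]
    exact mul_div_cancel₀ _ hne
  rw [← Finset.sum_mul, Finset.range_eq_Ico]
  simp_rw [mul_sub]
  rw [Finset.sum_sub_distrib, sum_logLoss_const, sum_logLoss_const]
  exact weight_mul_klBer hρ (by linarith [hmem.1]) (by linarith [hmem.2])

lemma IsRun.rhoBar_pos (h : IsRun p P y) {t : ℕ} (ht : t < p.T) {s : ℝ} (hs : 0 < P t s)
    (hy : y t = true) : 0 < rhoBar p.T P y s := by
  have hn : ∀ τ ∈ Finset.range p.T, 0 ≤ P τ s := fun τ hτ => h.nonneg (Finset.mem_range.1 hτ) s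
  refine div_pos (Finset.sum_pos' (fun τ hτ => mul_nonneg (hn τ hτ) (bit_nonneg _))
    ⟨t, Finset.mem_range.2 ht, ?_⟩) (Finset.sum_pos' hn ⟨t, Finset.mem_range.2 ht, hs⟩)
  simpa [hy, bit] using hs

lemma IsRun.rhoBar_lt_one (h : IsRun p P y) {t : ℕ} (ht : t < p.T) {s : ℝ} (hs : 0 < P t s)
    (hy : y t = false) : rhoBar p.T P y s < 1 := by
  have hn : ∀ τ ∈ Finset.range p.T, 0 ≤ P τ s := fun τ hτ => h.nonneg (Finset.mem_range.1 hτ) s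
  refine (div_lt_one (Finset.sum_pos' hn ⟨t, Finset.mem_range.2 ht, hs⟩)).2 ?_
  refine Finset.sum_lt_sum (fun τ hτ => mul_le_of_le_one_right (hn τ hτ) (bit_le_one _))
    ⟨t, Finset.mem_range.2 ht, ?_⟩
  simpa [hy, bit] using hs

lemma IsRun.rhoBar_mem (h : IsRun p P y) (s : ℝ) : rhoBar p.T P y s ∈ Icc (0 : ℝ) 1 := by
  have hn : ∀ τ ∈ Finset.range p.T, 0 ≤ P τ s := fun τ hτ => h.nonneg (Finset.mem_range.1 hτ) s
  refine ⟨div_nonneg (Finset.sum_nonneg fun τ hτ => mul_nonneg (hn τ hτ) (bit_nonneg _))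
    (Finset.sum_nonneg hn), div_le_one_of_le₀ ?_ (Finset.sum_nonneg hn)⟩
  exact Finset.sum_le_sum fun τ hτ => mul_le_of_le_one_right (hn τ hτ) (bit_le_one _)

/-- The pathwise calibration bound. -/
theorem IsRun.pseudoKL_le (h : IsRun p P y) {c : ℝ}
    (hc : ∀ t < p.T, 2 ≤ t → |theta (prevMean (epoch t) y) - theta c| ≤ p.radius (epoch t)) :
    pseudoKL p.T P y ≤ 2 * log (p.T + 1) + 33 * log p.T ^ 2 * p.gridBound +
      66 * log p.T * p.innerRate * p.ι + 2 / (p.outerCount : ℝ) ^ 2 * sqDist p P y c := by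
  have hp := h.good
  rw [h.pseudoKL_eq rfl]
  set U := (Finset.range p.T).biUnion fun t => (P t).support with hU
  have hsub : ∀ t < p.T, (P t).support ⊆ U := fun t ht =>
    Finset.subset_biUnion_of_mem (fun t => (P t).support) (Finset.mem_range.2 ht)
  rw [← Finset.sum_range_add_sum_Ico _ hp.two_le]
  -- The two rounds of the first epoch are charged the maximal log loss on `[η, 1 - η]`, which is
  -- `log (1/η) = log (T + 1)`.
  have first : ∑ t ∈ Finset.range 2, ∑ s ∈ U,
      P t s * (logLoss s (y t) - logLoss (rhoBar p.T P y s) (y t)) ≤ 2 * log (p.T + 1) := by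
    have : ∀ t ∈ Finset.range 2, ∑ s ∈ U,
        P t s * (logLoss s (y t) - logLoss (rhoBar p.T P y s) (y t)) ≤ log (p.T + 1) := by
      intro t ht
      have ht : t < p.T := (Finset.mem_range.1 ht).trans_le hp.two_le
      rw [← sum_support_eq (hsub t ht)]
      calc _ ≤ ∑ s ∈ (P t).support, P t s * log (p.T + 1) := by
            refine Finset.sum_le_sum fun s hs => ?_
            have h1 := logLoss_le p.eta_pos (h.support_mem ht hs) (y t)
            have h2 := logLoss_nonneg (h.rhoBar_mem s) (y t)
            have h3 : 1 / p.eta = p.T + 1 := by unfold Params.eta; simp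
            rw [h3] at h1
            have := h.nonneg ht s
            gcongr
            linarith
        _ = _ := by rw [← Finset.sum_mul, (h.isDist t ht).2, one_mul]
    refine (Finset.sum_le_sum this).trans ?_
    simp
  -- Inserting the losses of the unrounded actions splits the swap regret into rounding excess and
  -- regret of the instances.
  have later : ∑ t ∈ Finset.Ico 2 p.T, ∑ s ∈ U,
      P t s * (logLoss s (y t) - logLoss (rhoBar p.T P y s) (y t)) =
      ∑ t ∈ Finset.Ico 2 p.T, (∑ s ∈ gridAt p y t, P t s * logLoss s (y t) -
        ∑ s ∈ gridAt p y t, P t s * logLoss (action P y t s) (y t)) +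
      ∑ t ∈ Finset.Ico 2 p.T, ∑ s ∈ gridAt p y t,
        P t s * (logLoss (action P y t s) (y t) - logLoss (rhoBar p.T P y s) (y t)) := by
    rw [← Finset.sum_add_distrib]
    refine Finset.sum_congr rfl fun t ht => ?_
    rw [Finset.mem_Ico] at ht
    rw [← sum_support_eq (hsub t ht.2), sum_support_eq (h.later t ht.2 ht.1).1]
    change ∑ s ∈ gridAt p y t, _ = _
    rw [← Finset.sum_sub_distrib, ← Finset.sum_add_distrib]
    exact Finset.sum_congr rfl fun s _ => by ring
  rw [later]
  have h1 := h.rounding_le hc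
  have h2 := h.total_regret_le (ρ := rhoBar p.T P y) h.rhoBar_mem
    (fun t ht s hs hy => h.rhoBar_pos ht hs hy) (fun t ht s hs hy => h.rhoBar_lt_one ht hs hy)
  linarith

end

end
end AdaptiveCalibration

namespace AdaptiveCalibration
noncomputable section
open Real Set MeasureTheory

/-! ### Independent Bernoulli outcomes -/

/-- The mass function of a Bernoulli law. -/
def bern (x : ℝ) (b : Bool) : ℝ := if b then x else 1 - x

lemma bern_nonneg {x : ℝ} (h : x ∈ Icc (0 : ℝ) 1) (b : Bool) : 0 ≤ bern x b := by
  cases b <;> simp [bern, h.1, h.2]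

/-- The expectation of a function of the first `n` outcomes, when these are independent with means
`q`; the later outcomes are set to `false`. -/
def expect (q : ℕ → ℝ) : ℕ → ((ℕ → Bool) → ℝ) → ℝ
  | 0, F => F fun _ => false
  | n + 1, F => expect q n fun y =>
      q n * F (Function.update y n true) + (1 - q n) * F (Function.update y n false)

section
variable {q : ℕ → ℝ}

lemma expect_mono {n : ℕ} (hq : ∀ t < n, q t ∈ Icc (0 : ℝ) 1) {F G : (ℕ → Bool) → ℝ}
    (h : ∀ y, F y ≤ G y) : expect q n F ≤ expect q n G := by
  induction n generalizing F G with
  | zero => exact h _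
  | succ n ih =>
    refine ih (fun t ht => hq t (by omega)) fun y => ?_
    have := hq n (by omega)
    have h1 := this.1
    have h2 : 0 ≤ 1 - q n := by linarith [this.2]
    exact add_le_add (mul_le_mul_of_nonneg_left (h _) h1) (mul_le_mul_of_nonneg_left (h _) h2)

lemma expect_add (n : ℕ) (F G : (ℕ → Bool) → ℝ) :
    expect q n (fun y => F y + G y) = expect q n F + expect q n G := by
  induction n generalizing F G with
  | zero => rfl
  | succ n ih =>
    unfold expect
    rw [← ih]
    congr 1
    funext y
    ring

lemma expect_const_mul (n : ℕ) (c : ℝ) (F : (ℕ → Bool) → ℝ) :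
    expect q n (fun y => c * F y) = c * expect q n F := by
  induction n generalizing F with
  | zero => rfl
  | succ n ih =>
    unfold expect
    rw [← ih]
    congr 1
    funext y
    ring

lemma expect_zero (n : ℕ) : expect q n (fun _ => 0) = 0 := by
  have := expect_const_mul (q := q) n 0 fun _ => 0
  simpa using this

lemma expect_sum {ι : Type*} (n : ℕ) (s : Finset ι) (F : ι → (ℕ → Bool) → ℝ) :
    expect q n (fun y => ∑ i ∈ s, F i y) = ∑ i ∈ s, expect q n (F i) := by
  classical
  induction s using Finset.induction_on with
  | empty => simpa using expect_zero n
  | insert a s ha ih =>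
    simp_rw [Finset.sum_insert ha]
    rw [expect_add, ih]

/-- Products of conditionally bounded factors. -/
lemma expect_prod_le {n : ℕ} (hq : ∀ t < n, q t ∈ Icc (0 : ℝ) 1) {f : ℕ → (ℕ → Bool) → Bool → ℝ}
    {g : ℕ → ℝ} (hf : ∀ t < n, ∀ y b, 0 ≤ f t y b)
    (hadapt : ∀ t < n, ∀ y y' : ℕ → Bool, (∀ i < t, y i = y' i) → f t y = f t y')
    (hstep : ∀ t < n, ∀ y, q t * f t y true + (1 - q t) * f t y false ≤ g t) :
    expect q n (fun y => ∏ t ∈ Finset.range n, f t y (y t)) ≤ ∏ t ∈ Finset.range n, g t := by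
  induction n with
  | zero => simp [expect]
  | succ n ih =>
    have hqn := hq n (by omega)
    have hg : 0 ≤ g n := by
      refine le_trans ?_ (hstep n (by omega) fun _ => false)
      have h1 := hf n (by omega) (fun _ => false) true
      have h2 := hf n (by omega) (fun _ => false) false
      have := hqn.1
      have : 0 ≤ 1 - q n := by linarith [hqn.2]
      positivity
    have hupd : ∀ (y : ℕ → Bool) (b : Bool),
        ∏ t ∈ Finset.range (n + 1), f t (Function.update y n b) (Function.update y n b t) =
          (∏ t ∈ Finset.range n, f t y (y t)) * f n y b := by
      intro y b
      rw [Finset.prod_range_succ, Function.update_self]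
      congr 1
      · refine Finset.prod_congr rfl fun t ht => ?_
        have ht := Finset.mem_range.1 ht
        rw [Function.update_of_ne ht.ne, hadapt t (by omega) (Function.update y n b) y]
        exact fun i hi => Function.update_of_ne (by omega) _ _
      · rw [hadapt n (by omega) (Function.update y n b) y]
        exact fun i hi => Function.update_of_ne (by omega) _ _
    rw [Finset.prod_range_succ, mul_comm]
    calc expect q (n + 1) (fun y => ∏ t ∈ Finset.range (n + 1), f t y (y t))
        ≤ expect q n (fun y => g n * ∏ t ∈ Finset.range n, f t y (y t)) := by
          refine expect_mono (n := n) (fun t ht => hq t (by omega)) fun y => ?_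
          beta_reduce
          rw [hupd, hupd]
          have h0 : 0 ≤ ∏ t ∈ Finset.range n, f t y (y t) := Finset.prod_nonneg fun t ht =>
            hf t ((Finset.mem_range.1 ht).trans (by omega)) _ _
          have := mul_le_mul_of_nonneg_right (hstep n (by omega) y) h0
          linarith
      _ = g n * expect q n (fun y => ∏ t ∈ Finset.range n, f t y (y t)) := expect_const_mul _ _ _
      _ ≤ _ := mul_le_mul_of_nonneg_left (ih (fun t ht => hq t (by omega))
          (fun t ht => hf t (by omega)) (fun t ht => hadapt t (by omega))
          (fun t ht => hstep t (by omega))) hg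

/-- Extension of a finite sequence of outcomes. -/
def extend {n : ℕ} (y : Fin n → Bool) (i : ℕ) : Bool := if h : i < n then y ⟨i, h⟩ else false

lemma extend_snoc {n : ℕ} (y : Fin n → Bool) (b : Bool) :
    extend (Fin.snoc y b : Fin (n + 1) → Bool) = Function.update (extend y) n b := by
  funext i
  unfold extend
  rcases lt_trichotomy i n with h | rfl | h
  · rw [Function.update_of_ne h.ne, dif_pos (by omega), dif_pos h]
    exact Fin.snoc_castSucc (α := fun _ => Bool) b y ⟨i, h⟩
  · rw [Function.update_self, dif_pos (by omega)]
    exact Fin.snoc_last (α := fun _ => Bool) b y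
  · rw [Function.update_of_ne h.ne', dif_neg (by omega), dif_neg (by omega)]

/-- Links the recursive expectation with the product law, so that probabilities enter only through
the masses of finitely many outcome sequences. -/
lemma expect_eq_sum (n : ℕ) (F : (ℕ → Bool) → ℝ) :
    expect q n F = ∑ y : Fin n → Bool, (∏ i : Fin n, bern (q i) (y i)) * F (extend y) := by
  induction n generalizing F with
  | zero =>
    rw [Fintype.sum_unique]
    simp only [Finset.univ_eq_empty, Finset.prod_empty, one_mul, expect]
    congr 1
  | succ n ih =>
    unfold expect
    rw [ih, ← (Fin.snocEquiv fun _ : Fin (n + 1) => Bool).sum_comp, Fintype.sum_prod_type,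
      Fintype.sum_bool, ← Finset.sum_add_distrib]
    refine Finset.sum_congr rfl fun y _ => ?_
    simp only [Fin.snocEquiv, Equiv.coe_fn_mk, extend_snoc, Fin.prod_univ_castSucc,
      Fin.snoc_castSucc, Fin.snoc_last, Fin.val_castSucc, Fin.val_last]
    simp only [bern, if_true, Bool.false_eq_true, if_false]
    ring

end

/-- Markov's inequality for independent Bernoulli outcomes. -/
theorem prob_ge_of_expect_le {Ω : Type*} [MeasurableSpace Ω] {μ : Measure Ω}
    [IsProbabilityMeasure μ] {T : ℕ} {q : ℕ → ℝ} {Y : ℕ → Ω → Bool}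
    (hY : ∀ t < T, Measurable (Y t))
    (hind : ProbabilityTheory.iIndepFun (fun t : Fin T => Y t) μ)
    (hlaw : ∀ t < T, μ.real {ω | Y t ω = true} = q t) {good : (ℕ → Bool) → Prop}
    (hdep : ∀ y y' : ℕ → Bool, (∀ i < T, y i = y' i) → (good y ↔ good y'))
    {F : (ℕ → Bool) → ℝ} {a δ : ℝ} (hF0 : ∀ y, 0 ≤ F y) (ha : 0 < a) (hδ : 0 < δ)
    (hE : expect q T F ≤ a) (hF : ∀ y, F y ≤ a / δ → good y) :
    1 - δ ≤ μ.real {ω | good fun i => Y i ω} := by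
  classical
  have hbern : ∀ t < T, ∀ b, μ.real (Y t ⁻¹' {b}) = bern (q t) b := by
    intro t ht b
    cases b
    · have h := probReal_compl_eq_one_sub (μ := μ) (hY t ht (measurableSet_singleton true))
      have e : Y t ⁻¹' {false} = (Y t ⁻¹' {true})ᶜ := by
        ext ω
        simp
      rw [e, h]
      change 1 - μ.real {ω | Y t ω = true} = _
      rw [hlaw t ht]
      rfl
    · exact hlaw t ht
  have hq : ∀ t < T, q t ∈ Icc (0 : ℝ) 1 := fun t ht => by
    rw [← hlaw t ht]
    exact ⟨measureReal_nonneg, measureReal_le_one⟩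
  set A : (Fin T → Bool) → Set Ω := fun y => ⋂ i ∈ (Finset.univ : Finset (Fin T)),
    Y i ⁻¹' {y i} with hA
  have hAm : ∀ y, MeasurableSet (A y) := fun y =>
    Finset.measurableSet_biInter _ fun i _ => hY i i.2 (measurableSet_singleton _)
  have hAμ : ∀ y, μ.real (A y) = ∏ i : Fin T, bern (q i) (y i) := by
    intro y
    have h := hind.measure_inter_preimage_eq_mul Finset.univ (sets := fun i => {y i})
      (fun i _ => measurableSet_singleton _)
    rw [Measure.real, hA]
    simp only
    rw [h, ENNReal.toReal_prod]
    exact Finset.prod_congr rfl fun i _ => hbern i i.2 (y i)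
  set bad : Finset (Fin T → Bool) := Finset.univ.filter fun y => ¬ good (extend y) with hbad
  -- The event depends on the first `T` outcomes only, so its complement is a finite union of
  -- cylinders; this also settles measurability.
  have hset : {ω | good fun i => Y i ω} = (⋃ y ∈ bad, A y)ᶜ := by
    ext ω
    have hω : good (fun i => Y i ω) ↔ good (extend fun i : Fin T => Y i ω) := by
      apply hdep
      intro i hi
      simp [extend, hi]
    simp only [mem_ofPred_eq, mem_compl_iff, mem_iUnion, not_exists, hA, mem_iInter,
      Finset.mem_univ, true_imp_iff, mem_preimage, mem_singleton_iff, hbad, Finset.mem_filter,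
      true_and]
    constructor
    · intro h y hy hy'
      apply hy
      have : (fun i : Fin T => Y i ω) = y := funext hy'
      rw [← this]
      exact hω.1 h
    · intro h
      by_contra hcon
      exact h (fun i => Y i ω) (fun hg => hcon (hω.2 hg)) fun _ => rfl
  rw [hset, probReal_compl_eq_one_sub (Finset.measurableSet_biUnion _ fun y _ => hAm y)]
  have h1 : μ.real (⋃ y ∈ bad, A y) ≤ ∑ y ∈ bad, ∏ i : Fin T, bern (q i) (y i) := by
    refine (measureReal_biUnion_finset_le _ _).trans (le_of_eq ?_)
    exact Finset.sum_congr rfl fun y _ => hAμ y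
  have hw : ∀ y : Fin T → Bool, 0 ≤ ∏ i : Fin T, bern (q i) (y i) := fun y =>
    Finset.prod_nonneg fun i _ => bern_nonneg (hq i i.2) _
  have h2 : a / δ * ∑ y ∈ bad, ∏ i : Fin T, bern (q i) (y i) ≤ a := by
    rw [expect_eq_sum] at hE
    refine le_trans ?_ hE
    rw [Finset.mul_sum]
    refine le_trans (Finset.sum_le_sum fun y hy => ?_)
      (Finset.sum_le_sum_of_subset_of_nonneg (Finset.subset_univ bad)
        fun y _ _ => mul_nonneg (hw y) (hF0 _))
    rw [mul_comm]
    refine mul_le_mul_of_nonneg_left ?_ (hw y)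
    by_contra hlt
    exact (Finset.mem_filter.1 hy).2 (hF _ (not_le.1 hlt).le)
  have h3 : ∑ y ∈ bad, ∏ i : Fin T, bern (q i) (y i) ≤ δ := by
    rw [div_mul_eq_mul_div, div_le_iff₀ hδ] at h2
    exact le_of_mul_le_mul_left h2 ha
  linarith

/-! ### One-step exponential moments -/

lemma mul_exp_half_log_le {u v : ℝ} (hu : 0 ≤ u) (hv : 0 < v) :
    u * exp ((-log u + log v) / 2) = sqrt (v * u) := by
  rcases hu.eq_or_lt with rfl | hu
  · simp
  · rw [show (-log u + log v) / 2 = log v * (1 / 2) + -(log u * (1 / 2)) by ring, exp_add, exp_neg,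
      ← rpow_def_of_pos hv, ← rpow_def_of_pos hu, ← sqrt_eq_rpow, ← sqrt_eq_rpow, sqrt_mul hv.le]
    have : sqrt u ≠ 0 := (sqrt_pos.2 hu).ne'
    field_simp
    rw [sq_sqrt hu.le]

/-- The mean of the square root of the likelihood ratio of `a` to `q` is the Bhattacharyya
coefficient `1 - hell a q ≤ exp (-hell a q)`. -/
lemma hell_step {q a : ℝ} (hq : q ∈ Icc (0 : ℝ) 1) (ha : a ∈ Ioo (0 : ℝ) 1) :
    q * exp ((logLoss q true - logLoss a true) / 2 + hell a q) +
      (1 - q) * exp ((logLoss q false - logLoss a false) / 2 + hell a q) ≤ 1 := by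
  have h1 := mul_exp_half_log_le hq.1 ha.1
  have h2 := mul_exp_half_log_le (by linarith [hq.2] : 0 ≤ 1 - q) (by linarith [ha.2] : 0 < 1 - a)
  rw [logLoss_true, logLoss_true, logLoss_false, logLoss_false, exp_add, exp_add, ← mul_assoc,
    ← mul_assoc, sub_neg_eq_add, sub_neg_eq_add, h1, h2, ← add_mul]
  have e : sqrt (a * q) + sqrt ((1 - a) * (1 - q)) = 1 - hell a q := by unfold hell; ring
  rw [e]
  have h3 := one_sub_le_exp_neg (hell a q)
  calc _ ≤ exp (-hell a q) * exp (hell a q) := by gcongr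
    _ = 1 := by rw [← exp_add]; simp

/-- By convexity of the exponential, the average over the instances may stay in the exponent, where
the weights of the regret are. -/
lemma hell_step_mixture {q : ℝ} {S : Finset ℝ} {P a : ℝ → ℝ} (hq : q ∈ Icc (0 : ℝ) 1)
    (hP : ∀ s ∈ S, 0 ≤ P s) (hP1 : ∑ s ∈ S, P s = 1) (ha : ∀ s ∈ S, a s ∈ Ioo (0 : ℝ) 1) :
    q * exp (∑ s ∈ S, P s * ((logLoss q true - logLoss (a s) true) / 2 + hell (a s) q)) +
      (1 - q) * exp (∑ s ∈ S, P s * ((logLoss q false - logLoss (a s) false) / 2 + hell (a s) q))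
      ≤ 1 := by
  have jensen : ∀ f : ℝ → ℝ, exp (∑ s ∈ S, P s * f s) ≤ ∑ s ∈ S, P s * exp (f s) := fun f => by
    have := convexOn_exp.map_sum_le hP hP1 (p := f) (fun _ _ => mem_univ _)
    simpa only [smul_eq_mul] using this
  have h1 : 0 ≤ 1 - q := by linarith [hq.2]
  calc _ ≤ q * ∑ s ∈ S, P s * exp ((logLoss q true - logLoss (a s) true) / 2 + hell (a s) q) +
      (1 - q) * ∑ s ∈ S, P s * exp ((logLoss q false - logLoss (a s) false) / 2 + hell (a s) q) :=
        add_le_add (mul_le_mul_of_nonneg_left (jensen _) hq.1)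
          (mul_le_mul_of_nonneg_left (jensen _) h1)
    _ = ∑ s ∈ S, P s * (q * exp ((logLoss q true - logLoss (a s) true) / 2 + hell (a s) q) +
      (1 - q) * exp ((logLoss q false - logLoss (a s) false) / 2 + hell (a s) q)) := by
        rw [Finset.mul_sum, Finset.mul_sum, ← Finset.sum_add_distrib]
        exact Finset.sum_congr rfl fun s _ => by ring
    _ ≤ ∑ s ∈ S, P s * 1 := Finset.sum_le_sum fun s hs =>
        mul_le_mul_of_nonneg_left (hell_step hq (ha s hs)) (hP s hs)
    _ = 1 := by simpa using hP1

/-- Only `u > v` needs work. Then `x = log (u/v)` satisfies `x ≤ Λ` and `v x ≤ u - v`, whence `u x ≤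
2 (u - v) Λ`. The chord bound `exp z ≤ 1 + 2z` on `[0,1]` doubles this to the constant 4. -/
lemma likelihood_term_le {u v Λ : ℝ} (hu0 : 0 ≤ u) (hu1 : u ≤ 1) (hv : 0 < v) (hΛ : 1 ≤ Λ)
    (hvΛ : -log v ≤ Λ) : u * exp ((-log v + log u) / Λ) ≤ u + 4 * max (u - v) 0 := by
  rcases hu0.eq_or_lt with rfl | hu
  · simp
  rcases le_total u v with h | h
  · have h1 : exp ((-log v + log u) / Λ) ≤ 1 := by
      rw [exp_le_one_iff]
      have := log_le_log hu h
      apply div_nonpos_of_nonpos_of_nonneg <;> linarith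
    have := mul_le_mul_of_nonneg_left h1 hu.le
    have := le_max_right (u - v) 0
    linarith
  · set x := -log v + log u with hx
    have hx0 : 0 ≤ x := by
      have := log_le_log hv h
      linarith
    have hxΛ : x ≤ Λ := by
      have := log_nonpos hu.le hu1
      linarith
    have hz : x / Λ ≤ 1 := (div_le_one (by linarith)).2 hxΛ
    have hz0 : 0 ≤ x / Λ := by positivity
    have hexp : exp (x / Λ) ≤ 1 + 2 * (x / Λ) := by
      have h1 := convexOn_exp.2 (mem_univ (0 : ℝ)) (mem_univ (1 : ℝ))
        (by linarith : 0 ≤ 1 - x / Λ) hz0 (by ring)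
      simp only [smul_eq_mul, mul_zero, mul_one, zero_add, exp_zero] at h1
      have := exp_one_lt_d9
      nlinarith
    have hxu : v * x ≤ u - v := by
      have h1 := log_le_sub_one_of_pos (div_pos hu hv)
      rw [log_div hu.ne' hv.ne'] at h1
      have := mul_le_mul_of_nonneg_left h1 hv.le
      have e : v * (u / v - 1) = u - v := by field_simp
      rw [hx]
      linarith
    have hux : u * (x / Λ) ≤ 2 * (u - v) := by
      rw [← mul_div_assoc, div_le_iff₀ (by linarith)]
      have : (u - v) * x ≤ (u - v) * Λ := mul_le_mul_of_nonneg_left hxΛ (by linarith)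
      nlinarith
    rw [max_eq_left (by linarith)]
    nlinarith [mul_le_mul_of_nonneg_left hexp hu.le]

/-- Dividing by a bound `Λ` for the log loss of `c` tempers the likelihood ratio: its mean becomes
at most `1 + 4 |q - c|`, linear in the deviation. The two outcomes contribute the positive parts of
`q - c` and `c - q`. -/
lemma likelihood_step {q c Λ : ℝ} (hq : q ∈ Icc (0 : ℝ) 1) (hc : c ∈ Ioo (0 : ℝ) 1) (hΛ : 1 ≤ Λ)
    (h1 : -log c ≤ Λ) (h2 : -log (1 - c) ≤ Λ) :
    q * exp ((logLoss c true - logLoss q true) / Λ - 4 * |q - c|) +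
      (1 - q) * exp ((logLoss c false - logLoss q false) / Λ - 4 * |q - c|) ≤ 1 := by
  have t1 := likelihood_term_le hq.1 hq.2 hc.1 hΛ h1
  have t2 := likelihood_term_le (by linarith [hq.2] : 0 ≤ 1 - q) (by linarith [hq.1])
    (by linarith [hc.2] : 0 < 1 - c) hΛ h2
  rw [logLoss_true, logLoss_true, logLoss_false, logLoss_false, sub_eq_add_neg _ (4 * |q - c|),
    sub_eq_add_neg _ (4 * |q - c|), exp_add, exp_add, ← mul_assoc, ← mul_assoc, sub_neg_eq_add,
    sub_neg_eq_add, ← add_mul]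
  have hmax : max (q - c) 0 + max (1 - q - (1 - c)) 0 = |q - c| := by
    rcases le_total q c with h | h
    · rw [max_eq_right (by linarith), max_eq_left (by linarith), abs_of_nonpos (by linarith)]
      ring
    · rw [max_eq_left (by linarith), max_eq_right (by linarith), abs_of_nonneg (by linarith)]
      ring
  calc _ ≤ exp (4 * |q - c|) * exp (-(4 * |q - c|)) := by
        gcongr
        have := add_one_le_exp (4 * |q - c|)
        linarith
    _ = 1 := by rw [← exp_add]; simp

end
end AdaptiveCalibration

namespace AdaptiveCalibration
noncomputable section
open Real Set MeasureTheory

/-! ### Concentration of the mean outcome of an epoch -/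

/-- The mean outcome of a block. -/
def blockMean (B : Finset ℕ) (y : ℕ → Bool) : ℝ := (∑ t ∈ B, bit (y t)) / B.card

/-- The smoothed expected mean outcome of a block. -/
def smoothMean (B : Finset ℕ) (q : ℕ → ℝ) : ℝ := (∑ t ∈ B, q t + 1) / (B.card + 2)

section
variable {B : Finset ℕ} {q : ℕ → ℝ}

lemma sum_mem (hq : ∀ t ∈ B, q t ∈ Icc (0 : ℝ) 1) : ∑ t ∈ B, q t ∈ Icc (0 : ℝ) B.card := by
  refine ⟨Finset.sum_nonneg fun t ht => (hq t ht).1, ?_⟩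
  calc _ ≤ ∑ t ∈ B, (1 : ℝ) := Finset.sum_le_sum fun t ht => (hq t ht).2
    _ = _ := by simp

lemma smoothMean_mem (hq : ∀ t ∈ B, q t ∈ Icc (0 : ℝ) 1) : smoothMean B q ∈ Ioo (0 : ℝ) 1 := by
  obtain ⟨h0, h1⟩ := sum_mem hq
  unfold smoothMean
  have : (0 : ℝ) ≤ B.card := by positivity
  refine ⟨by positivity, ?_⟩
  rw [div_lt_one (by positivity)]
  linarith

/-- Smoothing moves the mean of a block of `n` rounds by at most `1/n`; the rest is the triangle
inequality. -/
lemma abs_smoothMean_sub_le (hq : ∀ t ∈ B, q t ∈ Icc (0 : ℝ) 1) (hB : 0 < B.card) {c C : ℝ}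
    (hC : ∑ t ∈ B, |q t - c| ≤ C) : |smoothMean B q - c| ≤ (C + 1) / B.card := by
  obtain ⟨h0, h1⟩ := sum_mem hq
  have hn : (0 : ℝ) < B.card := by exact_mod_cast hB
  have e : smoothMean B q - c = (∑ t ∈ B, (q t - c)) / B.card +
      (B.card - 2 * ∑ t ∈ B, q t) / (B.card * (B.card + 2)) := by
    unfold smoothMean
    rw [Finset.sum_sub_distrib, Finset.sum_const, nsmul_eq_mul]
    field_simp
    ring
  rw [e, add_div]
  refine (abs_add_le _ _).trans (add_le_add ?_ ?_)
  · rw [abs_div, abs_of_pos hn]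
    gcongr
    exact (Finset.abs_sum_le_sum_abs _ _).trans hC
  · rw [abs_div, abs_of_pos (by positivity : (0 : ℝ) < B.card * (B.card + 2)),
      div_le_div_iff₀ (by positivity) hn]
    have : |(B.card : ℝ) - 2 * ∑ t ∈ B, q t| ≤ B.card + 2 := by
      rw [abs_le]
      constructor <;> linarith
    nlinarith

/-- The likelihood ratio factors. -/
def ratioFactor (B : Finset ℕ) (x c : ℝ) (t : ℕ) (b : Bool) : ℝ :=
  if t ∈ B then sqrt (bern x b / bern c b) else 1

lemma ratioFactor_nonneg (B : Finset ℕ) (x c : ℝ) (t : ℕ) (b : Bool) :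
    0 ≤ ratioFactor B x c t b := by
  unfold ratioFactor
  split_ifs
  · exact sqrt_nonneg _
  · exact zero_le_one

lemma mul_sqrt_div_le {u v x k : ℝ} (hv : 0 < v) (h : u ≤ k * v) :
    u * sqrt (x / v) ≤ k * sqrt (x * v) := by
  have e : v * sqrt (x / v) = sqrt (x * v) := by
    rw [show x * v = v ^ 2 * (x / v) by field_simp, sqrt_mul (by positivity), sqrt_sq hv.le]
  calc _ ≤ k * v * sqrt (x / v) := by gcongr
    _ = _ := by rw [mul_assoc, e]

/-- The mean `g t` of a factor is at most `exp (g t - 1)`, so only the sum of the `g t` matters.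
Smoothing by one success and one failure gives `∑ q ≤ (n + 2) c`, and likewise for `1 - q`, so the
sum is at most `n + 2` times the Bhattacharyya coefficient. The excess 2 becomes the summand in the
exponent. -/
lemma expect_ratio_le {T : ℕ} (hBT : ∀ t ∈ B, t < T) (hq : ∀ t < T, q t ∈ Icc (0 : ℝ) 1)
    (hB : 0 < B.card) {x : ℝ} (hx : x ∈ Icc (0 : ℝ) 1) :
    expect q T (fun y => ∏ t ∈ Finset.range T, ratioFactor B x (smoothMean B q) t (y t)) ≤
      exp (2 - B.card * hell x (smoothMean B q)) := by
  have hqB : ∀ t ∈ B, q t ∈ Icc (0 : ℝ) 1 := fun t ht => hq t (hBT t ht)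
  obtain ⟨hc0, hc1⟩ := smoothMean_mem hqB
  set c := smoothMean B q with hc
  set g : ℕ → ℝ := fun t => if t ∈ B then
    q t * sqrt (x / c) + (1 - q t) * sqrt ((1 - x) / (1 - c)) else 1 with hg
  refine (expect_prod_le hq (f := fun t _ b => ratioFactor B x c t b) (g := g)
    (fun t _ y b => ratioFactor_nonneg _ _ _ _ _) (fun _ _ _ _ _ => rfl) ?_).trans ?_
  · intro t ht y
    simp only [ratioFactor, hg]
    split_ifs
    · simp [bern]
    · linarith
  have e : ∏ t ∈ Finset.range T, g t = ∏ t ∈ B, g t := by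
    symm
    apply Finset.prod_subset (fun t ht => Finset.mem_range.2 (hBT t ht))
    intro t _ ht
    simp [hg, ht]
  have hg0 : ∀ t ∈ B, 0 ≤ g t := by
    intro t ht
    simp only [hg, if_pos ht]
    have h1 := (hqB t ht).1
    have h2 := sub_nonneg.2 (hqB t ht).2
    positivity
  rw [e]
  refine (Finset.prod_le_prod hg0 (g := fun t => exp (g t - 1)) fun t _ => ?_).trans ?_
  · have := add_one_le_exp (g t - 1)
    linarith
  rw [← exp_sum, exp_le_exp]
  have hsum : ∑ t ∈ B, (g t - 1) = (∑ t ∈ B, q t) * sqrt (x / c) +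
      (B.card - ∑ t ∈ B, q t) * sqrt ((1 - x) / (1 - c)) - B.card := by
    rw [Finset.sum_sub_distrib, Finset.sum_congr rfl fun t ht => show g t = q t * sqrt (x / c) +
      (1 - q t) * sqrt ((1 - x) / (1 - c)) by simp only [hg, if_pos ht],
      Finset.sum_add_distrib, ← Finset.sum_mul, ← Finset.sum_mul, Finset.sum_sub_distrib]
    simp
  have hn : (0 : ℝ) < B.card := by exact_mod_cast hB
  have hcn : c * (B.card + 2) = ∑ t ∈ B, q t + 1 := by
    rw [hc, smoothMean]
    field_simp
  have h1 := mul_sqrt_div_le (u := ∑ t ∈ B, q t) (v := c) (x := x) (k := B.card + 2) hc0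
    (by linarith)
  have h2 := mul_sqrt_div_le (u := B.card - ∑ t ∈ B, q t) (v := 1 - c) (x := 1 - x)
    (k := B.card + 2) (by linarith) (by linarith)
  rw [hsum]
  have h3 : 0 ≤ hell x c := by
    rw [hell_eq hx ⟨hc0.le, hc1.le⟩]
    positivity
  have e3 : sqrt (x * c) + sqrt ((1 - x) * (1 - c)) = 1 - hell x c := by unfold hell; ring
  have e4 : (B.card + 2 : ℝ) * sqrt (x * c) + (B.card + 2) * sqrt ((1 - x) * (1 - c)) =
      (B.card + 2) * (1 - hell x c) := by rw [← e3]; ring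
  nlinarith

lemma sum_bit_eq (B : Finset ℕ) (y : ℕ → Bool) :
    ∑ t ∈ B, bit (y t) = ((B.filter fun t => y t = true).card : ℝ) := by
  unfold bit
  rw [Finset.sum_boole]

/-- The empirical mean maximizes the likelihood of the observed block. -/
lemma one_le_prod_ratio {T : ℕ} (hBT : ∀ t ∈ B, t < T) (hB : 0 < B.card) {c : ℝ}
    (hc : c ∈ Ioo (0 : ℝ) 1) (y : ℕ → Bool) :
    1 ≤ ∏ t ∈ Finset.range T, ratioFactor B (blockMean B y) c t (y t) := by
  have hn : (0 : ℝ) < B.card := by exact_mod_cast hB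
  set x := blockMean B y with hx
  have hS : ∑ t ∈ B, bit (y t) = B.card * x := by
    rw [hx, blockMean]
    field_simp
  have e : ∏ t ∈ Finset.range T, ratioFactor B x c t (y t) =
      ∏ t ∈ B, sqrt (bern x (y t) / bern c (y t)) := by
    rw [← Finset.prod_subset (fun t ht => Finset.mem_range.2 (hBT t ht))
      (fun t _ ht => by simp [ratioFactor, ht])]
    exact Finset.prod_congr rfl fun t ht => by simp only [ratioFactor, if_pos ht]
  have hcpos : ∀ b, 0 < bern c b := by
    intro b
    cases b <;> simp [bern, hc.1, hc.2]
  have hxpos : ∀ t ∈ B, 0 < bern x (y t) := by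
    intro t ht
    cases hy : y t
    · have : ∑ t ∈ B, bit (y t) < ∑ t ∈ B, (1 : ℝ) :=
        Finset.sum_lt_sum (fun t _ => bit_le_one _) ⟨t, ht, by simp [hy, bit]⟩
      rw [hS] at this
      simp only [Finset.sum_const, nsmul_eq_mul, mul_one] at this
      simp only [bern, Bool.false_eq_true, if_false]
      nlinarith
    · have : 0 < ∑ t ∈ B, bit (y t) :=
        Finset.sum_pos' (fun t _ => bit_nonneg _) ⟨t, ht, by simp [hy, bit]⟩
      rw [hS] at this
      simp only [bern, if_true]
      exact pos_of_mul_pos_right this hn.le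
  have hx0 : 0 ≤ x := div_nonneg (Finset.sum_nonneg fun t _ => bit_nonneg _) hn.le
  have hx1 : x ≤ 1 := by
    have : ∑ t ∈ B, bit (y t) ≤ ∑ t ∈ B, (1 : ℝ) := Finset.sum_le_sum fun t _ => bit_le_one _
    rw [hS] at this
    simp only [Finset.sum_const, nsmul_eq_mul, mul_one] at this
    nlinarith
  -- For the inverse ratios, `√r ≤ exp ((r - 1)/2)`, and the ratios sum to at most the length of the
  -- block; the inequality `≤` also covers an empirical mean 0 or 1.
  have hinv : ∏ t ∈ B, sqrt (bern c (y t) / bern x (y t)) ≤ 1 := by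
    calc _ ≤ ∏ t ∈ B, exp ((bern c (y t) / bern x (y t) - 1) / 2) := by
          refine Finset.prod_le_prod (fun _ _ => sqrt_nonneg _) fun t ht => ?_
          have hr : 0 < bern c (y t) / bern x (y t) := div_pos (hcpos _) (hxpos t ht)
          rw [sqrt_le_left (exp_pos _).le, ← exp_nat_mul]
          have := add_one_le_exp (bern c (y t) / bern x (y t) - 1)
          push_cast
          rw [mul_div_cancel₀ _ (two_ne_zero)]
          linarith
      _ = exp (∑ t ∈ B, (bern c (y t) / bern x (y t) - 1) / 2) := (exp_sum _ _).symm
      _ ≤ 1 := by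
          rw [exp_le_one_iff, ← Finset.sum_div, Finset.sum_sub_distrib]
          have e1 : ∑ t ∈ B, bern c (y t) / bern x (y t) =
              ∑ t ∈ B, (bit (y t) * (c / x) + (1 - bit (y t)) * ((1 - c) / (1 - x))) :=
            Finset.sum_congr rfl fun t _ => by cases y t <;> simp [bern, bit]
          rw [e1, Finset.sum_add_distrib, ← Finset.sum_mul, ← Finset.sum_mul,
            Finset.sum_sub_distrib, hS]
          simp only [Finset.sum_const, nsmul_eq_mul, mul_one]
          have a1 : x * (c / x) ≤ c := by
            rcases hx0.eq_or_lt with h | h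
            · rw [← h]; simp [hc.1.le]
            · exact le_of_eq (by field_simp)
          have a2 : (1 - x) * ((1 - c) / (1 - x)) ≤ 1 - c := by
            rcases hx1.eq_or_lt with h | h
            · rw [h]; simp [hc.2.le]
            · have : 1 - x ≠ 0 := by linarith
              exact le_of_eq (by field_simp)
          have a3 := mul_le_mul_of_nonneg_left (add_le_add a1 a2) hn.le
          apply div_nonpos_of_nonpos_of_nonneg _ zero_le_two
          linarith
  have hprod : (∏ t ∈ B, sqrt (bern x (y t) / bern c (y t))) *
      ∏ t ∈ B, sqrt (bern c (y t) / bern x (y t)) = 1 := by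
    rw [← Finset.prod_mul_distrib]
    refine Finset.prod_eq_one fun t ht => ?_
    have h1 := hxpos t ht
    have h2 := hcpos (y t)
    rw [← sqrt_mul (by positivity)]
    rw [div_mul_div_comm, mul_comm (bern c (y t)), div_self (by positivity), sqrt_one]
  rw [e]
  have h0 : 0 ≤ ∏ t ∈ B, sqrt (bern x (y t) / bern c (y t)) :=
    Finset.prod_nonneg fun _ _ => sqrt_nonneg _
  nlinarith

/-- Exponential moment of the Hellinger deviation of the mean outcome of a block. -/
lemma expect_exp_hell_le {T : ℕ} (hBT : ∀ t ∈ B, t < T) (hq : ∀ t < T, q t ∈ Icc (0 : ℝ) 1)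
    (hB : 0 < B.card) :
    expect q T (fun y => exp (B.card * hell (blockMean B y) (smoothMean B q))) ≤
      exp 2 * (B.card + 1) := by
  have hqB : ∀ t ∈ B, q t ∈ Icc (0 : ℝ) 1 := fun t ht => hq t (hBT t ht)
  have hn : (0 : ℝ) < B.card := by exact_mod_cast hB
  set c := smoothMean B q with hc
  have hx : ∀ k ∈ Finset.range (B.card + 1), (k / B.card : ℝ) ∈ Icc (0 : ℝ) 1 := by
    intro k hk
    have hk : (k : ℝ) ≤ B.card := by exact_mod_cast Nat.lt_succ_iff.1 (Finset.mem_range.1 hk)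
    exact ⟨by positivity, (div_le_one hn).2 hk⟩
  -- The empirical mean is random, but takes only `n + 1` values. Summing over all of them makes the
  -- point `x` of the likelihood ratio deterministic, at the price of the factor `n + 1`.
  calc _ ≤ expect q T (fun y => ∑ k ∈ Finset.range (B.card + 1),
        exp (B.card * hell (k / B.card) c) *
          ∏ t ∈ Finset.range T, ratioFactor B (k / B.card) c t (y t)) := by
        refine expect_mono hq fun y => ?_
        set k := (B.filter fun t => y t = true).card with hk
        have e : blockMean B y = k / B.card := by rw [blockMean, sum_bit_eq]
        have hkm : k ∈ Finset.range (B.card + 1) :=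
          Finset.mem_range.2 (Nat.lt_succ_of_le (Finset.card_filter_le _ _))
        refine le_trans ?_ (Finset.single_le_sum (f := fun k : ℕ =>
          exp (B.card * hell (k / B.card) c) *
          ∏ t ∈ Finset.range T, ratioFactor B (k / B.card) c t (y t)) (fun i _ => mul_nonneg
            (exp_pos _).le (Finset.prod_nonneg fun _ _ => ratioFactor_nonneg _ _ _ _ _)) hkm)
        have := one_le_prod_ratio hBT hB (smoothMean_mem hqB) y
        rw [e] at this ⊢
        exact le_mul_of_one_le_right (exp_pos _).le this
    _ = ∑ k ∈ Finset.range (B.card + 1), exp (B.card * hell (k / B.card) c) *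
          expect q T (fun y => ∏ t ∈ Finset.range T, ratioFactor B (k / B.card) c t (y t)) := by
        rw [expect_sum]
        exact Finset.sum_congr rfl fun k _ => expect_const_mul _ _ _
    _ ≤ ∑ k ∈ Finset.range (B.card + 1), exp 2 := by
        refine Finset.sum_le_sum fun k hk => ?_
        have h1 := expect_ratio_le hBT hq hB (hx k hk)
        calc _ ≤ exp (B.card * hell (k / B.card) c) * exp (2 - B.card * hell (k / B.card) c) := by
              gcongr
          _ = exp 2 := by rw [← exp_add]; congr 1; ring
    _ = _ := by
        rw [Finset.sum_const, Finset.card_range, nsmul_eq_mul]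
        push_cast
        ring

end

end
end AdaptiveCalibration

namespace AdaptiveCalibration
noncomputable section
open Real Set MeasureTheory

/-! ### The calibration bound -/

lemma exists_nonStationarity (T : ℕ) (q : ℕ → ℝ) :
    ∃ c ∈ Icc (0 : ℝ) 1, ∑ t ∈ Finset.range T, |q t - c| = nonStationarity T q := by
  have hcont : ContinuousOn (fun x : ℝ => ∑ t ∈ Finset.range T, |q t - x|) (Icc 0 1) := by
    fun_prop
  obtain ⟨c, hc, hmin⟩ := isCompact_Icc.exists_isMinOn (nonempty_Icc.2 zero_le_one) hcont
  refine ⟨c, hc, le_antisymm ?_ ?_⟩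
  · have : Nonempty (Icc (0 : ℝ) 1) := ⟨⟨c, hc⟩⟩
    exact le_ciInf fun x => hmin x.2
  · unfold nonStationarity
    refine ciInf_le (f := fun x : Icc (0 : ℝ) 1 => ∑ t ∈ Finset.range T, |q t - (x : ℝ)|)
      ⟨0, ?_⟩ ⟨c, hc⟩
    rintro _ ⟨x, rfl⟩
    exact Finset.sum_nonneg fun _ _ => abs_nonneg _

/-- The block of rounds that precedes epoch `m`. -/
def prevBlock (m : ℕ) : Finset ℕ := Finset.Ico (2 ^ (m - 1) - 2) (2 ^ m - 2)

lemma card_prevBlock {m : ℕ} (hm : 2 ≤ m) : (prevBlock m).card = 2 ^ (m - 1) := by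
  obtain ⟨k, rfl⟩ := Nat.exists_eq_add_of_le' hm
  unfold prevBlock
  rw [Nat.card_Ico]
  simp only [show k + 2 - 1 = k + 1 by omega, pow_succ]
  have := Nat.one_le_two_pow (n := k)
  omega

lemma blockMean_prevBlock {m : ℕ} (hm : 2 ≤ m) (y : ℕ → Bool) :
    blockMean (prevBlock m) y = prevMean m y := by
  unfold blockMean prevMean
  rw [card_prevBlock hm]
  push_cast
  rfl

lemma prevMean_congr {m : ℕ} {y y' : ℕ → Bool} (h : ∀ i < 2 ^ m - 2, y i = y' i) :
    prevMean m y = prevMean m y' := by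
  unfold prevMean
  congr 1
  exact Finset.sum_congr rfl fun t ht => by rw [h t (Finset.mem_Ico.1 ht).2]

lemma gridAt_congr (p : Params) {t : ℕ} {y y' : ℕ → Bool} (h : ∀ i < t, y i = y' i) :
    gridAt p y t = gridAt p y' t := by
  unfold gridAt
  rw [prevMean_congr fun i hi => h i (hi.trans_le (epoch_start_le t))]

lemma action_congr {P P' : ℕ → ℝ →₀ ℝ} {t : ℕ} {y y' : ℕ → Bool} (hP : ∀ τ < t, P τ = P' τ)
    (h : ∀ i < t, y i = y' i) : action P y t = action P' y' t := by
  unfold action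
  funext s
  congr 1
  funext x
  refine Finset.sum_congr rfl fun τ hτ => ?_
  have := (Finset.mem_Ico.1 hτ).2
  rw [hP τ this, h τ this]

lemma pseudoKL_congr {T : ℕ} {P P' : ℕ → ℝ →₀ ℝ} {y y' : ℕ → Bool} (hP : ∀ t < T, P t = P' t)
    (h : ∀ i < T, y i = y' i) : pseudoKL T P y = pseudoKL T P' y' := by
  have hρ : rhoBar T P y = rhoBar T P' y' := by
    funext s
    unfold rhoBar
    rw [Finset.sum_congr rfl fun t ht => by
      rw [hP t (Finset.mem_range.1 ht), h t (Finset.mem_range.1 ht)],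
      Finset.sum_congr (f := fun t => P t s) rfl fun t ht => by rw [hP t (Finset.mem_range.1 ht)]]
  unfold pseudoKL
  rw [hρ]
  exact Finset.sum_congr rfl fun t ht => by rw [hP t (Finset.mem_range.1 ht)]

/-- The cube of the cube root. -/
lemma rpow_third_cube {x : ℝ} (hx : 0 ≤ x) : (x ^ (1 / 3 : ℝ)) ^ 3 = x := by
  rw [← rpow_natCast, ← rpow_mul hx]
  norm_num

/-- All quantities are written through the cube roots `l`, `j`, `x` of `log T`, `ι`, `1 + C`, which
makes the balancing of `K` polynomial. The targets are `Y = ι log² T` and `X = (1 + C)^(1/3)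
log^(7/3) T`. -/
lemma calibration_arith {L ι W K R M l x j V : ℝ} (hl : 0.8 ≤ l) (hL : L = l ^ 3) (hj : ι = j ^ 3)
    (hlj : l ≤ j) (hι1 : 1 ≤ ι) (hW : W = x ^ 3) (hx : 1 ≤ x) (hjM : j ≤ M * l ^ 2)
    (hK2 : 2 ≤ K) (hKx : x ≤ K * l ^ 2) (hKu : K * l ^ 2 ≤ x + 2 * l ^ 2) (hR0 : 0 ≤ R)
    (hR : R * j ≤ j + x)
    (hV : V ≤ 40 * (ι + 17 * L ^ 2 * (11 * R + 6 + 10 * L * K) + L * (4 * W + ι) + W)) :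
    4 * L + 33 * L ^ 2 * (11 * R + 6 + 10 * L * K) + 66 * L * R * ι + 2 / K ^ 2 * V ≤
      (15000 + 66 * M ^ 2) * (ι * L ^ 2 + x * l ^ 7) := by
  have hl0 : 0 < l := by linarith
  have hj0 : 0 < j := by linarith
  have hK0 : 0 < K := by linarith
  have hL0 : 0.5 ≤ L := by
    rw [hL]
    calc (0.5 : ℝ) ≤ 0.8 ^ 3 := by norm_num
      _ ≤ _ := by gcongr
  have hLp : 0 < L := by linarith
  set Y := ι * L ^ 2 with hY
  set X := x * l ^ 7 with hX
  have hX0 : 0 ≤ X := by positivity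
  have hιL : L ≤ ι := by rw [hL, hj]; gcongr
  have hLsq : 1 ≤ 4 * L ^ 2 := by
    have := pow_le_pow_left₀ (by norm_num) hL0 2
    norm_num at this
    linarith
  have v1 : ι ≤ 4 * Y := by
    calc ι = ι * 1 := by ring
      _ ≤ ι * (4 * L ^ 2) := by gcongr
      _ = _ := by rw [hY]; ring
  have v2 : L * ι ≤ 2 * Y := by
    calc L * ι = L * ι * 1 := by ring
      _ ≤ L * ι * (2 * L) := by gcongr; linarith
      _ = _ := by rw [hY]; ring
  have v3 : L ^ 2 ≤ Y := by rw [hY]; exact le_mul_of_one_le_left (by positivity) hι1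
  have v4 : L ^ 3 ≤ Y := by
    calc L ^ 3 = L * L ^ 2 := by ring
      _ ≤ _ := by rw [hY]; gcongr
  have v5 : L ≤ 4 * Y := hιL.trans v1
  have hR' : R ≤ 1 + x / j := by
    rw [← mul_le_mul_iff_left₀ hj0]
    calc R * j ≤ j + x := hR
      _ = (1 + x / j) * j := by field_simp
  have r1 : L ^ 2 * R ≤ Y + 2 * X := by
    have h1 : L ^ 2 * (x / j) ≤ 2 * X := by
      rw [← mul_div_assoc, div_le_iff₀ hj0, hL, hX]
      have : l ^ 5 * x * l ≤ l ^ 5 * x * j := by gcongr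
      have h2 : 1 ≤ 2 * l ^ 2 := by
        have := pow_le_pow_left₀ (by norm_num) hl 2
        norm_num at this
        linarith
      have : l ^ 5 * x * j * 1 ≤ l ^ 5 * x * j * (2 * l ^ 2) := by gcongr
      calc (l ^ 3) ^ 2 * x = l ^ 5 * x * l := by ring
        _ ≤ l ^ 5 * x * j * 1 := by linarith
        _ ≤ _ := this
        _ = _ := by ring
    calc L ^ 2 * R ≤ L ^ 2 * (1 + x / j) := by gcongr
      _ = L ^ 2 + L ^ 2 * (x / j) := by ring
      _ ≤ _ := by linarith
  -- The only use of `j ≤ M l²`, that is, of `ι = O(log² T)`: it turns the inner rounding cost `x j²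
  -- L` into `x l⁷`.
  have r2 : L * R * ι ≤ 2 * Y + M ^ 2 * X := by
    have h1 : L * (x / j) * ι ≤ M ^ 2 * X := by
      have e : L * (x / j) * ι = l ^ 3 * x * j ^ 2 := by rw [hL, hj]; field_simp
      rw [e, hX]
      calc l ^ 3 * x * j ^ 2 ≤ l ^ 3 * x * (M * l ^ 2) ^ 2 := by gcongr
        _ = _ := by ring
    calc L * R * ι ≤ L * (1 + x / j) * ι := by gcongr
      _ = L * ι + L * (x / j) * ι := by ring
      _ ≤ _ := by linarith
  -- First half of the balance: the regret of the `K log T` outer points. The additive 2 in the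
  -- bound for `K` leaves `log³ T`, which is at most `Y` because `log T ≤ ι`.
  have r3 : L ^ 3 * K ≤ X + 2 * Y := by
    calc L ^ 3 * K = l ^ 7 * (K * l ^ 2) := by rw [hL]; ring
      _ ≤ l ^ 7 * (x + 2 * l ^ 2) := by gcongr
      _ = X + 2 * L ^ 3 := by rw [hX, hL]; ring
      _ ≤ _ := by linarith
  set Z := L ^ 2 * (11 * R + 6 + 10 * L * K) with hZ
  have r4 : Z ≤ 37 * Y + 32 * X := by
    have e : Z = 11 * (L ^ 2 * R) + 6 * L ^ 2 + 10 * (L ^ 3 * K) := by rw [hZ]; ring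
    linarith
  have hKinv : 2 / K ^ 2 ≤ 1 / 2 := by
    rw [div_le_div_iff₀ (by positivity) (by norm_num)]
    have := pow_le_pow_left₀ zero_le_two hK2 2
    linarith
  have hVV : 2 / K ^ 2 * V ≤ 20 * (ι + 17 * Z + L * ι) + 480 * X := by
    have h0 : 0 ≤ 2 / K ^ 2 := by positivity
    have hZ0 : 0 ≤ Z := by positivity
    -- Second half of the balance: with `K l² ≥ x`, dividing `L x³` by `K²` leaves at most `x l⁷`.
    have h1 : 2 / K ^ 2 * (4 * L * W + W) ≤ 12 * X := by
      have hW0 : 0 ≤ W := by rw [hW]; positivity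
      have h2 : 4 * L * W + W ≤ 6 * L * W := by
        have := mul_le_mul_of_nonneg_right (by linarith : 1 ≤ 2 * L) hW0
        linarith
      calc _ ≤ 2 / K ^ 2 * (6 * L * W) := by gcongr
        _ ≤ 12 * X := by
          rw [div_mul_eq_mul_div, div_le_iff₀ (by positivity), hL, hW, hX]
          calc 2 * (6 * l ^ 3 * x ^ 3) = 12 * l ^ 3 * x * x ^ 2 := by ring
            _ ≤ 12 * l ^ 3 * x * (K * l ^ 2) ^ 2 := by gcongr
            _ = _ := by ring
    have h5 : 2 / K ^ 2 * (ι + 17 * Z + L * ι) ≤ 1 / 2 * (ι + 17 * Z + L * ι) := by gcongr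
    calc 2 / K ^ 2 * V ≤ 2 / K ^ 2 * (40 * (ι + 17 * L ^ 2 * (11 * R + 6 + 10 * L * K) +
          L * (4 * W + ι) + W)) := mul_le_mul_of_nonneg_left hV h0
      _ = 40 * (2 / K ^ 2 * (ι + 17 * Z + L * ι)) + 40 * (2 / K ^ 2 * (4 * L * W + W)) := by
        rw [hZ]; ring
      _ ≤ _ := by linarith
  have hMX : 0 ≤ M ^ 2 * Y := by positivity
  have e : 33 * L ^ 2 * (11 * R + 6 + 10 * L * K) = 33 * Z := by rw [hZ]; ring
  have e' : (15000 + 66 * M ^ 2) * (Y + X) =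
      15000 * Y + 15000 * X + 66 * (M ^ 2 * Y) + 66 * (M ^ 2 * X) := by ring
  rw [e, e']
  linarith

section
variable {T : ℕ} {C ι : ℝ} {P : ℕ → (ℕ → Bool) → ℝ →₀ ℝ} {q : ℕ → ℝ}

lemma IsForecaster.isRun {p : Params} (h : IsForecaster p P) (hp : p.Good) (y : ℕ → Bool) :
    IsRun p (fun t => P t y) y :=
  ⟨hp, fun t ht => h.isDist t ht y, fun t ht h2 => h.firstEpoch t ht h2 y,
    fun t ht h2 => h.laterEpochs t ht h2 y⟩

/-- The factors of the likelihood-ratio supermartingale of the base instances. -/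
def instFactor (p : Params) (P : ℕ → (ℕ → Bool) → ℝ →₀ ℝ) (q : ℕ → ℝ) (t : ℕ) (y : ℕ → Bool)
    (b : Bool) : ℝ :=
  if 2 ≤ t then exp (∑ s ∈ gridAt p y t, P t y s *
    ((logLoss (q t) b - logLoss (action (fun τ => P τ y) y t s) b) / 2
      + hell (action (fun τ => P τ y) y t s) (q t))) else 1

/-- Given the past, the distribution, grid and actions of round `t` are fixed, so
`hell_step_mixture` bounds each conditional factor by one. -/
lemma IsForecaster.expect_inst_le {p : Params} (h : IsForecaster p P) (hp : p.Good)
    (hq : ∀ t < p.T, q t ∈ Icc (0 : ℝ) 1) :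
    expect q p.T (fun y => ∏ t ∈ Finset.range p.T, instFactor p P q t y (y t)) ≤ 1 := by
  refine (expect_prod_le hq (g := fun _ => 1) ?_ ?_ ?_).trans (by simp)
  · intro t _ y b
    unfold instFactor
    split_ifs
    · exact (exp_pos _).le
    · exact zero_le_one
  · intro t ht y y' hy
    funext b
    unfold instFactor
    rw [gridAt_congr p hy, h.nonanticipating t ht y y' hy, action_congr (fun τ hτ =>
      h.nonanticipating τ (hτ.trans ht) y y' fun i hi => hy i (hi.trans hτ)) hy]
  · intro t ht y
    unfold instFactor
    split_ifs with h2
    · have hr := h.isRun hp y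
      exact hell_step_mixture (hq t ht) (fun s _ => hr.nonneg ht s)
        ((hr.isDist t ht).sum_eq_one (hr.later t ht h2).1) (fun s _ => hr.action_mem ht s)
    · linarith

/-- The factors of the likelihood-ratio supermartingale of a constant mean. -/
def constFactor (c Λ : ℝ) (q : ℕ → ℝ) (t : ℕ) (b : Bool) : ℝ :=
  if 2 ≤ t then exp ((logLoss c b - logLoss (q t) b) / Λ - 4 * |q t - c|) else 1

lemma expect_const_factor_le {c Λ : ℝ} (hq : ∀ t < T, q t ∈ Icc (0 : ℝ) 1)
    (hc : c ∈ Ioo (0 : ℝ) 1) (hΛ : 1 ≤ Λ) (h1 : -log c ≤ Λ) (h2 : -log (1 - c) ≤ Λ) :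
    expect q T (fun y => ∏ t ∈ Finset.range T, constFactor c Λ q t (y t)) ≤ 1 := by
  refine (expect_prod_le hq (f := fun t _ b => constFactor c Λ q t b) (g := fun _ => 1)
    ?_ (fun _ _ _ _ _ => rfl) ?_).trans (by simp)
  · intro t _ _ b
    unfold constFactor
    split_ifs
    · exact (exp_pos _).le
    · exact zero_le_one
  · intro t ht y
    unfold constFactor
    split_ifs
    · exact likelihood_step (hq t ht) hc hΛ h1 h2
    · linarith

lemma prod_range_ite_exp (T : ℕ) (hT : 2 ≤ T) (f : ℕ → ℝ) :
    ∏ t ∈ Finset.range T, (if 2 ≤ t then exp (f t) else 1) = exp (∑ t ∈ Finset.Ico 2 T, f t) := by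
  rw [exp_sum, ← Finset.prod_range_mul_prod_Ico _ hT]
  have : ∏ t ∈ Finset.range 2, (if 2 ≤ t then exp (f t) else 1) = 1 :=
    Finset.prod_eq_one fun t ht => by
      rw [if_neg]
      exact not_le.2 (Finset.mem_range.1 ht)
  rw [this, one_mul]
  exact Finset.prod_congr rfl fun t ht => if_pos (Finset.mem_Ico.1 ht).1

/-- The deviation of the mean outcomes of the epochs. -/
def epochDev (T : ℕ) (q : ℕ → ℝ) (y : ℕ → Bool) : ℝ :=
  ∑ m ∈ Finset.Icc 2 (epoch (T - 1)), exp ((prevBlock m).card *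
    hell (blockMean (prevBlock m) y) (smoothMean (prevBlock m) q))

lemma prevBlock_lt (hT : 2 ≤ T) {m : ℕ} (hm : m ∈ Finset.Icc 2 (epoch (T - 1))) :
    ∀ t ∈ prevBlock m, t < T := by
  intro t ht
  have h1 := (Finset.mem_Ico.1 ht).2
  have h2 := Nat.pow_le_pow_right (by norm_num : 0 < 2) (Finset.mem_Icc.1 hm).2
  have h3 := two_pow_epoch_le (T - 1)
  omega

/-- The previous block of epoch `m` has length `2^(m-1)` and contributes at most `e² 2^m`; the
powers of two up to the last epoch form a geometric sum. -/
lemma expect_epochDev_le (hT : 2 ≤ T) (hq : ∀ t < T, q t ∈ Icc (0 : ℝ) 1) :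
    expect q T (epochDev T q) ≤ exp 2 * (3 * T) := by
  unfold epochDev
  rw [expect_sum]
  have h1 : ∀ m ∈ Finset.Icc 2 (epoch (T - 1)), expect q T (fun y => exp ((prevBlock m).card *
      hell (blockMean (prevBlock m) y) (smoothMean (prevBlock m) q))) ≤ exp 2 * 2 ^ m := by
    intro m hm
    have hm2 := (Finset.mem_Icc.1 hm).1
    have hc := card_prevBlock hm2
    refine (expect_exp_hell_le (prevBlock_lt hT hm) hq (by rw [hc]; positivity)).trans ?_
    rw [hc]
    obtain ⟨k, rfl⟩ := Nat.exists_eq_add_of_le' hm2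
    simp only [show k + 2 - 1 = k + 1 by omega]
    push_cast
    have : (1 : ℝ) ≤ 2 ^ (k + 1) := one_le_pow₀ (by norm_num)
    have e : (2 : ℝ) ^ (k + 2) = 2 * 2 ^ (k + 1) := by ring
    rw [e]
    gcongr
    linarith
  refine (Finset.sum_le_sum h1).trans ?_
  rw [← Finset.mul_sum]
  gcongr
  have h2 : ∑ m ∈ Finset.Icc 2 (epoch (T - 1)), (2 : ℕ) ^ m + 4 ≤ 2 ^ (epoch (T - 1) + 1) := by
    have h3 := Nat.geomSum_eq (le_refl 2) (epoch (T - 1) + 1)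
    simp only [show 2 - 1 = 1 by rfl, Nat.div_one] at h3
    have h5 := one_le_epoch (T - 1)
    have h4 := Finset.sum_range_add_sum_Ico (fun m => (2 : ℕ) ^ m)
      (by omega : 2 ≤ epoch (T - 1) + 1)
    have h6 : ∑ m ∈ Finset.range 2, (2 : ℕ) ^ m = 3 := rfl
    have h7 : Finset.Icc 2 (epoch (T - 1)) = Finset.Ico 2 (epoch (T - 1) + 1) := by
      ext m; simp
    rw [h7]
    have := Nat.one_le_two_pow (n := epoch (T - 1) + 1)
    omega
  have h3 := two_pow_epoch_le (T - 1)
  rw [pow_succ] at h2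
  have : ∑ m ∈ Finset.Icc 2 (epoch (T - 1)), (2 : ℕ) ^ m ≤ 3 * T := by omega
  exact_mod_cast this

end

end
end AdaptiveCalibration

namespace AdaptiveCalibration
noncomputable section
open Real Set MeasureTheory

section
variable {p : Params} {P : ℕ → (ℕ → Bool) → ℝ →₀ ℝ} {q : ℕ → ℝ} {c δ : ℝ}

/-! ### The high-probability events and the final bound. -/

/-- The average is compared with the smoothed mean by concentration, and the smoothed mean with `c`
by the total deviation `C` plus one for smoothing. Both comparisons are in Hellinger distance, which
the factor 2π in `r_m` converts to θ. -/
lemma abs_theta_sub_le_radius (hp : p.Good) (hδ0 : 0 < δ) (hδ1 : δ < 1)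
    (hι : 10 * log (p.T / δ) ≤ p.ι) (hq : ∀ t < p.T, q t ∈ Icc (0 : ℝ) 1) (hc : c ∈ Icc (0 : ℝ) 1)
    (hC : ∑ t ∈ Finset.range p.T, |q t - c| = p.C) {y : ℕ → Bool}
    (hy : epochDev p.T q y / (exp 2 * (3 * p.T)) ≤ 3 / δ) {t : ℕ} (ht : t < p.T) (h2 : 2 ≤ t) :
    |theta (prevMean (epoch t) y) - theta c| ≤ p.radius (epoch t) := by
  set m := epoch t with hm
  have hT := hp.T_pos
  have hm2 : 2 ≤ m := Nat.le_log_of_pow_le one_lt_two (by omega)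
  have hmem : m ∈ Finset.Icc 2 (epoch (p.T - 1)) :=
    Finset.mem_Icc.2 ⟨hm2, Nat.log_mono_right (by omega)⟩
  have hcard := card_prevBlock hm2
  have hlt := prevBlock_lt hp.two_le hmem
  have hqB : ∀ t ∈ prevBlock m, q t ∈ Icc (0 : ℝ) 1 := fun t ht => hq t (hlt t ht)
  have hcs := smoothMean_mem hqB
  set n : ℝ := (2 : ℝ) ^ (m - 1) with hn
  have hn0 : 0 < n := by positivity
  have hcn : ((prevBlock m).card : ℝ) = n := by rw [hcard]; push_cast; rfl
  set z := smoothMean (prevBlock m) q with hz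
  have hdev : exp (n * hell (prevMean m y) z) ≤ 9 * exp 2 * (p.T / δ) := by
    have h1 : exp (n * hell (prevMean m y) z) ≤ epochDev p.T q y := by
      rw [← blockMean_prevBlock hm2, ← hcn]
      exact Finset.single_le_sum (f := fun m => exp ((prevBlock m).card *
        hell (blockMean (prevBlock m) y) (smoothMean (prevBlock m) q)))
        (fun _ _ => (exp_pos _).le) hmem
    rw [div_le_iff₀ (by positivity)] at hy
    refine (h1.trans hy).trans (le_of_eq ?_)
    field_simp
    norm_num
  set ℓ := log (p.T / δ) with hℓ
  have hTδ : 0 < p.T / δ := by positivity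
  have hℓ2 : 0.69 ≤ ℓ := by
    have h1 : (p.T : ℝ) ≤ p.T / δ := by
      rw [le_div_iff₀ hδ0]
      nlinarith
    have := log_le_log hT h1
    have := hp.log_T_ge
    have := log_two_gt_d9
    linarith
  -- `log 9 + 2 ≤ 4.8 ≤ 7ℓ`, because `ℓ ≥ log 2`.
  have hhell : n * hell (prevMean m y) z ≤ 8 * ℓ := by
    have h1 := log_le_log (exp_pos _) hdev
    rw [log_exp, log_mul (by positivity) hTδ.ne', log_mul (by norm_num) (exp_pos _).ne',
      log_exp] at h1
    have h9 : log 9 ≤ 2.8 := by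
      have h3 : log 9 ≤ log (2 ^ 4) := log_le_log (by norm_num) (by norm_num)
      rw [log_pow] at h3
      have := log_two_lt_d9
      push_cast at h3
      linarith
    linarith
  have hsm : n * hell z c ≤ p.C + 1 := by
    have h1 := hell_le_abs ⟨hcs.1.le, hcs.2.le⟩ hc
    have h2 := abs_smoothMean_sub_le hqB (by rw [hcard]; positivity) (c := c) (C := p.C) (by
      rw [← hC]
      exact Finset.sum_le_sum_of_subset_of_nonneg
        (fun t ht => Finset.mem_range.2 (hlt t ht)) fun _ _ _ => abs_nonneg _)
    rw [hcn, le_div_iff₀ hn0] at h2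
    nlinarith
  have e1 := sq_theta_sub_le (prevMean_mem m y) ⟨hcs.1.le, hcs.2.le⟩
  have e2 := sq_theta_sub_le ⟨hcs.1.le, hcs.2.le⟩ hc
  have hpi := pi_pos
  have hsq : (theta (prevMean m y) - theta c) ^ 2 ≤ p.radius m ^ 2 := by
    unfold Params.radius
    rw [mul_pow, mul_pow, sq_sqrt (by have := hp.C_nonneg; have := hp.one_le; positivity),
      ← hn, ← mul_div_assoc, le_div_iff₀ hn0]
    have h3 : (theta (prevMean m y) - theta c) ^ 2 ≤
        2 * (theta (prevMean m y) - theta z) ^ 2 + 2 * (theta z - theta c) ^ 2 := by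
      nlinarith [sq_nonneg ((theta (prevMean m y) - theta z) - (theta z - theta c))]
    calc _ ≤ (2 * (2 * π ^ 2 * hell (prevMean m y) z) + 2 * (2 * π ^ 2 * hell z c)) * n := by
          gcongr
          linarith
      _ = 4 * π ^ 2 * (n * hell (prevMean m y) z + n * hell z c) := by ring
      -- Here `8ℓ + 1 ≤ 10ℓ ≤ ι` is needed, the reason for the constant 10.
      _ ≤ 4 * π ^ 2 * (p.ι + p.C) := mul_le_mul_of_nonneg_left (by linarith) (by positivity)
      _ = _ := by ring
  exact abs_le_of_sq_le_sq hsq (hp.radius_pos m).le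

/-- The clipped mean. -/
def Params.clip (p : Params) (c : ℝ) : ℝ := max p.eta (min c (1 - p.eta))

lemma Params.Good.clip_mem (hp : p.Good) (c : ℝ) : p.clip c ∈ Icc p.eta (1 - p.eta) := by
  have := hp.eta_lt
  exact ⟨le_max_left _ _, max_le (by linarith) (min_le_right _ _)⟩

/-- Over the whole horizon clipping adds at most `T η ≤ 1` to the deviation, and in return the log
loss of the clipped mean is at most `log (T + 1)`. -/
lemma Params.Good.abs_sub_clip_le (hp : p.Good) {c : ℝ} (hc : c ∈ Icc (0 : ℝ) 1) :
    |c - p.clip c| ≤ p.eta := by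
  have h1 := hp.eta_lt
  have h2 := p.eta_pos
  unfold Params.clip
  rw [abs_le]
  rcases le_total c (1 - p.eta) with h | h
  · rw [min_eq_left h]
    rcases le_total p.eta c with h' | h'
    · rw [max_eq_right h']; constructor <;> linarith
    · rw [max_eq_left h']; constructor <;> linarith [hc.1]
  · rw [min_eq_right h, max_eq_right (by linarith)]
    constructor <;> linarith [hc.2]

/-- The actions nearly match the loss of the constant clipped mean, and that constant nearly matches
the loss of the true means. The Hellinger supermartingale turns the small loss excess of the actions
into closeness to the true means, hence to `c`. -/
lemma IsForecaster.sqDist_le (hF : IsForecaster p P) (hp : p.Good) (hδ0 : 0 < δ)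
    (hq : ∀ t < p.T, q t ∈ Icc (0 : ℝ) 1) (hc : c ∈ Icc (0 : ℝ) 1)
    (hC : ∑ t ∈ Finset.range p.T, |q t - c| = p.C) (hδι : log (3 / δ) ≤ p.ι) {y : ℕ → Bool}
    (hA : ∏ t ∈ Finset.range p.T, instFactor p P q t y (y t) ≤ 3 / δ)
    (hB : ∏ t ∈ Finset.range p.T, constFactor (p.clip c) (log (p.T + 1)) q t (y t) ≤ 3 / δ) :
    sqDist p (fun t => P t y) y c ≤ 40 * (p.ι + 17 * log p.T ^ 2 * p.gridBound +
      log p.T * (4 * (1 + p.C) + p.ι) + (1 + p.C)) := by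
  have hr := hF.isRun hp y
  have hT := hp.T_pos
  have h3δ : 0 < 3 / δ := by positivity
  set z := p.clip c with hz
  have hzm := hp.clip_mem c
  have hη := p.eta_pos
  have hz0 : 0 < z := by linarith [hzm.1]
  have hz1 : z < 1 := by linarith [hzm.2]
  set a : ℕ → ℝ → ℝ := fun t s => action (fun τ => P τ y) y t s with ha
  -- the two supermartingales
  have eA : ∑ t ∈ Finset.Ico 2 p.T, ∑ s ∈ gridAt p y t, P t y s *
      ((logLoss (q t) (y t) - logLoss (a t s) (y t)) / 2 + hell (a t s) (q t)) ≤ p.ι := by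
    refine le_trans ?_ hδι
    rw [le_log_iff_exp_le h3δ]
    refine le_trans (le_of_eq ?_) hA
    exact (prod_range_ite_exp p.T hp.two_le _).symm
  have hL2 := hp.log_T_ge
  have hl2 := log_two_gt_d9
  have hΛ : log (p.T + 1) ≤ 2 * log p.T := by
    have h2 : (2 : ℝ) ≤ p.T := by exact_mod_cast hp.two_le
    have h := log_le_log (by linarith) (by nlinarith : (p.T : ℝ) + 1 ≤ p.T ^ 2)
    rw [log_pow] at h
    push_cast at h
    exact h
  have hΛ0 : 0 < log (p.T + 1) := log_pos (by linarith)
  have hdist : ∑ t ∈ Finset.Ico 2 p.T, |q t - z| ≤ p.C + 1 := by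
    calc _ ≤ ∑ t ∈ Finset.range p.T, |q t - z| := by
          refine Finset.sum_le_sum_of_subset_of_nonneg ?_ fun _ _ _ => abs_nonneg _
          rw [Finset.range_eq_Ico]
          exact Finset.Ico_subset_Ico (by norm_num) le_rfl
      _ ≤ ∑ t ∈ Finset.range p.T, (|q t - c| + p.eta) := by
          refine Finset.sum_le_sum fun t _ => ?_
          have := abs_sub_le (q t) c z
          have := hp.abs_sub_clip_le hc
          linarith
      _ = p.C + p.T * p.eta := by
          rw [Finset.sum_add_distrib, hC]
          simp
      _ ≤ _ := by
          have : p.T * p.eta ≤ 1 := by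
            unfold Params.eta
            rw [mul_one_div, div_le_one (by positivity)]
            linarith
          linarith
  -- The event for the tempered likelihood ratio, multiplied back by `Λ = log (T + 1) ≤ 2 log T`.
  have eB : ∑ t ∈ Finset.Ico 2 p.T, (logLoss z (y t) - logLoss (q t) (y t)) ≤
      2 * log p.T * (4 * (1 + p.C) + p.ι) := by
    have h1 : ∑ t ∈ Finset.Ico 2 p.T,
        ((logLoss z (y t) - logLoss (q t) (y t)) / log (p.T + 1) - 4 * |q t - z|) ≤ p.ι := by
      refine le_trans ?_ hδι
      rw [le_log_iff_exp_le h3δ]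
      refine le_trans (le_of_eq ?_) hB
      exact (prod_range_ite_exp p.T hp.two_le _).symm
    rw [Finset.sum_sub_distrib, ← Finset.sum_div, ← Finset.mul_sum, sub_le_iff_le_add,
      div_le_iff₀ hΛ0] at h1
    refine h1.trans ?_
    have hC0 := hp.C_nonneg
    have := hp.one_le
    rw [mul_comm]
    exact mul_le_mul hΛ (by linarith) (add_nonneg (by linarith)
      (mul_nonneg (by norm_num) (Finset.sum_nonneg fun _ _ => abs_nonneg _))) (by linarith)
  -- regret against the clipped mean
  have eR := hr.total_regret_le (ρ := fun _ => z) (fun _ => ⟨hz0.le, hz1.le⟩)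
    (fun _ _ _ _ _ => hz0) (fun _ _ _ _ _ => hz1)
  have hone : ∀ t ∈ Finset.Ico 2 p.T, ∑ s ∈ gridAt p y t, P t y s = 1 := fun t ht =>
    (hr.isDist t (Finset.mem_Ico.1 ht).2).sum_eq_one
      (hr.later t (Finset.mem_Ico.1 ht).2 (Finset.mem_Ico.1 ht).1).1
  have eH : ∑ t ∈ Finset.Ico 2 p.T, ∑ s ∈ gridAt p y t, P t y s * hell (a t s) (q t) ≤
      p.ι + 3 * log p.T * (p.gridBound * (11 * log p.T)) / 2
        + log p.T * (4 * (1 + p.C) + p.ι) := by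
    -- The Hellinger term is isolated by adding and subtracting the losses: supermartingale
    -- exponent, half the regret against the clipped mean, half the excess of the clipped mean over
    -- the true ones.
    have e : ∑ t ∈ Finset.Ico 2 p.T, ∑ s ∈ gridAt p y t, P t y s * hell (a t s) (q t) =
        ∑ t ∈ Finset.Ico 2 p.T, ∑ s ∈ gridAt p y t, P t y s *
          ((logLoss (q t) (y t) - logLoss (a t s) (y t)) / 2 + hell (a t s) (q t)) +
        (∑ t ∈ Finset.Ico 2 p.T, ∑ s ∈ gridAt p y t,
          P t y s * (logLoss (a t s) (y t) - logLoss z (y t))) / 2 +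
        (∑ t ∈ Finset.Ico 2 p.T, (logLoss z (y t) - logLoss (q t) (y t))) / 2 := by
      rw [Finset.sum_div, Finset.sum_div, ← Finset.sum_add_distrib, ← Finset.sum_add_distrib]
      refine Finset.sum_congr rfl fun t ht => ?_
      have e1 : (logLoss z (y t) - logLoss (q t) (y t)) / 2 =
          ∑ s ∈ gridAt p y t, P t y s * ((logLoss z (y t) - logLoss (q t) (y t)) / 2) := by
        rw [← Finset.sum_mul, hone t ht, one_mul]
      rw [e1, Finset.sum_div, ← Finset.sum_add_distrib, ← Finset.sum_add_distrib]
      exact Finset.sum_congr rfl fun s _ => by ring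
    rw [e]
    linarith
  have hpi2 : π ^ 2 ≤ 10 := by
    have := pi_lt_d2
    have := pi_pos
    nlinarith
  have hfin : sqDist p (fun t => P t y) y c ≤ 40 *
      (∑ t ∈ Finset.Ico 2 p.T, ∑ s ∈ gridAt p y t, P t y s * hell (a t s) (q t) + p.C) := by
    calc _ ≤ ∑ t ∈ Finset.Ico 2 p.T,
          40 * (∑ s ∈ gridAt p y t, P t y s * hell (a t s) (q t) + |q t - c|) := by
          refine Finset.sum_le_sum fun t ht => ?_
          have e1 : |q t - c| = ∑ s ∈ gridAt p y t, P t y s * |q t - c| := by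
            rw [← Finset.sum_mul, hone t ht, one_mul]
          rw [e1, ← Finset.sum_add_distrib, Finset.mul_sum]
          refine Finset.sum_le_sum fun s _ => ?_
          have htT := (Finset.mem_Ico.1 ht).2
          have hP := hr.nonneg htT s
          have ham := hr.action_mem htT s
          have hqt := hq t htT
          have h1 := sq_theta_sub_le ⟨ham.1.le, ham.2.le⟩ hqt
          have h2 := sq_theta_sub_le hqt hc
          have h3 := hell_le_abs hqt hc
          have h4 : 0 ≤ hell (a t s) (q t) := by
            rw [hell_eq ⟨ham.1.le, ham.2.le⟩ hqt]; positivity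
          have h5 : 0 ≤ hell (q t) c := by rw [hell_eq hqt hc]; positivity
          -- Triangle inequality through the true mean `q t`; the constant is `4π² ≤ 40`.
          have h6 : (theta (a t s) - theta c) ^ 2 ≤ 40 * (hell (a t s) (q t) + |q t - c|) := by
            calc _ ≤ 2 * (theta (a t s) - theta (q t)) ^ 2 + 2 * (theta (q t) - theta c) ^ 2 := by
                  nlinarith [sq_nonneg ((theta (a t s) - theta (q t)) - (theta (q t) - theta c))]
              _ ≤ 2 * (2 * π ^ 2 * hell (a t s) (q t)) + 2 * (2 * π ^ 2 * hell (q t) c) := by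
                  gcongr
              _ = 4 * π ^ 2 * (hell (a t s) (q t) + hell (q t) c) := by ring
              _ ≤ 4 * 10 * (hell (a t s) (q t) + |q t - c|) := by gcongr
              _ = _ := by ring
          calc _ ≤ P t y s * (40 * (hell (a t s) (q t) + |q t - c|)) := by gcongr
            _ = _ := by ring
      _ ≤ _ := by
          rw [← Finset.mul_sum, Finset.sum_add_distrib]
          gcongr
          rw [← hC]
          refine Finset.sum_le_sum_of_subset_of_nonneg ?_ fun _ _ _ => abs_nonneg _
          rw [Finset.range_eq_Ico]
          exact Finset.Ico_subset_Ico (by norm_num) le_rfl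
  refine hfin.trans ?_
  have hZ := hp.gridBound_nonneg
  have : 0 ≤ log p.T ^ 2 * p.gridBound := by positivity
  linarith

lemma Params.Good.final_le (hp : p.Good) {κ b : ℝ} (hδ0 : 0 < δ)
    (hb : log (1 / δ) ≤ b * log p.T ^ 2) (hι : 10 * log (p.T / δ) ≤ p.ι) (hδ1 : δ < 1)
    (hκ : p.ι ≤ κ * log (p.T / δ)) {V : ℝ}
    (hV : V ≤ 40 * (p.ι + 17 * log p.T ^ 2 * p.gridBound +
      log p.T * (4 * (1 + p.C) + p.ι) + (1 + p.C))) :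
    2 * log (p.T + 1) + 33 * log p.T ^ 2 * p.gridBound +
      66 * log p.T * p.innerRate * p.ι + 2 / (p.outerCount : ℝ) ^ 2 * V ≤
    (15000 + 66 * (|κ| * (2 + |b|) + 1) ^ 2) *
      (p.ι * log p.T ^ 2 + (1 + p.C) ^ (1 / 3 : ℝ) * log p.T ^ (7 / 3 : ℝ)) := by
  have hT := hp.T_pos
  have hC := hp.C_nonneg
  have hι1 := hp.one_le
  have hL2 := hp.log_T_ge
  have hl2 := log_two_gt_d9
  set L := log p.T with hLdef
  have hL0 : 0 < L := by linarith
  set l := L ^ (1 / 3 : ℝ) with hl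
  set x := (1 + p.C) ^ (1 / 3 : ℝ) with hx
  set j := p.ι ^ (1 / 3 : ℝ) with hj
  have hl0 : 0 < l := by positivity
  have hx0 : 0 < x := by positivity
  have hj0 : 0 < j := by positivity
  have el : l ^ 3 = L := rpow_third_cube hL0.le
  have ex : x ^ 3 = 1 + p.C := rpow_third_cube (by linarith)
  have ej : j ^ 3 = p.ι := rpow_third_cube (by linarith)
  have el7 : L ^ (7 / 3 : ℝ) = l ^ 7 := by
    rw [hl, ← rpow_natCast, ← rpow_mul hL0.le]
    norm_num
  have cube_le : ∀ u v : ℝ, 0 ≤ v → u ^ 3 ≤ v ^ 3 → u ≤ v := fun u v hv h =>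
    le_of_pow_le_pow_left₀ (by norm_num) hv h
  have hℓ : log (p.T / δ) = L + log (1 / δ) := by
    rw [div_eq_mul_one_div, log_mul hT.ne' (by positivity)]
  have hδlog : 0 ≤ log (1 / δ) := log_nonneg (by rw [le_div_iff₀ hδ0]; linarith)
  have hιL : L ≤ p.ι := by linarith
  have hΛ : log (p.T + 1) ≤ 2 * L := by
    have h2 : (2 : ℝ) ≤ p.T := by exact_mod_cast hp.two_le
    have h := log_le_log (by linarith) (by nlinarith : (p.T : ℝ) + 1 ≤ p.T ^ 2)
    rw [log_pow] at h
    push_cast at h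
    exact h
  -- Since `log T ≤ 2 log² T`, the upper bound for `ι` is at most `|κ| (2 + |b|) log² T`. Adding one
  -- ensures `M ≤ M³`, so that `j ≤ M l²` follows on cubing.
  set M := |κ| * (2 + |b|) + 1 with hM
  have hM1 : 1 ≤ M := by rw [hM]; have : 0 ≤ |κ| * (2 + |b|) := by positivity
                         linarith
  have hK : ((1 + p.C) / L ^ 2) ^ (1 / 3 : ℝ) * l ^ 2 = x := by
    have e : ((1 + p.C) / L ^ 2) ^ (1 / 3 : ℝ) = x / l ^ 2 := by
      rw [div_rpow (by linarith) (by positivity), hx, hl]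
      congr 1
      rw [← rpow_natCast, ← rpow_natCast, ← rpow_mul hL0.le, ← rpow_mul hL0.le, mul_comm]
    rw [e]
    field_simp
  have key := calibration_arith (L := L) (ι := p.ι) (W := 1 + p.C) (K := p.outerCount)
    (R := p.innerRate) (M := M) (l := l) (x := x) (j := j) (V := V) ?_ el.symm ej.symm ?_ hι1
    ex.symm ?_ ?_ (by exact_mod_cast p.two_le_outerCount) ?_ ?_ hp.innerRate_nonneg ?_ ?_
  · rw [el7]
    unfold Params.gridBound
    linarith
  · apply cube_le _ _ hl0.le
    rw [el]
    norm_num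
    linarith
  · apply cube_le _ _ hj0.le
    rwa [el, ej]
  · apply cube_le _ _ hx0.le
    rw [ex]
    linarith
  · apply cube_le _ _ (by positivity)
    rw [mul_pow, ej, ← pow_mul, mul_comm 2 3, pow_mul, el]
    calc p.ι ≤ κ * log (p.T / δ) := hκ
      _ ≤ |κ| * (L + log (1 / δ)) := by
          rw [hℓ]
          gcongr
          exact le_abs_self κ
      _ ≤ |κ| * (2 * L ^ 2 + |b| * L ^ 2) := by
          gcongr
          · nlinarith
          · exact hb.trans (by gcongr; exact le_abs_self b)
      _ = |κ| * (2 + |b|) * L ^ 2 := by ring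
      _ ≤ M ^ 3 * L ^ 2 := by
          gcongr
          have : M ≤ M ^ 3 := le_self_pow₀ hM1 (by norm_num)
          linarith
  · rw [← hK]
    gcongr
    exact p.le_outerCount
  · have := mul_le_mul_of_nonneg_right hp.outerCount_le (by positivity : 0 ≤ l ^ 2)
    rw [add_mul, hK] at this
    exact this
  · apply cube_le _ _ (by positivity)
    rw [mul_pow, hp.innerRate_cube, ej]
    have e : (1 + p.C / p.ι) * p.ι = p.ι + p.C := by field_simp
    rw [e, ← ej]
    have : j ^ 3 + x ^ 3 ≤ (j + x) ^ 3 := by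
      have h1 : 0 ≤ j ^ 2 * x := by positivity
      have h2 : 0 ≤ j * x ^ 2 := by positivity
      nlinarith
    linarith
  · unfold Params.gridBound at hV
    exact hV

end

/-- The calibration part of the theorem. -/
theorem calibration {κ b : ℝ} {T : ℕ} {δ ι : ℝ} {q : ℕ → ℝ} (hT : 2 ≤ T) (hδ0 : 0 < δ)
    (hδ1 : δ < 1) (hb : log (1 / δ) ≤ b * log T ^ 2) (hι : 10 * log (T / δ) ≤ ι)
    (hκ : ι ≤ κ * log (T / δ)) (hq : ∀ t < T, q t ∈ Icc (0 : ℝ) 1)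
    {P : ℕ → (ℕ → Bool) → ℝ →₀ ℝ} (hF : IsForecaster ⟨T, nonStationarity T q, ι⟩ P)
    {Ω : Type*} [MeasurableSpace Ω] {μ : Measure Ω} [IsProbabilityMeasure μ] {Y : ℕ → Ω → Bool}
    (hY : ∀ t < T, Measurable (Y t))
    (hind : ProbabilityTheory.iIndepFun (fun t : Fin T => Y t) μ)
    (hlaw : ∀ t < T, μ.real {ω | Y t ω = true} = q t) :
    1 - δ ≤ μ.real {ω | pseudoKL T (fun t => P t fun i => Y i ω) (fun i => Y i ω) ≤
      (15000 + 66 * (|κ| * (2 + |b|) + 1) ^ 2) * (ι * log T ^ 2 +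
        (1 + nonStationarity T q) ^ (1 / 3 : ℝ) * log T ^ (7 / 3 : ℝ))} := by
  obtain ⟨c, hc, hC⟩ := exists_nonStationarity T q
  set p : Params := ⟨T, nonStationarity T q, ι⟩ with hpdef
  have hT2 : (2 : ℝ) ≤ T := by exact_mod_cast hT
  have hL2 : log 2 ≤ log T := log_le_log (by norm_num) hT2
  have hl2 := log_two_gt_d9
  have hℓ : log (T / δ) = log T + log (1 / δ) := by
    rw [div_eq_mul_one_div, log_mul (by linarith) (by positivity)]
  have hδlog : 0 ≤ log (1 / δ) := log_nonneg (by rw [le_div_iff₀ hδ0]; linarith)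
  have hp : p.Good := ⟨hT, by
    change 0 ≤ nonStationarity T q
    rw [← hC]
    exact Finset.sum_nonneg fun _ _ => abs_nonneg _, by
    change 1 ≤ ι
    linarith⟩
  have hδι : log (3 / δ) ≤ ι := by
    have h1 : log (3 / δ) = log 3 + log (1 / δ) := by
      rw [div_eq_mul_one_div, log_mul (by norm_num) (by positivity)]
    have h2 : log 3 ≤ log (2 ^ 2) := log_le_log (by norm_num) (by norm_num)
    rw [log_pow] at h2
    push_cast at h2
    linarith
  have hz := hp.clip_mem c
  have hη := p.eta_pos
  have hΛ1 : 1 ≤ log ((T : ℝ) + 1) := by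
    rw [le_log_iff_exp_le (by linarith)]
    have := exp_one_lt_d9
    linarith
  have hlogη : -log p.eta = log ((T : ℝ) + 1) := by
    unfold Params.eta
    rw [one_div, log_inv, neg_neg]
  have hEB := expect_const_factor_le (T := T) (q := q) (c := p.clip c) (Λ := log ((T : ℝ) + 1)) hq
    ⟨by linarith [hz.1], by linarith [hz.2]⟩ hΛ1
    (by rw [← hlogη]; exact neg_le_neg (log_le_log hη hz.1))
    (by rw [← hlogη]; exact neg_le_neg (log_le_log hη (by linarith [hz.2])))
  have hEA := hF.expect_inst_le hp hq
  have hEC := expect_epochDev_le hT hq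
  set FA : (ℕ → Bool) → ℝ := fun y => ∏ t ∈ Finset.range T, instFactor p P q t y (y t) with hFA
  set FB : (ℕ → Bool) → ℝ := fun y =>
    ∏ t ∈ Finset.range T, constFactor (p.clip c) (log (T + 1)) q t (y t) with hFB
  set e3 : ℝ := exp 2 * (3 * T) with he3
  have he3p : 0 < e3 := by positivity
  have hA0 : ∀ y, 0 ≤ FA y := fun y => Finset.prod_nonneg fun t _ => by
    unfold instFactor
    split_ifs
    · exact (exp_pos _).le
    · exact zero_le_one
  have hB0 : ∀ y, 0 ≤ FB y := fun y => Finset.prod_nonneg fun t _ => by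
    unfold constFactor
    split_ifs
    · exact (exp_pos _).le
    · exact zero_le_one
  have hC0 : ∀ y, 0 ≤ e3⁻¹ * epochDev T q y := fun y =>
    mul_nonneg (inv_nonneg.2 he3p.le) (Finset.sum_nonneg fun _ _ => (exp_pos _).le)
  -- Three nonnegative statistics of mean at most one are added, so a single Markov bound at level
  -- `3/δ` controls all of them.
  refine prob_ge_of_expect_le (good := fun y => pseudoKL T (fun t => P t y) y ≤
      (15000 + 66 * (|κ| * (2 + |b|) + 1) ^ 2) * (ι * log T ^ 2 +
        (1 + nonStationarity T q) ^ (1 / 3 : ℝ) * log T ^ (7 / 3 : ℝ)))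
    (F := fun y => FA y + (FB y + e3⁻¹ * epochDev T q y)) (a := 3) hY hind hlaw ?_
    (fun y => add_nonneg (hA0 y) (add_nonneg (hB0 y) (hC0 y))) (by norm_num) hδ0 ?_ ?_
  · intro y y' hyy
    have e : pseudoKL T (fun t => P t y) y = pseudoKL T (fun t => P t y') y' :=
      pseudoKL_congr (fun t ht => hF.nonanticipating t ht y y' fun i hi => hyy i (hi.trans ht)) hyy
    rw [e]
  · rw [expect_add, expect_add, expect_const_mul]
    have : e3⁻¹ * expect q T (epochDev T q) ≤ 1 := by
      rw [inv_mul_le_iff₀ he3p, mul_one]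
      exact hEC
    linarith
  · intro y hy
    have hy' : FA y + (FB y + e3⁻¹ * epochDev T q y) ≤ 3 / δ := hy
    have h1 : FA y ≤ 3 / δ := by linarith [hA0 y, hB0 y, hC0 y]
    have h2 : FB y ≤ 3 / δ := by linarith [hA0 y, hB0 y, hC0 y]
    have h3 : epochDev p.T q y / (exp 2 * (3 * p.T)) ≤ 3 / δ := by
      rw [div_eq_inv_mul]
      change e3⁻¹ * epochDev T q y ≤ 3 / δ
      linarith [hA0 y, hB0 y, hC0 y]
    have hS := hF.sqDist_le hp hδ0 hq hc hC hδι h1 h2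
    refine ((hF.isRun hp y).pseudoKL_le fun t ht ht2 =>
      abs_theta_sub_le_radius hp hδ0 hδ1 hι hq hc hC h3 ht ht2).trans ?_
    exact hp.final_le hδ0 hb hι hδ1 hκ hS

end
end AdaptiveCalibration

namespace AdaptiveCalibration
noncomputable section
open Real Set

/-! ### Conjugate gradients for a stationary vector -/

/-- The inner product of the first `M` coordinates. -/
def dot (M : ℕ) (x y : ℕ → ℝ) : ℝ := ∑ i ∈ Finset.range M, x i * y i

section dot
variable {M : ℕ} (x y z : ℕ → ℝ) (c : ℝ)

lemma dot_comm : dot M x y = dot M y x := Finset.sum_congr rfl fun _ _ => mul_comm _ _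

lemma dot_add_left : dot M (x + y) z = dot M x z + dot M y z := by
  unfold dot
  rw [← Finset.sum_add_distrib]
  exact Finset.sum_congr rfl fun i _ => by simp only [Pi.add_apply]; ring

lemma dot_smul_left : dot M (c • x) z = c * dot M x z := by
  unfold dot
  rw [Finset.mul_sum]
  exact Finset.sum_congr rfl fun i _ => by simp only [Pi.smul_apply, smul_eq_mul]; ring

lemma dot_sub_left : dot M (x - y) z = dot M x z - dot M y z := by
  unfold dot
  rw [← Finset.sum_sub_distrib]
  exact Finset.sum_congr rfl fun i _ => by simp only [Pi.sub_apply]; ring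

lemma dot_add_right : dot M z (x + y) = dot M z x + dot M z y := by
  rw [dot_comm, dot_add_left, dot_comm x, dot_comm y]

lemma dot_smul_right : dot M z (c • x) = c * dot M z x := by
  rw [dot_comm, dot_smul_left, dot_comm x]

lemma dot_self_eq_zero : dot M x x = 0 ↔ ∀ i < M, x i = 0 := by
  unfold dot
  rw [Finset.sum_eq_zero_iff_of_nonneg fun _ _ => mul_self_nonneg _]
  simp

end dot

/-- Orthogonal vectors cannot outnumber the coordinates. -/
lemma exists_dot_self_eq_zero {M : ℕ} (s : ℕ → ℕ → ℝ)
    (h : ∀ i ≤ M, ∀ j < i, dot M (s i) (s j) = 0) : ∃ k ≤ M, dot M (s k) (s k) = 0 := by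
  by_contra! hne
  let v : Fin (M + 1) → Fin M → ℝ := fun k i => s k i
  have hdot : ∀ k l : Fin (M + 1), ∑ i, v k i * v l i = dot M (s k) (s l) := fun k l =>
    Fin.sum_univ_eq_sum_range (fun i => s k i * s l i) M
  have hli : LinearIndependent ℝ v := by
    rw [Fintype.linearIndependent_iff]
    intro g hg k
    have h0 : ∑ i, (∑ l, g l • v l) i * v k i = 0 := by rw [hg]; simp
    have h1 : ∑ i, (∑ l, g l • v l) i * v k i = ∑ l, g l * dot M (s l) (s k) := by
      simp_rw [Finset.sum_apply, Finset.sum_mul]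
      rw [Finset.sum_comm]
      refine Finset.sum_congr rfl fun l _ => ?_
      rw [← hdot, Finset.mul_sum]
      exact Finset.sum_congr rfl fun i _ => by simp only [Pi.smul_apply, smul_eq_mul]; ring
    rw [h1, Finset.sum_eq_single k] at h0
    · exact (mul_eq_zero.1 h0).resolve_right (hne k (Nat.lt_succ_iff.1 k.2))
    · intro l _ hlk
      have : dot M (s l) (s k) = 0 := by
        rcases lt_or_gt_of_ne (Fin.val_ne_of_ne hlk) with hlt | hlt
        · rw [dot_comm]
          exact h k (Nat.lt_succ_iff.1 k.2) l hlt
        · exact h l (Nat.lt_succ_iff.1 l.2) k hlt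
      rw [this, mul_zero]
    · simp
  have := hli.fintype_card_le_finrank
  simp at this

section cg
variable (M : ℕ) (f fT : (ℕ → ℝ) →ₗ[ℝ] (ℕ → ℝ))

/-- Conjugate gradients for the least-squares problem `f x ≈ 1`: residual and direction. -/
def cg : ℕ → (ℕ → ℝ) × (ℕ → ℝ)
  | 0 => (1, fT 1)
  | k + 1 =>
    let r := (cg k).1
    let d := (cg k).2
    let r' := r - (dot M (fT r) (fT r) / dot M (f d) (f d)) • f d
    (r', fT r' + (dot M (fT r') (fT r') / dot M (fT r) (fT r)) • d)

/-- The squared norm of the gradient. -/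
def cgGrad (k : ℕ) : ℝ := dot M (fT (cg M f fT k).1) (fT (cg M f fT k).1)

variable {M f fT}

lemma cg_fst_succ (k : ℕ) : (cg M f fT (k + 1)).1 = (cg M f fT k).1 -
    (cgGrad M f fT k / dot M (f (cg M f fT k).2) (f (cg M f fT k).2)) • f (cg M f fT k).2 := rfl

lemma cg_snd_succ (k : ℕ) : (cg M f fT (k + 1)).2 = fT (cg M f fT (k + 1)).1 +
    (cgGrad M f fT (k + 1) / cgGrad M f fT k) • (cg M f fT k).2 := rfl

/-- Residuals differ from the right-hand side 1 by an element of the range of `f`; this later shows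
that the final residual is nonzero. -/
lemma cg_residual_mem (k : ℕ) : ∃ x, (1 : ℕ → ℝ) - (cg M f fT k).1 = f x := by
  induction k with
  | zero => exact ⟨0, by simp [cg]⟩
  | succ k ih =>
    obtain ⟨x, hx⟩ := ih
    refine ⟨x + (cgGrad M f fT k / dot M (f (cg M f fT k).2) (f (cg M f fT k).2)) •
      (cg M f fT k).2, ?_⟩
    rw [map_add, map_smul, ← hx, cg_fst_succ]
    abel

lemma cgGrad_nonneg (k : ℕ) : 0 ≤ cgGrad M f fT k := by
  unfold cgGrad dot
  exact Finset.sum_nonneg fun _ _ => mul_self_nonneg _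

/-- A vanishing gradient makes the step length zero, whatever the denominator, so the iteration may
be run for a fixed number of steps. -/
lemma cgGrad_succ_eq_zero {k : ℕ} (h : cgGrad M f fT k = 0) : cgGrad M f fT (k + 1) = 0 := by
  have e : (cg M f fT (k + 1)).1 = (cg M f fT k).1 := by
    rw [cg_fst_succ, h, zero_div, zero_smul, sub_zero]
  unfold cgGrad
  rw [e]
  exact h

lemma cg_snd_eq_zero {k : ℕ} (h : cgGrad M f fT k = 0) : ∀ i < M, (cg M f fT k).2 i = 0 := by
  have hg := (dot_self_eq_zero _).1 h
  rcases k with _ | k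
  · exact hg
  · intro i hi
    rw [cg_snd_succ, h, zero_div, zero_smul, add_zero]
    exact hg i hi

/-- The classical invariants, by strong induction: gradients are orthogonal to earlier directions,
and the images of the directions are orthogonal. Nonzero gradients are assumed because the step
lengths divide by them and by `|f d|²`. -/
lemma cg_orthogonal (hadj : ∀ x y, dot M (f x) y = dot M x (fT y)) (k : ℕ)
    (hne : ∀ i ≤ k, cgGrad M f fT i ≠ 0) :
    dot M (fT (cg M f fT k).1) (cg M f fT k).2 = cgGrad M f fT k ∧
    (∀ i < k, dot M (fT (cg M f fT k).1) (cg M f fT i).2 = 0) ∧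
    (∀ i < k, dot M (f (cg M f fT k).2) (f (cg M f fT i).2) = 0) := by
  -- If `f d` vanished, adjointness would give `⟨fT r, d⟩ = ⟨r, f d⟩ = 0`, although this product is
  -- the squared gradient.
  have hnorm : ∀ k, cgGrad M f fT k ≠ 0 →
      dot M (fT (cg M f fT k).1) (cg M f fT k).2 = cgGrad M f fT k →
      dot M (f (cg M f fT k).2) (f (cg M f fT k).2) ≠ 0 := by
    intro k hk h hz
    rw [dot_comm, ← hadj] at h
    rw [dot_self_eq_zero] at hz
    apply hk
    rw [← h]
    exact Finset.sum_eq_zero fun i hi => by rw [hz i (Finset.mem_range.1 hi), zero_mul]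
  induction k using Nat.strong_induction_on with
  | _ k ih =>
    rcases k with _ | k
    · exact ⟨rfl, by simp, by simp⟩
    have ihk := ih k (by omega) (fun i hi => hne i (by omega))
    obtain ⟨h1, h2, h3⟩ := ihk
    have hq := hnorm k (hne k (by omega)) h1
    have hs : fT (cg M f fT (k + 1)).1 = fT (cg M f fT k).1 -
        (cgGrad M f fT k / dot M (f (cg M f fT k).2) (f (cg M f fT k).2)) •
          fT (f (cg M f fT k).2) := by
      rw [cg_fst_succ, map_sub, map_smul]
    have hsp : ∀ i ≤ k, dot M (fT (cg M f fT (k + 1)).1) (cg M f fT i).2 = 0 := by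
      intro i hi
      have e : dot M (fT (f (cg M f fT k).2)) (cg M f fT i).2 =
          dot M (f (cg M f fT k).2) (f (cg M f fT i).2) := by
        rw [dot_comm, ← hadj, dot_comm]
      rw [hs, dot_sub_left, dot_smul_left, e]
      rcases hi.eq_or_lt with rfl | hi
      · rw [h1, div_mul_cancel₀ _ hq, sub_self]
      · rw [h2 i hi, h3 i hi, mul_zero, sub_zero]
    have hg : dot M (fT (cg M f fT (k + 1)).1) (cg M f fT (k + 1)).2 = cgGrad M f fT (k + 1) := by
      rw [cg_snd_succ, dot_add_right, dot_smul_right, hsp k le_rfl, mul_zero, add_zero]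
      rfl
    -- orthogonality to the earlier gradients
    have hss : ∀ i ≤ k, dot M (fT (cg M f fT (k + 1)).1) (fT (cg M f fT i).1) = 0 := by
      intro i hi
      rcases i with _ | i
      · exact hsp 0 (by omega)
      · have e : fT (cg M f fT (i + 1)).1 = (cg M f fT (i + 1)).2 -
            (cgGrad M f fT (i + 1) / cgGrad M f fT i) • (cg M f fT i).2 := by
          rw [cg_snd_succ]
          abel
        rw [e, dot_comm, dot_sub_left, dot_smul_left, dot_comm, hsp (i + 1) hi, dot_comm,
          hsp i (by omega), mul_zero, sub_zero]
    refine ⟨hg, fun i hi => hsp i (by omega), fun i hi => ?_⟩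
    have hik : i ≤ k := by omega
    have hqi : dot M (f (cg M f fT i).2) (f (cg M f fT i).2) ≠ 0 :=
      hnorm i (hne i (by omega)) (ih i (by omega) fun l hl => hne l (by omega)).1
    have hgi := hne i (by omega)
    set a := cgGrad M f fT i / dot M (f (cg M f fT i).2) (f (cg M f fT i).2) with ha
    have ha0 : a ≠ 0 := div_ne_zero hgi hqi
    -- `fT (f d_i)` is a multiple of the difference of two consecutive gradients, so the products
    -- with it reduce to products of gradients.
    have hsi : fT (cg M f fT (i + 1)).1 = fT (cg M f fT i).1 - a • fT (f (cg M f fT i).2) := by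
      rw [cg_fst_succ, map_sub, map_smul]
    have e1 : dot M (f (fT (cg M f fT (k + 1)).1)) (f (cg M f fT i).2) =
        dot M (fT (cg M f fT (k + 1)).1) (fT (f (cg M f fT i).2)) := hadj _ _
    have e2 : a * dot M (fT (cg M f fT (k + 1)).1) (fT (f (cg M f fT i).2)) =
        - dot M (fT (cg M f fT (k + 1)).1) (fT (cg M f fT (i + 1)).1) := by
      rw [← dot_smul_right]
      have : a • fT (f (cg M f fT i).2) = fT (cg M f fT i).1 - fT (cg M f fT (i + 1)).1 := by
        rw [hsi]; abel
      rw [this, dot_comm, dot_sub_left, dot_comm, hss i hik, zero_sub, dot_comm]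
    rw [cg_snd_succ, map_add, map_smul, dot_add_left, dot_smul_left, e1]
    -- For the last direction the coefficient in the update cancels exactly; for earlier ones every
    -- term is already zero.
    rcases hik.eq_or_lt with rfl | hlt
    · have e3 : dot M (fT (cg M f fT (i + 1)).1) (fT (f (cg M f fT i).2)) =
          - cgGrad M f fT (i + 1) / a := by
        rw [eq_div_iff ha0, mul_comm]
        exact e2
      rw [e3, ha]
      field_simp
      ring
    · rw [hss (i + 1) hlt, neg_zero] at e2
      rw [(mul_eq_zero.1 e2).resolve_left ha0, h3 i hlt, mul_zero, add_zero]

/-- The gradients are pairwise orthogonal as long as none vanishes, so in dimension `M` one of the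
first `M + 1` is zero, and then all later ones are. -/
lemma cgGrad_eq_zero (hadj : ∀ x y, dot M (f x) y = dot M x (fT y)) : cgGrad M f fT M = 0 := by
  have hex : ∃ k ≤ M, cgGrad M f fT k = 0 := by
    by_contra! hne
    obtain ⟨k, hk, h0⟩ := exists_dot_self_eq_zero (M := M) (fun k => fT (cg M f fT k).1) (by
      intro i hi l hl
      have H := cg_orthogonal hadj i (fun m hm => hne m (by omega))
      rcases l with _ | l
      · exact H.2.1 0 hl
      · have e : fT (cg M f fT (l + 1)).1 = (cg M f fT (l + 1)).2 -
            (cgGrad M f fT (l + 1) / cgGrad M f fT l) • (cg M f fT l).2 := by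
          rw [cg_snd_succ]
          abel
        rw [e, dot_comm, dot_sub_left, dot_smul_left, dot_comm, H.2.1 (l + 1) hl, dot_comm,
          H.2.1 l (by omega), mul_zero, sub_zero])
    exact hne k hk h0
  obtain ⟨k, hk, h0⟩ := hex
  have hmono : ∀ n, k ≤ n → cgGrad M f fT n = 0 := fun n hn =>
    Nat.le_induction h0 (fun n _ ih => cgGrad_succ_eq_zero ih) n hn
  exact hmono M hk

end cg

/-! ### Chains whose rows have two adjacent points -/

section chain
variable (M : ℕ) (j : ℕ → ℕ) (α : ℕ → ℝ)

/-- The transition probability from `i` to `z` if row `i` charges `j i` and `j i + 1`. -/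
def trans (i z : ℕ) : ℝ := (if z = j i then α i else 0) + if z = j i + 1 then 1 - α i else 0

/-- Identity minus transition operator. -/
def lap : (ℕ → ℝ) →ₗ[ℝ] (ℕ → ℝ) where
  toFun x i := x i - (α i * x (j i) + (1 - α i) * x (j i + 1))
  map_add' x y := by funext i; simp only [Pi.add_apply]; ring
  map_smul' c x := by
    funext i
    simp only [Pi.smul_apply, smul_eq_mul, RingHom.id_apply]
    ring

/-- The adjoint of `lap`. -/
def lapT : (ℕ → ℝ) →ₗ[ℝ] (ℕ → ℝ) where
  toFun x z := x z - ∑ i ∈ Finset.range M, x i * trans j α i z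
  map_add' x y := by
    funext z
    simp only [Pi.add_apply, add_mul, Finset.sum_add_distrib]
    ring
  map_smul' c x := by
    funext z
    simp only [Pi.smul_apply, smul_eq_mul, RingHom.id_apply, mul_sub, Finset.mul_sum, mul_assoc]

lemma lap_apply (x : ℕ → ℝ) (i : ℕ) :
    lap j α x i = x i - (α i * x (j i) + (1 - α i) * x (j i + 1)) := rfl

lemma lapT_apply (x : ℕ → ℝ) (z : ℕ) :
    lapT M j α x z = x z - ∑ i ∈ Finset.range M, x i * trans j α i z := rfl

variable {M j α}

lemma sum_trans_mul {i : ℕ} (hj : j i + 1 < M) (x : ℕ → ℝ) :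
    ∑ z ∈ Finset.range M, trans j α i z * x z = α i * x (j i) + (1 - α i) * x (j i + 1) := by
  unfold trans
  simp only [add_mul, Finset.sum_add_distrib, ite_mul, zero_mul, Finset.sum_ite_eq',
    Finset.mem_range]
  rw [if_pos (by omega), if_pos hj]

/-- The condition on `j` keeps both targets of each row among the first `M` coordinates, so
truncating the inner product loses nothing. -/
lemma dot_lap (hj : ∀ i < M, j i + 1 < M) (x y : ℕ → ℝ) :
    dot M (lap j α x) y = dot M x (lapT M j α y) := by
  have h1 : dot M (lap j α x) y = ∑ i ∈ Finset.range M, x i * y i -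
      ∑ i ∈ Finset.range M, (∑ z ∈ Finset.range M, trans j α i z * x z) * y i := by
    unfold dot
    rw [← Finset.sum_sub_distrib]
    refine Finset.sum_congr rfl fun i hi => ?_
    rw [sum_trans_mul (hj i (Finset.mem_range.1 hi)), lap_apply, sub_mul]
  have h2 : dot M x (lapT M j α y) = ∑ i ∈ Finset.range M, x i * y i -
      ∑ z ∈ Finset.range M, x z * ∑ i ∈ Finset.range M, y i * trans j α i z := by
    unfold dot
    rw [← Finset.sum_sub_distrib]
    exact Finset.sum_congr rfl fun z _ => by rw [lapT_apply, mul_sub]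
  rw [h1, h2]
  congr 1
  simp_rw [Finset.mul_sum, Finset.sum_mul]
  rw [Finset.sum_comm]
  exact Finset.sum_congr rfl fun z _ => Finset.sum_congr rfl fun i _ => by ring

variable (M j α)

/-- The vector computed by conjugate gradients. -/
def statVec : ℕ → ℝ := (cg M (lap j α) (lapT M j α) M).1

/-- The stationary distribution computed from it. -/
def statDist (z : ℕ) : ℝ := |statVec M j α z| / ∑ i ∈ Finset.range M, |statVec M j α i|

variable {M j α}

lemma lapT_statVec (hj : ∀ i < M, j i + 1 < M) : ∀ z < M, lapT M j α (statVec M j α) z = 0 :=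
  (dot_self_eq_zero _).1 (cgGrad_eq_zero (dot_lap hj))

/-- A zero residual would mean `x - Qx = 1` on the chain. Where `x` is minimal the left side is at
most zero. -/
lemma exists_statVec_ne_zero (hM : 0 < M) (hj : ∀ i < M, j i + 1 < M)
    (hα : ∀ i < M, α i ∈ Icc (0 : ℝ) 1) : ∃ z < M, statVec M j α z ≠ 0 := by
  by_contra! h
  obtain ⟨x, hx⟩ := cg_residual_mem (M := M) (f := lap j α) (fT := lapT M j α) M
  obtain ⟨i, hi, hmin⟩ := Finset.exists_min_image (Finset.range M) x ⟨0, Finset.mem_range.2 hM⟩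
  have hi := Finset.mem_range.1 hi
  have h1 := congrFun hx i
  have h2 := h i hi
  unfold statVec at h2
  rw [Pi.sub_apply, h2, lap_apply, Pi.one_apply] at h1
  have h3 := hmin (j i) (Finset.mem_range.2 (by have := hj i hi; omega))
  have h4 := hmin (j i + 1) (Finset.mem_range.2 (hj i hi))
  have h5 := mul_le_mul_of_nonneg_left h3 (hα i hi).1
  have h6 := mul_le_mul_of_nonneg_left h4 (sub_nonneg.2 (hα i hi).2)
  linarith

lemma trans_nonneg {i : ℕ} (hα : α i ∈ Icc (0 : ℝ) 1) (z : ℕ) : 0 ≤ trans j α i z := by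
  unfold trans
  refine add_nonneg ?_ ?_ <;> split_ifs <;> linarith [hα.1, hα.2]

lemma sum_abs_statVec_pos (hM : 0 < M) (hj : ∀ i < M, j i + 1 < M)
    (hα : ∀ i < M, α i ∈ Icc (0 : ℝ) 1) : 0 < ∑ i ∈ Finset.range M, |statVec M j α i| := by
  obtain ⟨z, hz, h⟩ := exists_statVec_ne_zero hM hj hα
  exact Finset.sum_pos' (fun _ _ => abs_nonneg _) ⟨z, Finset.mem_range.2 hz, abs_pos.2 h⟩

lemma statDist_nonneg (z : ℕ) : 0 ≤ statDist M j α z :=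
  div_nonneg (abs_nonneg _) (Finset.sum_nonneg fun _ _ => abs_nonneg _)

lemma sum_statDist (hM : 0 < M) (hj : ∀ i < M, j i + 1 < M)
    (hα : ∀ i < M, α i ∈ Icc (0 : ℝ) 1) : ∑ z ∈ Finset.range M, statDist M j α z = 1 := by
  unfold statDist
  rw [← Finset.sum_div]
  exact div_self (sum_abs_statVec_pos hM hj hα).ne'

/-- The residual `r` is an invariant vector, possibly of mixed sign. Then `|r| ≤ |r| Q` entrywise,
and both sides have the same sum because the rows of `Q` sum to one; so equality holds. -/
lemma statDist_stationary (hj : ∀ i < M, j i + 1 < M)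
    (hα : ∀ i < M, α i ∈ Icc (0 : ℝ) 1) {z : ℕ} (hz : z < M) :
    ∑ i ∈ Finset.range M, statDist M j α i * trans j α i z = statDist M j α z := by
  set r := statVec M j α with hr
  have hle : ∀ z ∈ Finset.range M, |r z| ≤ ∑ i ∈ Finset.range M, |r i| * trans j α i z := by
    intro z hz
    have h := lapT_statVec (α := α) hj z (Finset.mem_range.1 hz)
    rw [lapT_apply, sub_eq_zero] at h
    rw [hr, h]
    refine (Finset.abs_sum_le_sum_abs _ _).trans (le_of_eq ?_)
    refine Finset.sum_congr rfl fun i hi => ?_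
    rw [abs_mul, abs_of_nonneg (trans_nonneg (hα i (Finset.mem_range.1 hi)) z)]
  have hsum : ∑ z ∈ Finset.range M, |r z| =
      ∑ z ∈ Finset.range M, ∑ i ∈ Finset.range M, |r i| * trans j α i z := by
    rw [Finset.sum_comm]
    refine Finset.sum_congr rfl fun i hi => ?_
    rw [← Finset.mul_sum]
    have := sum_trans_mul (α := α) (hj i (Finset.mem_range.1 hi)) fun _ => 1
    simp only [mul_one] at this
    rw [this]
    ring
  have heq := (Finset.sum_eq_sum_iff_of_le hle).1 hsum z (Finset.mem_range.2 hz)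
  unfold statDist
  rw [← hr, heq, Finset.sum_div]
  exact Finset.sum_congr rfl fun i _ => by ring

end chain

end
end AdaptiveCalibration

namespace AdaptiveCalibration
noncomputable section
open Real Set

/-! ### The nodes of the partition in increasing order -/

/-- A list of nodes `h 0, …, h n`, recorded as `(n, h)`, is extended by the right ends of the `N`
pieces of the interval from `l` to `u`. -/
def appendBlock (l u : ℝ) (N : ℕ) (s : ℕ × (ℕ → ℝ)) : ℕ × (ℕ → ℝ) :=
  if l < u then
    (s.1 + N, fun k => if k ≤ s.1 then s.2 k else l + ((k - s.1 : ℕ) : ℝ) / N * (u - l))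
  else s

/-- The intervals between consecutive nodes are the elements of `F`. -/
structure Tiling (F : Finset (ℝ × ℝ)) (lo hi : ℝ) (s : ℕ × (ℕ → ℝ)) : Prop where
  first : s.2 0 = lo
  last : s.2 s.1 = hi
  lt_succ : ∀ k < s.1, s.2 k < s.2 (k + 1)
  eq_image : F = (Finset.range s.1).image fun k => (s.2 k, s.2 (k + 1))

lemma Tiling.mono {F : Finset (ℝ × ℝ)} {lo hi : ℝ} {s : ℕ × (ℕ → ℝ)} (h : Tiling F lo hi s)
    {i j : ℕ} (hij : i ≤ j) (hj : j ≤ s.1) : s.2 i ≤ s.2 j := by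
  induction j, hij using Nat.le_induction with
  | base => exact le_rfl
  | succ k _ ih => exact (ih (by omega)).trans (h.lt_succ k (by omega)).le

lemma Tiling.strictMono {F : Finset (ℝ × ℝ)} {lo hi : ℝ} {s : ℕ × (ℕ → ℝ)} (h : Tiling F lo hi s)
    {i j : ℕ} (hij : i < j) (hj : j ≤ s.1) : s.2 i < s.2 j :=
  (h.lt_succ i (by omega)).trans_le (h.mono hij hj)

/-- The block has to start where the list ends only if it is non-empty; empty bands are thereby
absorbed. -/
lemma Tiling.append {F : Finset (ℝ × ℝ)} {lo hi : ℝ} {s : ℕ × (ℕ → ℝ)} (h : Tiling F lo hi s)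
    {l u : ℝ} {N : ℕ} (hN : 0 < N) (hl : l < u → hi = l) :
    Tiling (F ∪ unifPart l u N) lo (if l < u then u else hi) (appendBlock l u N s) := by
  unfold appendBlock unifPart
  split_ifs with hlu
  · have hN0 : (0 : ℝ) < N := by exact_mod_cast hN
    have hd : 0 < u - l := sub_pos.2 hlu
    -- The two cases of the definition agree at the joint, where the last node equals the left end
    -- of the block.
    have hval : ∀ k, (if s.1 + k ≤ s.1 then s.2 (s.1 + k) else
        l + ((s.1 + k - s.1 : ℕ) : ℝ) / N * (u - l)) = l + (k : ℝ) / N * (u - l) := by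
      intro k
      rcases Nat.eq_zero_or_pos k with rfl | hk
      · rw [if_pos (by omega), add_zero, h.last, hl hlu]
        simp
      · rw [if_neg (by omega), Nat.add_sub_cancel_left]
    refine ⟨by simpa using h.first, ?_, ?_, ?_⟩
    · change (if s.1 + N ≤ s.1 then _ else _) = u
      rw [hval N, div_self hN0.ne']
      ring
    · intro k hk
      change (if k ≤ s.1 then _ else _) < if k + 1 ≤ s.1 then _ else _
      rcases lt_or_ge k s.1 with hks | hks
      · rw [if_pos hks.le, if_pos (show k + 1 ≤ s.1 from hks)]
        exact h.lt_succ k hks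
      · obtain ⟨i, rfl⟩ := Nat.exists_eq_add_of_le hks
        rw [hval, add_assoc, hval]
        push_cast
        gcongr
        linarith
    · rw [h.eq_image]
      ext J
      simp only [Finset.mem_union, Finset.mem_image, Finset.mem_range]
      constructor
      · rintro (⟨k, hk, rfl⟩ | ⟨k, hk, rfl⟩)
        · refine ⟨k, by omega, ?_⟩
          rw [if_pos hk.le, if_pos (show k + 1 ≤ s.1 from hk)]
        · refine ⟨s.1 + k, by omega, ?_⟩
          rw [hval, add_assoc, hval]
          push_cast
          rfl
      · rintro ⟨k, hk, rfl⟩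
        rcases lt_or_ge k s.1 with hks | hks
        · refine Or.inl ⟨k, hks, ?_⟩
          rw [if_pos hks.le, if_pos (show k + 1 ≤ s.1 from hks)]
        · obtain ⟨i, rfl⟩ := Nat.exists_eq_add_of_le hks
          refine Or.inr ⟨i, by omega, ?_⟩
          rw [hval, add_assoc, hval]
          push_cast
          rfl
  · rw [Finset.union_empty]
    exact h

lemma appendBlock_fst_le (l u : ℝ) (N : ℕ) (s : ℕ × (ℕ → ℝ)) :
    (appendBlock l u N s).1 ≤ s.1 + N := by
  unfold appendBlock
  split_ifs
  · exact le_rfl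
  · omega

section nodes
variable (p : Params) (m : ℕ) (v : ℝ)

/-- The left and right ends of the bands. -/
def Params.leftLo (q : ℕ) : ℝ := max (p.innerLo m v - (2 ^ (q + 1) - 1) * p.radius m) (theta p.eta)
def Params.leftHi (q : ℕ) : ℝ :=
  min (p.innerLo m v - (2 ^ q - 1) * p.radius m) (theta (1 - p.eta))
def Params.rightLo (q : ℕ) : ℝ := max (p.innerHi m v + (2 ^ q - 1) * p.radius m) (theta p.eta)
def Params.rightHi (q : ℕ) : ℝ :=
  min (p.innerHi m v + (2 ^ (q + 1) - 1) * p.radius m) (theta (1 - p.eta))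

/-- The nodes after the outermost `i` bands on the left. -/
def Params.leftNodes : ℕ → ℕ × (ℕ → ℝ)
  | 0 => (0, fun _ => theta p.eta)
  | i + 1 => appendBlock (p.leftLo m v (Nat.clog 2 p.T - i)) (p.leftHi m v (Nat.clog 2 p.T - i))
      p.outerCount (Params.leftNodes i)

/-- The nodes up to the right end of the inner region. -/
def Params.innerNodes : ℕ × (ℕ → ℝ) :=
  appendBlock (p.innerLo m v) (p.innerHi m v) (p.innerCount m v)
    (p.leftNodes m v (Nat.clog 2 p.T + 1))

/-- The nodes after the innermost `i` bands on the right. -/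
def Params.rightNodes : ℕ → ℕ × (ℕ → ℝ)
  | 0 => p.innerNodes m v
  | i + 1 => appendBlock (p.rightLo m v i) (p.rightHi m v i) p.outerCount (Params.rightNodes i)

/-- All nodes. -/
def Params.nodes : ℕ × (ℕ → ℝ) := p.rightNodes m v (Nat.clog 2 p.T + 1)

/-- A bound for the number of nodes. -/
def Params.size : ℕ := p.innerCount m v + (Nat.clog 2 p.T + 1) * (2 * p.outerCount) + 2

lemma Params.leftNodes_fst_le (i : ℕ) : (p.leftNodes m v i).1 ≤ i * p.outerCount := by
  induction i with
  | zero => simp [Params.leftNodes]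
  | succ i ih =>
    refine (appendBlock_fst_le _ _ _ _).trans ?_
    rw [Nat.succ_mul]
    omega

lemma Params.rightNodes_fst_le (i : ℕ) : (p.rightNodes m v i).1 ≤
    p.innerCount m v + (Nat.clog 2 p.T + 1) * p.outerCount + i * p.outerCount := by
  induction i with
  | zero =>
    refine (appendBlock_fst_le _ _ _ _).trans ?_
    have := p.leftNodes_fst_le m v (Nat.clog 2 p.T + 1)
    omega
  | succ i ih =>
    refine (appendBlock_fst_le _ _ _ _).trans ?_
    rw [Nat.succ_mul i]
    omega

lemma Params.nodes_fst_lt : (p.nodes m v).1 + 1 < p.size m v := by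
  have := p.rightNodes_fst_le m v (Nat.clog 2 p.T + 1)
  unfold Params.nodes Params.size
  have : (Nat.clog 2 p.T + 1) * (2 * p.outerCount) =
      (Nat.clog 2 p.T + 1) * p.outerCount + (Nat.clog 2 p.T + 1) * p.outerCount := by ring
  omega

variable {p m}

/-- The outermost bands reach at least π away from the inner region, so the bands cover the whole
domain: `2^(Q+1) - 1 ≥ T ≥ √T`, and the radius is at least `2π/√T`. -/
lemma Params.Good.two_pow_mul_radius_ge (hp : p.Good) (hm : 2 ^ (m - 1) ≤ p.T) :
    π ≤ (2 ^ (Nat.clog 2 p.T + 1) - 1) * p.radius m := by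
  have h1 := hp.radius_ge hm
  have hT : (p.T : ℝ) ≤ 2 ^ Nat.clog 2 p.T := by
    exact_mod_cast Nat.le_pow_clog one_lt_two p.T
  have hT2 : (2 : ℝ) ≤ p.T := by exact_mod_cast hp.two_le
  have hs : 0 < sqrt p.T := sqrt_pos.2 hp.T_pos
  have hss := mul_self_sqrt hp.T_pos.le
  have hpi := pi_pos
  rw [div_le_iff₀ hs] at h1
  have hr := hp.radius_pos m
  have h2 : (p.T : ℝ) ≤ 2 ^ (Nat.clog 2 p.T + 1) - 1 := by rw [pow_succ]; linarith
  have h3 : sqrt p.T ≤ p.T := by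
    nlinarith [one_le_sqrt.2 (by linarith : (1 : ℝ) ≤ p.T)]
  nlinarith

/-- Left bands are appended from the outermost inwards, which produces the nodes in increasing
order. The current right end is the inner boundary of the last band, clipped to the domain. -/
lemma Params.Good.tiling_left (hp : p.Good) (hm : 2 ^ (m - 1) ≤ p.T) {i : ℕ}
    (hi : i ≤ Nat.clog 2 p.T + 1) :
    Tiling ((Finset.range i).biUnion fun k => p.leftBand m v (Nat.clog 2 p.T - k)) (theta p.eta)
      (max (p.innerLo m v - (2 ^ (Nat.clog 2 p.T + 1 - i) - 1) * p.radius m) (theta p.eta))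
      (p.leftNodes m v i) := by
  have hr := hp.radius_pos m
  have hab := (hp.inner_lt hm v).le
  have hb := p.innerHi_le m v
  have htop := theta_le_pi (1 - p.eta)
  induction i with
  | zero =>
    have h := hp.two_pow_mul_radius_ge hm
    refine ⟨rfl, ?_, fun k hk => absurd hk (by simp [Params.leftNodes]), by
      simp [Params.leftNodes]⟩
    rw [max_eq_right]
    · rfl
    · rw [Nat.sub_zero]
      have := theta_nonneg p.eta
      linarith
  | succ i ih =>
    have ih := ih (by omega)
    set Q := Nat.clog 2 p.T
    obtain ⟨q, hq⟩ := Nat.exists_eq_add_of_le (show i ≤ Q by omega)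
    have e1 : Q + 1 - i = q + 1 := by omega
    have e2 : Q + 1 - (i + 1) = q := by omega
    have e3 : Q - i = q := by omega
    rw [e1] at ih
    have h := ih.append (N := p.outerCount) (l := p.leftLo m v q) (u := p.leftHi m v q)
      (by have := p.two_le_outerCount; omega) (fun _ => rfl)
    rw [Finset.range_add_one, Finset.biUnion_insert, Finset.union_comm, e2, e3]
    have hq1 : (1 : ℝ) ≤ 2 ^ q := one_le_pow₀ one_le_two
    have hlt : p.innerLo m v - (2 ^ (q + 1) - 1) * p.radius m <
        p.innerLo m v - (2 ^ q - 1) * p.radius m := by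
      rw [pow_succ]
      nlinarith
    have hle : p.innerLo m v - (2 ^ q - 1) * p.radius m ≤ theta (1 - p.eta) := by
      nlinarith
    have e4 : p.leftNodes m v (i + 1) = appendBlock (p.leftLo m v q) (p.leftHi m v q)
        p.outerCount (p.leftNodes m v i) := by
      rw [← e3]
      rfl
    rw [e4]
    change Tiling (_ ∪ unifPart (p.leftLo m v q) (p.leftHi m v q) p.outerCount) _ _ _
    convert h using 1
    · have e4 : p.leftHi m v q = p.innerLo m v - (2 ^ q - 1) * p.radius m := min_eq_left hle
      split_ifs with hc
      · rw [e4] at hc ⊢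
        exact max_eq_left ((le_max_right _ _).trans hc.le)
      · rw [e4] at hc
        push Not at hc
        unfold Params.leftLo at hc
        have h5 : p.innerLo m v - (2 ^ q - 1) * p.radius m ≤ theta p.eta := by
          rcases le_max_iff.1 hc with h | h
          · linarith
          · exact h
        rw [max_eq_right h5, max_eq_right (hlt.le.trans h5)]

lemma Params.Good.tiling_right (hp : p.Good) (hm : 2 ^ (m - 1) ≤ p.T) (i : ℕ) :
    Tiling (((Finset.range (Nat.clog 2 p.T + 1)).biUnion fun k =>
        p.leftBand m v (Nat.clog 2 p.T - k)) ∪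
        unifPart (p.innerLo m v) (p.innerHi m v) (p.innerCount m v) ∪
        (Finset.range i).biUnion fun k => p.rightBand m v k) (theta p.eta)
      (min (p.innerHi m v + (2 ^ i - 1) * p.radius m) (theta (1 - p.eta)))
      (p.rightNodes m v i) := by
  have hr := hp.radius_pos m
  have hab := hp.inner_lt hm v
  have hb := p.innerHi_le m v
  have ha := p.theta_eta_le_innerLo m v
  induction i with
  | zero =>
    have h := (hp.tiling_left v hm le_rfl).append (hp.innerCount_pos hm v)
      (l := p.innerLo m v) (u := p.innerHi m v) (fun _ => by simpa using ha)
    rw [if_pos hab] at h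
    change Tiling _ _ _ (p.innerNodes m v)
    simpa [hb, Params.innerNodes] using h
  | succ i ih =>
    have h := ih.append (N := p.outerCount) (l := p.rightLo m v i) (u := p.rightHi m v i)
      (by have := p.two_le_outerCount; omega) (fun hlu => ?_)
    · rw [Finset.range_add_one (n := i), Finset.biUnion_insert,
        Finset.union_comm (p.rightBand m v i), ← Finset.union_assoc]
      change Tiling (_ ∪ unifPart (p.rightLo m v i) (p.rightHi m v i) p.outerCount) _ _
        (appendBlock (p.rightLo m v i) (p.rightHi m v i) p.outerCount (p.rightNodes m v i))
      convert h using 1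
      have hq1 : (1 : ℝ) ≤ 2 ^ i := one_le_pow₀ one_le_two
      have hlt : p.innerHi m v + (2 ^ i - 1) * p.radius m <
          p.innerHi m v + (2 ^ (i + 1) - 1) * p.radius m := by
        rw [pow_succ]
        nlinarith
      have hge : theta p.eta ≤ p.innerHi m v + (2 ^ i - 1) * p.radius m := by nlinarith
      have e4 : p.rightLo m v i = p.innerHi m v + (2 ^ i - 1) * p.radius m := max_eq_left hge
      split_ifs with hc
      · rfl
      · rw [e4] at hc
        push Not at hc
        unfold Params.rightHi at hc
        have h5 : theta (1 - p.eta) ≤ p.innerHi m v + (2 ^ i - 1) * p.radius m := by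
          rcases min_le_iff.1 hc with h | h
          · linarith
          · exact h
        rw [min_eq_right h5, min_eq_right (h5.trans hlt.le)]
    · have hq1 : (1 : ℝ) ≤ 2 ^ i := one_le_pow₀ one_le_two
      have hge : theta p.eta ≤ p.innerHi m v + (2 ^ i - 1) * p.radius m := by nlinarith
      have e4 : p.rightLo m v i = p.innerHi m v + (2 ^ i - 1) * p.radius m := max_eq_left hge
      rw [e4] at hlu ⊢
      exact min_eq_left (hlu.le.trans (min_le_right _ _))

lemma Params.Good.tiling (hp : p.Good) (hm : 2 ^ (m - 1) ≤ p.T) :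
    Tiling (p.partition m v) (theta p.eta) (theta (1 - p.eta)) (p.nodes m v) := by
  have h := hp.tiling_right v hm (Nat.clog 2 p.T + 1)
  have h0 := hp.two_pow_mul_radius_ge hm
  change Tiling _ _ _ (p.rightNodes m v (Nat.clog 2 p.T + 1))
  convert h using 1
  · unfold Params.partition
    ext J
    simp only [Finset.mem_union, Finset.mem_biUnion, Finset.mem_range]
    constructor
    · rintro (h | ⟨q, hq, h | h⟩)
      · exact Or.inl (Or.inr h)
      · refine Or.inl (Or.inl ⟨Nat.clog 2 p.T - q, by omega, ?_⟩)
        rwa [Nat.sub_sub_self (by omega)]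
      · exact Or.inr ⟨q, hq, h⟩
    · rintro ((⟨k, hk, h⟩ | h) | ⟨q, hq, h⟩)
      · exact Or.inr ⟨_, by omega, Or.inl h⟩
      · exact Or.inl h
      · exact Or.inr ⟨q, hq, Or.inr h⟩
  · rw [min_eq_right]
    have := p.theta_eta_le_innerLo m v
    have := hp.inner_lt hm v
    linarith [theta_nonneg p.eta, theta_le_pi (1 - p.eta)]

variable (p m)

/-- The grid points in increasing order. -/
def Params.point (k : ℕ) : ℝ := psi ((p.nodes m v).2 k)

variable {p m}

lemma Params.Good.nodes_mem (hp : p.Good) (hm : 2 ^ (m - 1) ≤ p.T) {k : ℕ}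
    (hk : k ≤ (p.nodes m v).1) : (p.nodes m v).2 k ∈ Icc (theta p.eta) (theta (1 - p.eta)) := by
  have h := hp.tiling v hm
  exact ⟨h.first ▸ h.mono (Nat.zero_le k) hk, h.last ▸ h.mono hk le_rfl⟩

lemma Params.Good.point_lt (hp : p.Good) (hm : 2 ^ (m - 1) ≤ p.T) {i j : ℕ} (hij : i < j)
    (hj : j ≤ (p.nodes m v).1) : p.point m v i < p.point m v j := by
  have hI : ∀ k ≤ (p.nodes m v).1, (p.nodes m v).2 k ∈ Icc 0 π := fun k hk =>
    have h := hp.nodes_mem v hm hk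
    ⟨(theta_nonneg _).trans h.1, h.2.trans (theta_le_pi _)⟩
  exact psi_strictMonoOn (hI i (by omega)) (hI j hj) ((hp.tiling v hm).strictMono hij hj)

lemma Params.Good.point_injOn (hp : p.Good) (hm : 2 ^ (m - 1) ≤ p.T) :
    Set.InjOn (p.point m v) (Finset.range ((p.nodes m v).1 + 1)) := by
  intro i hi j hj h
  rw [Finset.mem_coe, Finset.mem_range] at hi hj
  rcases lt_trichotomy i j with hlt | rfl | hlt
  · exact absurd h (hp.point_lt v hm hlt (by omega)).ne
  · rfl
  · exact absurd h (hp.point_lt v hm hlt (by omega)).ne'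

lemma Params.Good.point_zero (hp : p.Good) (hm : 2 ^ (m - 1) ≤ p.T) :
    p.point m v 0 = p.eta := by
  unfold Params.point
  rw [(hp.tiling v hm).first, psi_theta hp.eta_mem]

lemma Params.Good.point_last (hp : p.Good) (hm : 2 ^ (m - 1) ≤ p.T) :
    p.point m v (p.nodes m v).1 = 1 - p.eta := by
  unfold Params.point
  rw [(hp.tiling v hm).last, psi_theta hp.one_sub_eta_mem]

lemma Params.Good.nodes_fst_pos (hp : p.Good) (hm : 2 ^ (m - 1) ≤ p.T) :
    0 < (p.nodes m v).1 := by
  by_contra h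
  have h0 : (p.nodes m v).1 = 0 := by omega
  have h1 := hp.point_last v hm
  rw [h0, hp.point_zero v hm] at h1
  linarith [hp.eta_lt]

lemma Params.Good.point_mem (hp : p.Good) (hm : 2 ^ (m - 1) ≤ p.T) {k : ℕ}
    (hk : k ≤ (p.nodes m v).1) : p.point m v k ∈ Ioo (0 : ℝ) 1 := by
  have h0 := p.eta_pos
  constructor
  · rcases Nat.eq_zero_or_pos k with rfl | hk0
    · rw [hp.point_zero v hm]
      exact h0
    · have := hp.point_lt v hm hk0 hk
      rw [hp.point_zero v hm] at this
      linarith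
  · rcases hk.eq_or_lt with rfl | hk
    · rw [hp.point_last v hm]
      linarith
    · have := hp.point_lt v hm hk le_rfl
      rw [hp.point_last v hm] at this
      linarith

/-- Right ends of pieces are all nodes but the first, which is θ(η); the point `1 - η` is the last
node. -/
lemma Params.Good.grid_eq (hp : p.Good) (hm : 2 ^ (m - 1) ≤ p.T) :
    p.grid m v = (Finset.range ((p.nodes m v).1 + 1)).image (p.point m v) := by
  have h0 := hp.point_zero v hm
  have h1 := hp.point_last v hm
  unfold Params.grid
  rw [(hp.tiling v hm).eq_image]
  ext z
  simp only [Finset.mem_union, Finset.mem_image, Finset.mem_range, Finset.mem_insert,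
    Finset.mem_singleton]
  constructor
  · rintro (⟨_, ⟨k, hk, rfl⟩, rfl⟩ | rfl | rfl)
    · exact ⟨k + 1, by omega, rfl⟩
    · exact ⟨0, by omega, h0⟩
    · exact ⟨_, by omega, h1⟩
  · rintro ⟨k, hk, rfl⟩
    rcases k with _ | k
    · exact Or.inr (Or.inl h0)
    · exact Or.inl ⟨_, ⟨k, by omega, rfl⟩, rfl⟩

end nodes

/-! ### A forecaster that follows the algorithm -/

section forecaster
variable (p : Params)

/-- The index of the grid interval that contains `a`. -/
def rowIndex (g : ℕ → ℝ) (a : ℝ) : ℕ := sInf {j | a ≤ g (j + 1)}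

/-- The probability of the left end in the rounding of `a` to `d < b`. -/
def leftProb (a d b : ℝ) : ℝ :=
  ((b - a) / (b * (1 - b))) / ((b - a) / (b * (1 - b)) + (a - d) / (d * (1 - d)))

/-- The grid interval into which the row `k` of the transition matrix of round `t` points. -/
def Params.row (past : ℕ → ℝ →₀ ℝ) (y : ℕ → Bool) (t k : ℕ) : ℕ :=
  rowIndex (p.point (epoch t) (prevMean (epoch t) y))
    (action past y t (p.point (epoch t) (prevMean (epoch t) y) k))

def Params.rowProb (past : ℕ → ℝ →₀ ℝ) (y : ℕ → Bool) (t k : ℕ) : ℝ :=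
  leftProb (action past y t (p.point (epoch t) (prevMean (epoch t) y) k))
    (p.point (epoch t) (prevMean (epoch t) y) (p.row past y t k))
    (p.point (epoch t) (prevMean (epoch t) y) (p.row past y t k + 1))

/-- The masses of the stationary distribution in round `t`. -/
def Params.mass (past : ℕ → ℝ →₀ ℝ) (y : ℕ → Bool) (t : ℕ) : ℕ → ℝ :=
  statDist ((p.nodes (epoch t) (prevMean (epoch t) y)).1 + 1) (p.row past y t)
    (p.rowProb past y t)

/-- The distribution in round `t`, given the earlier ones. -/
def Params.next (past : ℕ → ℝ →₀ ℝ) (y : ℕ → Bool) (t : ℕ) : ℝ →₀ ℝ :=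
  ∑ k ∈ Finset.range ((p.nodes (epoch t) (prevMean (epoch t) y)).1 + 1),
    Finsupp.single (p.point (epoch t) (prevMean (epoch t) y) k) (p.mass past y t k)

/-- The forecaster, with stationary distributions computed by conjugate gradients. -/
def Params.forecast (y : ℕ → Bool) (t : ℕ) : ℝ →₀ ℝ :=
  p.next (fun τ => if _h : τ < t then Params.forecast y τ else 0) y t
termination_by t

variable {p}

lemma Params.next_congr {P P' : ℕ → ℝ →₀ ℝ} {t : ℕ} {y y' : ℕ → Bool} (hP : ∀ τ < t, P τ = P' τ)
    (h : ∀ i < t, y i = y' i) : p.next P y t = p.next P' y' t := by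
  have h1 := action_congr hP h
  have h2 := prevMean_congr fun i (hi : i < 2 ^ epoch t - 2) => h i (hi.trans_le (epoch_start_le t))
  have h3 : p.row P y t = p.row P' y' t := by
    unfold Params.row
    rw [h1, h2]
  have h4 : p.rowProb P y t = p.rowProb P' y' t := by
    unfold Params.rowProb
    rw [h1, h2, h3]
  unfold Params.next Params.mass
  rw [h2, h3, h4]

/-- The cut-off `τ < t` in the recursive definition is immaterial, since the next distribution
depends on strictly earlier ones only. -/
lemma Params.forecast_eq (y : ℕ → Bool) (t : ℕ) :
    p.forecast y t = p.next (p.forecast y) y t := by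
  rw [Params.forecast]
  exact Params.next_congr (fun τ hτ => by rw [dif_pos hτ]) fun _ _ => rfl

lemma Params.forecast_congr {y y' : ℕ → Bool} (t : ℕ) (h : ∀ i < t, y i = y' i) :
    p.forecast y t = p.forecast y' t := by
  induction t using Nat.strong_induction_on with
  | _ t ih =>
    rw [p.forecast_eq y, p.forecast_eq y']
    exact Params.next_congr (fun τ hτ => ih τ hτ fun i hi => h i (hi.trans hτ)) h

/-- The actions lie between the extreme grid points. -/
lemma action_mem_of_isDist {P : ℕ → ℝ →₀ ℝ} {y : ℕ → Bool} {t : ℕ} (ht : t < p.T)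
    (hP : ∀ τ < t, IsDist (P τ)) (s : ℝ) : action P y t s ∈ Icc p.eta (1 - p.eta) := by
  have h0 : ∀ τ ∈ Finset.Ico (2 ^ epoch t - 2) t, 0 ≤ P τ s := fun τ hτ =>
    ((hP τ (Finset.mem_Ico.1 hτ).2).mem_Icc s).1
  have h1 := weightOne_nonneg (y := y) h0
  have h2 := weightOne_le_weight (y := y) h0
  have h3 : weight P (2 ^ epoch t - 2) t s ≤ t := by
    calc _ ≤ ∑ τ ∈ Finset.Ico (2 ^ epoch t - 2) t, (1 : ℝ) :=
          Finset.sum_le_sum fun τ hτ => ((hP τ (Finset.mem_Ico.1 hτ).2).mem_Icc s).2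
      _ ≤ t := by
        rw [Finset.sum_const, Nat.card_Ico, nsmul_eq_mul, mul_one]
        exact_mod_cast Nat.sub_le _ _
  have hT : (t : ℝ) + 1 ≤ p.T := by exact_mod_cast ht
  have hw : 0 < weight P (2 ^ epoch t - 2) t s + 2 := by linarith
  have hη : p.eta ≤ 1 / (weight P (2 ^ epoch t - 2) t s + 2) :=
    one_div_le_one_div_of_le hw (by linarith)
  rw [action_eq h0]
  constructor
  · refine hη.trans ?_
    gcongr
    linarith
  · rw [le_sub_comm, one_sub_div hw.ne']
    refine hη.trans ?_
    gcongr
    linarith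

/-- The action is at most the last grid point `1 - η`, so the infimum is attained inside the grid;
its minimality puts the preceding point below the action. At index zero that point is η, which is
below every action. -/
lemma Params.Good.row_spec (hp : p.Good) {P : ℕ → ℝ →₀ ℝ} {y : ℕ → Bool} {t : ℕ} (ht : t < p.T)
    (hP : ∀ τ < t, IsDist (P τ)) (k : ℕ) :
    p.row P y t k < (p.nodes (epoch t) (prevMean (epoch t) y)).1 ∧
    action P y t (p.point (epoch t) (prevMean (epoch t) y) k) ∈
      Icc (p.point (epoch t) (prevMean (epoch t) y) (p.row P y t k))
        (p.point (epoch t) (prevMean (epoch t) y) (p.row P y t k + 1)) := by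
  have hm := two_pow_epoch_pred_le ht
  set v := prevMean (epoch t) y
  set m := epoch t
  set a := action P y t (p.point m v k) with ha
  have hmem : a ∈ Icc p.eta (1 - p.eta) := action_mem_of_isDist ht hP _
  have hn := hp.nodes_fst_pos v hm
  have hlast : (p.nodes m v).1 - 1 ∈ {j | a ≤ p.point m v (j + 1)} := by
    rw [Set.mem_ofPred_eq, Nat.sub_add_cancel hn, hp.point_last v hm]
    exact hmem.2
  have hrow : p.row P y t k = sInf {j | a ≤ p.point m v (j + 1)} := rfl
  have h1 := Nat.sInf_mem ⟨_, hlast⟩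
  have h2 := Nat.sInf_le hlast
  rw [← hrow] at h1 h2
  refine ⟨by omega, ?_, h1⟩
  rcases Nat.eq_zero_or_pos (p.row P y t k) with h0 | h0
  · rw [h0, hp.point_zero v hm]
    exact hmem.1
  · have h3 : p.row P y t k - 1 ∉ {j | a ≤ p.point m v (j + 1)} :=
      Nat.notMem_of_lt_sInf (by rw [← hrow]; omega)
    rw [Set.mem_ofPred_eq, Nat.sub_add_cancel h0, not_le] at h3
    exact h3.le

lemma leftProb_mem {a d b : ℝ} (hd : 0 < d) (hb : b < 1) (hda : d ≤ a) (hab : a ≤ b) :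
    leftProb a d b ∈ Icc (0 : ℝ) 1 := by
  have h1 : 0 ≤ (b - a) / (b * (1 - b)) :=
    div_nonneg (by linarith) (mul_nonneg (by linarith) (by linarith))
  have h2 : 0 ≤ (a - d) / (d * (1 - d)) :=
    div_nonneg (by linarith) (mul_nonneg hd.le (by linarith))
  exact ⟨div_nonneg h1 (add_nonneg h1 h2), div_le_one_of_le₀ (by linarith) (add_nonneg h1 h2)⟩

lemma twoPoint_eq {a d b : ℝ} (hd : 0 < d) (hb : b < 1) (hdb : d < b) (hda : d ≤ a)
    (hab : a ≤ b) : twoPoint a d b =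
      Finsupp.single d (leftProb a d b) + Finsupp.single b (1 - leftProb a d b) := by
  have hbb : 0 < b * (1 - b) := mul_pos (by linarith) (by linarith)
  have hdd : 0 < d * (1 - d) := mul_pos hd (by linarith)
  have h1 : 0 ≤ (b - a) / (b * (1 - b)) := div_nonneg (by linarith) hbb.le
  have h2 : 0 ≤ (a - d) / (d * (1 - d)) := div_nonneg (by linarith) hdd.le
  have h3 : 0 < (b - a) / (b * (1 - b)) + (a - d) / (d * (1 - d)) := by
    rcases hda.eq_or_lt with h | h
    · have : 0 < (b - a) / (b * (1 - b)) := div_pos (by linarith) hbb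
      linarith
    · have : 0 < (a - d) / (d * (1 - d)) := div_pos (by linarith) hdd
      linarith
  unfold twoPoint leftProb
  rw [one_sub_div h3.ne', add_sub_cancel_left]

section dist
variable (hp : p.Good) {P : ℕ → ℝ →₀ ℝ} {y : ℕ → Bool} {t : ℕ} (ht : t < p.T)
  (hP : ∀ τ < t, IsDist (P τ))
include hp ht hP

lemma Params.Good.rowProb_mem (k : ℕ) : p.rowProb P y t k ∈ Icc (0 : ℝ) 1 := by
  have hm := two_pow_epoch_pred_le ht
  obtain ⟨h1, h2⟩ := hp.row_spec (y := y) ht hP k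
  exact leftProb_mem (hp.point_mem _ hm h1.le).1 (hp.point_mem _ hm h1).2 h2.1 h2.2

lemma Params.Good.sum_mass : ∑ k ∈ Finset.range ((p.nodes (epoch t) (prevMean (epoch t) y)).1 + 1),
    p.mass P y t k = 1 :=
  sum_statDist (Nat.succ_pos _) (fun k _ => Nat.succ_lt_succ (hp.row_spec ht hP k).1)
    fun k _ => hp.rowProb_mem ht hP k

omit hp hP ht in
lemma Params.mass_nonneg (k : ℕ) : 0 ≤ p.mass P y t k := statDist_nonneg k

omit hP in
lemma Params.Good.next_apply {k : ℕ} (hk : k ≤ (p.nodes (epoch t) (prevMean (epoch t) y)).1) :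
    p.next P y t (p.point (epoch t) (prevMean (epoch t) y) k) = p.mass P y t k := by
  have hm := two_pow_epoch_pred_le ht
  unfold Params.next
  rw [Finsupp.finsetSum_apply, Finset.sum_eq_single k, Finsupp.single_eq_same]
  · intro i hi hik
    refine Finsupp.single_eq_of_ne fun h => hik ?_
    exact hp.point_injOn _ hm (by simpa using hi) (by simpa using Nat.lt_succ_of_le hk) h.symm
  · intro h
    exact absurd (Finset.mem_range.2 (Nat.lt_succ_of_le hk)) h

omit hP in
lemma Params.Good.support_next : (p.next P y t).support ⊆
    p.grid (epoch t) (prevMean (epoch t) y) := by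
  rw [hp.grid_eq _ (two_pow_epoch_pred_le ht)]
  intro z hz
  by_contra hn
  rw [Finsupp.mem_support_iff] at hz
  apply hz
  unfold Params.next
  rw [Finsupp.finsetSum_apply]
  refine Finset.sum_eq_zero fun k hk => Finsupp.single_eq_of_ne fun h => hn ?_
  exact Finset.mem_image.2 ⟨k, hk, h.symm⟩

omit hP in
lemma Params.Good.sum_grid (f : ℝ → ℝ) : ∑ z ∈ p.grid (epoch t) (prevMean (epoch t) y), f z =
    ∑ k ∈ Finset.range ((p.nodes (epoch t) (prevMean (epoch t) y)).1 + 1),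
      f (p.point (epoch t) (prevMean (epoch t) y) k) := by
  have hm := two_pow_epoch_pred_le ht
  rw [hp.grid_eq _ hm]
  exact Finset.sum_image (hp.point_injOn _ hm)

lemma Params.Good.isDist_next : IsDist (p.next P y t) := by
  constructor
  · intro z
    unfold Params.next
    rw [Finsupp.finsetSum_apply]
    refine Finset.sum_nonneg fun k _ => ?_
    rw [Finsupp.single_apply]
    split_ifs
    · exact Params.mass_nonneg k
    · exact le_rfl
  · rw [Finset.sum_subset (hp.support_next ht) fun s _ hs => Finsupp.notMem_support_iff.1 hs,
      hp.sum_grid ht, ← hp.sum_mass (y := y) ht hP]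
    exact Finset.sum_congr rfl fun k hk =>
      hp.next_apply ht (Nat.lt_succ_iff.1 (Finset.mem_range.1 hk))

/-- The chain lives on indices and is transported to grid points by the injective enumeration. Off
the grid both sides of the stationarity equation vanish. -/
lemma Params.Good.isStationaryChoice_next : IsStationaryChoice p P y t (p.next P y t) := by
  have hm := two_pow_epoch_pred_le ht
  refine ⟨hp.support_next ht, ?_⟩
  set m := epoch t
  set v := prevMean m y
  have hrow := hp.row_spec (y := y) ht hP
  -- the row of a grid point, through its index
  let idx : ℝ → ℕ := fun s => sInf {k | p.point m v k = s}
  have hidx : ∀ k ≤ (p.nodes m v).1, idx (p.point m v k) = k := by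
    intro k hk
    have h1 : p.point m v (idx (p.point m v k)) = p.point m v k :=
      Nat.sInf_mem (s := {i | p.point m v i = p.point m v k}) ⟨k, rfl⟩
    have h2 : idx (p.point m v k) ≤ k := Nat.sInf_le rfl
    exact hp.point_injOn v hm (by simpa using (by omega)) (by simpa using (by omega)) h1
  refine ⟨fun s => twoPoint (action P y t s) (p.point m v (p.row P y t (idx s)))
    (p.point m v (p.row P y t (idx s) + 1)), ?_, ?_⟩
  · intro s hs
    rw [hp.grid_eq v hm, Finset.mem_image] at hs
    obtain ⟨k, hk, rfl⟩ := hs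
    have hk := Nat.lt_succ_iff.1 (Finset.mem_range.1 hk)
    beta_reduce
    rw [hidx k hk]
    obtain ⟨h1, h2⟩ := hrow k
    refine ⟨((p.nodes m v).2 (p.row P y t k), (p.nodes m v).2 (p.row P y t k + 1)), ?_, ?_, rfl⟩
    · rw [(hp.tiling v hm).eq_image]
      exact Finset.mem_image_of_mem _ (Finset.mem_range.2 h1)
    · have e : ∀ i ≤ (p.nodes m v).1, theta (p.point m v i) = (p.nodes m v).2 i := fun i hi =>
        have h := hp.nodes_mem v hm hi
        theta_psi ⟨(theta_nonneg _).trans h.1, h.2.trans (theta_le_pi _)⟩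
      have h3 := theta_mono h2.1
      have h4 := theta_mono h2.2
      rw [e _ h1.le] at h3
      rw [e _ h1] at h4
      exact ⟨h3, h4⟩
  · intro z
    refine (hp.sum_grid ht _).trans ?_
    have hQ : ∀ k ∈ Finset.range ((p.nodes m v).1 + 1), ∀ z,
        p.next P y t (p.point m v k) * twoPoint (action P y t (p.point m v k))
          (p.point m v (p.row P y t (idx (p.point m v k))))
          (p.point m v (p.row P y t (idx (p.point m v k)) + 1)) z =
        p.mass P y t k * (Finsupp.single (p.point m v (p.row P y t k)) (p.rowProb P y t k) +
          Finsupp.single (p.point m v (p.row P y t k + 1)) (1 - p.rowProb P y t k) : ℝ →₀ ℝ) z := by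
      intro k hk z
      have hk := Nat.lt_succ_iff.1 (Finset.mem_range.1 hk)
      obtain ⟨h1, h2⟩ := hrow k
      rw [hidx k hk, hp.next_apply ht hk]
      congr 2
      exact twoPoint_eq (hp.point_mem v hm h1.le).1 (hp.point_mem v hm h1).2
        (hp.point_lt v hm (Nat.lt_succ_self _) h1) h2.1 h2.2
    refine (Finset.sum_congr rfl fun k hk => hQ k hk z).trans ?_
    by_cases hz : z ∈ p.grid m v
    · rw [hp.grid_eq v hm, Finset.mem_image] at hz
      obtain ⟨i, hi, rfl⟩ := hz
      have hi := Nat.lt_succ_iff.1 (Finset.mem_range.1 hi)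
      rw [hp.next_apply ht hi]
      refine Eq.trans ?_ (statDist_stationary (M := (p.nodes m v).1 + 1) (j := p.row P y t)
        (α := p.rowProb P y t) (fun k _ => Nat.succ_lt_succ (hrow k).1)
        (fun k _ => hp.rowProb_mem ht hP k) (Nat.lt_succ_of_le hi))
      refine Finset.sum_congr rfl fun k _ => ?_
      have hinj : ∀ l ≤ (p.nodes m v).1, p.point m v l = p.point m v i ↔ i = l := fun l hl =>
        ⟨fun h => hp.point_injOn v hm (by simpa using (by omega)) (by simpa using (by omega)) h.symm,
          fun h => by rw [h]⟩
      unfold trans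
      simp only [Finsupp.add_apply, Finsupp.single_apply, hinj _ (hrow k).1.le, hinj _ (hrow k).1]
      rfl
    · rw [Finsupp.notMem_support_iff.1 fun h => hz (hp.support_next ht h)]
      refine Finset.sum_eq_zero fun k _ => ?_
      rw [hp.grid_eq v hm] at hz
      have hne : ∀ l ≤ (p.nodes m v).1, p.point m v l ≠ z := fun l hl h =>
        hz (Finset.mem_image.2 ⟨l, Finset.mem_range.2 (Nat.lt_succ_of_le hl), h⟩)
      rw [Finsupp.add_apply, Finsupp.single_eq_of_ne (hne _ (hrow k).1.le).symm,
        Finsupp.single_eq_of_ne (hne _ (hrow k).1).symm, add_zero, mul_zero]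

end dist

lemma Params.Good.isDist_forecast (hp : p.Good) (y : ℕ → Bool) {t : ℕ} (ht : t < p.T) :
    IsDist (p.forecast y t) := by
  induction t using Nat.strong_induction_on with
  | _ t ih =>
    rw [p.forecast_eq]
    exact hp.isDist_next ht fun τ hτ => ih τ hτ (hτ.trans ht)

/-- The rule of the later epochs is also used in the first, where any distribution on `[η, 1 - η]`
is admissible. -/
theorem Params.Good.isForecaster (hp : p.Good) :
    IsForecaster p fun t y => p.forecast y t where
  nonanticipating t _ y y' h := Params.forecast_congr t h
  isDist t ht y := hp.isDist_forecast y ht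
  firstEpoch t ht _ y z hz := by
    rw [p.forecast_eq] at hz
    exact hp.grid_subset (hp.support_next ht hz)
  laterEpochs t ht _ y := by
    have h := hp.isStationaryChoice_next (P := p.forecast y) (y := y) ht fun τ hτ =>
      hp.isDist_forecast y (hτ.trans ht)
    rwa [← p.forecast_eq] at h

end forecaster

end
end AdaptiveCalibration

namespace AdaptiveCalibration
noncomputable section
open Real Set

/-! ### Reasoning about programs -/

instance : Add IExpr := ⟨IExpr.add⟩
instance : Sub IExpr := ⟨IExpr.sub⟩
instance (n : ℕ) : OfNat IExpr n := ⟨IExpr.lit n⟩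
instance : Add RExpr := ⟨RExpr.add⟩
instance : Sub RExpr := ⟨RExpr.sub⟩
instance : Mul RExpr := ⟨RExpr.mul⟩
instance : Div RExpr := ⟨RExpr.div⟩
instance (n : ℕ) : OfNat RExpr n := ⟨RExpr.ofInt (IExpr.lit n)⟩

/-- The scalar variables are the arrays read at index zero. -/
def ivar (a : ℕ) : IExpr := IExpr.get a 0
def rvar (a : ℕ) : RExpr := RExpr.get a 0

/-- The entry of the array `a` at the index stored in the variable `i`. -/
def entry (a i : ℕ) : RExpr := RExpr.get a (ivar i)

def letInt (a : ℕ) (e : IExpr) : Prog := Prog.setInt a 0 e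
def letReal (a : ℕ) (e : RExpr) : Prog := Prog.setReal a 0 e
def letEntry (a i : ℕ) (e : RExpr) : Prog := Prog.setReal a (ivar i) e

/-- Sequential composition. -/
def block : List Prog → Prog
  | [] => .skip
  | c :: cs => .seq c (block cs)

section eval
variable (σ : Store)

@[simp] lemma IExpr.eval_add (e f : IExpr) : (e + f).eval σ = e.eval σ + f.eval σ := rfl
@[simp] lemma IExpr.eval_sub (e f : IExpr) : (e - f).eval σ = e.eval σ - f.eval σ := rfl
@[simp] lemma IExpr.eval_ofNat (n : ℕ) : (no_index (OfNat.ofNat n : IExpr)).eval σ = OfNat.ofNat n := rfl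
@[simp] lemma RExpr.eval_add (e f : RExpr) : (e + f).eval σ = e.eval σ + f.eval σ := rfl
@[simp] lemma RExpr.eval_sub (e f : RExpr) : (e - f).eval σ = e.eval σ - f.eval σ := rfl
@[simp] lemma RExpr.eval_mul (e f : RExpr) : (e * f).eval σ = e.eval σ * f.eval σ := rfl
@[simp] lemma RExpr.eval_div (e f : RExpr) : (e / f).eval σ = e.eval σ / f.eval σ := rfl
@[simp] lemma RExpr.eval_ofNat (n : ℕ) :
    (no_index (OfNat.ofNat n : RExpr)).eval σ = (OfNat.ofNat n : ℕ) := rfl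
@[simp] lemma RExpr.eval_ofInt (e : IExpr) : (RExpr.ofInt e).eval σ = e.eval σ := rfl
@[simp] lemma RExpr.eval_sqrt (e : RExpr) : (RExpr.sqrt e).eval σ = √(e.eval σ) := rfl
@[simp] lemma RExpr.eval_log (e : RExpr) : (RExpr.log e).eval σ = Real.log (e.eval σ) := rfl
@[simp] lemma RExpr.eval_sin (e : RExpr) : (RExpr.sin e).eval σ = Real.sin (e.eval σ) := rfl
@[simp] lemma RExpr.eval_arcsin (e : RExpr) : (RExpr.arcsin e).eval σ = Real.arcsin (e.eval σ) := rfl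
@[simp] lemma IExpr.eval_get (a : ℕ) (i : IExpr) : (IExpr.get a i).eval σ = σ.int a (i.eval σ) :=
  rfl
@[simp] lemma RExpr.eval_get (a : ℕ) (i : IExpr) : (RExpr.get a i).eval σ = σ.real a (i.eval σ) :=
  rfl
@[simp] lemma eval_ivar (a : ℕ) : (ivar a).eval σ = σ.int a 0 := rfl
@[simp] lemma eval_rvar (a : ℕ) : (rvar a).eval σ = σ.real a 0 := rfl
@[simp] lemma eval_entry (a i : ℕ) : (entry a i).eval σ = σ.real a (σ.int i 0) := rfl
@[simp] lemma BExpr.holds_leInt (e f : IExpr) :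
    (BExpr.leInt e f).holds σ ↔ e.eval σ ≤ f.eval σ := Iff.rfl
@[simp] lemma BExpr.holds_leReal (e f : RExpr) :
    (BExpr.leReal e f).holds σ ↔ e.eval σ ≤ f.eval σ := Iff.rfl
@[simp] lemma BExpr.holds_neg (b : BExpr) : (BExpr.neg b).holds σ ↔ ¬ b.holds σ := Iff.rfl

@[simp] lemma IExpr.cost_add (e f : IExpr) : (e + f).cost = e.cost + f.cost + 1 := rfl
@[simp] lemma IExpr.cost_sub (e f : IExpr) : (e - f).cost = e.cost + f.cost + 1 := rfl
@[simp] lemma IExpr.cost_ofNat (n : ℕ) : (no_index (OfNat.ofNat n : IExpr)).cost = 1 := rfl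
@[simp] lemma IExpr.cost_get (a : ℕ) (i : IExpr) : (IExpr.get a i).cost = i.cost + 1 := rfl
@[simp] lemma cost_ivar (a : ℕ) : (ivar a).cost = 2 := rfl
@[simp] lemma RExpr.cost_add (e f : RExpr) : (e + f).cost = e.cost + f.cost + 1 := rfl
@[simp] lemma RExpr.cost_sub (e f : RExpr) : (e - f).cost = e.cost + f.cost + 1 := rfl
@[simp] lemma RExpr.cost_mul (e f : RExpr) : (e * f).cost = e.cost + f.cost + 1 := rfl
@[simp] lemma RExpr.cost_div (e f : RExpr) : (e / f).cost = e.cost + f.cost + 1 := rfl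
@[simp] lemma RExpr.cost_ofNat (n : ℕ) : (no_index (OfNat.ofNat n : RExpr)).cost = 2 := rfl
@[simp] lemma RExpr.cost_ofInt (e : IExpr) : (RExpr.ofInt e).cost = e.cost + 1 := rfl
@[simp] lemma RExpr.cost_get (a : ℕ) (i : IExpr) : (RExpr.get a i).cost = i.cost + 1 := rfl
@[simp] lemma RExpr.cost_sqrt (e : RExpr) : (RExpr.sqrt e).cost = e.cost + 1 := rfl
@[simp] lemma RExpr.cost_log (e : RExpr) : (RExpr.log e).cost = e.cost + 1 := rfl
@[simp] lemma RExpr.cost_sin (e : RExpr) : (RExpr.sin e).cost = e.cost + 1 := rfl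
@[simp] lemma RExpr.cost_arcsin (e : RExpr) : (RExpr.arcsin e).cost = e.cost + 1 := rfl
@[simp] lemma cost_rvar (a : ℕ) : (rvar a).cost = 2 := rfl
@[simp] lemma cost_entry (a i : ℕ) : (entry a i).cost = 3 := rfl
@[simp] lemma BExpr.cost_leInt (e f : IExpr) : (BExpr.leInt e f).cost = e.cost + f.cost + 1 := rfl
@[simp] lemma BExpr.cost_leReal (e f : RExpr) : (BExpr.leReal e f).cost = e.cost + f.cost + 1 := rfl
@[simp] lemma BExpr.cost_neg (b : BExpr) : (BExpr.neg b).cost = b.cost + 1 := rfl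

/-- Absolute values, maxima and minima. -/
def RExpr.abs (e : RExpr) : RExpr := .sqrt (e * e)
def RExpr.max (e f : RExpr) : RExpr := (e + f + (e - f).abs) / 2
def RExpr.min (e f : RExpr) : RExpr := (e + f - (e - f).abs) / 2

@[simp] lemma RExpr.eval_abs (e : RExpr) : e.abs.eval σ = |e.eval σ| :=
  sqrt_mul_self_eq_abs _

@[simp] lemma RExpr.eval_max (e f : RExpr) :
    (e.max f).eval σ = Max.max (e.eval σ) (f.eval σ) := by
  simp only [RExpr.max, RExpr.eval_div, RExpr.eval_add, RExpr.eval_abs, RExpr.eval_sub,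
    RExpr.eval_ofNat, Nat.cast_ofNat]
  rcases le_total (e.eval σ) (f.eval σ) with h | h
  · rw [max_eq_right h, abs_of_nonpos (sub_nonpos.2 h)]
    ring
  · rw [max_eq_left h, abs_of_nonneg (sub_nonneg.2 h)]
    ring

@[simp] lemma RExpr.eval_min (e f : RExpr) :
    (e.min f).eval σ = Min.min (e.eval σ) (f.eval σ) := by
  simp only [RExpr.min, RExpr.eval_div, RExpr.eval_add, RExpr.eval_abs, RExpr.eval_sub,
    RExpr.eval_ofNat, Nat.cast_ofNat]
  rcases le_total (e.eval σ) (f.eval σ) with h | h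
  · rw [min_eq_left h, abs_of_nonpos (sub_nonpos.2 h)]
    ring
  · rw [min_eq_right h, abs_of_nonneg (sub_nonneg.2 h)]
    ring

@[simp] lemma RExpr.cost_abs (e : RExpr) : e.abs.cost = 2 * e.cost + 2 := by
  simp [RExpr.abs]
  ring

@[simp] lemma RExpr.cost_max (e f : RExpr) : (e.max f).cost = 3 * e.cost + 3 * f.cost + 9 := by
  simp [RExpr.max]
  ring

@[simp] lemma RExpr.cost_min (e f : RExpr) : (e.min f).cost = 3 * e.cost + 3 * f.cost + 9 := by
  simp [RExpr.min]
  ring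

@[simp] lemma Store.int_setInt (a i n b j : ℕ) :
    (σ.setInt a i n).int b j = if b = a ∧ j = i then n else σ.int b j := by
  unfold Store.setInt
  by_cases h : b = a
  · subst h
    by_cases h : j = i <;> simp [h]
  · simp [h]

@[simp] lemma Store.real_setInt (a i n : ℕ) : (σ.setInt a i n).real = σ.real := rfl

@[simp] lemma Store.int_setReal (a i : ℕ) (x : ℝ) : (σ.setReal a i x).int = σ.int := rfl

@[simp] lemma Store.real_setReal (a i : ℕ) (x : ℝ) (b j : ℕ) :
    (σ.setReal a i x).real b j = if b = a ∧ j = i then x else σ.real b j := by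
  unfold Store.setReal
  by_cases h : b = a
  · subst h
    by_cases h : j = i <;> simp [h]
  · simp [h]

end eval

/-- The program `c` halts after at most `B` steps in a memory that satisfies `Q`. -/
def Ter (c : Prog) (σ : Store) (B : ℕ) (Q : Store → Prop) : Prop :=
  ∃ σ' n, Exec c σ σ' n ∧ n ≤ B ∧ Q σ'

namespace Ter
variable {c d : Prog} {b : BExpr} {σ : Store} {B B' : ℕ} {Q Q' : Store → Prop}

lemma mono (h : Ter c σ B Q) (hB : B ≤ B') : Ter c σ B' Q :=
  let ⟨σ', n, h1, h2, h3⟩ := h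
  ⟨σ', n, h1, h2.trans hB, h3⟩

lemma imp (h : Ter c σ B Q) (hQ : ∀ σ', Q σ' → Q' σ') : Ter c σ B Q' :=
  let ⟨σ', n, h1, h2, h3⟩ := h
  ⟨σ', n, h1, h2, hQ σ' h3⟩

lemma letInt {a : ℕ} {e : IExpr} (h : Q (σ.setInt a 0 (e.eval σ))) :
    Ter (letInt a e) σ (e.cost + 2) Q :=
  ⟨_, _, Exec.setInt _ _ _ _, by change 1 + _ + 1 ≤ _; omega, h⟩

lemma letReal {a : ℕ} {e : RExpr} (h : Q (σ.setReal a 0 (e.eval σ))) :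
    Ter (letReal a e) σ (e.cost + 2) Q :=
  ⟨_, _, Exec.setReal _ _ _ _, by change 1 + _ + 1 ≤ _; omega, h⟩

lemma letEntry {a i : ℕ} {e : RExpr} (h : Q (σ.setReal a (σ.int i 0) (e.eval σ))) :
    Ter (letEntry a i e) σ (e.cost + 3) Q :=
  ⟨_, _, Exec.setReal _ _ _ _, by change 2 + _ + 1 ≤ _; omega, h⟩

lemma setReal {a : ℕ} {i : IExpr} {e : RExpr} (h : Q (σ.setReal a (i.eval σ) (e.eval σ))) :
    Ter (.setReal a i e) σ (i.cost + e.cost + 1) Q :=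
  ⟨_, _, Exec.setReal _ _ _ _, le_rfl, h⟩

lemma setInt {a : ℕ} {i : IExpr} {e : IExpr} (h : Q (σ.setInt a (i.eval σ) (e.eval σ))) :
    Ter (.setInt a i e) σ (i.cost + e.cost + 1) Q :=
  ⟨_, _, Exec.setInt _ _ _ _, le_rfl, h⟩

lemma nil (h : Q σ) : Ter (block []) σ 1 Q := ⟨_, _, Exec.skip _, le_rfl, h⟩

lemma cons {cs : List Prog} {R : Store → Prop} (h1 : Ter c σ B R)
    (h2 : ∀ τ, R τ → Ter (block cs) τ B' Q) : Ter (block (c :: cs)) σ (B + B') Q := by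
  obtain ⟨σ', n, e1, hn, hR⟩ := h1
  obtain ⟨σ'', k, e2, hk, hQ⟩ := h2 σ' hR
  exact ⟨σ'', n + k, Exec.seq e1 e2, by omega, hQ⟩

lemma cons_letInt {cs : List Prog} {a : ℕ} {e : IExpr}
    (h : Ter (block cs) (σ.setInt a 0 (e.eval σ)) B Q) :
    Ter (block (AdaptiveCalibration.letInt a e :: cs)) σ (e.cost + 2 + B) Q :=
  cons (letInt (Q := fun τ => τ = σ.setInt a 0 (e.eval σ)) rfl) fun _ hτ => hτ ▸ h

lemma cons_letReal {cs : List Prog} {a : ℕ} {e : RExpr}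
    (h : Ter (block cs) (σ.setReal a 0 (e.eval σ)) B Q) :
    Ter (block (AdaptiveCalibration.letReal a e :: cs)) σ (e.cost + 2 + B) Q :=
  cons (letReal (Q := fun τ => τ = σ.setReal a 0 (e.eval σ)) rfl) fun _ hτ => hτ ▸ h

lemma cons_letEntry {cs : List Prog} {a i : ℕ} {e : RExpr}
    (h : Ter (block cs) (σ.setReal a (σ.int i 0) (e.eval σ)) B Q) :
    Ter (block (AdaptiveCalibration.letEntry a i e :: cs)) σ (e.cost + 3 + B) Q :=
  cons (letEntry (Q := fun τ => τ = σ.setReal a (σ.int i 0) (e.eval σ)) rfl) fun _ hτ => hτ ▸ h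

lemma cons_setReal {cs : List Prog} {a : ℕ} {i : IExpr} {e : RExpr}
    (h : Ter (block cs) (σ.setReal a (i.eval σ) (e.eval σ)) B Q) :
    Ter (block (.setReal a i e :: cs)) σ (i.cost + e.cost + 1 + B) Q :=
  cons (setReal (Q := fun τ => τ = σ.setReal a (i.eval σ) (e.eval σ)) rfl) fun _ hτ => hτ ▸ h

lemma cons_setInt {cs : List Prog} {a : ℕ} {i e : IExpr}
    (h : Ter (block cs) (σ.setInt a (i.eval σ) (e.eval σ)) B Q) :
    Ter (block (.setInt a i e :: cs)) σ (i.cost + e.cost + 1 + B) Q :=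
  cons (setInt (Q := fun τ => τ = σ.setInt a (i.eval σ) (e.eval σ)) rfl) fun _ hτ => hτ ▸ h

lemma ite (h1 : b.holds σ → Ter c σ B Q) (h2 : ¬ b.holds σ → Ter d σ B Q) :
    Ter (.ite b c d) σ (b.cost + B + 1) Q := by
  by_cases hb : b.holds σ
  · obtain ⟨σ', n, e, hn, hQ⟩ := h1 hb
    exact ⟨σ', _, Exec.iteTrue hb e, by omega, hQ⟩
  · obtain ⟨σ', n, e, hn, hQ⟩ := h2 hb
    exact ⟨σ', _, Exec.iteFalse hb e, by omega, hQ⟩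

/-- A loop with a bound for the number of its iterations. -/
lemma loop {J : ℕ → Store → Prop} {N : ℕ} (h0 : J 0 σ)
    (h : ∀ k τ, J k τ → b.holds τ → k < N ∧ Ter c τ B (J (k + 1))) :
    Ter (.loop b c) σ ((N + 1) * (b.cost + B + 1)) fun τ => ∃ k ≤ N, J k τ ∧ ¬ b.holds τ := by
  -- Induction on the number `i` of passes still allowed.
  have key : ∀ i k τ, k + i = N → J k τ →
      Ter (.loop b c) τ ((i + 1) * (b.cost + B + 1)) fun τ => ∃ k ≤ N, J k τ ∧ ¬ b.holds τ := by
    intro i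
    induction i with
    | zero =>
      intro k τ hk hJ
      have hb : ¬ b.holds τ := fun hb => by have := (h k τ hJ hb).1; omega
      exact ⟨τ, _, Exec.loopDone hb, by omega, k, by omega, hJ, hb⟩
    | succ i ih =>
      intro k τ hk hJ
      by_cases hb : b.holds τ
      · obtain ⟨-, τ', n, e, hn, hJ'⟩ := h k τ hJ hb
        obtain ⟨τ'', n', e', hn', hQ⟩ := ih (k + 1) τ' (by omega) hJ'
        refine ⟨τ'', _, Exec.loopStep hb e e', ?_, hQ⟩
        rw [Nat.succ_mul]
        omega
      · refine ⟨τ, _, Exec.loopDone hb, ?_, k, by omega, hJ, hb⟩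
        rw [Nat.succ_mul]
        omega
  exact key N 0 σ (by omega) h0

end Ter

/-- The memories agree outside the listed real and integer arrays. -/
structure Same (R I : List ℕ) (σ τ : Store) : Prop where
  real : ∀ a, a ∉ R → τ.real a = σ.real a
  int : ∀ a, a ∉ I → τ.int a = σ.int a

namespace Same
variable {R I R' I' : List ℕ} {σ τ υ : Store}

lemma refl : Same R I σ σ := ⟨fun _ _ => rfl, fun _ _ => rfl⟩

lemma setReal (h : Same R I σ τ) {a i : ℕ} {x : ℝ} (ha : a ∈ R) :
    Same R I σ (τ.setReal a i x) := by
  refine ⟨fun b hb => ?_, h.int⟩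
  rw [← h.real b hb]
  funext j
  rw [Store.real_setReal, if_neg]
  rintro ⟨rfl, -⟩
  exact hb ha

lemma setInt (h : Same R I σ τ) {a i n : ℕ} (ha : a ∈ I) : Same R I σ (τ.setInt a i n) := by
  refine ⟨h.real, fun b hb => ?_⟩
  rw [← h.int b hb]
  funext j
  rw [Store.int_setInt, if_neg]
  rintro ⟨rfl, -⟩
  exact hb ha

lemma trans (h : Same R I σ τ) (h' : Same R' I' τ υ) (hR : R' ⊆ R) (hI : I' ⊆ I) :
    Same R I σ υ :=
  ⟨fun a ha => (h'.real a fun h => ha (hR h)).trans (h.real a ha),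
    fun a ha => (h'.int a fun h => ha (hI h)).trans (h.int a ha)⟩

/-- Frames accumulate along a sequence of commands as explicit lists, so that whether an array is
untouched can be decided. -/
lemma append (h : Same R I σ τ) (h' : Same R' I' τ υ) : Same (R ++ R') (I ++ I') σ υ :=
  ⟨fun a ha => (h'.real a fun h => ha (List.mem_append_right _ h)).trans
      (h.real a fun h => ha (List.mem_append_left _ h)),
    fun a ha => (h'.int a fun h => ha (List.mem_append_right _ h)).trans
      (h.int a fun h => ha (List.mem_append_left _ h))⟩

lemma mono (h : Same R' I' σ τ) (hR : R' ⊆ R) (hI : I' ⊆ I) : Same R I σ τ :=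
  refl.trans h hR hI

end Same

/-- Execution of `c` for all values of the variable `i` below that of the variable `n`. -/
def forLoop (i n : ℕ) (c : Prog) : Prog :=
  block [letInt i 0, .loop (.leInt (ivar i + 1) (ivar n)) (block [c, letInt i (ivar i + 1)])]

/-- The invariant for the next pass is required after the increment of the counter, while the body
has to preserve the counter and the bound. The test and the increment are covered by the allowance
of 20 steps per pass. -/
lemma Ter.forLoop {i n : ℕ} {c : Prog} {σ : Store} {B N : ℕ} {J : ℕ → Store → Prop}
    (hin : n ≠ i) (hN : σ.int n 0 = N) (h0 : J 0 (σ.setInt i 0 0))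
    (h : ∀ k < N, ∀ τ, J k τ → τ.int i 0 = k → τ.int n 0 = N →
      Ter c τ B fun τ' => τ'.int i 0 = k ∧ τ'.int n 0 = N ∧ J (k + 1) (τ'.setInt i 0 (k + 1))) :
    Ter (forLoop i n c) σ ((N + 1) * (B + 20)) fun τ => τ.int i 0 = N ∧ τ.int n 0 = N ∧ J N τ := by
  have key : Ter (.loop (.leInt (ivar i + 1) (ivar n)) (block [c, AdaptiveCalibration.letInt i (ivar i + 1)]))
      (σ.setInt i 0 0) ((N + 1) * (7 + (B + (6 + 1)) + 1))
      fun τ => ∃ k ≤ N, (τ.int i 0 = k ∧ τ.int n 0 = N ∧ J k τ) ∧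
        ¬ (BExpr.leInt (ivar i + 1) (ivar n)).holds τ := by
    refine (Ter.loop (B := B + (6 + 1)) (J := fun k τ => τ.int i 0 = k ∧ τ.int n 0 = N ∧ J k τ) ?_ ?_).mono
      le_rfl
    · exact ⟨by simp, by simp [hin, hN], h0⟩
    · rintro k τ ⟨h1, h2, h3⟩ hb
      have hk : k < N := by simpa [h1, h2] using hb
      refine ⟨hk, Ter.cons (h k hk τ h3 h1 h2) ?_⟩
      rintro τ' ⟨h4, h5, h6⟩
      refine Ter.cons_letInt (Ter.nil ?_)
      simp only [IExpr.eval_add, eval_ivar, h4, IExpr.eval_ofNat]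
      exact ⟨by simp, by simp [hin, h5], h6⟩
  refine (Ter.cons_letInt (Ter.cons key ?_)).mono (B := 1 + 2 + ((N + 1) * (7 + (B + (6 + 1)) + 1) + 1)) ?_
  · rintro τ ⟨k, hk, ⟨h1, h2, h3⟩, hb⟩
    have : k = N := by
      simp only [BExpr.holds_leInt, IExpr.eval_add, eval_ivar, h1, h2, IExpr.eval_ofNat] at hb
      omega
    subst this
    exact Ter.nil ⟨h1, h2, h3⟩
  · nlinarith

/-- The first entries of the array `dst` are computed one after the other. -/
def mapTo (dst i n : ℕ) (e : RExpr) : Prog := forLoop i n (letEntry dst i e)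

/-- The value at `k` is evaluated while the entries from `k` on are still the original ones, which
permits updating an array in place. -/
lemma Ter.mapTo {dst i n : ℕ} {e : RExpr} {σ : Store} {N : ℕ} (f : ℕ → ℝ)
    (hin : n ≠ i) (hN : σ.int n 0 = N)
    (h : ∀ k < N, ∀ τ, Same [dst] [i] σ τ → τ.int i 0 = k →
      (∀ l, k ≤ l → τ.real dst l = σ.real dst l) → e.eval τ = f k) :
    Ter (mapTo dst i n e) σ ((N + 1) * (e.cost + 23)) fun τ => Same [dst] [i] σ τ ∧
      (∀ k < N, τ.real dst k = f k) ∧ ∀ k, N ≤ k → τ.real dst k = σ.real dst k := by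
  refine ((Ter.forLoop (B := e.cost + 3) (J := fun k τ => Same [dst] [i] σ τ ∧
      (∀ l < k, τ.real dst l = f l) ∧ ∀ l, k ≤ l → τ.real dst l = σ.real dst l) hin hN
    ⟨Same.refl.setInt (by simp), by simp, by simp⟩ ?_).mono le_rfl).imp fun τ h => h.2.2
  rintro k hk τ ⟨h1, h2, h3⟩ hi hn
  refine Ter.letEntry ?_
  rw [h k hk τ h1 hi h3, hi]
  refine ⟨hi, hn, (h1.setReal (by simp)).setInt (by simp), fun l hl => ?_, fun l hl => ?_⟩
  · rcases (Nat.lt_succ_iff.1 hl).eq_or_lt with rfl | hlt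
    · simp
    · simp [hlt.ne, h2 l hlt]
  · have : l ≠ k := by omega
    simp [this, h3 l (by omega)]

/-- The variable `acc` receives the sum of the values of `e`. -/
def sumTo (acc i n : ℕ) (e : RExpr) : Prog :=
  block [letReal acc 0, forLoop i n (letReal acc (rvar acc + e))]

lemma Ter.sumTo {acc i n : ℕ} {e : RExpr} {σ : Store} {N : ℕ} (f : ℕ → ℝ)
    (hin : n ≠ i) (hN : σ.int n 0 = N)
    (h : ∀ k < N, ∀ τ, Same [acc] [i] σ τ → τ.int i 0 = k → e.eval τ = f k) :
    Ter (sumTo acc i n e) σ ((N + 1) * (e.cost + 35)) fun τ => Same [acc] [i] σ τ ∧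
      τ.real acc 0 = ∑ k ∈ Finset.range N, f k := by
  have key : Ter (AdaptiveCalibration.forLoop i n (AdaptiveCalibration.letReal acc (rvar acc + e)))
      (σ.setReal acc 0 0) ((N + 1) * (e.cost + 5 + 20)) fun τ => τ.int i 0 = N ∧ τ.int n 0 = N ∧
      Same [acc] [i] σ τ ∧ τ.real acc 0 = ∑ k ∈ Finset.range N, f k := by
    refine (Ter.forLoop (B := e.cost + 5) (J := fun k τ => Same [acc] [i] σ τ ∧
      τ.real acc 0 = ∑ l ∈ Finset.range k, f l) hin (by simpa using hN)
      ⟨(Same.refl.setReal (by simp)).setInt (by simp), by simp⟩ ?_)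
    rintro k hk τ ⟨h1, h2⟩ hi hn
    refine (Ter.letReal ?_).mono (B := 2 + e.cost + 1 + 2) (by omega)
    rw [RExpr.eval_add, h k hk τ h1 hi, eval_rvar, h2, ← Finset.sum_range_succ]
    exact ⟨hi, hn, (h1.setReal (by simp)).setInt (by simp), by simp⟩
  refine (Ter.cons_letReal (B := (N + 1) * (e.cost + 5 + 20) + 1) ?_).mono
    (B := 2 + 2 + ((N + 1) * (e.cost + 5 + 20) + 1)) ?_
  · rw [RExpr.eval_ofNat, Nat.cast_zero]
    refine Ter.cons key ?_
    rintro τ ⟨-, -, h⟩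
    exact Ter.nil h
  · nlinarith

end
end AdaptiveCalibration

namespace AdaptiveCalibration
noncomputable section
open Real Set

/-! ### The program: variables -/

notation "vCount" => 1
notation "vLast" => 2
notation "vLength" => 3
notation "vRemaining" => 4
notation "vOnes" => 5
notation "vIndex" => 6
notation "vBand" => 7
notation "vPieces" => 8
notation "vOuter" => 9
notation "vBands" => 10
notation "vPower" => 11
notation "aRow" => 12
notation "vSearch" => 13
notation "vIter" => 14

notation "aNode" => 1
notation "aPoint" => 2
notation "aMass" => 3
notation "aWeight" => 4
notation "aWeightOne" => 5
notation "aProb" => 6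
notation "aRes" => 7
notation "aDir" => 8
notation "aImage" => 9
notation "aGrad" => 10
notation "xInnerLo" => 11
notation "xInnerHi" => 12
notation "xRadius" => 13
notation "xBottom" => 14
notation "xTop" => 15
notation "xPower" => 16
notation "xLeft" => 17
notation "xRight" => 18
notation "xNormSq" => 19
notation "xImageSq" => 20
notation "xNextSq" => 21
notation "xTotal" => 22
notation "xPrefix" => 23
notation "xMean" => 24
notation "xAction" => 25
notation "xPi" => 26

/-! ### The program: conjugate gradients -/

/-- The left end of the row `vIndex`. -/
def rowEnd : IExpr := .get aRow (ivar vIndex)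

/-- Application of the adjoint. -/
def gradProg : Prog :=
  block [mapTo aGrad vIndex vCount (entry aRes vIndex),
    forLoop vIndex vCount (block [
      .setReal aGrad rowEnd (.get aGrad rowEnd - entry aRes vIndex * entry aProb vIndex),
      .setReal aGrad (rowEnd + 1)
        (.get aGrad (rowEnd + 1) - entry aRes vIndex * (1 - entry aProb vIndex))])]

/-- One step of the method. -/
def cgStep : Prog :=
  block [
    mapTo aImage vIndex vCount (entry aDir vIndex - (entry aProb vIndex * .get aDir rowEnd +
      (1 - entry aProb vIndex) * .get aDir (rowEnd + 1))),
    sumTo xImageSq vIndex vCount (entry aImage vIndex * entry aImage vIndex),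
    mapTo aRes vIndex vCount
      (entry aRes vIndex - rvar xNormSq / rvar xImageSq * entry aImage vIndex),
    gradProg,
    sumTo xNextSq vIndex vCount (entry aGrad vIndex * entry aGrad vIndex),
    mapTo aDir vIndex vCount
      (entry aGrad vIndex + rvar xNextSq / rvar xNormSq * entry aDir vIndex),
    letReal xNormSq (rvar xNextSq)]

def cgProg : Prog :=
  block [
    mapTo aRes vIndex vCount 1,
    gradProg,
    sumTo xNormSq vIndex vCount (entry aGrad vIndex * entry aGrad vIndex),
    mapTo aDir vIndex vCount (entry aGrad vIndex),
    forLoop vIter vCount (.ite (.leReal (rvar xNormSq) 0) (block []) cgStep),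
    sumTo xTotal vIndex vCount (entry aRes vIndex).abs,
    mapTo aMass vIndex vCount ((entry aRes vIndex).abs / rvar xTotal)]

/-- The memory holds the chain. -/
structure HoldsChain (M : ℕ) (j : ℕ → ℕ) (α : ℕ → ℝ) (σ : Store) : Prop where
  count : σ.int vCount 0 = M
  row : ∀ i < M, σ.int aRow i = j i
  prob : ∀ i < M, σ.real aProb i = α i

section cg
variable {M : ℕ} {j : ℕ → ℕ} {α : ℕ → ℝ} {σ τ : Store}

lemma HoldsChain.of_same (h : HoldsChain M j α σ) {R I : List ℕ} (hS : Same R I σ τ)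
    (h1 : vCount ∉ I) (h2 : aRow ∉ I) (h3 : aProb ∉ R) : HoldsChain M j α τ := by
  refine ⟨?_, ?_, ?_⟩
  · rw [hS.int _ h1]; exact h.count
  · rw [hS.int _ h2]; exact h.row
  · rw [hS.real _ h3]; exact h.prob

/-- Each row is scattered to its two targets, so the adjoint takes linear time although its defining
formula sums over all rows for each entry. -/
lemma Ter.gradProg (h : HoldsChain M j α σ) {x : ℕ → ℝ} (hx : ∀ i < M, σ.real aRes i = x i) :
    Ter gradProg σ ((M + 1) * 120) fun τ => Same [aGrad] [vIndex] σ τ ∧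
      ∀ z < M, τ.real aGrad z = lapT M j α x z := by
  refine (Ter.cons (Ter.mapTo x (by decide) h.count ?_) fun τ hτ => Ter.cons
    (B := (M + 1) * (60 + 20)) (R := fun υ => υ.int vIndex 0 = M ∧ υ.int vCount 0 = M ∧
      Same [aGrad] [vIndex] σ υ ∧ ∀ z < M, υ.real aGrad z = x z - ∑ i ∈ Finset.range M, x i * trans j α i z)
    ?_ fun υ hυ => Ter.nil hυ.2.2).mono ?_
  · intro k hk τ hS hi _
    rw [eval_entry, hi, hS.real _ (by decide)]
    exact hx k hk
  · obtain ⟨hS, h1, -⟩ := hτ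
    refine Ter.forLoop (J := fun k υ => Same [aGrad] [vIndex] σ υ ∧
      ∀ z < M, υ.real aGrad z = x z - ∑ i ∈ Finset.range k, x i * trans j α i z) (by decide) ?_ ?_ ?_
    · rw [hS.int _ (by decide)]
      exact h.count
    · exact ⟨hS.setInt (by decide), fun z hz => by simp [h1 z hz]⟩
    · rintro k hk υ ⟨hS', h2⟩ hi hn
      refine (Ter.cons_setReal (Ter.cons_setReal (Ter.nil ?_))).mono (by decide)
      have e1 : υ.real aRes k = x k := by rw [hS'.real _ (by decide), hx k hk]
      have e2 : υ.real aProb k = α k := by rw [hS'.real _ (by decide), h.prob k hk]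
      have e3 : υ.int aRow k = j k := by rw [hS'.int _ (by decide), h.row k hk]
      refine ⟨by simpa using hi, by simpa using hn,
        ((hS'.setReal (by decide)).setReal (by decide)).setInt (by decide), fun z hz => ?_⟩
      rw [Finset.sum_range_succ]
      have h3 := h2 z hz
      unfold trans at h3 ⊢
      simp [rowEnd, hi, e1, e2, e3]
      by_cases hz1 : z = j k
      · have : z ≠ j k + 1 := by omega
        subst hz1
        simp [h3]
        ring
      · by_cases hz2 : z = j k + 1
        · subst hz2
          simp [h3]
          ring
        · simp [hz1, hz2, h3]
  · simp
    omega

/-- The memory holds the state of conjugate gradients after `k` steps. -/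
structure HoldsCG (M : ℕ) (j : ℕ → ℕ) (α : ℕ → ℝ) (k : ℕ) (σ : Store) : Prop where
  chain : HoldsChain M j α σ
  res : ∀ i < M, σ.real aRes i = (cg M (lap j α) (lapT M j α) k).1 i
  dir : ∀ i < M, σ.real aDir i = (cg M (lap j α) (lapT M j α) k).2 i
  normSq : σ.real xNormSq 0 = cgGrad M (lap j α) (lapT M j α) k

/-- After the gradient has vanished the exact iteration is stationary on the first `M` coordinates,
so the program may skip the step. -/
lemma HoldsCG.succ {k : ℕ} (h : HoldsCG M j α k σ)
    (h0 : cgGrad M (lap j α) (lapT M j α) k = 0) : HoldsCG M j α (k + 1) σ := by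
  have h1 := cgGrad_succ_eq_zero h0
  refine ⟨h.chain, fun i hi => ?_, fun i hi => ?_, ?_⟩
  · rw [h.res i hi, cg_fst_succ, h0, zero_div, zero_smul, sub_zero]
  · rw [h.dir i hi, cg_snd_eq_zero h0 i hi, cg_snd_eq_zero h1 i hi]
  · rw [h.normSq, h0, h1]

lemma Ter.cgStep (hj : ∀ i < M, j i + 1 < M) {k : ℕ} (h : HoldsCG M j α k σ) :
    Ter cgStep σ ((M + 1) * 400) fun τ =>
      Same [aImage, xImageSq, aRes, aGrad, xNextSq, aDir, xNormSq] [vIndex] σ τ ∧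
      HoldsCG M j α (k + 1) τ := by
  set r := (cg M (lap j α) (lapT M j α) k).1
  set d := (cg M (lap j α) (lapT M j α) k).2
  set γ := cgGrad M (lap j α) (lapT M j α) k
  set r' := (cg M (lap j α) (lapT M j α) (k + 1)).1
  refine (Ter.cons (Ter.mapTo (lap j α d) (by decide) h.chain.count ?_) fun σ1 H1 =>
    Ter.cons (Ter.sumTo (N := M) (fun i => lap j α d i * lap j α d i) (by decide) ?_ ?_) fun σ2 H2 =>
    have S2 := H1.1.append H2.1
    Ter.cons (Ter.mapTo (N := M) r' (by decide) ?_ ?_) fun σ3 H3 =>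
    have S3 := S2.append H3.1
    have C3 := h.chain.of_same S3 (by decide) (by decide) (by decide)
    Ter.cons (Ter.gradProg C3 H3.2.1) fun σ4 H4 =>
    have S4 := S3.append H4.1
    Ter.cons (Ter.sumTo (N := M) (fun i => lapT M j α r' i * lapT M j α r' i) (by decide) ?_ ?_)
      fun σ5 H5 =>
    have S5 := S4.append H5.1
    Ter.cons (Ter.mapTo (N := M) (cg M (lap j α) (lapT M j α) (k + 1)).2 (by decide) ?_ ?_)
      fun σ6 H6 =>
    have S6 := S5.append H6.1
    Ter.cons_letReal (Ter.nil ?_)).mono ?_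
  · intro i hi τ hS hk _
    have hd := hS.real aDir (by decide)
    have hp := hS.real aProb (by decide)
    have hr := hS.int aRow (by decide)
    have := hj i hi
    simp [rowEnd, hk, hd, hp, hr, h.chain.row i hi, h.chain.prob i hi, lap_apply, h.dir i hi,
      h.dir (j i) (by omega), h.dir (j i + 1) (by omega), d]
  · rw [H1.1.int _ (by decide)]
    exact h.chain.count
  · intro i hi τ hS hk
    simp [hk, hS.real aImage (by decide), H1.2.1 i hi]
  · rw [S2.int _ (by decide)]
    exact h.chain.count
  · intro i hi τ hS hk hl
    have e1 : τ.real aRes i = r i := by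
      rw [hl i le_rfl, S2.real _ (by decide)]
      exact h.res i hi
    have e2 : τ.real aImage i = lap j α d i := by
      rw [hS.real _ (by decide), H2.1.real _ (by decide), H1.2.1 i hi]
    have e3 : τ.real xImageSq 0 = dot M (lap j α d) (lap j α d) := by
      rw [hS.real _ (by decide), H2.2]
      rfl
    have e4 : τ.real xNormSq 0 = γ := by
      rw [hS.real _ (by decide), S2.real _ (by decide)]
      exact h.normSq
    simp only [RExpr.eval_sub, RExpr.eval_mul, RExpr.eval_div, eval_entry, eval_rvar, hk, e1, e2,
      e3, e4]
    simp only [r', cg_fst_succ]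
    rfl
  · exact C3.count ▸ by rw [H4.1.int _ (by decide)]
  · intro i hi τ hS hk
    simp [hk, hS.real aGrad (by decide), H4.2 i hi]
  · rw [S5.int _ (by decide)]
    exact h.chain.count
  · intro i hi τ hS hk hl
    have e1 : τ.real aGrad i = lapT M j α r' i := by
      rw [hS.real _ (by decide), H5.1.real _ (by decide), H4.2 i hi]
    have e2 : τ.real aDir i = d i := by
      rw [hl i le_rfl, S5.real _ (by decide)]
      exact h.dir i hi
    have e3 : τ.real xNextSq 0 = cgGrad M (lap j α) (lapT M j α) (k + 1) := by
      rw [hS.real _ (by decide), H5.2]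
      rfl
    have e4 : τ.real xNormSq 0 = γ := by
      rw [hS.real _ (by decide), S5.real _ (by decide)]
      exact h.normSq
    simp only [RExpr.eval_add, RExpr.eval_mul, RExpr.eval_div, eval_entry, eval_rvar, hk, e1, e2,
      e3, e4]
    simp only [cg_snd_succ]
    rfl
  · have S7 : Same [aImage, xImageSq, aRes, aGrad, xNextSq, aDir, xNormSq] [vIndex] σ
        (σ6.setReal xNormSq 0 ((rvar xNextSq).eval σ6)) :=
      (S6.mono (by decide) (by decide)).setReal (by decide)
    refine ⟨S7, h.chain.of_same S7 (by decide) (by decide) (by decide), fun i hi => ?_,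
      fun i hi => ?_, ?_⟩
    · simp [H6.1.real aRes (by decide), H5.1.real aRes (by decide), H4.1.real aRes (by decide),
        H3.2.1 i hi, r']
    · simp [H6.2.1 i hi]
    · simp [H6.1.real xNextSq (by decide), H5.2]
      rfl
  · simp [rowEnd]
    omega

lemma Ter.cgProg (hj : ∀ i < M, j i + 1 < M) (h : HoldsChain M j α σ) :
    Ter cgProg σ ((M + 1) * ((M + 1) * 900)) fun τ =>
      Same [aImage, xImageSq, aRes, aGrad, xNextSq, aDir, xNormSq, xTotal, aMass] [vIndex, vIter]
        σ τ ∧ ∀ i < M, τ.real aMass i = statDist M j α i := by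
  refine (Ter.cons (Ter.mapTo 1 (by decide) h.count ?_) fun σ1 H1 =>
    have C1 := h.of_same H1.1 (by decide) (by decide) (by decide)
    Ter.cons (Ter.gradProg C1 H1.2.1) fun σ2 H2 =>
    have S2 := H1.1.append H2.1
    Ter.cons (Ter.sumTo (N := M) (fun i => lapT M j α 1 i * lapT M j α 1 i) (by decide) ?_ ?_)
      fun σ3 H3 =>
    have S3 := S2.append H3.1
    Ter.cons (Ter.mapTo (N := M) (lapT M j α 1) (by decide) ?_ ?_) fun σ4 H4 =>
    have S4 := S3.append H4.1
    Ter.cons (B := (M + 1) * ((M + 1) * 400 + 30)) (R := fun τ => (τ.int vIter 0 = M ∧ τ.int vCount 0 = M ∧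
      Same [aImage, xImageSq, aRes, aGrad, xNextSq, aDir, xNormSq] [vIndex, vIter] σ τ ∧
      HoldsCG M j α M τ)) (Ter.forLoop (J := fun k τ =>
      Same [aImage, xImageSq, aRes, aGrad, xNextSq, aDir, xNormSq] [vIndex, vIter] σ τ ∧
      HoldsCG M j α k τ) (by decide) ?_ ?_ ?_) fun σ5 H5 =>
    have S5 := H5.2.2.1
    Ter.cons (Ter.sumTo (N := M) (fun i => |statVec M j α i|) (by decide) ?_ ?_) fun σ6 H6 =>
    have S6 := S5.append H6.1
    Ter.cons (Ter.mapTo (N := M) (statDist M j α) (by decide) ?_ ?_) fun σ7 H7 =>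
    Ter.nil ⟨(S6.append H7.1).mono (by decide) (by decide), H7.2.1⟩).mono ?_
  · intro i hi τ hS hk _
    simp
  · rw [H2.1.int _ (by decide)]
    exact C1.count
  · intro i hi τ hS hk
    simp [hk, hS.real aGrad (by decide), H2.2 i hi]
  · rw [S3.int _ (by decide)]
    exact h.count
  · intro i hi τ hS hk hl
    simp [hk, hS.real aGrad (by decide), H3.1.real aGrad (by decide), H2.2 i hi]
  · rw [S4.int _ (by decide)]
    exact h.count
  · have S5 : Same [aImage, xImageSq, aRes, aGrad, xNextSq, aDir, xNormSq] [vIndex, vIter] σ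
        (σ4.setInt vIter 0 0) := (S4.mono (by decide) (by decide)).setInt (by decide)
    refine ⟨S5, h.of_same S5 (by decide) (by decide) (by decide), fun i hi => ?_, fun i hi => ?_, ?_⟩
    · simp [H4.1.real aRes (by decide), H3.1.real aRes (by decide), H2.1.real aRes (by decide),
        H1.2.1 i hi, cg]
    · simp [H4.2.1 i hi, cg]
    · simp [H4.1.real xNormSq (by decide), H3.2]
      rfl
  · rintro k hk τ ⟨h1, h2⟩ hi hn
    have hstep : Ter (.ite (.leReal (rvar xNormSq) 0) (block []) AdaptiveCalibration.cgStep) τ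
        ((M + 1) * 400 + 10) fun υ =>
        Same [aImage, xImageSq, aRes, aGrad, xNextSq, aDir, xNormSq] [vIndex] τ υ ∧
        HoldsCG M j α (k + 1) υ := by
      refine (Ter.ite (B := (M + 1) * 400) (fun hb => ?_) fun _ => Ter.cgStep hj h2).mono ?_
      · have hle : cgGrad M (lap j α) (lapT M j α) k ≤ 0 := by
          rw [← h2.normSq]
          simpa using hb
        exact (Ter.nil ⟨Same.refl, h2.succ (le_antisymm hle (cgGrad_nonneg k))⟩).mono (by omega)
      · simp
        omega
    refine hstep.imp fun υ ⟨h3, h4⟩ => ?_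
    have S5 : Same [] [vIter] υ (υ.setInt vIter 0 (k + 1)) := Same.refl.setInt (by decide)
    refine ⟨by rw [h3.int _ (by decide)]; exact hi, h4.chain.count,
      (h1.trans h3 (by decide) (by decide)).setInt (by decide), h4.chain.of_same S5 (by decide)
        (by decide) (by decide), h4.res, h4.dir, h4.normSq⟩
  · exact H5.2.1
  · intro i hi τ hS hk
    simp [hk, hS.real aRes (by decide), H5.2.2.2.res i hi]
    rfl
  · rw [H6.1.int _ (by decide)]
    exact H5.2.1
  · intro i hi τ hS hk hl
    simp [hk, hS.real aRes (by decide), H6.1.real aRes (by decide), H5.2.2.2.res i hi,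
      hS.real xTotal (by decide), H6.2]
    rfl
  · simp
    nlinarith

end cg

end
end AdaptiveCalibration

namespace AdaptiveCalibration
noncomputable section
open Real Set

/-! ### The program: transition probabilities, sampling and updates -/

/-- The entry `vSearch` of a real array, and the next one. -/
def nextEntry (a : ℕ) : RExpr := .get a (ivar vSearch + 1)

/-- The chain is computed from the weights of the instances. -/
def rowProg : Prog :=
  forLoop vIndex vCount (block [
    letReal xAction ((entry aWeightOne vIndex + 1) / (entry aWeight vIndex + 2)),
    letInt vSearch 0,
    .loop (.neg (.leReal (rvar xAction) (nextEntry aPoint))) (letInt vSearch (ivar vSearch + 1)),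
    .setInt aRow (ivar vIndex) (ivar vSearch),
    letReal xLeft ((nextEntry aPoint - rvar xAction) / (nextEntry aPoint * (1 - nextEntry aPoint))),
    letReal xRight ((rvar xAction - entry aPoint vSearch) /
      (entry aPoint vSearch * (1 - entry aPoint vSearch))),
    letEntry aProb vIndex (rvar xLeft / (rvar xLeft + rvar xRight))])

/-- Each row index is found by linear search, within the quadratic budget of conjugate gradients.
The invariant that all smaller indices fail identifies the first success with the infimum in
`rowIndex`; `hex` keeps the search inside the array. -/
lemma Ter.rowProg {M : ℕ} {σ : Store} {g w w1 : ℕ → ℝ} (hM : σ.int vCount 0 = M)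
    (hg : ∀ i < M, σ.real aPoint i = g i) (hw : ∀ i < M, σ.real aWeight i = w i)
    (hw1 : ∀ i < M, σ.real aWeightOne i = w1 i)
    (hex : ∀ i < M, ∃ j, j + 1 < M ∧ (w1 i + 1) / (w i + 2) ≤ g (j + 1)) :
    Ter rowProg σ ((M + 1) * ((M + 1) * 150)) fun τ =>
      Same [xAction, xLeft, xRight, aProb] [vIndex, vSearch, aRow] σ τ ∧
      HoldsChain M (fun i => rowIndex g ((w1 i + 1) / (w i + 2)))
        (fun i => leftProb ((w1 i + 1) / (w i + 2)) (g (rowIndex g ((w1 i + 1) / (w i + 2))))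
          (g (rowIndex g ((w1 i + 1) / (w i + 2)) + 1))) τ := by
  set act : ℕ → ℝ := fun i => (w1 i + 1) / (w i + 2) with hact
  refine ((Ter.forLoop (B := (M + 1) * 120) (J := fun k τ =>
    Same [xAction, xLeft, xRight, aProb] [vIndex, vSearch, aRow] σ τ ∧
    (∀ i < k, τ.int aRow i = rowIndex g (act i)) ∧ ∀ i < k, τ.real aProb i =
      leftProb (act i) (g (rowIndex g (act i))) (g (rowIndex g (act i) + 1))) (by decide) hM
    ⟨Same.refl.setInt (by decide), by simp, by simp⟩ ?_).imp ?_).mono ?_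
  · rintro i hi τ ⟨hS, hr, hp⟩ hk hn
    obtain ⟨j, hj, hle⟩ := hex i hi
    have eg : ∀ {υ : Store}, Same [xAction] [vSearch] τ υ → ∀ k < M, υ.real aPoint k = g k := by
      intro υ h k hk
      rw [h.real _ (by decide), hS.real _ (by decide), hg k hk]
    have S1 : Same [xAction] [vSearch] τ ((τ.setReal xAction 0 (act i)).setInt vSearch 0 0) :=
      (Same.refl.setReal (by decide)).setInt (by decide)
    refine (Ter.cons_letReal (Ter.cons_letInt (Ter.cons (Ter.loop (N := M) (B := 7)
      (J := fun k υ => Same [xAction] [vSearch] τ υ ∧ υ.real xAction 0 = act i ∧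
        υ.int vSearch 0 = k ∧ ∀ l < k, ¬ act i ≤ g (l + 1)) ?_ ?_)
      fun υ H => Ter.cons_setInt (Ter.cons_letReal (Ter.cons_letReal (Ter.cons_letEntry
        (Ter.nil ?_))))))).mono ?_
    · have e : ((entry aWeightOne vIndex + 1) / (entry aWeight vIndex + 2)).eval τ = act i := by
        simp [hk, hS.real aWeight (by decide), hS.real aWeightOne (by decide), hw i hi, hw1 i hi,
          hact]
      rw [e]
      exact ⟨S1, by simp, by simp, by simp⟩
    · rintro k υ ⟨h1, h2, h3, h4⟩ hb
      have hkj : k ≤ j := by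
        by_contra hc
        exact h4 j (by omega) hle
      refine ⟨by omega, (Ter.letInt ?_).mono (by decide)⟩
      refine ⟨h1.setInt (by decide), h2, by simp [h3], fun l hl => ?_⟩
      rcases (Nat.lt_succ_iff.1 hl).eq_or_lt with rfl | hl
      · simpa [nextEntry, h2, h3, eg h1 _ (show l + 1 < M by omega)] using hb
      · exact h4 l hl
    · obtain ⟨k, -, ⟨h1, h2, h3, h4⟩, hb⟩ := H
      have hkj : k ≤ j := by
        by_contra hc
        exact h4 j (by omega) hle
      have hrow : rowIndex g (act i) = k := by
        have hb : act i ≤ g (k + 1) := by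
          simpa [nextEntry, h2, h3, eg h1 _ (show k + 1 < M by omega)] using hb
        refine le_antisymm (Nat.sInf_le hb) ?_
        by_contra hc
        exact h4 _ (not_le.1 hc) (Nat.sInf_mem (s := {j | act i ≤ g (j + 1)}) ⟨k, hb⟩)
      have hk' : υ.int vIndex 0 = i := by rw [h1.int _ (by decide), hk]
      have hn' : υ.int vCount 0 = M := by rw [h1.int _ (by decide), hn]
      have e1 := eg h1 (k + 1) (by omega)
      have e2 := eg h1 k (by omega)
      refine ⟨by simpa using hk', by simpa using hn', ?_, fun l hl => ?_, fun l hl => ?_⟩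
      · exact (((((hS.trans h1 (by decide) (by decide)).setInt (by decide)).setReal
          (by decide)).setReal (by decide)).setReal (by decide)).setInt (by decide)
      · rcases (Nat.lt_succ_iff.1 hl).eq_or_lt with rfl | hl
        · simp [hk', h3, hrow]
        · simp [hk', hl.ne, h1.int aRow (by decide), hr l hl]
      · rcases (Nat.lt_succ_iff.1 hl).eq_or_lt with rfl | hl
        · simp [hk', h3, hrow, nextEntry, e1, e2, h2, leftProb]
        · simp [hk', hl.ne, h1.real aProb (by decide), hp l hl]
    · simp [nextEntry]
      omega
  · rintro τ ⟨-, hn, hS, h1, h2⟩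
    exact ⟨hS, hn, h1, h2⟩
  · nlinarith

/-- The prediction is found by inversion of the distribution function. -/
def sampleProg : Prog :=
  block [letInt vSearch 0, letReal xPrefix (.get aMass 0),
    .loop (.neg (.leReal (.get 0 2) (rvar xPrefix))) (block [
      letInt vSearch (ivar vSearch + 1),
      letReal xPrefix (rvar xPrefix + entry aMass vSearch)]),
    .setReal 0 3 (entry aPoint vSearch)]

/-- The search stops at the first prefix sum that reaches `u`, at the latest at the total mass. -/
lemma Ter.sampleProg {M : ℕ} {σ : Store} {w : ℕ → ℝ} {u : ℝ} (hM : 0 < M)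
    (hw : ∀ i < M, σ.real aMass i = w i) (hu : σ.real 0 2 = u) (hu0 : 0 < u)
    (hsum : u ≤ ∑ i ∈ Finset.range M, w i) :
    Ter sampleProg σ ((M + 1) * 60) fun τ => Same [0, xPrefix] [vSearch] σ τ ∧
      (∀ a, a ≠ 3 → τ.real 0 a = σ.real 0 a) ∧
      ∃ k < M, τ.real 0 3 = σ.real aPoint k ∧ ∑ i ∈ Finset.range k, w i < u ∧
        u ≤ ∑ i ∈ Finset.range (k + 1), w i := by
  refine (Ter.cons_letInt (Ter.cons_letReal (Ter.cons (Ter.loop (N := M) (B := 16)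
    (J := fun k τ => Same [xPrefix] [vSearch] σ τ ∧ τ.int vSearch 0 = k ∧ k < M ∧
      τ.real xPrefix 0 = ∑ i ∈ Finset.range (k + 1), w i ∧ ∑ i ∈ Finset.range k, w i < u)
    ?_ ?_) fun τ H => Ter.cons_setReal (Ter.nil ?_)))).mono ?_
  · refine ⟨(Same.refl.setInt (by decide)).setReal (by decide), by simp, hM, by simp [hw 0 hM],
      by simpa using hu0⟩
  · rintro k τ ⟨h1, h2, h3, h4, h5⟩ hb
    have hb : ∑ i ∈ Finset.range (k + 1), w i < u := by
      simpa [h1.real 0 (by decide), hu, h4] using hb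
    have hk : k + 1 < M := by
      by_contra hc
      have : k + 1 = M := by omega
      rw [this] at hb
      exact absurd hsum (not_le.2 hb)
    refine ⟨h3, (Ter.cons_letInt (Ter.cons_letReal (Ter.nil ?_))).mono (by decide)⟩
    refine ⟨(h1.setInt (by decide)).setReal (by decide), by simp [h2], hk, ?_, hb⟩
    rw [Finset.sum_range_succ _ (k + 1)]
    simp [h2, h4, h1.real aMass (by decide), hw (k + 1) hk]
  · obtain ⟨k, -, ⟨h1, h2, h3, h4, h5⟩, hb⟩ := H
    refine ⟨(h1.mono (by decide) (by decide)).setReal (by decide), fun a ha => ?_, k, h3, ?_, h5, ?_⟩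
    · simp [ha, h1.real 0 (by decide)]
    · simp [h2, h1.real aPoint (by decide)]
    · simpa [h1.real 0 (by decide), hu, h4] using hb
  · simp
    omega

/-- The last outcome is fed to the instances. -/
def updateProg : Prog :=
  block [
    mapTo aWeight vIndex vCount (entry aWeight vIndex + entry aMass vIndex),
    mapTo aWeightOne vIndex vCount
      (entry aWeightOne vIndex + entry aMass vIndex * .ofInt (.get 0 1)),
    letInt vOnes (ivar vOnes + .get 0 1)]

lemma Ter.updateProg {M : ℕ} {σ : Store} (hM : σ.int vCount 0 = M) :
    Ter updateProg σ ((M + 1) * 80) fun τ => Same [aWeight, aWeightOne] [vIndex, vOnes] σ τ ∧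
      (∀ i < M, τ.real aWeight i = σ.real aWeight i + σ.real aMass i) ∧
      (∀ i < M, τ.real aWeightOne i = σ.real aWeightOne i + σ.real aMass i * σ.int 0 1) ∧
      τ.int vOnes 0 = σ.int vOnes 0 + σ.int 0 1 := by
  refine (Ter.cons (Ter.mapTo (N := M) (fun i => σ.real aWeight i + σ.real aMass i) (by decide)
    hM ?_) fun σ1 H1 => Ter.cons (Ter.mapTo (N := M)
      (fun i => σ.real aWeightOne i + σ.real aMass i * σ.int 0 1) (by decide) ?_ ?_) fun σ2 H2 =>
      have S2 := H1.1.append H2.1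
      Ter.cons_letInt (Ter.nil ?_)).mono ?_
  · intro i hi τ hS hk hl
    simp [hk, hl i le_rfl, hS.real aMass (by decide)]
  · rw [H1.1.int _ (by decide)]
    exact hM
  · intro i hi τ hS hk hl
    simp [hk, hl i le_rfl, hS.real aMass (by decide), H1.1.real aMass (by decide),
      H1.1.real aWeightOne (by decide), hS.int 0 (by decide), H1.1.int 0 (by decide)]
  · refine ⟨(S2.mono (by decide) (by decide)).setInt (by decide), fun i hi => ?_, fun i hi => ?_, ?_⟩
    · simp [H2.1.real aWeight (by decide), H1.2.1 i hi]
    · simp [H2.2.1 i hi]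
    · simp [S2.int 0 (by decide), S2.int vOnes (by decide)]
  · simp
    omega

end
end AdaptiveCalibration

namespace AdaptiveCalibration
noncomputable section
open Real Set

/-! ### The program: the partition of an epoch -/

/-- The function `θ`. -/
def RExpr.theta (e : RExpr) : RExpr := 2 * .arcsin (.sqrt e)

@[simp] lemma RExpr.eval_theta (σ : Store) (e : RExpr) :
    e.theta.eval σ = AdaptiveCalibration.theta (e.eval σ) := by
  simp [RExpr.theta, AdaptiveCalibration.theta]

@[simp] lemma RExpr.cost_theta (e : RExpr) : e.theta.cost = e.cost + 5 := by
  simp [RExpr.theta]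
  ring

/-- The memory holds the parameters. -/
structure HoldsParams (p : Params) (σ : Store) : Prop where
  horizon : σ.int 0 0 = p.T
  dev : σ.real 0 0 = p.C
  conf : σ.real 0 1 = p.ι

/-- The memory holds the shape of the partition of epoch `m`. -/
structure HoldsShape (p : Params) (m : ℕ) (v : ℝ) (σ : Store) : Prop extends HoldsParams p σ where
  length : σ.int vLength 0 = 2 ^ m
  pi : σ.real xPi 0 = π
  bottom : σ.real xBottom 0 = theta p.eta
  top : σ.real xTop 0 = theta (1 - p.eta)
  radius : σ.real xRadius 0 = p.radius m
  innerLo : σ.real xInnerLo 0 = p.innerLo m v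
  innerHi : σ.real xInnerHi 0 = p.innerHi m v

/-- The smallest prediction. -/
def etaExpr : RExpr := 1 / (.ofInt (.get 0 0) + 1)

/-- The shape of the partition; an empty epoch before the first one counts as one round. -/
def shapeProg : Prog :=
  block [
    letInt vLength (ivar vLength + (1 - ivar vLength)),
    letReal xMean (.ofInt (ivar vOnes) / .ofInt (ivar vLength)),
    letReal xPi (2 * .arcsin 1),
    letReal xRadius (2 * rvar xPi * .sqrt ((.get 0 1 + .get 0 0) / .ofInt (ivar vLength))),
    letInt vLength (ivar vLength + ivar vLength),
    letInt vRemaining (ivar vLength),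
    letReal xBottom etaExpr.theta,
    letReal xTop (1 - etaExpr).theta,
    letReal xInnerLo (((rvar xMean).theta - 2 * rvar xRadius).max (rvar xBottom)),
    letReal xInnerHi (((rvar xMean).theta + 2 * rvar xRadius).min (rvar xTop))]

/-- `H` is the length of the preceding epoch. Before the first epoch the stored length is zero and
is replaced by one, consistently with `2 ^ (1 - 1)`; doubling then gives the new length. -/
lemma Ter.shapeProg {p : Params} {m : ℕ} {v : ℝ} {σ : Store} (h : HoldsParams p σ) {H : ℕ}
    (hH : σ.int vLength 0 + (1 - σ.int vLength 0) = H) (hm : H + H = 2 ^ m)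
    (hH' : (H : ℝ) = 2 ^ (m - 1)) (hv : (σ.int vOnes 0 : ℝ) / H = v) :
    Ter shapeProg σ 400 fun τ =>
      Same [xMean, xPi, xRadius, xBottom, xTop, xInnerLo, xInnerHi] [vLength, vRemaining] σ τ ∧
      HoldsShape p m v τ ∧ τ.int vRemaining 0 = 2 ^ m := by
  have h1 := h.horizon
  have h2 := h.dev
  have h3 := h.conf
  have hπ : 2 * (π / 2) = π := by ring
  refine (Ter.cons_letInt (Ter.cons_letReal (Ter.cons_letReal (Ter.cons_letReal (Ter.cons_letInt
    (Ter.cons_letInt (Ter.cons_letReal (Ter.cons_letReal (Ter.cons_letReal (Ter.cons_letReal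
    (Ter.nil ?_))))))))))).mono (by simp [etaExpr])
  refine ⟨?_, ⟨⟨?_, ?_, ?_⟩, ?_, ?_, ?_, ?_, ?_, ?_, ?_⟩, ?_⟩
  · repeat first
      | exact Same.refl
      | refine Same.setReal ?_ (by decide)
      | refine Same.setInt ?_ (by decide)
  all_goals simp [etaExpr, h1, h2, h3, hH, hm, ← hv, hH', Params.eta, Params.radius, Params.innerLo,
    Params.innerHi, hπ]

/-- The variable `v` is increased until a condition holds. -/
lemma Ter.countLoop {v k₀ : ℕ} {b : BExpr} {σ : Store} (x : ℝ) (h0 : σ.int v 0 = k₀)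
    (hb : ∀ k τ, Same [] [v] σ τ → τ.int v 0 = k → (b.holds τ ↔ x ≤ k)) :
    Ter (.loop (.neg b) (AdaptiveCalibration.letInt v (ivar v + 1))) σ ((⌈x⌉₊ + 1) * (b.cost + 8)) fun τ =>
      Same [] [v] σ τ ∧ τ.int v 0 = max k₀ ⌈x⌉₊ := by
  -- The counter may start above the ceiling, so it is bounded by the ceiling only once a pass has
  -- been made.
  refine ((Ter.loop (N := ⌈x⌉₊) (B := 6) (J := fun i τ => Same [] [v] σ τ ∧ τ.int v 0 = k₀ + i ∧
    (i = 0 ∨ k₀ + i ≤ ⌈x⌉₊)) ⟨Same.refl, by simpa using h0, Or.inl rfl⟩ ?_).mono ?_).imp ?_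
  · rintro i τ ⟨h1, h2, h3⟩ hc
    rw [BExpr.holds_neg, hb _ τ h1 h2, not_le, ← Nat.lt_ceil] at hc
    refine ⟨by omega, (Ter.letInt ?_).mono (by simp)⟩
    exact ⟨h1.setInt (by simp), by simp [h2, add_assoc], Or.inr (by omega)⟩
  · simp
  · rintro τ ⟨i, -, ⟨h1, h2, h3⟩, hc⟩
    rw [BExpr.holds_neg, hb _ τ h1 h2, not_not, ← Nat.ceil_le] at hc
    refine ⟨h1, ?_⟩
    rcases h3 with rfl | h3 <;> omega

/-- The numbers of bands and of pieces. -/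
def countProg : Prog :=
  block [
    letInt vBands 0,
    letInt vPower 1,
    .loop (.neg (.leInt (.get 0 0) (ivar vPower))) (block [
      letInt vPower (ivar vPower + ivar vPower), letInt vBands (ivar vBands + 1)]),
    letInt vOuter 2,
    .loop (.neg (.leReal (1 + .get 0 0) (.ofInt (ivar vOuter) * .ofInt (ivar vOuter) *
      .ofInt (ivar vOuter) * (.log (.ofInt (.get 0 0)) * .log (.ofInt (.get 0 0))))))
      (letInt vOuter (ivar vOuter + 1)),
    letInt vPieces 0,
    .loop (.neg (.leReal (.ofInt (ivar vLength) * ((rvar xInnerHi - rvar xInnerLo) *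
        (rvar xInnerHi - rvar xInnerLo))) (.ofInt (ivar vPieces) * .ofInt (ivar vPieces) *
      .ofInt (ivar vPieces) * .get 0 1))) (letInt vPieces (ivar vPieces + 1)),
    .loop (.neg (.leReal (2 * (rvar xInnerHi - rvar xInnerLo))
      (.ofInt (ivar vPieces) * rvar xPi))) (letInt vPieces (ivar vPieces + 1))]

/-- The memory holds the numbers of bands and of pieces. -/
structure HoldsCounts (p : Params) (m : ℕ) (v : ℝ) (σ : Store) : Prop
    extends HoldsShape p m v σ where
  bands : σ.int vBands 0 = Nat.clog 2 p.T
  power : σ.int vPower 0 = 2 ^ Nat.clog 2 p.T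
  outer : σ.int vOuter 0 = p.outerCount
  pieces : σ.int vPieces 0 = p.innerCount m v

lemma HoldsShape.of_same {p : Params} {m : ℕ} {v : ℝ} {σ τ : Store} (h : HoldsShape p m v σ)
    {R I : List ℕ} (hS : Same R I σ τ)
    (hR : ∀ a ∈ [0, xPi, xBottom, xTop, xRadius, xInnerLo, xInnerHi], a ∉ R)
    (hI : ∀ a ∈ [0, vLength], a ∉ I) : HoldsShape p m v τ := by
  refine ⟨⟨?_, ?_, ?_⟩, ?_, ?_, ?_, ?_, ?_, ?_, ?_⟩
  · rw [hS.int _ (hI _ (by decide))]; exact h.horizon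
  · rw [hS.real _ (hR _ (by decide))]; exact h.dev
  · rw [hS.real _ (hR _ (by decide))]; exact h.conf
  · rw [hS.int _ (hI _ (by decide))]; exact h.length
  · rw [hS.real _ (hR _ (by decide))]; exact h.pi
  · rw [hS.real _ (hR _ (by decide))]; exact h.bottom
  · rw [hS.real _ (hR _ (by decide))]; exact h.top
  · rw [hS.real _ (hR _ (by decide))]; exact h.radius
  · rw [hS.real _ (hR _ (by decide))]; exact h.innerLo
  · rw [hS.real _ (hR _ (by decide))]; exact h.innerHi

/-- Comparison with a real number whose cube is known. -/
lemma le_natCast_iff_cube {x c d : ℝ} (hx : 0 ≤ x) (hd : 0 < d) (hc : x ^ 3 * d = c) (k : ℕ) :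
    c ≤ k * k * k * d ↔ x ≤ k := by
  have e : (k : ℝ) * k * k = k ^ 3 := by ring
  rw [← hc, e, mul_le_mul_iff_left₀ hd]
  exact pow_le_pow_iff_left₀ hx (Nat.cast_nonneg k) (by norm_num)

/-- Rounding reals to integers is impossible, so the ceilings are found by counting up, with cubes
compared instead of cube roots. Two consecutive loops on one counter yield the maximum of two
ceilings. The cost stays linear because the counted numbers are themselves bounded by the size of
the partition. -/
lemma Ter.countProg {p : Params} (hp : p.Good) {m : ℕ} (hm : 2 ^ (m - 1) ≤ p.T) {v : ℝ}
    {σ : Store} (h : HoldsShape p m v σ) :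
    Ter countProg σ (p.size m v * 300) fun τ =>
      Same [] [vBands, vPower, vOuter, vPieces] σ τ ∧ HoldsCounts p m v τ := by
  have hι : 0 < p.ι := by linarith [hp.one_le]
  have hlog : 0 < log p.T := by linarith [hp.log_T_ge, log_two_gt_d9]
  have hC := hp.C_nonneg
  have S0 : Same [] [vBands, vPower] σ ((σ.setInt vBands 0 0).setInt vPower 0 1) :=
    (Same.refl.setInt (by decide)).setInt (by decide)
  refine (Ter.cons_letInt (Ter.cons_letInt (Ter.cons (Ter.loop (N := Nat.clog 2 p.T) (B := 15)
    (J := fun i τ => Same [] [vBands, vPower] σ τ ∧ τ.int vBands 0 = i ∧ τ.int vPower 0 = 2 ^ i ∧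
      i ≤ Nat.clog 2 p.T) ⟨S0, by simp, by simp, by simp⟩ ?_) fun σ1 H1 =>
    have S1 : Same [] [vBands, vPower] σ σ1 := H1.elim fun _ h => h.2.1.1
    have S1' : Same [] [vBands, vPower, vOuter] σ (σ1.setInt vOuter 0 (IExpr.eval σ1 2)) :=
      (S1.mono (by decide) (by decide)).setInt (by decide)
    Ter.cons_letInt (Ter.cons (Ter.countLoop (((1 + p.C) / log p.T ^ 2) ^ (1 / 3 : ℝ))
      (k₀ := 2) (by simp) ?_) fun σ2 H2 =>
    have S2' : Same [] [vBands, vPower, vOuter, vPieces] σ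
        (σ2.setInt vPieces 0 (IExpr.eval σ2 0)) :=
      ((S1'.append H2.1).mono (by decide) (by decide)).setInt (by decide)
    Ter.cons_letInt (Ter.cons (Ter.countLoop (p.innerReal m v) (k₀ := 0) (by simp) ?_) fun σ3 H3 =>
    have S3 : Same [] [vBands, vPower, vOuter, vPieces] σ σ3 :=
      S2'.trans H3.1 (by decide) (by decide)
    Ter.cons (Ter.countLoop (2 * (p.innerHi m v - p.innerLo m v) / π) H3.2 ?_) fun σ4 H4 =>
    have S4 : Same [] [vBands, vPower, vOuter, vPieces] σ σ4 :=
      S3.trans H4.1 (by decide) (by decide)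
    Ter.nil ?_))))).mono ?_
  · rintro i τ ⟨h1, h2, h3, h4⟩ hc
    have hT : τ.int 0 0 = p.T := by rw [h1.int _ (by decide)]; exact h.horizon
    have hlt : i < Nat.clog 2 p.T := by
      rw [Nat.lt_clog_iff_pow_lt one_lt_two]
      simpa [hT, h3] using hc
    refine ⟨hlt, (Ter.cons_letInt (Ter.cons_letInt (Ter.nil ?_))).mono (by decide)⟩
    exact ⟨(h1.setInt (by decide)).setInt (by decide), by simp [h2], by simp [h3]; ring, hlt⟩
  · intro k τ hS hk
    have G := h.of_same (S1'.append hS) (by decide) (by decide)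
    have hx : 0 ≤ (1 + p.C) / log p.T ^ 2 := by positivity
    rw [← le_natCast_iff_cube (d := log p.T ^ 2) (by positivity) (by positivity) rfl,
      rpow_third_cube hx, div_mul_cancel₀ _ (by positivity)]
    simp [G.horizon, G.dev, hk, sq]
  · intro k τ hS hk
    have G := h.of_same (S2'.append hS) (by decide) (by decide)
    rw [← le_natCast_iff_cube (hp.innerReal_pos hm v).le hι (hp.innerReal_cube hm v)]
    simp [G.length, G.innerLo, G.innerHi, G.conf, hk, sq]
  · intro k τ hS hk
    have G := h.of_same (S3.append hS) (by decide) (by decide)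
    rw [div_le_iff₀ pi_pos]
    simp [G.innerLo, G.innerHi, G.pi, hk]
  · refine ⟨S4, h.of_same S4 (by decide) (by decide), ?_, ?_, ?_, ?_⟩
    · obtain ⟨i, -, ⟨h1, h2, h3, h4⟩, h5⟩ := H1
      have hT : σ1.int 0 0 = p.T := by rw [h1.int _ (by decide)]; exact h.horizon
      have hi : i = Nat.clog 2 p.T := by
        refine le_antisymm h4 (Nat.clog_le_of_le_pow ?_)
        simpa [hT, h3] using h5
      simp [H4.1.int vBands (by decide), H3.1.int vBands (by decide), H2.1.int vBands (by decide),
        h2, hi]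
    · obtain ⟨i, -, ⟨h1, h2, h3, h4⟩, h5⟩ := H1
      have hT : σ1.int 0 0 = p.T := by rw [h1.int _ (by decide)]; exact h.horizon
      have hi : i = Nat.clog 2 p.T := by
        refine le_antisymm h4 (Nat.clog_le_of_le_pow ?_)
        simpa [hT, h3] using h5
      simp [H4.1.int vPower (by decide), H3.1.int vPower (by decide), H2.1.int vPower (by decide),
        h3, hi]
    · simp [H4.1.int vOuter (by decide), H3.1.int vOuter (by decide), H2.2, Params.outerCount,
        max_comm]
    · rw [H4.2, Nat.zero_max]
      rfl
  · have h1 : ⌈((1 + p.C) / log p.T ^ 2) ^ (1 / 3 : ℝ)⌉₊ ≤ p.outerCount := le_max_left _ _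
    have h2 : ⌈p.innerReal m v⌉₊ ≤ p.innerCount m v := le_max_left _ _
    have h3 : ⌈2 * (p.innerHi m v - p.innerLo m v) / π⌉₊ ≤ p.innerCount m v := le_max_right _ _
    have h4 := p.two_le_outerCount
    have h5 : p.outerCount ≤ (Nat.clog 2 p.T + 1) * p.outerCount :=
      Nat.le_mul_of_pos_left _ (by omega)
    have h6 : Nat.clog 2 p.T + 1 ≤ (Nat.clog 2 p.T + 1) * p.outerCount :=
      Nat.le_mul_of_pos_right _ (by omega)
    have h7 : p.size m v = p.innerCount m v + 2 * ((Nat.clog 2 p.T + 1) * p.outerCount) + 2 := by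
      unfold Params.size
      ring
    simp only [one_div] at h1
    simp
    rw [h7]
    omega

end
end AdaptiveCalibration

namespace AdaptiveCalibration
noncomputable section
open Real Set

/-! ### The program: the nodes of the partition -/

/-- The nodes in the interval from `xLeft` to `xRight`, cut into `n` pieces. -/
def appendProg (n : ℕ) : Prog :=
  .ite (.leReal (rvar xRight) (rvar xLeft)) (block []) (block [
    forLoop vIndex n (.setReal aNode (ivar vLast + ivar vIndex + 1)
      (rvar xLeft + .ofInt (ivar vIndex + 1) / .ofInt (ivar n) * (rvar xRight - rvar xLeft))),
    letInt vLast (ivar vLast + ivar n)])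

def leftProg : Prog :=
  block [
    letReal xLeft ((rvar xInnerLo - (rvar xPower + rvar xPower - 1) * rvar xRadius).max
      (rvar xBottom)),
    letReal xRight ((rvar xInnerLo - (rvar xPower - 1) * rvar xRadius).min (rvar xTop)),
    appendProg vOuter,
    letReal xPower (rvar xPower / 2)]

def rightProg : Prog :=
  block [
    letReal xLeft ((rvar xInnerHi + (rvar xPower - 1) * rvar xRadius).max (rvar xBottom)),
    letReal xRight ((rvar xInnerHi + (rvar xPower + rvar xPower - 1) * rvar xRadius).min
      (rvar xTop)),
    appendProg vOuter,
    letReal xPower (rvar xPower + rvar xPower)]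

def nodeProg : Prog :=
  block [
    letInt vLast 0,
    letReal aNode (rvar xBottom),
    letReal xPower (.ofInt (ivar vPower)),
    letInt vBands (ivar vBands + 1),
    forLoop vBand vBands leftProg,
    letReal xLeft (rvar xInnerLo),
    letReal xRight (rvar xInnerHi),
    appendProg vPieces,
    letReal xPower 1,
    forLoop vBand vBands rightProg,
    letInt vCount (ivar vLast + 1)]

def gridProg : Prog :=
  block [
    mapTo aPoint vIndex vCount (.sin (entry aNode vIndex / 2) * .sin (entry aNode vIndex / 2)),
    mapTo aWeight vIndex vCount 0,
    mapTo aWeightOne vIndex vCount 0,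
    letInt vOnes 0]

/-- The memory holds a list of nodes. -/
structure HoldsNodes (s : ℕ × (ℕ → ℝ)) (σ : Store) : Prop where
  last : σ.int vLast 0 = s.1
  node : ∀ k ≤ s.1, σ.real aNode k = s.2 k

lemma HoldsNodes.of_same {s : ℕ × (ℕ → ℝ)} {σ τ : Store} (h : HoldsNodes s σ) {R I : List ℕ}
    (hS : Same R I σ τ) (h1 : vLast ∉ I) (h2 : aNode ∉ R) : HoldsNodes s τ := by
  refine ⟨?_, ?_⟩
  · rw [hS.int _ h1]; exact h.last
  · rw [hS.real _ h2]; exact h.node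

lemma Ter.appendProg {n N : ℕ} {s : ℕ × (ℕ → ℝ)} {σ : Store} (h : HoldsNodes s σ)
    (hn : n ≠ vIndex) (hN : σ.int n 0 = N) :
    Ter (appendProg n) σ ((N + 1) * 80) fun τ => Same [aNode] [vIndex, vLast] σ τ ∧
      HoldsNodes (appendBlock (σ.real xLeft 0) (σ.real xRight 0) N s) τ := by
  set l := σ.real xLeft 0
  set u := σ.real xRight 0
  refine (Ter.ite (B := (N + 1) * 55 + 9) (fun hb => (Ter.nil ?_).mono (by omega)) fun hb => ?_).mono
    (by simp; try omega)
  · have hb : ¬ l < u := by simpa using hb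
    exact ⟨Same.refl, by rw [appendBlock, if_neg hb]; exact h⟩
  · have hb : l < u := by simpa using hb
    rw [appendBlock, if_pos hb]
    refine (Ter.cons (Ter.forLoop (B := 35) (N := N) (J := fun k τ => Same [aNode] [vIndex] σ τ ∧
      (∀ i ≤ s.1, τ.real aNode i = s.2 i) ∧
      ∀ i < k, τ.real aNode (s.1 + i + 1) = l + ((i + 1 : ℕ) : ℝ) / N * (u - l))
      hn hN ⟨Same.refl.setInt (by decide), h.node, by simp⟩ ?_) fun τ H =>
      Ter.cons_letInt (Ter.nil ?_)).mono (by simp)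
    · rintro k hk τ ⟨h1, h2, h3⟩ hi hn
      have e1 : τ.int vLast 0 = s.1 := by rw [h1.int _ (by decide)]; exact h.last
      refine (Ter.setReal ?_).mono (by simp)
      refine ⟨hi, hn, (h1.setReal (by decide)).setInt (by decide), fun i hi' => ?_, fun i hi' => ?_⟩
      · have : i ≠ s.1 + k + 1 := by omega
        simp [e1, hi, this, h2 i hi']
      · rcases (Nat.lt_succ_iff.1 hi').eq_or_lt with rfl | hlt
        · simp [e1, hi, hn, h1.real xLeft (by decide), h1.real xRight (by decide), l, u]
        · have h3 := h3 i hlt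
          push_cast at h3
          simp [e1, hi, hlt.ne, h3]
    · obtain ⟨_, h2, h3, h4, h5⟩ := H
      refine ⟨(h3.mono (by decide) (by decide)).setInt (by decide), ?_, fun k hk => ?_⟩
      · simp [h2, h3.int vLast (by decide), h.last]
      · simp only [Store.real_setInt]
        split_ifs with hks
        · exact h4 k hks
        · obtain ⟨i, rfl⟩ := Nat.exists_eq_add_of_le (not_le.1 hks)
          have hk : s.1 + 1 + i ≤ s.1 + N := hk
          have e : s.1 + 1 + i = s.1 + i + 1 := by omega
          have e' : s.1 + i + 1 - s.1 = i + 1 := by omega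
          rw [e, h5 i (by omega), e']

section
variable {p : Params} {m : ℕ} {v : ℝ} {σ : Store}

lemma Ter.leftProg (h : HoldsShape p m v σ) (ho : σ.int vOuter 0 = p.outerCount) {i : ℕ}
    (hi : i ≤ Nat.clog 2 p.T) (hn : HoldsNodes (p.leftNodes m v i) σ)
    (hx : σ.real xPower 0 = 2 ^ Nat.clog 2 p.T / 2 ^ i) :
    Ter leftProg σ ((p.outerCount + 1) * 400) fun τ =>
      Same [aNode, xLeft, xRight, xPower] [vIndex, vLast] σ τ ∧
      HoldsNodes (p.leftNodes m v (i + 1)) τ ∧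
      τ.real xPower 0 = 2 ^ Nat.clog 2 p.T / 2 ^ (i + 1) := by
  set Q := Nat.clog 2 p.T
  -- Bands come outermost first, so the power of two is obtained by halving the real number `2^Q`.
  have hQ : (2 : ℝ) ^ Q / 2 ^ i = 2 ^ (Q - i) := by
    rw [pow_sub₀ _ two_ne_zero hi, div_eq_mul_inv]
  refine (Ter.cons_letReal (Ter.cons_letReal (Ter.cons (Ter.appendProg (s := p.leftNodes m v i)
    (N := p.outerCount) ?_ (by decide) ?_) fun τ H =>
    Ter.cons_letReal (Ter.nil ?_)))).mono ?_
  · exact ⟨by simpa using hn.last, by simpa using hn.node⟩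
  · simpa using ho
  · obtain ⟨h1, h2⟩ := H
    refine ⟨?_, ?_, ?_⟩
    · refine Same.setReal ?_ (by decide)
      exact ((Same.refl.setReal (by decide)).setReal (by decide)).trans h1 (by decide) (by decide)
    · suffices h : HoldsNodes (p.leftNodes m v (i + 1)) τ from
        ⟨h.last, fun k hk => by simpa using h.node k hk⟩
      have e : p.leftNodes m v (i + 1) = appendBlock (p.leftLo m v (Q - i)) (p.leftHi m v (Q - i))
        p.outerCount (p.leftNodes m v i) := rfl
      rw [e]
      convert h2 using 2
      · simp [h.innerLo, h.radius, h.bottom, hx, hQ, Params.leftLo, pow_succ, mul_two]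
      · simp [h.innerLo, h.radius, h.top, hx, hQ, Params.leftHi]
    · simp [h1.real xPower (by decide), hx]
      ring
  · simp
    omega

lemma Ter.rightProg (h : HoldsShape p m v σ) (ho : σ.int vOuter 0 = p.outerCount) {i : ℕ}
    (hn : HoldsNodes (p.rightNodes m v i) σ) (hx : σ.real xPower 0 = 2 ^ i) :
    Ter rightProg σ ((p.outerCount + 1) * 400) fun τ =>
      Same [aNode, xLeft, xRight, xPower] [vIndex, vLast] σ τ ∧
      HoldsNodes (p.rightNodes m v (i + 1)) τ ∧ τ.real xPower 0 = 2 ^ (i + 1) := by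
  refine (Ter.cons_letReal (Ter.cons_letReal (Ter.cons (Ter.appendProg (s := p.rightNodes m v i)
    (N := p.outerCount) ?_ (by decide) ?_) fun τ H =>
    Ter.cons_letReal (Ter.nil ?_)))).mono ?_
  · exact ⟨by simpa using hn.last, by simpa using hn.node⟩
  · simpa using ho
  · obtain ⟨h1, h2⟩ := H
    refine ⟨?_, ?_, ?_⟩
    · refine Same.setReal ?_ (by decide)
      exact ((Same.refl.setReal (by decide)).setReal (by decide)).trans h1 (by decide) (by decide)
    · suffices h : HoldsNodes (p.rightNodes m v (i + 1)) τ from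
        ⟨h.last, fun k hk => by simpa using h.node k hk⟩
      have e : p.rightNodes m v (i + 1) = appendBlock (p.rightLo m v i) (p.rightHi m v i)
        p.outerCount (p.rightNodes m v i) := rfl
      rw [e]
      convert h2 using 2
      · simp [h.innerHi, h.radius, h.bottom, hx, Params.rightLo]
      · simp [h.innerHi, h.radius, h.top, hx, Params.rightHi, pow_succ, mul_two]
    · simp [h1.real xPower (by decide), hx]
      ring
  · simp
    omega

lemma Ter.nodeProg (h : HoldsCounts p m v σ) :
    Ter nodeProg σ (p.size m v * (p.size m v * 800)) fun τ =>
      Same [aNode, xLeft, xRight, xPower] [vIndex, vLast, vBand, vBands, vCount] σ τ ∧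
      τ.int vCount 0 = (p.nodes m v).1 + 1 ∧
      ∀ k ≤ (p.nodes m v).1, τ.real aNode k = (p.nodes m v).2 k := by
  set Q := Nat.clog 2 p.T with hQ
  let R := [aNode, xLeft, xRight, xPower]
  let I := [vIndex, vLast, vBand, vBands]
  have hc : ∀ τ, Same R I σ τ → HoldsShape p m v τ ∧ τ.int vOuter 0 = p.outerCount ∧
      τ.int vPieces 0 = p.innerCount m v := fun τ hS => by
    refine ⟨h.toHoldsShape.of_same hS (by decide) (by decide), ?_, ?_⟩
    · rw [hS.int _ (by decide)]; exact h.outer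
    · rw [hS.int _ (by decide)]; exact h.pieces
  refine (Ter.cons_letInt (Ter.cons_letReal (Ter.cons_letReal (Ter.cons_letInt
    (Ter.cons (Ter.forLoop (N := Q + 1) (B := (p.outerCount + 1) * 400)
      (J := fun i τ => Same R I σ τ ∧
        HoldsNodes (p.leftNodes m v i) τ ∧ τ.real xPower 0 = 2 ^ Q / 2 ^ i)
      (by decide) ?_ ⟨?_, ⟨?_, ?_⟩, ?_⟩ ?_) fun σ1 H1 =>
    have S1 : Same R I σ ((σ1.setReal xLeft 0 ((rvar xInnerLo).eval σ1)).setReal xRight 0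
        ((rvar xInnerHi).eval (σ1.setReal xLeft 0 ((rvar xInnerLo).eval σ1)))) :=
      (H1.2.2.1.setReal (by decide)).setReal (by decide)
    Ter.cons_letReal (Ter.cons_letReal (Ter.cons (Ter.appendProg
      (s := p.leftNodes m v (Q + 1)) (N := p.innerCount m v) ⟨?_, ?_⟩ (by decide) ?_)
      fun σ2 H2 =>
    have S2 : Same R I σ σ2 := S1.trans H2.1 (by decide) (by decide)
    Ter.cons_letReal (Ter.cons (Ter.forLoop (N := Q + 1) (B := (p.outerCount + 1) * 400)
      (J := fun i τ => Same R I σ τ ∧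
        HoldsNodes (p.rightNodes m v i) τ ∧ τ.real xPower 0 = 2 ^ i)
      (by decide) ?_ ⟨?_, ⟨?_, ?_⟩, ?_⟩ ?_) fun σ3 H3 =>
    Ter.cons_letInt (Ter.nil ?_))))))))).mono ?_
  · simp [h.bands, Q]
  · repeat first
      | exact Same.refl
      | refine Same.setReal ?_ (by decide)
      | refine Same.setInt ?_ (by decide)
  · simp [Params.leftNodes]
  · simp [Params.leftNodes, h.bottom]
  · simp [h.power, Q]
  · rintro i hi τ ⟨h1, h2, h3⟩ hk hn
    obtain ⟨g1, g2, g3⟩ := hc τ h1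
    refine (Ter.leftProg g1 g2 (by omega) h2 h3).imp fun υ ⟨h4, h5, h6⟩ => ?_
    refine ⟨by rw [h4.int _ (by decide)]; exact hk, by rw [h4.int _ (by decide)]; exact hn,
      (h1.trans h4 (by decide) (by decide)).setInt (by decide), h5.of_same (R := []) (I := [vBand])
        (Same.refl.setInt (by decide)) (by decide) (by decide), h6⟩
  · obtain ⟨_, _, _, h2, _⟩ := H1
    simpa using h2.last
  · obtain ⟨_, _, _, h2, _⟩ := H1
    simpa using h2.node
  · exact (hc _ S1).2.2
  · simpa [H2.1.int vBands (by decide)] using H1.2.1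
  · exact (S2.setReal (by decide)).setInt (by decide)
  · have h2 := H2.2.last
    have g := (hc _ H1.2.2.1).1
    simpa [Params.rightNodes, Params.innerNodes, g.innerLo, g.innerHi] using h2
  · have h3 := H2.2.node
    have g := (hc _ H1.2.2.1).1
    simpa [Params.rightNodes, Params.innerNodes, g.innerLo, g.innerHi] using h3
  · simp
  · rintro i hi τ ⟨h1, h2, h3⟩ hk hn
    obtain ⟨g1, g2, g3⟩ := hc τ h1
    refine (Ter.rightProg g1 g2 h2 h3).imp fun υ ⟨h4, h5, h6⟩ => ?_
    refine ⟨by rw [h4.int _ (by decide)]; exact hk, by rw [h4.int _ (by decide)]; exact hn,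
      (h1.trans h4 (by decide) (by decide)).setInt (by decide), h5.of_same (R := []) (I := [vBand])
        (Same.refl.setInt (by decide)) (by decide) (by decide), h6⟩
  · obtain ⟨_, _, S3, N3, _⟩ := H3
    refine ⟨(S3.mono (by decide) (by decide)).setInt (by decide), ?_, N3.node⟩
    simp [N3.last, Params.nodes, Q]
  · have h4 := p.two_le_outerCount
    have h7 : p.size m v = p.innerCount m v + 2 * ((Q + 1) * p.outerCount) + 2 := by
      unfold Params.size
      ring
    -- Both the number of bands and the number of pieces per band are bounded by the size of the
    -- partition; the quadratic bound is crude but matches the cost of the linear algebra.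
    have h8 : (Q + 1 + 1) * ((p.outerCount + 1) * 400 + 20) ≤ p.size m v * (p.size m v * 300) := by
      have h5 : Q + 1 + 1 ≤ p.size m v := by nlinarith
      have h6 : (p.outerCount + 1) * 400 + 20 ≤ p.size m v * 300 := by nlinarith
      exact Nat.mul_le_mul h5 h6
    have h9 : 2 ≤ p.size m v := by omega
    simp
    nlinarith

lemma Ter.gridProg {n : ℕ} {h : ℕ → ℝ} (hM : σ.int vCount 0 = n)
    (hn : ∀ k < n, σ.real aNode k = h k) :
    Ter gridProg σ ((n + 1) * 150) fun τ => Same [aPoint, aWeight, aWeightOne] [vIndex, vOnes] σ τ ∧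
      (∀ k < n, τ.real aPoint k = psi (h k)) ∧ (∀ k < n, τ.real aWeight k = 0) ∧
      (∀ k < n, τ.real aWeightOne k = 0) ∧ τ.int vOnes 0 = 0 := by
  refine (Ter.cons (Ter.mapTo (N := n) (fun k => psi (h k)) (by decide) hM ?_) fun σ1 H1 =>
    Ter.cons (Ter.mapTo (N := n) 0 (by decide) ?_ ?_) fun σ2 H2 =>
    have S2 := H1.1.append H2.1
    Ter.cons (Ter.mapTo (N := n) 0 (by decide) ?_ ?_) fun σ3 H3 =>
    have S3 := S2.append H3.1
    Ter.cons_letInt (Ter.nil ?_)).mono ?_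
  · intro k hk τ hS hi _
    simp [hi, hS.real aNode (by decide), hn k hk, psi, sq]
  · rw [H1.1.int _ (by decide)]
    exact hM
  · intro k hk τ hS hi _
    simp
  · rw [S2.int _ (by decide)]
    exact hM
  · intro k hk τ hS hi _
    simp
  · refine ⟨(S3.mono (by decide) (by decide)).setInt (by decide), fun k hk => ?_, fun k hk => ?_,
      fun k hk => ?_, by simp⟩
    · simp [H3.1.real aPoint (by decide), H2.1.real aPoint (by decide), H1.2.1 k hk]
    · simp [H3.1.real aWeight (by decide), H2.2.1 k hk]
    · simp [H3.2.1 k hk]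
  · simp
    omega

end

end
end AdaptiveCalibration

namespace AdaptiveCalibration
noncomputable section
open Real Set

/-! ### The program: one round -/

/-- The beginning of an epoch. -/
def epochProg : Prog := block [shapeProg, countProg, nodeProg, gridProg]

/-- The last outcome is processed, and a new epoch is begun if the last one is over. -/
def prepareProg : Prog :=
  block [updateProg, .ite (.leInt (ivar vRemaining) 0) epochProg (block [])]

def roundProg : Prog :=
  block [
    prepareProg,
    rowProg,
    cgProg,
    sampleProg,
    letInt vRemaining (ivar vRemaining - 1)]

lemma HoldsParams.of_same {p : Params} {σ τ : Store} (h : HoldsParams p σ) {R I : List ℕ}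
    (hS : Same R I σ τ) (h1 : 0 ∉ R) (h2 : 0 ∉ I) : HoldsParams p τ := by
  refine ⟨?_, ?_, ?_⟩
  · rw [hS.int _ h2]; exact h.horizon
  · rw [hS.real _ h1]; exact h.dev
  · rw [hS.real _ h1]; exact h.conf

/-- The memory holds the state of epoch `m` before round `t` of that epoch. -/
structure HoldsEpoch (p : Params) (y : ℕ → Bool) (m t : ℕ) (σ : Store) : Prop
    extends HoldsParams p σ where
  count : σ.int vCount 0 = (p.nodes m (prevMean m y)).1 + 1
  length : σ.int vLength 0 = 2 ^ m
  ones : (σ.int vOnes 0 : ℝ) = ∑ τ ∈ Finset.Ico (2 ^ m - 2) t, bit (y τ)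
  point : ∀ k < (p.nodes m (prevMean m y)).1 + 1, σ.real aPoint k = p.point m (prevMean m y) k
  weight : ∀ k < (p.nodes m (prevMean m y)).1 + 1, σ.real aWeight k =
    weight (p.forecast y) (2 ^ m - 2) t (p.point m (prevMean m y) k)
  weightOne : ∀ k < (p.nodes m (prevMean m y)).1 + 1, σ.real aWeightOne k =
    weightOne (p.forecast y) y (2 ^ m - 2) t (p.point m (prevMean m y) k)

/-- The memory after round `t`. -/
structure HoldsRound (p : Params) (y : ℕ → Bool) (t : ℕ) (σ : Store) : Prop
    extends HoldsEpoch p y (epoch t) t σ where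
  remaining : σ.int vRemaining 0 = 2 ^ (epoch t + 1) - 2 - t - 1
  mass : ∀ k < (p.nodes (epoch t) (prevMean (epoch t) y)).1 + 1, σ.real aMass k =
    p.forecast y t (p.point (epoch t) (prevMean (epoch t) y) k)

section
variable {p : Params} {y : ℕ → Bool} {σ : Store} {B : ℕ}

lemma Ter.epochProg (hp : p.Good) {m : ℕ} (hm : 2 ^ (m - 1) ≤ p.T) {t : ℕ} (ht : t = 2 ^ m - 2)
    (hB : p.size m (prevMean m y) ≤ B) (h : HoldsParams p σ) {H : ℕ}
    (hH : σ.int vLength 0 + (1 - σ.int vLength 0) = H) (hH1 : H + H = 2 ^ m)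
    (hH2 : (H : ℝ) = 2 ^ (m - 1)) (hv : (σ.int vOnes 0 : ℝ) / H = prevMean m y) :
    Ter epochProg σ (B * (B * 2000)) fun τ => τ.real 0 = σ.real 0 ∧
      HoldsEpoch p y m t τ ∧ τ.int vRemaining 0 = 2 ^ m := by
  have hsz := p.nodes_fst_lt m (prevMean m y)
  refine (Ter.cons (Ter.shapeProg h hH hH1 hH2 hv) fun σ1 H1 =>
    Ter.cons (Ter.countProg hp hm H1.2.1) fun σ2 H2 =>
    Ter.cons (Ter.nodeProg H2.2) fun σ3 H3 =>
    have S3 := (H1.1.append H2.1).append H3.1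
    Ter.cons (Ter.gridProg (n := (p.nodes m (prevMean m y)).1 + 1)
      (h := (p.nodes m (prevMean m y)).2) H3.2.1 fun k hk => H3.2.2 k (by omega)) fun σ4 H4 =>
    have S4 := S3.append H4.1
    Ter.nil ?_).mono ?_
  · obtain ⟨g1, g2, g3, g4, g5⟩ := H4
    refine ⟨S4.real 0 (by decide), ⟨h.of_same S4 (by decide) (by decide), ?_, ?_, ?_, g2, ?_, ?_⟩, ?_⟩
    · rw [g1.int _ (by decide)]; exact H3.2.1
    · rw [g1.int _ (by decide), H3.1.int _ (by decide)]; exact H2.2.length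
    · simp [g5, ht]
    · intro k hk
      rw [g3 k hk, ht]
      simp [AdaptiveCalibration.weight]
    · intro k hk
      rw [g4 k hk, ht]
      simp [AdaptiveCalibration.weightOne]
    · rw [g1.int _ (by decide), H3.1.int _ (by decide), H2.1.int _ (by decide)]
      exact H1.2.2
  · nlinarith

/-- The first part of a round, after an earlier round. -/
lemma Ter.prepare_succ (hp : p.Good) {t : ℕ} (ht : t + 1 < p.T)
    (hB : ∀ m, 1 ≤ m → 2 ^ (m - 1) ≤ p.T → p.size m (prevMean m y) ≤ B)
    (h : HoldsRound p y t σ) (hbit : (σ.int 0 1 : ℝ) = bit (y t)) :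
    Ter prepareProg σ (B * (B * 2200)) fun τ => τ.real 0 = σ.real 0 ∧
      HoldsEpoch p y (epoch (t + 1)) (t + 1) τ ∧
      τ.int vRemaining 0 = 2 ^ (epoch (t + 1) + 1) - 2 - (t + 1) := by
  have hm := two_pow_epoch_pred_le (show t < p.T by omega)
  set m := epoch t with hmdef
  set v := prevMean m y with hv
  have hsz := p.nodes_fst_lt m v
  have hB0 := hB m (one_le_epoch t) hm
  refine (Ter.cons (Ter.updateProg h.count) fun σ1 H1 => ?_).mono
    (B := ((p.nodes m v).1 + 1 + 1) * 80 + (B * (B * 2000) + 19 + 1)) ?_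
  · obtain ⟨S1, w1, w2, o1⟩ := H1
    have P1 := h.toHoldsParams.of_same S1 (by decide) (by decide)
    have hlo : 2 ^ m - 2 ≤ t := epoch_start_le t
    have hhi : t + 2 < 2 ^ (m + 1) := lt_two_pow_epoch t
    have E1 : HoldsEpoch p y m (t + 1) σ1 := by
      refine ⟨P1, ?_, ?_, ?_, ?_, fun k hk => ?_, fun k hk => ?_⟩
      · rw [S1.int _ (by decide)]; exact h.count
      · rw [S1.int _ (by decide)]; exact h.length
      · rw [o1, Finset.sum_Ico_succ_top hlo, Nat.cast_add, hbit, h.ones]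
      · rw [S1.real _ (by decide)]; exact h.point
      · rw [w1 k hk, h.weight k hk, h.mass k hk, weight_succ hlo]
      · rw [w2 k hk, h.weightOne k hk, h.mass k hk, hbit, weightOne_succ hlo]
    have r1 : σ1.int vRemaining 0 = 2 ^ (m + 1) - 2 - t - 1 := by
      rw [S1.int _ (by decide)]; exact h.remaining
    refine Ter.cons (R := fun τ => τ.real 0 = σ.real 0 ∧ HoldsEpoch p y (epoch (t + 1)) (t + 1) τ ∧
      τ.int vRemaining 0 = 2 ^ (epoch (t + 1) + 1) - 2 - (t + 1)) (Ter.mono (Ter.ite (b := .leInt (ivar vRemaining) 0)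
      (B := B * (B * 2000) + 1) (fun hb => ?_) fun hb => ?_) (B' := B * (B * 2000) + 19) (by simp; omega)) fun τ hτ => (Ter.nil hτ).mono (B' := 1) le_rfl
    · have hrem : 2 ^ (m + 1) - 2 - t - 1 = 0 := by simpa [r1] using hb
      have he : epoch (t + 1) = m + 1 := epoch_eq (by omega) (by rw [pow_succ]; omega)
      have hm' := two_pow_epoch_pred_le ht
      have hp2 := Nat.one_le_two_pow (n := m)
      rw [he] at hm' ⊢
      refine ((Ter.epochProg (y := y) (t := t + 1) (B := B) hp hm' (by omega) (hB _ (by omega) hm') P1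
        (H := 2 ^ m) ?_ (by rw [pow_succ]; ring) (by simp) ?_).imp ?_).mono (by omega)
      · rw [E1.length]; omega
      · rw [E1.ones, prevMean, Nat.add_sub_cancel, show 2 ^ (m + 1) - 2 = t + 1 by omega]
        simp
      · rintro τ ⟨h1, h2, h3⟩
        refine ⟨h1.trans (S1.real _ (by decide)), h2, ?_⟩
        rw [h3, pow_succ 2 (m + 1)]
        omega
    · have hrem : 2 ^ (m + 1) - 2 - t - 1 ≠ 0 := by
        intro hc
        exact hb (by simp [r1, hc])
      have he : epoch (t + 1) = m := epoch_eq ((two_pow_epoch_le t).trans (by omega)) (by omega)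
      rw [he]
      exact (Ter.nil ⟨S1.real _ (by decide), E1, by omega⟩).mono (by omega)
  · nlinarith

/-- The zero memory needs no special treatment: there are no grid points to update, and no remaining
rounds, so the first epoch is begun with average outcome zero. -/
lemma Ter.prepare_zero (hp : p.Good)
    (hB : ∀ m, 1 ≤ m → 2 ^ (m - 1) ≤ p.T → p.size m (prevMean m y) ≤ B)
    (h : HoldsParams p σ) (h1 : σ.int vCount 0 = 0) (h2 : σ.int vLength 0 = 0)
    (h3 : σ.int vRemaining 0 = 0) (h4 : σ.int vOnes 0 = 0) (h5 : σ.int 0 1 = 0) :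
    Ter prepareProg σ (B * (B * 2200)) fun τ => τ.real 0 = σ.real 0 ∧
      HoldsEpoch p y (epoch 0) 0 τ ∧ τ.int vRemaining 0 = 2 ^ (epoch 0 + 1) - 2 - 0 := by
  have hm := two_pow_epoch_pred_le (show 0 < p.T by have := hp.two_le; omega)
  have he : epoch 0 = 1 := epoch_eq (by norm_num) (by norm_num)
  rw [he] at hm ⊢
  have hsz := p.nodes_fst_lt 1 (prevMean 1 y)
  have hB0 := hB 1 le_rfl hm
  refine (Ter.cons (Ter.updateProg h1) fun σ1 H1 => ?_).mono
    (B := (0 + 1) * 80 + (B * (B * 2000) + 19 + 1)) ?_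
  · obtain ⟨S1, w1, w2, o1⟩ := H1
    have P1 := h.of_same S1 (by decide) (by decide)
    refine Ter.cons (R := fun τ => τ.real 0 = σ.real 0 ∧ HoldsEpoch p y 1 0 τ ∧
      τ.int vRemaining 0 = 2 ^ (1 + 1) - 2 - 0) (Ter.mono (Ter.ite (b := .leInt (ivar vRemaining) 0)
      (B := B * (B * 2000) + 1) (fun hb => ?_) fun hb => ?_) (B' := B * (B * 2000) + 19) (by simp; omega)) fun τ hτ => (Ter.nil hτ).mono (B' := 1) le_rfl
    · refine ((Ter.epochProg (y := y) (t := 0) (B := B) hp hm (by norm_num) hB0 P1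
        (H := 1) ?_ (by norm_num) (by norm_num) ?_).imp ?_).mono (by omega)
      · rw [S1.int _ (by decide), h2]
      · rw [o1, h4, h5]
        simp [prevMean]
      · rintro τ ⟨g1, g2, g3⟩
        exact ⟨g1.trans (S1.real _ (by decide)), g2, by rw [g3]; norm_num⟩
    · refine absurd ?_ hb
      simp [S1.int vRemaining (by decide), h3]
  · nlinarith

end

end
end AdaptiveCalibration

namespace AdaptiveCalibration
noncomputable section
open Real Set

section
variable {p : Params} {y : ℕ → Bool} {σ : Store} {B : ℕ}

/-! ### Correctness of a round and the running time. -/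

lemma Params.Good.forecast_point (hp : p.Good) {t : ℕ} (ht : t < p.T) {k : ℕ}
    (hk : k < (p.nodes (epoch t) (prevMean (epoch t) y)).1 + 1) :
    p.forecast y t (p.point (epoch t) (prevMean (epoch t) y) k) =
      p.mass (p.forecast y) y t k := by
  rw [p.forecast_eq, hp.next_apply ht (Nat.lt_succ_iff.1 hk)]

/-- Partial sums of the masses, as probabilities. -/
lemma Params.Good.sum_filter_forecast (hp : p.Good) {t : ℕ} (ht : t < p.T) (q : ℝ → Prop)
    [DecidablePred q] {k : ℕ} (hk : k ≤ (p.nodes (epoch t) (prevMean (epoch t) y)).1 + 1)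
    (hq : ∀ i < (p.nodes (epoch t) (prevMean (epoch t) y)).1 + 1,
      q (p.point (epoch t) (prevMean (epoch t) y) i) ↔ i < k) :
    ∑ x ∈ (p.forecast y t).support with q x, p.forecast y t x =
      ∑ i ∈ Finset.range k, p.mass (p.forecast y) y t i := by
  have hs : (p.forecast y t).support ⊆ p.grid (epoch t) (prevMean (epoch t) y) := by
    rw [p.forecast_eq]
    exact hp.support_next ht
  rw [Finset.sum_filter, Finset.sum_subset hs fun x _ hx => by
    rw [Finsupp.notMem_support_iff.1 hx, ite_self], hp.sum_grid ht, ← Finset.sum_filter]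
  have e : (Finset.range ((p.nodes (epoch t) (prevMean (epoch t) y)).1 + 1)).filter
      (fun i => q (p.point (epoch t) (prevMean (epoch t) y) i)) = Finset.range k := by
    ext i
    rw [Finset.mem_filter, Finset.mem_range, Finset.mem_range]
    exact ⟨fun h => (hq i h.1).1 h.2, fun h => ⟨h.trans_le hk, (hq i (h.trans_le hk)).2 h⟩⟩
  rw [e]
  exact Finset.sum_congr rfl fun i hi =>
    hp.forecast_point ht ((Finset.mem_range.1 hi).trans_le hk)

/-- As the grid points increase with the index, values of the distribution function at grid points
are prefix sums of the masses. -/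
lemma Params.Good.isSample (hp : p.Good) {t : ℕ} (ht : t < p.T) {k : ℕ} {u : ℝ}
    (hk : k < (p.nodes (epoch t) (prevMean (epoch t) y)).1 + 1)
    (h1 : ∑ i ∈ Finset.range k, p.mass (p.forecast y) y t i < u)
    (h2 : u ≤ ∑ i ∈ Finset.range (k + 1), p.mass (p.forecast y) y t i) :
    IsSample (p.forecast y t) u (p.point (epoch t) (prevMean (epoch t) y) k) := by
  have hm := two_pow_epoch_pred_le ht
  set g := p.point (epoch t) (prevMean (epoch t) y)
  have hlt : ∀ i < (p.nodes (epoch t) (prevMean (epoch t) y)).1 + 1, g i < g k ↔ i < k := by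
    intro i hi
    constructor
    · intro h
      by_contra hc
      rcases (not_lt.1 hc).eq_or_lt with rfl | hlt
      · exact lt_irrefl _ h
      · exact lt_asymm h (hp.point_lt _ hm hlt (Nat.lt_succ_iff.1 hi))
    · intro h
      exact hp.point_lt _ hm h (Nat.lt_succ_iff.1 hk)
  have hle : ∀ i < (p.nodes (epoch t) (prevMean (epoch t) y)).1 + 1, g i ≤ g k ↔ i < k + 1 := by
    intro i hi
    constructor
    · intro h
      by_contra hc
      exact absurd (hp.point_lt _ hm (show k < i by omega) (Nat.lt_succ_iff.1 hi)) (not_lt.2 h)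
    · intro h
      rcases (Nat.lt_succ_iff.1 h).eq_or_lt with rfl | h
      · exact le_rfl
      · exact ((hlt i hi).2 h).le
  unfold IsSample
  rw [hp.sum_filter_forecast ht (fun x => x < g k) hk.le hlt,
    hp.sum_filter_forecast ht (fun x => x ≤ g k) hk hle]
  exact ⟨h1, h2⟩

/-- The stored weights give the actions through the Laplace form `action_eq`, so the machine's chain
is the chain of the forecaster and its vector is that of `mass`. -/
lemma Ter.finish (hp : p.Good) {t : ℕ} (ht : t < p.T)
    (hB : p.size (epoch t) (prevMean (epoch t) y) ≤ B) (h : HoldsEpoch p y (epoch t) t σ)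
    (hrem : σ.int vRemaining 0 = 2 ^ (epoch t + 1) - 2 - t) {u : ℝ} (hu : σ.real 0 2 = u)
    (hu0 : u ∈ Ioc (0 : ℝ) 1) :
    Ter (block [AdaptiveCalibration.rowProg, AdaptiveCalibration.cgProg,
      AdaptiveCalibration.sampleProg, AdaptiveCalibration.letInt vRemaining (ivar vRemaining - 1)]) σ
      (B * (B * 1500)) fun τ => HoldsRound p y t τ ∧ IsSample (p.forecast y t) u (τ.real 0 3) := by
  have hsz := p.nodes_fst_lt (epoch t) (prevMean (epoch t) y)
  have hD : ∀ τ < t, IsDist (p.forecast y τ) := fun τ hτ => hp.isDist_forecast y (hτ.trans ht)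
  have hact : ∀ s, (weightOne (p.forecast y) y (2 ^ epoch t - 2) t s + 1) /
      (weight (p.forecast y) (2 ^ epoch t - 2) t s + 2) = action (p.forecast y) y t s := fun s =>
    (action_eq fun τ hτ => ((hD τ (Finset.mem_Ico.1 hτ).2).mem_Icc s).1).symm
  have hrow := hp.row_spec (y := y) ht hD
  have hmass := hp.sum_mass (y := y) ht hD
  set m := epoch t
  set v := prevMean m y
  set M := (p.nodes m v).1 + 1 with hM
  refine (Ter.cons (Ter.rowProg h.count h.point h.weight h.weightOne ?_) fun σ1 H1 =>
    have C1 : HoldsChain M (p.row (p.forecast y) y t) (p.rowProb (p.forecast y) y t) σ1 := ?_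
    Ter.cons (Ter.cgProg (fun i _ => Nat.succ_lt_succ (hrow i).1) C1) fun σ2 H2 =>
    have S2 := H1.1.append H2.1
    Ter.cons (Ter.sampleProg (M := M) (w := p.mass (p.forecast y) y t) (u := u) (Nat.succ_pos _)
      H2.2 ?_ hu0.1 ?_) fun σ3 H3 =>
    have S3 := S2.append H3.1
    Ter.cons_letInt (Ter.nil ?_)).mono ?_
  · intro i hi
    refine ⟨p.row (p.forecast y) y t i, Nat.succ_lt_succ (hrow i).1, ?_⟩
    rw [hact]
    exact (hrow i).2.2
  · have := H1.2
    simp only [hact] at this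
    exact this
  · rw [S2.real _ (by decide)]
    exact hu
  · rw [hmass]
    exact hu0.2
  · obtain ⟨S, h0, k, hk, ho, h1, h2⟩ := H3
    have S4 := S3.append (Same.refl.setInt (R := []) (I := [vRemaining]) (τ := σ3) (a := vRemaining)
      (i := 0) (n := (ivar vRemaining - 1).eval σ3) (by decide))
    have hpt : σ2.real aPoint k = p.point m v k := by
      rw [S2.real _ (by decide)]
      exact h.point k hk
    refine ⟨⟨⟨⟨?_, ?_, ?_⟩, ?_, ?_, ?_, ?_, ?_, ?_⟩, ?_, fun i hi => ?_⟩, ?_⟩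
    · rw [S4.int _ (by decide)]; exact h.horizon
    · simp [h0 0 (by decide), S2.real 0 (by decide), h.dev]
    · simp [h0 1 (by decide), S2.real 0 (by decide), h.conf]
    · rw [S4.int _ (by decide)]; exact h.count
    · rw [S4.int _ (by decide)]; exact h.length
    · rw [S4.int _ (by decide)]; exact h.ones
    · rw [S4.real _ (by decide)]; exact h.point
    · rw [S4.real _ (by decide)]; exact h.weight
    · rw [S4.real _ (by decide)]; exact h.weightOne
    · simp [S3.int vRemaining (by decide), hrem, m]
    · rw [hp.forecast_point ht hi, Store.real_setInt, S.real _ (by decide), H2.2 i hi]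
      rfl
    · rw [Store.real_setInt, ho, hpt]
      exact hp.isSample ht hk h1 h2
  · simp
    have : M + 1 ≤ B := by omega
    have h1 : (M + 1) * (M + 1) ≤ B * B := Nat.mul_le_mul this this
    nlinarith

/-- One round of the program. -/
lemma Ter.roundProg {t : ℕ} {u : ℝ} (hp : p.Good) (ht : t < p.T)
    (hB : ∀ m, 1 ≤ m → 2 ^ (m - 1) ≤ p.T → p.size m (prevMean m y) ≤ B) (hu0 : u ∈ Ioc (0 : ℝ) 1)
    (h : (t = 0 ∧ σ = p.initialStore) ∨ ∃ s, t = s + 1 ∧ HoldsRound p y s σ) :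
    Ter roundProg (roundInput t y u σ) (B * (B * 3700)) fun τ =>
      HoldsRound p y t τ ∧ IsSample (p.forecast y t) u (τ.real 0 3) := by
  have hu : (roundInput t y u σ).real 0 2 = u := by simp [roundInput]
  have key : Ter prepareProg (roundInput t y u σ) (B * (B * 2200)) fun τ =>
      τ.real 0 = (roundInput t y u σ).real 0 ∧ HoldsEpoch p y (epoch t) t τ ∧
      τ.int vRemaining 0 = 2 ^ (epoch t + 1) - 2 - t := by
    rcases h with ⟨rfl, rfl⟩ | ⟨s, rfl, h⟩
    · refine Ter.prepare_zero hp hB ⟨?_, ?_, ?_⟩ ?_ ?_ ?_ ?_ ?_ <;>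
        simp [roundInput, Params.initialStore]
    · refine Ter.prepare_succ hp ht hB ⟨⟨⟨?_, ?_, ?_⟩, ?_, ?_, ?_, fun k hk => ?_, fun k hk => ?_,
        fun k hk => ?_⟩, ?_, fun k hk => ?_⟩ ?_
      · simpa [roundInput] using h.horizon
      · simpa [roundInput] using h.dev
      · simpa [roundInput] using h.conf
      · simpa [roundInput] using h.count
      · simpa [roundInput] using h.length
      · simpa [roundInput] using h.ones
      · simpa [roundInput] using h.point k hk
      · simpa [roundInput] using h.weight k hk
      · simpa [roundInput] using h.weightOne k hk
      · simpa [roundInput] using h.remaining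
      · simpa [roundInput] using h.mass k hk
      · simp [roundInput, bit]
  have hm := two_pow_epoch_pred_le ht
  refine (Ter.cons key fun τ H => Ter.finish (B := B) (u := u) hp ht
    (hB _ (one_le_epoch t) hm) H.2.1 H.2.2 (by rw [H.1, hu]) hu0).mono ?_
  nlinarith

theorem Params.Good.implements (hp : p.Good) {A : ℝ}
    (hB : ∀ m v, 1 ≤ m → 2 ^ (m - 1) ≤ p.T → p.size m v ≤ B) (hA : (B : ℝ) * (B * 3700) ≤ A) :
    Implements AdaptiveCalibration.roundProg p (fun t y => p.forecast y t) A := by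
  intro y u hu
  -- The existence statement is made total in `t` and in the memory, so that a successor function
  -- can be chosen and iterated; the invariant is then recovered by induction.
  have step : ∀ t σ, ∃ τ, t < p.T →
      ((t = 0 ∧ σ = p.initialStore) ∨ ∃ s, t = s + 1 ∧ HoldsRound p y s σ) →
      HoldsRound p y t τ ∧ ∃ n, Exec AdaptiveCalibration.roundProg (roundInput t y (u t) σ) τ n ∧
        IsSample (p.forecast y t) (u t) (τ.real 0 3) ∧ n ≤ B * (B * 3700) := by
    intro t σ
    by_cases h : t < p.T ∧ ((t = 0 ∧ σ = p.initialStore) ∨ ∃ s, t = s + 1 ∧ HoldsRound p y s σ)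
    · obtain ⟨τ, n, h1, h2, h3, h4⟩ := Ter.roundProg hp h.1 (fun m => hB m (prevMean m y)) (hu t) h.2
      exact ⟨τ, fun _ _ => ⟨h3, n, h1, h4, h2⟩⟩
    · exact ⟨σ, fun h1 h2 => absurd ⟨h1, h2⟩ h⟩
  choose next hnext using step
  let σ : ℕ → Store := fun t => Nat.rec p.initialStore next t
  have inv : ∀ t ≤ p.T, (t = 0 ∧ σ t = p.initialStore) ∨ ∃ s, t = s + 1 ∧ HoldsRound p y s (σ t) := by
    intro t
    induction t with
    | zero => exact fun _ => Or.inl ⟨rfl, rfl⟩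
    | succ t ih => exact fun ht => Or.inr ⟨t, rfl, (hnext t (σ t) ht (ih (by omega))).1⟩
  refine ⟨σ, rfl, fun t ht => ?_⟩
  obtain ⟨-, n, h1, h2, h3⟩ := hnext t (σ t) ht (inv t ht.le)
  refine ⟨n, h1, h2, le_trans ?_ hA⟩
  exact_mod_cast h3

end

/-- As `ι ≥ 1`, the inner count is O((1 + C)^(1/3)), and there are O(log T) bands of O((1 +
C)^(1/3)) pieces. The square of this bound gives the complexity. -/
lemma Params.Good.size_le {p : Params} (hp : p.Good) {m : ℕ} (hm1 : 1 ≤ m)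
    (hm : 2 ^ (m - 1) ≤ p.T) (v : ℝ) :
    (p.size m v : ℝ) ≤ 100 * (log p.T * (1 + p.C) ^ (1 / 3 : ℝ)) := by
  have hC := hp.C_nonneg
  have hι := hp.one_le
  have hL0 := hp.log_T_ge
  have hl2 := log_two_gt_d9
  set L := log p.T
  set x := (1 + p.C) ^ (1 / 3 : ℝ)
  have hx : 1 ≤ x := one_le_rpow (by linarith) (by norm_num)
  have h1 := hp.innerCount_le hm1 hm v
  have h2 := hp.clog_le
  have h3 := hp.outerCount_le
  have h4 : p.innerRate ≤ x := by
    refine rpow_le_rpow (by positivity) ?_ (by norm_num)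
    gcongr
    exact div_le_self hC hι
  have h5 : ((1 + p.C) / L ^ 2) ^ (1 / 3 : ℝ) ≤ 2 * x := by
    have h8 : (2 : ℝ) = 8 ^ (1 / 3 : ℝ) := by
      rw [show (8 : ℝ) = 2 ^ (3 : ℝ) by norm_num, ← rpow_mul (by norm_num)]
      norm_num
    rw [h8, ← mul_rpow (by norm_num) (by linarith)]
    refine rpow_le_rpow (by positivity) ?_ (by norm_num)
    -- `log T ≥ log 2` keeps `log² T` above 1/8, so dividing by it costs at most a factor 2 after
    -- the cube root.
    have hL : 1 ≤ 8 * L ^ 2 := by nlinarith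
    rw [div_le_iff₀ (by linarith)]
    calc 1 + p.C ≤ (1 + p.C) * (8 * L ^ 2) := le_mul_of_one_le_right (by linarith) hL
      _ = 8 * (1 + p.C) * L ^ 2 := by ring
  have h6 : ((Nat.clog 2 p.T : ℝ) + 1) * (2 * p.outerCount) ≤ 5 * L * (2 * (2 * x + 2)) :=
    mul_le_mul h2 (by linarith) (by positivity) (by linarith)
  have h7 : (p.size m v : ℝ) =
      p.innerCount m v + (Nat.clog 2 p.T + 1) * (2 * p.outerCount) + 2 := by
    simp [Params.size]
  rw [h7]
  have h9 : (17 : ℝ) * x ≤ 30 * (L * x) := by nlinarith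
  have h10 : L ≤ L * x := le_mul_of_one_le_right (by linarith) hx
  linarith

/-- One program implements the algorithm. -/
theorem exists_implements : ∃ (c : Prog) (k : ℕ) (A : ℝ), ∀ (T : ℕ) (C δ ι : ℝ),
    2 ≤ T → 0 ≤ C → C ≤ T → 0 < δ → δ < 1 → 10 * log (T / δ) ≤ ι →
    ∃ P : ℕ → (ℕ → Bool) → ℝ →₀ ℝ, IsForecaster ⟨T, C, ι⟩ P ∧
      Implements c ⟨T, C, ι⟩ P (A * log T ^ k * (1 + C) ^ (2 / 3 : ℝ)) := by
  refine ⟨roundProg, 2, 100 ^ 2 * 3700, fun T C δ ι hT hC _ hδ0 hδ1 hι => ?_⟩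
  set p : Params := ⟨T, C, ι⟩ with hpdef
  have hT2 : (2 : ℝ) ≤ T := by exact_mod_cast hT
  have hlog : log 2 ≤ log (T / δ) := by
    refine log_le_log (by norm_num) ?_
    rw [le_div_iff₀ hδ0]
    nlinarith
  have hp : p.Good := ⟨hT, hC, by
    have := log_two_gt_d9
    change 1 ≤ ι
    linarith⟩
  set b : ℝ := 100 * (log T * (1 + C) ^ (1 / 3 : ℝ)) with hb
  have hb0 : 0 ≤ b := by
    have : 0 ≤ log (T : ℝ) := log_nonneg (by linarith)
    positivity
  have hsq : ((1 + C) ^ (1 / 3 : ℝ)) ^ 2 = (1 + C) ^ (2 / 3 : ℝ) := by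
    rw [← rpow_natCast, ← rpow_mul (by linarith)]
    norm_num
  -- Step counts are bounded through a natural number; the integer size stays below the floor of its
  -- real bound.
  refine ⟨_, hp.isForecaster, hp.implements (B := ⌊b⌋₊)
    (fun m v h1 h2 => Nat.le_floor (hp.size_le h1 h2 v)) ?_⟩
  have hf := Nat.floor_le hb0
  have h0 : (0 : ℝ) ≤ ⌊b⌋₊ := Nat.cast_nonneg _
  calc (⌊b⌋₊ : ℝ) * (⌊b⌋₊ * 3700) ≤ b * (b * 3700) := by gcongr
    _ = _ := by
      rw [hb, ← hsq]
      ring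

end
end AdaptiveCalibration

theorem mainTheorem3 :
    ∃ κ₀ : ℝ, 0 < κ₀ ∧
      -- calibration: every forecaster that follows the algorithm
      (∀ κ b : ℝ, ∃ A : ℝ, ∀ (T : ℕ) (δ ι : ℝ) (q : ℕ → ℝ),
        2 ≤ T → 0 < δ → δ < 1 →
        Real.log (1 / δ) ≤ b * Real.log T ^ 2 →
        κ₀ * Real.log (T / δ) ≤ ι → ι ≤ κ * Real.log (T / δ) →
        (∀ t < T, q t ∈ Set.Icc (0 : ℝ) 1) →
        ∀ P : ℕ → (ℕ → Bool) → ℝ →₀ ℝ,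
          AdaptiveCalibration.IsForecaster
            ⟨T, AdaptiveCalibration.nonStationarity T q, ι⟩ P →
          ∀ (Ω : Type*) [MeasurableSpace Ω] (μ : MeasureTheory.Measure Ω)
            [MeasureTheory.IsProbabilityMeasure μ] (Y : ℕ → Ω → Bool),
            (∀ t < T, Measurable (Y t)) →
            ProbabilityTheory.iIndepFun (fun t : Fin T => Y t) μ →
            (∀ t < T, μ.real {ω | Y t ω = true} = q t) →
            1 - δ ≤ μ.real {ω |
              AdaptiveCalibration.pseudoKL T (fun t => P t fun i => Y i ω) (fun i => Y i ω) ≤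
                A * (ι * Real.log T ^ 2 +
                  (1 + AdaptiveCalibration.nonStationarity T q) ^ (1 / 3 : ℝ) *
                    Real.log T ^ (7 / 3 : ℝ))}) ∧
      -- computation: one program implements such a forecaster for all parameters
      (∃ (c : AdaptiveCalibration.Prog) (k : ℕ) (A : ℝ), ∀ (T : ℕ) (C δ ι : ℝ),
        2 ≤ T → 0 ≤ C → C ≤ T → 0 < δ → δ < 1 → κ₀ * Real.log (T / δ) ≤ ι →
        ∃ P : ℕ → (ℕ → Bool) → ℝ →₀ ℝ,
          AdaptiveCalibration.IsForecaster ⟨T, C, ι⟩ P ∧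
          AdaptiveCalibration.Implements c ⟨T, C, ι⟩ P
            (A * Real.log T ^ k * (1 + C) ^ (2 / 3 : ℝ))) := by
  refine ⟨10, by norm_num, ?_, ?_⟩
  · intro κ b
    exact ⟨_, fun T δ ι q hT hδ0 hδ1 hb hι hκ hq P hF Ω _ μ _ Y hY hind hlaw =>
      AdaptiveCalibration.calibration hT hδ0 hδ1 hb hι hκ hq hF hY hind hlaw⟩
  · exact AdaptiveCalibration.exists_implements
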